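/- **Setting.** Let $X$ be a measurable space, $D$ a probability distribution on $X$, $C$ a finite class of measurable concepts $h:X\to\{0,1\}$ and $c\in C$ the target (realizable setting). For $V\subseteq C$ let $DIS(V)=\{x:\exists h_1,h_2\in V,\ h_1(x)\neq h_2(x)\}$, let $d(h,h')=\Pr_{x\sim D}[h(x)\ne h'(x)]$, $B(c,r)=\{h\in C: d(c,h)\le r\}$, and let $\Theta=\sup_{r>0}\Pr_{x\sim D}[x\in DIS(B(c,r))]/r$ be the disagreement coefficient. Let $\varepsilon,\delta,\rho\in(0,\tfrac12]$. **rSTAT.** $\mathrm{rSTAT}_{\rho',\tau',\psi}$ with failure parameter $\delta'$ puts $\alpha=2\tau'/(\rho'+1-2\delta')$, draws an offset $o$ uniformly from $[0,\alpha]$, splits $[0,1]$ into the regions $[0,o),[o,o+\alpha),[o+\alpha,o+2\alpha),\dots$ (the last one cut off at $1$), and returns the midpoint of the region that contains the empirical mean of $\psi$ on its sample. **Algorithm RepliCAL** (inputs $\varepsilon,\delta,\rho$, $\Theta$, $C$; label oracle for $c$). Let $N=\lceil a_N\log\frac1\varepsilon\rceil$ for a constant $a_N>0$; let the interval size be $\tau=\frac1{8\Theta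 M}$, where the integer $M=\lceil a\log|C|/\rho^2\rceil+2$ for a constant $a>0$ (so $\tau=O(\rho^2/(\Theta\log|C|))$ divides $\frac1{8\Theta}$); and let $$|T|=O\Big(\tfrac{\log^2(1/\varepsilon)\,\log(\log(1/\varepsilon)/\delta)}{\varepsilon^2\rho^2}\Big),\qquad k=O\Big(\Theta\cdot\tfrac{\log^2|C|\,\log\frac{\log(1/\varepsilon)}{\rho}\,\log^4\frac1\varepsilon+\rho^4\log\frac{|C|\log(1/\varepsilon)}{\delta}}{\rho^4}\Big),$$ where each of $|T|,k$ is a suitable constant times the displayed expression, rounded up. Draw $v_{\mathrm{init}}$ uniformly from $[0,\frac1{4\Theta}]$, then $v$ uniformly from $\{v_{\mathrm{init}}+\frac32\tau,\,v_{\mathrm{init}}+\frac52\tau,\dots,v_{\mathrm{init}}+\frac1{8\Theta}-\frac\tau2\}$, and a uniformly random ordering of $C$. Start with $V=C$. Repeat: on $|T|$ fresh unlabeled examples from $D$, estimate the mass of $DIS(V)$ by $\mathrm{rSTAT}_{\rho/(2N),\,\varepsilon/4,\,\mathbf 1_{DIS(V)}}$ with failure parameter $\delta/(2N)$ and a fresh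 offset; if the estimate is less than $\varepsilon/2$, stop and return the first hypothesis of $V$ in the random ordering; otherwise draw fresh examples from $D$ until $k$ of them lie in $DIS(V)$, query the labels of these $k$ points, and replace $V$ by the set of those $h\in V$ whose empirical error on the $k$ labeled points is at most $v$. **Theorem.** The constants in RepliCAL can be chosen universally (independent of $X,D,C,c,\varepsilon,\delta,\rho$) so that, for some universal constants in the bounds below, the following holds for every finite concept class $C$, every $D$, every target $c\in C$ and all $\varepsilon,\delta,\rho\in(0,\frac12]$. 1. (Active PAC learning, label complexity.) With probability at least $1-\delta$ over the examples and the internal randomness, RepliCAL stops and returns an $h\in C$ with $\Pr_{x\sim D}[h(x)\ne c(x)]<\varepsilon$, queries at most $$O\left(\Theta\log\frac{1}{\varepsilon}\cdot\frac{\log^2|C|\,\log\frac{\log(1/\varepsilon)}{\rho}\,\log^4\frac{1}{\varepsilon}+\rho^4\log\frac{|C|\log(1/\varepsilon)}{\delta}}{\rho^4}\right)$$ labels, and draws at most a number of (labeled or unlabeled) examples that is polynomial in $\frac1\varepsilon,\frac1\delta,\frac1\rho,|C|$. 2. (Replicability.) Two runs of RepliCAL on independent i.i.d. examples from $D$ with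 the same internal randomness both stop and return the same hypothesis with probability at least $1-\rho$. -/

import Mathlib

open MeasureTheory
open scoped ENNReal

noncomputable section

namespace RepliCAL

/-! ### Version spaces, disagreement region, disagreement coefficient -/

/-- `DIS(V)`: the points on which two hypotheses of `V` disagree. -/
def DIS {X : Type*} (V : Finset (X → Bool)) : Set X :=
  {x | ∃ h₁ ∈ V, ∃ h₂ ∈ V, h₁ x ≠ h₂ x}

/-- `d_D(h, h')`: the probability that `h` and `h'` disagree; `d_D(h, c)` is the error of `h`. -/
def dist {X : Type*} [MeasurableSpace X] (D : Measure X) (h h' : X → Bool) : ℝ :=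
  D.real {x | h x ≠ h' x}

open Classical in
/-- `B_D(h, r)`: the hypotheses of `C` at distance at most `r` from `h`. -/
def ball {X : Type*} [MeasurableSpace X] (D : Measure X) (C : Finset (X → Bool))
    (h : X → Bool) (r : ℝ) : Finset (X → Bool) :=
  {h' ∈ C | dist D h h' ≤ r}

/-- The disagreement coefficient `Θ = sup_{r > 0} D(DIS(B_D(c, r))) / r`. For finite `C` the
supremum is over a set that is bounded above (by the number of elements of `C`). -/
def disagreementCoeff {X : Type*} [MeasurableSpace X] (D : Measure X) (C : Finset (X → Bool))
    (c : X → Bool) : ℝ :=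
  ⨆ r : Set.Ioi (0 : ℝ), D.real (DIS (ball D C c r)) / r

/-! ### The replicable statistical query procedure -/

/-- The width of the regions used by `rSTAT`. -/
def rSTATWidth (ρ τ δ : ℝ) : ℝ := 2 * τ / (ρ + 1 - 2 * δ)

/-- `rSTAT_{ρ,τ,φ}` on the sample `x`: with `α = 2τ/(ρ + 1 - 2δ)` and the random offset `α u`
(uniform in `[0, α]`), split `[0, 1]` into the regions `[0, αu), [αu, αu + α), [αu + α, αu + 2α), …`
(the last one cut off at `1`), and return the midpoint of the region that contains the empirical
mean of the query `φ`. -/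
def rSTAT {X : Type*} (ρ τ δ : ℝ) (φ : X → ℝ) {T : ℕ} (x : Fin T → X) (u : unitInterval) : ℝ :=
  let α := rSTATWidth ρ τ δ
  let off := α * (u : ℝ)
  let mean := (∑ i, φ (x i)) / T
  if mean < off then off / 2
  else
    let lo := off + α * (⌊(mean - off) / α⌋ : ℤ)
    (lo + min (lo + α) 1) / 2

/-! ### Parameters of the algorithm -/

/-- The inputs of the algorithm: accuracy `ε`, failure probability `δ`, replicability parameter
`ρ`, the disagreement coefficient `Θ`, the size `card` of the concept class, and the constants
`aN`, `aτ`, `aT`, `ak` hidden in the `O(·)` of its parameter settings. -/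
structure Params where
  ε : ℝ
  δ : ℝ
  ρ : ℝ
  Θ : ℝ
  card : ℕ
  aN : ℝ
  aτ : ℝ
  aT : ℝ
  ak : ℝ

namespace Params

variable (P : Params)

/-- `log (1/ε)`. -/
def L : ℝ := Real.log (1 / P.ε)

/-- `N = O(log (1/ε))`, which sets the parameters of the calls of `rSTAT`. -/
def N : ℕ := ⌈P.aN * P.L⌉₊

/-- The number of threshold intervals minus two. -/
def g : ℕ := ⌈P.aτ * Real.log P.card / P.ρ ^ 2⌉₊

/-- The interval size `τ = O(ρ² / (Θ log |C|))`; it divides `1/(8Θ)`. -/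
def τ : ℝ := 1 / (8 * P.Θ * (P.g + 2 : ℕ))

/-- The size `|T| = O(log² (1/ε) log (log (1/ε) / δ) / (ε² ρ²))` of an unlabeled test sample. -/
def T : ℕ := ⌈P.aT * (P.L ^ 2 * Real.log (P.L / P.δ) / (P.ε ^ 2 * P.ρ ^ 2))⌉₊

/-- The expression in the numerator of the label complexity. -/
def labelNumerator : ℝ :=
  Real.log P.card ^ 2 * Real.log (P.L / P.ρ) * P.L ^ 4
    + P.ρ ^ 4 * Real.log (P.card * P.L / P.δ)

/-- The number `k` of labels queried per round. -/
def k : ℕ := ⌈P.ak * (P.Θ * (P.labelNumerator / P.ρ ^ 4))⌉₊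

/-- The label complexity, up to the constant:
`Θ log (1/ε) · (log² |C| log (log (1/ε) / ρ) log⁴ (1/ε) + ρ⁴ log (|C| log (1/ε) / δ)) / ρ⁴`. -/
def labelComplexity : ℝ := P.Θ * P.L * (P.labelNumerator / P.ρ ^ 4)

end Params

/-! ### Data and internal randomness of one run -/

/-- The fresh unlabeled examples of one run: `S.1 r` is the stream from which points to be labeled
are selected in round `r`, and `S.2 r` is the stream whose beginning is the unlabeled test sample
before round `r`. -/
abbrev Sample (X : Type*) := (ℕ → ℕ → X) × (ℕ → ℕ → X)

/-- All examples are drawn i.i.d. from `D`. -/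
def sampleLaw {X : Type*} [MeasurableSpace X] (D : Measure X) [IsProbabilityMeasure D] :
    Measure (Sample X) :=
  (Measure.infinitePi fun _ : ℕ => Measure.infinitePi fun _ : ℕ => D).prod
    (Measure.infinitePi fun _ : ℕ => Measure.infinitePi fun _ : ℕ => D)

/-- An ordering of the concept class. -/
def Ordering {X : Type*} (C : Finset (X → Bool)) := {h // h ∈ C} ≃ Fin C.card

open Classical in
instance {X : Type*} (C : Finset (X → Bool)) : Fintype (Ordering C) :=
  inferInstanceAs (Fintype ({h // h ∈ C} ≃ Fin C.card))

instance {X : Type*} (C : Finset (X → Bool)) : Nonempty (Ordering C) := ⟨C.equivFin⟩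

instance {X : Type*} (C : Finset (X → Bool)) : MeasurableSpace (Ordering C) := ⊤

/-- The internal randomness `b`: the position of the threshold start value, the index of the
threshold, the offsets of the calls of `rSTAT`, and the ordering of the hypotheses. -/
abbrev Coins {X : Type*} (P : Params) (C : Finset (X → Bool)) :=
  unitInterval × Fin (P.g + 1) × (ℕ → unitInterval) × Ordering C

/-- The components of the internal randomness are independent and uniform. -/
def coinLaw {X : Type*} (P : Params) (C : Finset (X → Bool)) : Measure (Coins P C) :=
  (volume : Measure unitInterval).prod
    ((PMF.uniformOfFintype (Fin (P.g + 1))).toMeasure.prod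
      ((Measure.infinitePi fun _ : ℕ => (volume : Measure unitInterval)).prod
        (PMF.uniformOfFintype (Ordering C)).toMeasure))

/-! ### The algorithm -/

/-- The threshold: `v_init` is uniform in `[0, 1/(4Θ)]`, and `v` is uniform in
`{v_init + 3τ/2, v_init + 5τ/2, …, v_init + 1/(8Θ) - τ/2}`. -/
def threshold {X : Type*} (P : Params) {C : Finset (X → Bool)} (b : Coins P C) : ℝ :=
  (b.1 : ℝ) * (1 / (4 * P.Θ)) + (2 * ((b.2.1 : ℕ) : ℝ) + 3) / 2 * P.τ

/-- The first `k` points of the stream that lie in `DIS(V)`, with their queried labels.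
(If the stream has fewer than `k` such points, then `pointsRead` below is `⊤`.) -/
def labeledSample {X : Type*} (k : ℕ) (label : X → Bool) (stream : ℕ → X)
    (V : Finset (X → Bool)) : Fin k → X × Bool := fun i =>
  let x := stream (Nat.nth (fun j => stream j ∈ DIS V) i)
  (x, label x)

/-- The empirical error of `h` on a labeled sample. -/
def empErr {X : Type*} {k : ℕ} (S : Fin k → X × Bool) (h : X → Bool) : ℝ :=
  (Finset.univ.filter fun i => h (S i).1 ≠ (S i).2).card / (k : ℝ)

open Classical in
/-- The version space after `r` rounds. -/
def versionSpace {X : Type*} (P : Params) (C : Finset (X → Bool)) (label : X → Bool)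
    (S : Sample X) (v : ℝ) : ℕ → Finset (X → Bool)
  | 0 => C
  | r + 1 =>
    let V := versionSpace P C label S v r
    {h ∈ V | empErr (labeledSample P.k label (S.1 r) V) h ≤ v}

/-- The estimate of the mass of the disagreement region of `V` before round `r`, for the query
`ψ = 1_{DIS(V)}`. -/
def massEstimate {X : Type*} (P : Params) {C : Finset (X → Bool)} (S : Sample X) (b : Coins P C)
    (V : Finset (X → Bool)) (r : ℕ) : ℝ :=
  rSTAT (P.ρ / (2 * P.N)) (P.ε / 4) (P.δ / (2 * P.N)) ((DIS V).indicator fun _ => 1)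
    (fun i : Fin P.T => S.2 r i) (b.2.2.1 r)

/-- The loop is left before round `r`. -/
def StopsAt {X : Type*} (P : Params) (C : Finset (X → Bool)) (label : X → Bool)
    (S : Sample X) (b : Coins P C) (r : ℕ) : Prop :=
  massEstimate P S b (versionSpace P C label S (threshold P b) r) r < P.ε / 2

open Classical in
/-- The first hypothesis in `V` in the given order. -/
def firstIn {X : Type*} {C : Finset (X → Bool)} (σ : Ordering C) (V : Finset (X → Bool)) :
    Option (X → Bool) :=
  (List.ofFn fun i : Fin C.card => (((Equiv.symm σ) i : {h // h ∈ C}) : X → Bool)).find?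
    fun h => decide (h ∈ V)

open Classical in
/-- The number of examples that are read until `k` points of `DIS(V)` have been seen. -/
def pointsRead {X : Type*} (k : ℕ) (stream : ℕ → X) (V : Finset (X → Bool)) : ℕ∞ :=
  ⨅ (m : ℕ) (_ : k ≤ Nat.count (fun j => stream j ∈ DIS V) m), (m : ℕ∞)

/-- The result of a run: the returned hypothesis (`none` if there is none), the number of queried
labels and the total number of (labeled or unlabeled) examples drawn. -/
structure Outcome (X : Type*) where
  hypothesis : Option (X → Bool)
  labels : ℕ∞
  examples : ℕ∞

open Classical in
/-- The algorithm RepliCAL, as a function of the examples `S` and the internal randomness `b`. -/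
def repliCAL {X : Type*} (P : Params) (C : Finset (X → Bool)) (label : X → Bool)
    (S : Sample X) (b : Coins P C) : Outcome X :=
  if stops : ∃ r, StopsAt P C label S b r then
    let R := Nat.find stops
    let V := versionSpace P C label S (threshold P b)
    { hypothesis := firstIn b.2.2.2 (V R)
      labels := P.k * R
      examples := (∑ r ∈ Finset.range R, pointsRead P.k (S.1 r) (V r)) + (R + 1) * P.T }
  else { hypothesis := none, labels := ⊤, examples := ⊤ }

/-! ### The guarantees -/

/-- Active PAC learning of the target `c`: except with probability `δ` over the examples and the
internal randomness, the algorithm returns a hypothesis of `C` with error less than `ε`, queries at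
most `q` labels, and draws at most `n` examples. -/
def IsActivePAC {X S B : Type*} [MeasurableSpace X] [MeasurableSpace S] [MeasurableSpace B]
    (D : Measure X) (C : Finset (X → Bool)) (c : X → Bool) (μ : Measure S) (ν : Measure B)
    (A : S → B → Outcome X) (ε δ q n : ℝ) : Prop :=
  (μ.prod ν) {ω | ¬ ((∃ h ∈ C, (A ω.1 ω.2).hypothesis = some h ∧ dist D h c < ε) ∧
      ((A ω.1 ω.2).labels : ℝ≥0∞) ≤ ENNReal.ofReal q ∧
      ((A ω.1 ω.2).examples : ℝ≥0∞) ≤ ENNReal.ofReal n)} ≤ ENNReal.ofReal δ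

/-- Replicability: two runs on independent examples with the same internal randomness return the
same hypothesis, except with probability `ρ`. -/
def IsReplicable {X S B : Type*} [MeasurableSpace S] [MeasurableSpace B]
    (μ : Measure S) (ν : Measure B) (A : S → B → Outcome X) (ρ : ℝ) : Prop :=
  (μ.prod (μ.prod ν)) {ω | ¬ ∃ h, (A ω.1 ω.2.2).hypothesis = some h ∧
      (A ω.2.1 ω.2.2).hypothesis = some h} ≤ ENNReal.ofReal ρ

end RepliCAL

end

/-! Notation: `L = log (1/ε)`, `κ = k/Θ`, and `m` is the mass of the current disagreement region.

Learning. The threshold is at most `3/(8Θ)`, while a hypothesis of error above `m/(2Θ)` is expected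
to err on about a fraction `1/(2Θ)` or more of the labeled points. Such hypotheses are eliminated,
so the survivors lie in a ball of radius `m/(2Θ)`, whose disagreement region has mass at most `m/2`
by the definition of `Θ` (`prob_halvingBad_le`, `mass_vspace_succ_le`). After `N - 1` halvings the
mass is at most `ε/8`, and the test samples are large enough to stop the loop by then, and only when
the mass is below `ε` (`run_success`).

Replicability. A run depends on the threshold `v` only through the integer `n = ⌊v k⌋`
(`versionSpace_eq`), and no value of `n` has probability above `4/κ` (`prob_admitted_eq_le`). For
each `n` there is a reference answer that is a function of the internal randomness alone; it is
enough that one run misses it with probability at most `ρ/2`. So the failure probabilities, summed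
over the `O(κ)` possible `n`, must be `O(ρ κ)`, apart from a part that is small for every `n`.

The number of points read in a round is random. The version spaces are therefore sandwiched between
two processes with deterministic reading lengths: a hypothesis survives if it makes at most `n`
errors on the first `R j` points of stream `j`, where `R j` is slightly below or above `k` divided
by a quantile of the mass of the same process (`Tuning.vspace_between`). Both processes grow with
`n`.

The core is a sharp-threshold estimate without a union bound over `C`. For a set `T` of hypotheses
consider the event that some member of `T` survives with `n` admitted errors, and average its
indicator over a window of `w` consecutive values of `n`. Resampling one example lowers this average
by at most `1/w`, and only if the new example falls into the error set of a survivor with the fewest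
errors, whose expected total number of errors is at most `σ = O(N κ)`. The one-sided Efron–Stein
inequality bounds the variance by `σ/w²` times the increment of the probability over the window.
Hence the survival probability of `T` is near `0` or near `1`, up to a factor `g = O(N κ / w²)` per
window times an increment (`prob_le_cube`, `one_sub_prob_le_cube`). For the sets `T` of hypotheses
erring at a common point this makes the mass of the survivors concentrate, provided that the
expected mass does not jump at `n` (`max_upperQuantile_le_of_smooth`). For singletons it shows that
the surviving set is close to a deterministic set `A`.

Two decisions remain per round. The answers of `rSTAT` at two values differ with probability at most
the distance of these values over the region width (`volume_decision_ne_le`). The first hypothesis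
of the version space differs from that of `A` only if the first element of their union lies in the
symmetric difference, which has probability at most the expected size of that difference over the
size of `A`; this is bounded by increments of logarithms of expected sizes
(`Tuning.prob_first_differs_le`).

Every remaining error is thus an increment, over `7w` steps, of a bounded monotone function of `n`:
a logarithm of an expected mass, a truncated mass, or a logarithm of an expected size. The sums over
`n` telescope to `7w` times the range (`sum_shift_sub_le`). With `w` about `ρ κ / (L log |C|)` all
of them are `O(ρ κ)` with small constants, and the size of `k` makes `w²/κ` large enough for `g =
O(ρ²/L)`. If `log |C| ≤ L`, a union bound over `C` replaces the concentration of the mass. -/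

noncomputable section
namespace RepliCAL

set_option linter.unusedSectionVars false

/-! ### The Efron–Stein inequality -/

section EfronStein

variable {ι X : Type*} [DecidableEq ι] [MeasurableSpace X]

theorem integrable_of_bounded {Ω : Type*} [MeasurableSpace Ω] {μ : Measure Ω} [IsFiniteMeasure μ]
    {f : Ω → ℝ} (hf : Measurable f) {b : ℝ} (hb : ∀ ω, |f ω| ≤ b) : Integrable f μ :=
  Integrable.of_bound hf.aestronglyMeasurable b (Filter.Eventually.of_forall hb)

/-- Boxes suffice. The preimage of a box times `t` is again a box times a set, with `t` and the side
in direction `i` interchanged; if direction `i` is unrestricted, that side is the whole space. -/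
theorem measurePreserving_swap_coordinate (D : Measure X) [IsProbabilityMeasure D] (i : ι) :
    MeasurePreserving (fun p : (ι → X) × X => (Function.update p.1 i p.2, p.1 i))
      ((Measure.infinitePi fun _ : ι => D).prod D)
      ((Measure.infinitePi fun _ : ι => D).prod D) := by
  have hmeas : Measurable (fun p : (ι → X) × X => (Function.update p.1 i p.2, p.1 i)) :=
    measurable_update'.prodMk ((measurable_pi_apply i).comp measurable_fst)
  refine ⟨hmeas, ?_⟩
  symm
  refine Measure.prod_eq_generateFrom (C := squareCylinders fun _ : ι => {s : Set X | MeasurableSet s})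
    (D := {s : Set X | MeasurableSet s}) ?_ ?_ ?_ ?_ ?_ ?_ ?_
  · exact generateFrom_squareCylinders
  · exact MeasurableSpace.generateFrom_measurableSet
  · exact isPiSystem_squareCylinders (fun _ => MeasurableSpace.isPiSystem_measurableSet)
      (fun _ => MeasurableSet.univ)
  · exact MeasurableSpace.isPiSystem_measurableSet
  · refine ⟨fun _ => Set.univ, fun _ => ?_, fun _ => by simp, by simp [Set.iUnion_const]⟩
    exact ⟨∅, fun _ => Set.univ, by simp, by simp⟩
  · exact ⟨fun _ => Set.univ, fun _ => MeasurableSet.univ, fun _ => by simp,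
      by simp [Set.iUnion_const]⟩
  · rintro s ⟨J, A, hA, rfl⟩ t ht
    have hA' : ∀ j, MeasurableSet (A j) := fun j => hA j (Set.mem_univ j)
    have hbox : MeasurableSet ((J : Set ι).pi A) :=
      MeasurableSet.pi (Finset.countable_toSet J) fun j _ => hA' j
    rw [Measure.map_apply hmeas (hbox.prod ht)]
    have hpre : (fun p : (ι → X) × X => (Function.update p.1 i p.2, p.1 i)) ⁻¹'
        ((J : Set ι).pi A ×ˢ t) =
        ((insert i J : Finset ι) : Set ι).pi (Function.update A i t) ×ˢ
          {y : X | i ∈ J → y ∈ A i} := by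
      ext ⟨ω, y⟩
      simp only [Set.mem_preimage, Set.mem_prod, Set.mem_pi, Finset.mem_coe, Finset.mem_insert,
        Set.mem_ofPred_eq]
      constructor
      · rintro ⟨h1, h2⟩
        refine ⟨fun j hj => ?_, fun hi => by simpa using h1 i hi⟩
        by_cases hji : j = i
        · subst hji; simpa using h2
        · have := h1 j (hj.resolve_left hji)
          simpa [Function.update_of_ne hji] using this
      · rintro ⟨h1, h2⟩
        refine ⟨fun j hj => ?_, by simpa using h1 i (Or.inl rfl)⟩
        by_cases hji : j = i
        · subst hji; simpa using h2 hj
        · have := h1 j (Or.inr hj)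
          simpa [Function.update_of_ne hji] using this
    rw [hpre, Measure.prod_prod, Measure.infinitePi_pi, Measure.infinitePi_pi _ fun j _ => hA' j]
    · by_cases hi : i ∈ J
      · rw [Finset.insert_eq_of_mem hi, ← Finset.mul_prod_erase _ _ hi,
          ← Finset.mul_prod_erase (a := i) (s := J) (fun j => D (A j)) hi]
        have h2 : {y : X | i ∈ J → y ∈ A i} = A i := by ext; simp [hi]
        rw [h2, Function.update_self, Finset.prod_congr rfl fun j hj => by
          rw [Function.update_of_ne (Finset.ne_of_mem_erase hj)]]
        ring
      · rw [Finset.prod_insert hi]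
        have h2 : {y : X | i ∈ J → y ∈ A i} = Set.univ := by ext; simp [hi]
        rw [h2, Function.update_self, Finset.prod_congr rfl fun j hj => by
          rw [Function.update_of_ne (ne_of_mem_of_not_mem hj hi)]]
        simp [mul_comm]
    · intro j _
      by_cases hji : j = i
      · subst hji; simpa using ht
      · simpa [Function.update_of_ne hji] using hA' j

theorem measurePreserving_update (D : Measure X) [IsProbabilityMeasure D] (i : ι) :
    MeasurePreserving (fun p : (ι → X) × X => Function.update p.1 i p.2)
      ((Measure.infinitePi fun _ : ι => D).prod D) (Measure.infinitePi fun _ : ι => D) :=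
  (measurePreserving_fst (μ := Measure.infinitePi fun _ : ι => D) (ν := D)).comp
    (measurePreserving_swap_coordinate D i)

theorem integral_update (D : Measure X) [IsProbabilityMeasure D] (i : ι) {F : (ι → X) → ℝ}
    (hF : Measurable F) {b : ℝ} (hb : ∀ ω, |F ω| ≤ b) :
    ∫ ω, ∫ y, F (Function.update ω i y) ∂D ∂(Measure.infinitePi fun _ : ι => D) =
      ∫ ω, F ω ∂(Measure.infinitePi fun _ : ι => D) := by
  have h := measurePreserving_update D i
  rw [← integral_prod (f := fun p : (ι → X) × X => F (Function.update p.1 i p.2))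
    (integrable_of_bounded (hF.comp h.measurable) fun _ => hb _)]
  conv_rhs => rw [← h.map_eq]
  rw [integral_map h.measurable.aemeasurable hF.aestronglyMeasurable]

/-- The mean squared change of `F` when the coordinate `i` is resampled. -/
def resampleSq (D : Measure X) (F : (ι → X) → ℝ) (i : ι) : ℝ :=
  ∫ ω, ∫ y, (F ω - F (Function.update ω i y)) ^ 2 ∂D ∂(Measure.infinitePi fun _ : ι => D)

theorem integral_sub_mul_add {Ω : Type*} [MeasurableSpace Ω] {μ : Measure Ω}
    {f g h : Ω → ℝ} (hf : Integrable f μ) (hg : Integrable g μ) (hh : Integrable h μ) (a : ℝ) :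
    ∫ ω, (f ω - a * g ω + h ω) ∂μ = ∫ ω, f ω ∂μ - a * ∫ ω, g ω ∂μ + ∫ ω, h ω ∂μ := by
  have h1 : Integrable (fun ω => a * g ω) μ := hg.const_mul a
  have h2 : Integrable (fun ω => f ω - a * g ω) μ := hf.sub h1
  rw [integral_add h2 hh, integral_sub hf h1, integral_const_mul]

theorem integral_sub_mul_add_const {Ω : Type*} [MeasurableSpace Ω] {μ : Measure Ω}
    [IsProbabilityMeasure μ] {f g : Ω → ℝ} (hf : Integrable f μ) (hg : Integrable g μ) (a c : ℝ) :
    ∫ ω, (f ω - a * g ω + c) ∂μ = ∫ ω, f ω ∂μ - a * ∫ ω, g ω ∂μ + c := by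
  rw [integral_sub_mul_add hf hg (integrable_const c)]; simp

theorem sq_integral_le {Ω : Type*} [MeasurableSpace Ω] {μ : Measure Ω} [IsProbabilityMeasure μ]
    {f : Ω → ℝ} (hf : Measurable f) {b : ℝ} (hb : ∀ ω, |f ω| ≤ b) :
    (∫ ω, f ω ∂μ) ^ 2 ≤ ∫ ω, f ω ^ 2 ∂μ := by
  set c := ∫ ω, f ω ∂μ
  have hi : Integrable f μ := integrable_of_bounded hf hb
  have hi2 : Integrable (fun ω => f ω ^ 2) μ :=
    integrable_of_bounded (hf.pow_const 2) (b := b ^ 2) fun ω => by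
      rw [abs_of_nonneg (sq_nonneg _)]; exact sq_le_sq' (by linarith [neg_abs_le (f ω), hb ω])
        (le_trans (le_abs_self _) (hb ω))
  have h0 : 0 ≤ ∫ ω, (f ω ^ 2 - 2 * c * f ω + c ^ 2) ∂μ :=
    integral_nonneg fun ω => by
      show 0 ≤ f ω ^ 2 - 2 * c * f ω + c ^ 2
      nlinarith [sq_nonneg (f ω - c)]
  rw [integral_sub_mul_add_const (f := fun ω => f ω ^ 2) hi2 hi] at h0
  change 0 ≤ _ - 2 * c * c + c ^ 2 at h0
  nlinarith

/-- Induction on the set of coordinates. Let `Fb` be the average of `F` over coordinate `i`. The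
variance of `F` is that of `Fb` plus half the mean squared change under resampling `i`. By Jensen,
`Fb` is no more sensitive than `F` to the other coordinates. -/
theorem efronStein (D : Measure X) [IsProbabilityMeasure D] (s : Finset ι) :
    ∀ {F : (ι → X) → ℝ} (_ : Measurable F) {b : ℝ} (_ : ∀ ω, |F ω| ≤ b)
      (_ : ∀ ω ω', (∀ i ∈ s, ω i = ω' i) → F ω = F ω'),
      ∫ ω, (F ω - ∫ ω', F ω' ∂(Measure.infinitePi fun _ : ι => D)) ^ 2
        ∂(Measure.infinitePi fun _ : ι => D) ≤ ∑ i ∈ s, resampleSq D F i / 2 := by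
  set P := Measure.infinitePi fun _ : ι => D with hP
  induction s using Finset.induction_on with
  | empty =>
    intro F hF b hb hdep
    obtain ⟨ω₀⟩ : Nonempty (ι → X) := P.nonempty_of_neZero
    have : ∀ ω, F ω = F ω₀ := fun ω => hdep ω ω₀ (by simp)
    simp [this]
  | insert i s his ih =>
    intro F hF b hb hdep
    have hsq : ∀ {x : ℝ}, |x| ≤ b → x ^ 2 ≤ b ^ 2 := fun {x} hx =>
      sq_le_sq' (by linarith [neg_abs_le x]) (le_trans (le_abs_self _) hx)
    have hU := measurePreserving_update D i
    set Fb : (ι → X) → ℝ := fun ω => ∫ y, F (Function.update ω i y) ∂D with hFb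
    have hFbm : Measurable Fb :=
      ((hF.comp hU.measurable).stronglyMeasurable.integral_prod_right
        (f := fun ω y => F (Function.update ω i y))).measurable
    have hFbb : ∀ ω, |Fb ω| ≤ b := fun ω => by
      have h := norm_integral_le_of_norm_le_const (μ := D) (f := fun y => F (Function.update ω i y))
        (C := b) (Filter.Eventually.of_forall fun y => hb _)
      simpa using h
    have hFbdep : ∀ ω ω', (∀ j ∈ s, ω j = ω' j) → Fb ω = Fb ω' := fun ω ω' h => by
      refine integral_congr_ae (Filter.Eventually.of_forall fun y => hdep _ _ fun j hj => ?_)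
      by_cases hji : j = i
      · subst hji; simp
      · simpa [Function.update_of_ne hji] using h j ((Finset.mem_insert.1 hj).resolve_left hji)
    have hFbu : ∀ ω y, Fb (Function.update ω i y) = Fb ω := fun ω y => by simp [hFb]
    have hmean : ∫ ω, Fb ω ∂P = ∫ ω, F ω ∂P := integral_update D i hF hb
    set c := ∫ ω, F ω ∂P
    have intg : ∀ {G : (ι → X) → ℝ} (_ : Measurable G) {b' : ℝ} (_ : ∀ ω, |G ω| ≤ b'),
        Integrable G P := fun hG _ hb' => integrable_of_bounded hG hb'
    have hmulb : ∀ {x y : ℝ}, |x| ≤ b → |y| ≤ b → |x * y| ≤ b * b := fun {x y} hx hy => by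
      rw [abs_mul]; exact mul_le_mul hx hy (abs_nonneg _) ((abs_nonneg _).trans hx)
    -- projection identity
    have hproj : ∫ ω, F ω * Fb ω ∂P = ∫ ω, Fb ω * Fb ω ∂P := by
      rw [← integral_update D i (F := fun ω => F ω * Fb ω) (hF.mul hFbm) (b := b * b)
        fun ω => hmulb (hb ω) (hFbb ω)]
      refine integral_congr_ae (Filter.Eventually.of_forall fun ω => ?_)
      simp only [hFbu]
      rw [integral_mul_const]
    have iFF := intg (hF.mul hF) (b' := b * b) fun ω => hmulb (hb ω) (hb ω)
    have iFB := intg (hF.mul hFbm) (b' := b * b) fun ω => hmulb (hb ω) (hFbb ω)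
    have iBB := intg (hFbm.mul hFbm) (b' := b * b) fun ω => hmulb (hFbb ω) (hFbb ω)
    have iF := intg hF hb
    have iB := intg hFbm hFbb
    have e1 : ∫ ω, (F ω - c) ^ 2 ∂P = ∫ ω, F ω * F ω ∂P - c ^ 2 := by
      have : ∀ ω, (F ω - c) ^ 2 = F ω * F ω - 2 * c * F ω + c ^ 2 := fun ω => by ring
      simp only [this]
      rw [integral_sub_mul_add_const (f := fun ω => F ω * F ω) iFF iF]
      ring
    have e2 : ∫ ω, (Fb ω - c) ^ 2 ∂P = ∫ ω, Fb ω * Fb ω ∂P - c ^ 2 := by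
      have : ∀ ω, (Fb ω - c) ^ 2 = Fb ω * Fb ω - 2 * c * Fb ω + c ^ 2 := fun ω => by ring
      simp only [this]
      rw [integral_sub_mul_add_const (f := fun ω => Fb ω * Fb ω) iBB iB, hmean]
      ring
    have e3 : resampleSq D F i = 2 * (∫ ω, F ω * F ω ∂P - ∫ ω, Fb ω * Fb ω ∂P) := by
      have hin : ∀ ω, ∫ y, (F ω - F (Function.update ω i y)) ^ 2 ∂D =
          F ω * F ω - 2 * (F ω * Fb ω) + ∫ y, (F * F) (Function.update ω i y) ∂D := fun ω => by
        have m1 : Measurable fun y => F (Function.update ω i y) := hF.comp (measurable_update ω)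
        have i1 : Integrable (fun y => F (Function.update ω i y)) D :=
          integrable_of_bounded m1 fun _ => hb _
        have i2 : Integrable (fun y => (F * F) (Function.update ω i y)) D :=
          integrable_of_bounded (m1.mul m1) (b := b * b) fun _ => hmulb (hb _) (hb _)
        have : ∀ y, (F ω - F (Function.update ω i y)) ^ 2 =
            F ω * F ω - 2 * F ω * F (Function.update ω i y) + (F * F) (Function.update ω i y) :=
          fun y => by simp only [Pi.mul_apply]; ring
        simp only [this]
        rw [integral_sub_mul_add (f := fun _ => F ω * F ω) (integrable_const _) i1 i2]
        simp only [integral_const, probReal_univ, one_smul, hFb]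
        ring
      unfold resampleSq
      simp only [hin]
      have iU : Integrable (fun ω => ∫ y, (F * F) (Function.update ω i y) ∂D) P := by
        refine intg ?_ (b' := b * b) fun ω => ?_
        · exact (((hF.mul hF).comp hU.measurable).stronglyMeasurable.integral_prod_right
            (f := fun ω y => (F * F) (Function.update ω i y))).measurable
        · have h := norm_integral_le_of_norm_le_const (μ := D)
            (f := fun y => (F * F) (Function.update ω i y))
            (C := b * b) (Filter.Eventually.of_forall fun y => hmulb (hb _) (hb _))
          simpa using h
      rw [integral_sub_mul_add (f := fun ω => F ω * F ω) (g := fun ω => F ω * Fb ω) iFF iFB iU,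
        integral_update D i (hF.mul hF) (b := b * b) fun ω => hmulb (hb ω) (hb ω), hproj]
      simp only [Pi.mul_apply, ← hP]
      ring
    -- Averaging over `i` commutes with resampling `j ≠ i`, so the change of `Fb` is a mean of
    -- changes of `F`, and its square is at most the mean of their squares.
    have e4 : ∀ j ∈ s, resampleSq D Fb j ≤ resampleSq D F j := fun j hj => by
      have hji : j ≠ i := ne_of_mem_of_not_mem hj his
      have hUj := measurePreserving_update D j
      set Q : (ι → X) → ℝ := fun ω => ∫ z, (F ω - F (Function.update ω j z)) ^ 2 ∂D with hQ
      have hjm : Measurable fun p : (ι → X) × X => (F p.1 - F (Function.update p.1 j p.2)) ^ 2 :=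
        ((hF.comp measurable_fst).sub (hF.comp hUj.measurable)).pow_const 2
      have hQm : Measurable Q := (hjm.stronglyMeasurable.integral_prod_right
        (f := fun ω z => (F ω - F (Function.update ω j z)) ^ 2)).measurable
      have hdb : ∀ {x y : ℝ}, |x| ≤ b → |y| ≤ b → |(x - y) ^ 2| ≤ (b + b) ^ 2 := fun {x y} hx hy => by
        rw [abs_of_nonneg (sq_nonneg _)]
        have : |x - y| ≤ b + b := (abs_sub _ _).trans (add_le_add hx hy)
        exact sq_le_sq' (by linarith [neg_abs_le (x - y)]) (le_trans (le_abs_self _) this)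
      have hQb : ∀ ω, |Q ω| ≤ (b + b) ^ 2 := fun ω => by
        have h := norm_integral_le_of_norm_le_const (μ := D)
          (f := fun z => (F ω - F (Function.update ω j z)) ^ 2)
          (C := (b + b) ^ 2) (Filter.Eventually.of_forall fun y => hdb (hb _) (hb _))
        simpa using h
      have hR : resampleSq D F j = ∫ ω, ∫ y, Q (Function.update ω i y) ∂D ∂P :=
        (integral_update D i hQm hQb).symm
      rw [hR]
      unfold resampleSq
      have hjb : Measurable fun p : (ι → X) × X => (Fb p.1 - Fb (Function.update p.1 j p.2)) ^ 2 :=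
        ((hFbm.comp measurable_fst).sub (hFbm.comp hUj.measurable)).pow_const 2
      refine integral_mono ?_ ?_ fun ω => ?_
      · refine intg (hjb.stronglyMeasurable.integral_prod_right
          (f := fun ω z => (Fb ω - Fb (Function.update ω j z)) ^ 2)).measurable
          (b' := (b + b) ^ 2) fun ω => ?_
        have h := norm_integral_le_of_norm_le_const (μ := D)
          (f := fun z => (Fb ω - Fb (Function.update ω j z)) ^ 2)
          (C := (b + b) ^ 2) (Filter.Eventually.of_forall fun y => hdb (hFbb _) (hFbb _))
        simpa using h
      · refine intg ((hQm.comp hU.measurable).stronglyMeasurable.integral_prod_right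
          (f := fun ω y => Q (Function.update ω i y))).measurable (b' := (b + b) ^ 2) fun ω => ?_
        have h := norm_integral_le_of_norm_le_const (μ := D)
          (f := fun y => Q (Function.update ω i y))
          (C := (b + b) ^ 2) (Filter.Eventually.of_forall fun y => hQb _)
        simpa using h
      · have hcomm : ∀ y z, Function.update (Function.update ω j z) i y =
            Function.update (Function.update ω i y) j z := fun y z =>
          Function.update_comm hji z y ω
        have hm2 : Measurable fun p : X × X => F (Function.update ω i p.2) -
            F (Function.update (Function.update ω i p.2) j p.1) := by
          refine (hF.comp ((measurable_update ω).comp measurable_snd)).sub (hF.comp ?_)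
          exact hUj.measurable.comp (((measurable_update ω).comp measurable_snd).prodMk measurable_fst)
        have hswap : ∫ y, Q (Function.update ω i y) ∂D = ∫ z, ∫ y, (F (Function.update ω i y) -
            F (Function.update (Function.update ω i y) j z)) ^ 2 ∂D ∂D := by
          simp only [hQ]
          rw [integral_integral_swap]
          exact integrable_of_bounded ((hm2.comp measurable_swap).pow_const 2)
            (b := (b + b) ^ 2) fun p => hdb (hb _) (hb _)
        show ∫ z, (Fb ω - Fb (Function.update ω j z)) ^ 2 ∂D ≤ ∫ y, Q (Function.update ω i y) ∂D
        rw [hswap]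
        refine integral_mono ?_ ?_ fun z => ?_
        · refine integrable_of_bounded (b := (b + b) ^ 2) ?_ fun z => hdb (hFbb _) (hFbb _)
          exact (measurable_const.sub (hFbm.comp (measurable_update ω))).pow_const 2
        · refine integrable_of_bounded (b := (b + b) ^ 2)
            ((hm2.pow_const 2).stronglyMeasurable.integral_prod_right
            (f := fun z y => (F (Function.update ω i y) -
              F (Function.update (Function.update ω i y) j z)) ^ 2)).measurable fun z => ?_
          have h := norm_integral_le_of_norm_le_const (μ := D)
            (f := fun y => (F (Function.update ω i y) -
              F (Function.update (Function.update ω i y) j z)) ^ 2)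
            (C := (b + b) ^ 2) (Filter.Eventually.of_forall fun y => hdb (hb _) (hb _))
          simpa using h
        · have m1 : Measurable fun y => F (Function.update ω i y) := hF.comp (measurable_update ω)
          have m2 : Measurable fun y => F (Function.update (Function.update ω i y) j z) := by
            refine hF.comp (hUj.measurable.comp ((measurable_update ω).prodMk measurable_const))
          have hd : Fb ω - Fb (Function.update ω j z) = ∫ y, (F (Function.update ω i y) -
              F (Function.update (Function.update ω i y) j z)) ∂D := by
            rw [integral_sub (integrable_of_bounded m1 fun _ => hb _)
              (integrable_of_bounded m2 fun _ => hb _)]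
            simp only [hFb, hcomm]
          show (Fb ω - Fb (Function.update ω j z)) ^ 2 ≤ _
          rw [hd]
          exact sq_integral_le (m1.sub m2) (b := b + b) fun y =>
            (abs_sub _ _).trans (add_le_add (hb _) (hb _))
    have h5 := ih hFbm hFbb hFbdep
    rw [hmean, e2] at h5
    rw [Finset.sum_insert his, e1]
    have h6 : ∑ j ∈ s, resampleSq D Fb j / 2 ≤ ∑ j ∈ s, resampleSq D F j / 2 :=
      Finset.sum_le_sum fun j hj => by linarith [e4 j hj]
    rw [e3]
    linarith

/-- Exchanging `ω i` with the fresh value turns the positive part of the change into the negative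
part, so both have the same mean square. -/
theorem resampleSq_eq_two_mul (D : Measure X) [IsProbabilityMeasure D] (i : ι) {F : (ι → X) → ℝ}
    (hF : Measurable F) {b : ℝ} (hb : ∀ ω, |F ω| ≤ b) :
    resampleSq D F i = 2 * ∫ ω, ∫ y, max (F ω - F (Function.update ω i y)) 0 ^ 2 ∂D
      ∂(Measure.infinitePi fun _ : ι => D) := by
  set P := Measure.infinitePi fun _ : ι => D with hP
  have hU := measurePreserving_update D i
  have hS := measurePreserving_swap_coordinate D i
  have m1 : Measurable fun p : (ι → X) × X => F p.1 - F (Function.update p.1 i p.2) :=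
    (hF.comp measurable_fst).sub (hF.comp hU.measurable)
  have mpos : Measurable fun p : (ι → X) × X => max (F p.1 - F (Function.update p.1 i p.2)) 0 ^ 2 :=
    (m1.max measurable_const).pow_const 2
  have mneg : Measurable fun p : (ι → X) × X => max (F (Function.update p.1 i p.2) - F p.1) 0 ^ 2 :=
    (((hF.comp hU.measurable).sub (hF.comp measurable_fst)).max measurable_const).pow_const 2
  have hb0 : ∀ x y, |F x - F y| ≤ b + b := fun x y => (abs_sub _ _).trans (add_le_add (hb _) (hb _))
  have hmb : ∀ x y, |max (F x - F y) 0 ^ 2| ≤ (b + b) ^ 2 := fun x y => by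
    rw [abs_of_nonneg (sq_nonneg _)]
    have := hb0 x y
    refine pow_le_pow_left₀ (le_max_right _ _) (max_le (le_trans (le_abs_self _) this) ?_) 2
    exact (abs_nonneg _).trans this
  have ipos := integrable_of_bounded (μ := P.prod D) mpos fun _ => hmb _ _
  have ineg := integrable_of_bounded (μ := P.prod D) mneg fun _ => hmb _ _
  have isq : Integrable (fun p : (ι → X) × X => (F p.1 - F (Function.update p.1 i p.2)) ^ 2)
      (P.prod D) := by
    refine integrable_of_bounded (m1.pow_const 2) (b := (b + b) ^ 2) fun p => ?_
    rw [abs_of_nonneg (sq_nonneg _)]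
    have h1 := hb0 p.1 (Function.update p.1 i p.2)
    have h2 := neg_abs_le (F p.1 - F (Function.update p.1 i p.2))
    exact sq_le_sq' (by linarith) (le_trans (le_abs_self _) h1)
  unfold resampleSq
  rw [← integral_prod _ isq, ← integral_prod _ ipos]
  have hsplit : ∀ p : (ι → X) × X, (F p.1 - F (Function.update p.1 i p.2)) ^ 2 =
      max (F p.1 - F (Function.update p.1 i p.2)) 0 ^ 2 +
        max (F (Function.update p.1 i p.2) - F p.1) 0 ^ 2 := fun p => by
    rcases le_total (F p.1) (F (Function.update p.1 i p.2)) with h | h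
    · rw [max_eq_right (by linarith), max_eq_left (by linarith)]; ring
    · rw [max_eq_left (by linarith), max_eq_right (by linarith)]; ring
  simp only [hsplit]
  rw [integral_add ipos ineg]
  have : ∫ p, max (F (Function.update p.1 i p.2) - F p.1) 0 ^ 2 ∂(P.prod D) =
      ∫ p, max (F p.1 - F (Function.update p.1 i p.2)) 0 ^ 2 ∂(P.prod D) := by
    conv_rhs => rw [← hS.map_eq]
    rw [integral_map hS.measurable.aemeasurable mpos.aestronglyMeasurable]
    simp [hP]
  rw [this]; ring

/-- The Efron–Stein inequality, in its one-sided form. -/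
theorem efronStein_oneSided (D : Measure X) [IsProbabilityMeasure D] (s : Finset ι)
    {F : (ι → X) → ℝ} (hF : Measurable F) {b : ℝ} (hb : ∀ ω, |F ω| ≤ b)
    (hdep : ∀ ω ω', (∀ i ∈ s, ω i = ω' i) → F ω = F ω') :
    ∫ ω, (F ω - ∫ ω', F ω' ∂(Measure.infinitePi fun _ : ι => D)) ^ 2
        ∂(Measure.infinitePi fun _ : ι => D) ≤
      ∑ i ∈ s, ∫ ω, ∫ y, max (F ω - F (Function.update ω i y)) 0 ^ 2 ∂D
        ∂(Measure.infinitePi fun _ : ι => D) := by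
  refine (efronStein D s hF hb hdep).trans (le_of_eq (Finset.sum_congr rfl fun i _ => ?_))
  rw [resampleSq_eq_two_mul D i hF hb]; ring

end EfronStein

/-! ### Counting hits of a set: Chernoff bounds and the variance -/

section Counts

variable {ι X : Type*}

open Classical in
/-- The number of indices in `J` at which `ω` lies in `A`. -/
def hitCount (A : Set X) (J : Finset ι) (ω : ι → X) : ℕ := (J.filter fun i => ω i ∈ A).card

theorem hitCount_le_card (A : Set X) (J : Finset ι) (ω : ι → X) : hitCount A J ω ≤ J.card := by
  classical exact Finset.card_filter_le _ _

theorem hitCount_mono_right (A : Set X) {J K : Finset ι} (h : J ⊆ K) (ω : ι → X) :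
    hitCount A J ω ≤ hitCount A K ω := by
  classical exact Finset.card_le_card (Finset.filter_subset_filter _ h)

theorem hitCount_congr (A : Set X) (J : Finset ι) {ω ω' : ι → X} (h : ∀ i ∈ J, ω i = ω' i) :
    hitCount A J ω = hitCount A J ω' := by
  classical
  unfold hitCount
  congr 1
  exact Finset.filter_congr fun i hi => by rw [h i hi]

theorem cast_hitCount (A : Set X) (J : Finset ι) (ω : ι → X) :
    (hitCount A J ω : ℝ) = ∑ i ∈ J, A.indicator (fun _ => (1 : ℝ)) (ω i) := by
  classical
  unfold hitCount
  rw [Finset.card_filter]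
  push_cast
  exact Finset.sum_congr rfl fun i _ => by simp [Set.indicator_apply]

theorem measurable_hitCount [MeasurableSpace X] {A : Set X} (hA : MeasurableSet A) (J : Finset ι) :
    Measurable fun ω : ι → X => hitCount A J ω := by
  classical
  unfold hitCount
  simp only [Finset.card_filter]
  exact Finset.measurable_sum _ fun i _ =>
    Measurable.ite (hA.preimage (measurable_pi_apply i)) measurable_const measurable_const

theorem hitCount_add_of_disjoint [DecidableEq ι] (A : Set X) {J K : Finset ι} (h : Disjoint J K)
    (ω : ι → X) : hitCount A (J ∪ K) ω = hitCount A J ω + hitCount A K ω := by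
  classical
  unfold hitCount
  rw [Finset.filter_union, Finset.card_union_of_disjoint]
  exact Finset.disjoint_filter_filter h

theorem hitCount_map {κ : Type*} (A : Set X) (f : ι ↪ κ) (J : Finset ι) (ω : κ → X) :
    hitCount A (J.map f) ω = hitCount A J fun i => ω (f i) := by
  classical
  unfold hitCount
  rw [Finset.filter_map, Finset.card_map]
  rfl

theorem hitCount_update_le [DecidableEq ι] (A : Set X) (J : Finset ι) (ω : ι → X) (i : ι) (y : X) :
    hitCount A J (Function.update ω i y) ≤ hitCount A J ω + 1 := by
  classical
  unfold hitCount
  refine (Finset.card_le_card (t := insert i (J.filter fun i => ω i ∈ A)) fun j hj => ?_).trans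
    (Finset.card_insert_le _ _)
  simp only [Finset.mem_filter, Finset.mem_insert] at hj ⊢
  by_cases hji : j = i
  · exact Or.inl hji
  · rw [Function.update_of_ne hji] at hj; exact Or.inr hj

theorem hitCount_update_le_of_notMem [DecidableEq ι] (A : Set X) (J : Finset ι) (ω : ι → X) (i : ι)
    {y : X} (hy : y ∉ A) : hitCount A J (Function.update ω i y) ≤ hitCount A J ω := by
  classical
  unfold hitCount
  refine Finset.card_le_card fun j hj => ?_
  simp only [Finset.mem_filter] at hj ⊢
  by_cases hji : j = i
  · subst hji; simp [hy] at hj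
  · rwa [Function.update_of_ne hji] at hj

variable [MeasurableSpace X] (D : Measure X) [IsProbabilityMeasure D]

theorem integral_indicator_eval {A : Set X} (hA : MeasurableSet A) (i : ι) :
    ∫ ω, A.indicator (fun _ => (1 : ℝ)) (ω i) ∂(Measure.infinitePi fun _ : ι => D) = D.real A := by
  have h := measurePreserving_eval_infinitePi (fun _ : ι => D) i
  have hm : Measurable (A.indicator fun _ => (1 : ℝ)) := measurable_const.indicator hA
  have := integral_map (μ := Measure.infinitePi fun _ : ι => D) h.measurable.aemeasurable
    (f := A.indicator fun _ => (1 : ℝ)) hm.aestronglyMeasurable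
  rw [h.map_eq] at this
  rw [← integral_indicator_one hA]
  exact this.symm

theorem integral_hitCount {A : Set X} (hA : MeasurableSet A) (J : Finset ι) :
    ∫ ω, (hitCount A J ω : ℝ) ∂(Measure.infinitePi fun _ : ι => D) = J.card * D.real A := by
  simp only [cast_hitCount]
  rw [integral_finsetSum]
  · simp [integral_indicator_eval D hA]
  · intro i _
    refine integrable_of_bounded (b := 1) ?_ fun ω => ?_
    · exact (measurable_const.indicator hA).comp (measurable_pi_apply i)
    · by_cases h : ω i ∈ A <;> simp [h]

/-- Independence reduces this to one point, where the moment generating function is `1 + p (exp θ -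
1) ≤ exp (p (exp θ - 1))`: the count is compared with a Poisson variable. -/
theorem mgf_hitCount_le {A : Set X} (hA : MeasurableSet A) (J : Finset ι) (θ : ℝ) :
    ProbabilityTheory.mgf (fun ω => (hitCount A J ω : ℝ)) (Measure.infinitePi fun _ : ι => D) θ ≤
      Real.exp (J.card * D.real A * (Real.exp θ - 1)) := by
  set P := Measure.infinitePi fun _ : ι => D
  have hm : Measurable (A.indicator fun _ => (1 : ℝ)) := measurable_const.indicator hA
  have hind : ProbabilityTheory.iIndepFun
      (fun (i : ι) (ω : ι → X) => A.indicator (fun _ => (1 : ℝ)) (ω i)) P :=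
    ProbabilityTheory.iIndepFun_infinitePi (P := fun _ : ι => D)
      (X := fun _ => A.indicator fun _ => (1 : ℝ)) fun _ => hm
  have heq : (fun ω => (hitCount A J ω : ℝ)) =
      ∑ i ∈ J, fun ω : ι → X => A.indicator (fun _ => (1 : ℝ)) (ω i) := by
    ext ω; simp [cast_hitCount]
  rw [heq, hind.mgf_sum fun i => hm.comp (measurable_pi_apply i)]
  have hone : ∀ i ∈ J, ProbabilityTheory.mgf (fun ω : ι → X => A.indicator (fun _ => (1 : ℝ)) (ω i))
      P θ ≤ Real.exp (D.real A * (Real.exp θ - 1)) := fun i _ => by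
    have h1 : ∀ ω : ι → X, Real.exp (θ * A.indicator (fun _ => (1 : ℝ)) (ω i)) =
        (Real.exp θ - 1) * A.indicator (fun _ => (1 : ℝ)) (ω i) + 1 := fun ω => by
      by_cases h : ω i ∈ A <;> simp [h]
    unfold ProbabilityTheory.mgf
    simp only [h1]
    rw [integral_add, integral_const_mul, integral_indicator_eval D hA]
    · simp only [integral_const, probReal_univ, one_smul]
      rw [mul_comm]; exact Real.add_one_le_exp _
    · refine Integrable.const_mul (integrable_of_bounded (b := 1) ?_ fun ω => ?_) _
      · exact hm.comp (measurable_pi_apply i)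
      · by_cases h : ω i ∈ A <;> simp [h]
    · exact integrable_const _
  refine (Finset.prod_le_prod (fun i _ => ProbabilityTheory.mgf_nonneg) hone).trans (le_of_eq ?_)
  rw [Finset.prod_const, ← Real.exp_nat_mul]
  ring_nf

theorem integrable_exp_hitCount {A : Set X} (hA : MeasurableSet A) (J : Finset ι) (θ : ℝ) :
    Integrable (fun ω => Real.exp (θ * (hitCount A J ω : ℝ)))
      (Measure.infinitePi fun _ : ι => D) := by
  refine integrable_of_bounded (b := Real.exp (|θ| * J.card)) ?_ fun ω => ?_
  · exact Real.measurable_exp.comp (measurable_const.mul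
      (measurable_from_top.comp (measurable_hitCount hA J)))
  · rw [Real.abs_exp]
    refine Real.exp_le_exp.2 ?_
    calc θ * (hitCount A J ω : ℝ) ≤ |θ| * hitCount A J ω := by gcongr; exact le_abs_self θ
      _ ≤ |θ| * J.card := by gcongr; exact hitCount_le_card _ _ _

theorem prob_le_hitCount {A : Set X} (hA : MeasurableSet A) (J : Finset ι) {θ : ℝ} (hθ : 0 ≤ θ)
    (a : ℝ) :
    (Measure.infinitePi fun _ : ι => D).real {ω | a ≤ hitCount A J ω} ≤
      Real.exp (J.card * D.real A * (Real.exp θ - 1) - θ * a) := by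
  refine (ProbabilityTheory.measure_ge_le_exp_mul_mgf a hθ
    (integrable_exp_hitCount D hA J θ)).trans ?_
  rw [sub_eq_neg_add, Real.exp_add, neg_mul]
  gcongr
  exact mgf_hitCount_le D hA J θ

theorem prob_hitCount_le {A : Set X} (hA : MeasurableSet A) (J : Finset ι) {θ : ℝ} (hθ : 0 ≤ θ)
    (a : ℝ) :
    (Measure.infinitePi fun _ : ι => D).real {ω | (hitCount A J ω : ℝ) ≤ a} ≤
      Real.exp (J.card * D.real A * (Real.exp (-θ) - 1) + θ * a) := by
  refine (ProbabilityTheory.measure_le_le_exp_mul_mgf a (neg_nonpos.2 hθ)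
    (integrable_exp_hitCount D hA J (-θ))).trans ?_
  rw [add_comm, Real.exp_add, neg_neg]
  gcongr
  exact mgf_hitCount_le D hA J (-θ)

theorem exp_sub_one_le {θ : ℝ} (h0 : 0 ≤ θ) (h1 : θ ≤ 1) : Real.exp θ - 1 ≤ θ + θ ^ 2 := by
  have := Real.abs_exp_sub_one_sub_id_le (x := θ) (by rwa [abs_of_nonneg h0])
  linarith [le_abs_self (Real.exp θ - 1 - θ)]

theorem exp_neg_sub_one_le {θ : ℝ} (h0 : 0 ≤ θ) : Real.exp (-θ) - 1 ≤ -θ + θ ^ 2 / 2 := by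
  have h2 := Real.quadratic_le_exp_of_nonneg h0
  have hp : (0 : ℝ) < 1 + θ + θ ^ 2 / 2 := by positivity
  have h3 : Real.exp (-θ) ≤ 1 / (1 + θ + θ ^ 2 / 2) := by
    rw [Real.exp_neg, ← one_div]; exact one_div_le_one_div_of_le hp h2
  have h4 : 1 / (1 + θ + θ ^ 2 / 2) ≤ 1 - θ + θ ^ 2 / 2 := by
    rw [div_le_iff₀ hp]; nlinarith [sq_nonneg (θ ^ 2)]
  linarith

/-- A crude Chernoff bound for the upper tail. -/
theorem prob_le_hitCount_exp {A : Set X} (hA : MeasurableSet A) (J : Finset ι) {m : ℝ}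
    (hm : J.card * D.real A ≤ m) (w : ℝ) :
    (Measure.infinitePi fun _ : ι => D).real {ω | w ≤ hitCount A J ω} ≤ Real.exp (2 * m - w) := by
  have hm0 : 0 ≤ m := le_trans (by positivity) hm
  refine (prob_le_hitCount D hA J zero_le_one _).trans (Real.exp_le_exp.2 ?_)
  have h1 : Real.exp 1 - 1 ≤ 2 := by linarith [Real.exp_one_lt_d9]
  have h2 : 0 ≤ Real.exp 1 - 1 := by linarith [Real.add_one_le_exp 1]
  have := mul_le_mul hm h1 h2 hm0
  linarith

/-- Chernoff bound for the lower tail, in terms of a lower bound of the mean. -/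
theorem prob_hitCount_le_sub {A : Set X} (hA : MeasurableSet A) (J : Finset ι) {m t : ℝ}
    (hm0 : 0 ≤ m) (hm : m ≤ J.card * D.real A) (ht : 0 ≤ t) :
    (Measure.infinitePi fun _ : ι => D).real {ω | (hitCount A J ω : ℝ) ≤ m - t} ≤
      Real.exp (-(t ^ 2 / (2 * m))) := by
  rcases hm0.eq_or_lt with h0 | hpos
  · rw [← h0]; simp
  have hθ : 0 ≤ t / m := by positivity
  refine (prob_hitCount_le D hA J hθ _).trans (Real.exp_le_exp.2 ?_)
  have h1 := exp_neg_sub_one_le hθ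
  have h2 : Real.exp (-(t / m)) - 1 ≤ 0 := by
    have := Real.exp_le_one_iff.2 (neg_nonpos.2 hθ); linarith
  calc J.card * D.real A * (Real.exp (-(t / m)) - 1) + t / m * (m - t)
      ≤ m * (-(t / m) + (t / m) ^ 2 / 2) + t / m * (m - t) := by
        have h3 := mul_le_mul_of_nonpos_right hm h2
        have h4 := mul_le_mul_of_nonneg_left h1 hm0
        linarith
    _ = -(t ^ 2 / (2 * m)) := by field_simp; ring

/-- Chernoff bound for the lower tail, in terms of an upper bound of the mean. -/
theorem prob_hitCount_le_mean_sub {A : Set X} (hA : MeasurableSet A) (J : Finset ι) {m t : ℝ}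
    (hm0 : 0 < m) (hm : J.card * D.real A ≤ m) (ht : 0 ≤ t) :
    (Measure.infinitePi fun _ : ι => D).real
        {ω | (hitCount A J ω : ℝ) ≤ J.card * D.real A - t} ≤
      Real.exp (-(t ^ 2 / (2 * m))) := by
  have hθ : 0 ≤ t / m := by positivity
  refine (prob_hitCount_le D hA J hθ _).trans (Real.exp_le_exp.2 ?_)
  have h1 := exp_neg_sub_one_le hθ
  have hq : 0 ≤ J.card * D.real A := by positivity
  calc J.card * D.real A * (Real.exp (-(t / m)) - 1) + t / m * (J.card * D.real A - t)
      ≤ J.card * D.real A * (-(t / m) + (t / m) ^ 2 / 2) + t / m * (J.card * D.real A - t) := by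
        gcongr
    _ = J.card * D.real A * ((t / m) ^ 2 / 2) - t / m * t := by ring
    _ ≤ m * ((t / m) ^ 2 / 2) - t / m * t := by gcongr
    _ = -(t ^ 2 / (2 * m)) := by field_simp; ring

/-- One-sided Efron–Stein with decrements of at most `1`; this crude variance is all that the test
samples need. -/
theorem integral_sq_hitCount_sub_le [DecidableEq ι] {A : Set X} (hA : MeasurableSet A)
    (J : Finset ι) :
    ∫ ω, ((hitCount A J ω : ℝ) - J.card * D.real A) ^ 2 ∂(Measure.infinitePi fun _ : ι => D) ≤
      J.card := by
  have hmeas : Measurable fun ω : ι → X => (hitCount A J ω : ℝ) :=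
    measurable_from_top.comp (measurable_hitCount hA J)
  have h := efronStein_oneSided D J hmeas (b := J.card)
    (fun ω => by rw [Nat.abs_cast]; exact_mod_cast hitCount_le_card A J ω)
    (fun ω ω' hω => by rw [hitCount_congr A J hω])
  rw [integral_hitCount D hA] at h
  refine h.trans ((Finset.sum_le_sum (g := fun _ => (1 : ℝ)) fun i _ => ?_).trans (by simp))
  have hin : ∀ ω : ι → X, ∫ y, max ((hitCount A J ω : ℝ) -
      hitCount A J (Function.update ω i y)) 0 ^ 2 ∂D ≤ 1 := fun ω => by
    have hle : ∀ y, max ((hitCount A J ω : ℝ) - hitCount A J (Function.update ω i y)) 0 ^ 2 ≤ 1 :=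
      fun y => by
        have h1 := hitCount_update_le A J (Function.update ω i y) i (ω i)
        simp only [Function.update_idem, Function.update_eq_self] at h1
        have h2 : (hitCount A J ω : ℝ) ≤ hitCount A J (Function.update ω i y) + 1 := by
          exact_mod_cast h1
        exact pow_le_one₀ (le_max_right _ _) (max_le (by linarith) zero_le_one)
    have := norm_integral_le_of_norm_le_const (μ := D) (C := 1)
      (f := fun y => max ((hitCount A J ω : ℝ) - hitCount A J (Function.update ω i y)) 0 ^ 2)
      (Filter.Eventually.of_forall fun y => by
        rw [Real.norm_eq_abs, abs_of_nonneg (by positivity)]; exact hle y)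
    exact (le_abs_self _).trans (by simpa using this)
  have := norm_integral_le_of_norm_le_const (μ := Measure.infinitePi fun _ : ι => D) (C := 1)
      (f := fun ω => ∫ y, max ((hitCount A J ω : ℝ) -
        hitCount A J (Function.update ω i y)) 0 ^ 2 ∂D)
      (Filter.Eventually.of_forall fun ω => by
        rw [Real.norm_eq_abs, abs_of_nonneg (integral_nonneg fun y => by positivity)]; exact hin ω)
  exact (le_abs_self _).trans (by simpa using this)

end Counts

/-! ### Sharp thresholds for increasing families of events -/

section CoverEvents

variable {ι X : Type*} [DecidableEq ι] [MeasurableSpace X]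

theorem integral_indicator_one_real {Ω : Type*} [MeasurableSpace Ω] {μ : Measure Ω} {A : Set Ω}
    (hA : MeasurableSet A) : ∫ ω, A.indicator (fun _ => (1 : ℝ)) ω ∂μ = μ.real A :=
  integral_indicator_one hA

/-- A family of events `Cov t`, increasing in `t`, that depends on the finitely many coordinates in
`s`, loses at most one level when a coordinate is changed, and loses nothing when the new value
avoids a set `E` (depending on the outcome) with `#s * D E ≤ σ`. -/
structure IsCoverFamily (D : Measure X) (s : Finset ι) (Cov : ℕ → Set (ι → X)) (σ : ℝ) : Prop where
  meas : ∀ t, MeasurableSet (Cov t)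
  mono : Monotone Cov
  dep : ∀ t ω ω', (∀ i ∈ s, ω i = ω' i) → ω ∈ Cov t → ω' ∈ Cov t
  step : ∀ t ω i y, ω ∈ Cov t → Function.update ω i y ∈ Cov (t + 1)
  witness : ∀ t ω, ω ∈ Cov t → ∃ E, MeasurableSet E ∧ s.card * D.real E ≤ σ ∧
    ∀ t', ω ∈ Cov t' → ∀ i, ∀ y ∉ E, Function.update ω i y ∈ Cov t'

/-- The fraction of the levels `t + 1, …, t + w` at which `ω` is covered. -/
def coverRamp (Cov : ℕ → Set (ι → X)) (t w : ℕ) (ω : ι → X) : ℝ :=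
  (∑ a ∈ Finset.range w, (Cov (t + 1 + a)).indicator (fun _ => (1 : ℝ)) ω) / w

theorem coverRamp_nonneg (Cov : ℕ → Set (ι → X)) (t w : ℕ) (ω : ι → X) :
    0 ≤ coverRamp Cov t w ω :=
  div_nonneg (Finset.sum_nonneg fun _ _ => Set.indicator_nonneg (fun _ _ => zero_le_one) _)
    (Nat.cast_nonneg _)

namespace IsCoverFamily

variable {D : Measure X} [IsProbabilityMeasure D] {s : Finset ι} {Cov : ℕ → Set (ι → X)} {σ : ℝ}

theorem coverRamp_eq_zero (h : IsCoverFamily D s Cov σ) {t w : ℕ} {ω : ι → X}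
    (hω : ω ∉ Cov (t + w)) : coverRamp Cov t w ω = 0 := by
  unfold coverRamp
  rw [Finset.sum_eq_zero, zero_div]
  intro a ha
  refine Set.indicator_of_notMem (fun hmem => hω (h.mono ?_ hmem)) _
  have := Finset.mem_range.1 ha; omega

theorem coverRamp_eq_one (h : IsCoverFamily D s Cov σ) {t w : ℕ} (hw : 0 < w) {ω : ι → X}
    (hω : ω ∈ Cov (t + 1)) : coverRamp Cov t w ω = 1 := by
  unfold coverRamp
  rw [Finset.sum_congr rfl fun a _ =>
    Set.indicator_of_mem (h.mono (by omega : t + 1 ≤ t + 1 + a) hω) _]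
  have : (w : ℝ) ≠ 0 := by positivity
  simp [this]

theorem coverRamp_le_one (_h : IsCoverFamily D s Cov σ) (t w : ℕ) (ω : ι → X) :
    coverRamp Cov t w ω ≤ 1 := by
  unfold coverRamp
  refine div_le_one_of_le₀ ?_ (Nat.cast_nonneg _)
  refine (Finset.sum_le_sum (g := fun _ => (1 : ℝ)) fun a _ => ?_).trans (by simp)
  exact Set.indicator_le_self' (fun _ _ => zero_le_one) ω

theorem measurable_coverRamp (h : IsCoverFamily D s Cov σ) (t w : ℕ) :
    Measurable (coverRamp Cov t w) :=
  (Finset.measurable_sum _ fun a _ => measurable_const.indicator (h.meas (t + 1 + a))).div_const _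

/-- A changed coordinate costs at most one level, so the sum at `ω` is at most the sum at the
changed point shifted by one level. The shift gains at most the single indicator at the top. -/
theorem coverRamp_sub_update_le (h : IsCoverFamily D s Cov σ) {t w : ℕ} (ω : ι → X)
    (i : ι) (y : X) : coverRamp Cov t w ω - coverRamp Cov t w (Function.update ω i y) ≤ 1 / w := by
  unfold coverRamp
  rw [← sub_div]
  refine div_le_div_of_nonneg_right ?_ (Nat.cast_nonneg _)
  set ω' := Function.update ω i y
  have h1 : ∑ a ∈ Finset.range w, (Cov (t + 1 + a)).indicator (fun _ => (1 : ℝ)) ω ≤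
      ∑ a ∈ Finset.range w, (Cov (t + 1 + (a + 1))).indicator (fun _ => (1 : ℝ)) ω' :=
    Finset.sum_le_sum fun a _ => by
      by_cases ha : ω ∈ Cov (t + 1 + a)
      · have := h.step _ ω i y ha
        rw [Set.indicator_of_mem ha, Set.indicator_of_mem (by rwa [← add_assoc])]
      · rw [Set.indicator_of_notMem ha]
        exact Set.indicator_nonneg (fun _ _ => zero_le_one) _
  have h2 := Finset.sum_range_succ' (fun a => (Cov (t + 1 + a)).indicator (fun _ => (1 : ℝ)) ω') w
  have h3 := Finset.sum_range_succ (fun a => (Cov (t + 1 + a)).indicator (fun _ => (1 : ℝ)) ω') w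
  have h4 : (Cov (t + 1 + w)).indicator (fun _ => (1 : ℝ)) ω' ≤ 1 :=
    Set.indicator_le_self' (fun _ _ => zero_le_one) ω'
  have h5 : 0 ≤ (Cov (t + 1 + 0)).indicator (fun _ => (1 : ℝ)) ω' :=
    Set.indicator_nonneg (fun _ _ => zero_le_one) _
  linarith

/-- Resampling lowers the ramp only when `ω` lies in the window `Cov (t + w) \ Cov t` and the new
value falls into the witness set `E` of `ω`, and then by at most `1/w`. Summed over the coordinates,
`#s * D E ≤ σ` gives `σ / w²` times the probability of the window. The one-sided inequality is
essential: the witness of `ω` does not control resamplings that raise the ramp. -/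
theorem integral_coverRamp_sub_sq_le (h : IsCoverFamily D s Cov σ) {t w : ℕ} (hw : 0 < w) :
    ∫ ω, (coverRamp Cov t w ω - ∫ ω', coverRamp Cov t w ω' ∂(Measure.infinitePi fun _ : ι => D)) ^ 2
        ∂(Measure.infinitePi fun _ : ι => D) ≤
      σ / w ^ 2 * ((Measure.infinitePi fun _ : ι => D).real (Cov (t + w)) -
        (Measure.infinitePi fun _ : ι => D).real (Cov t)) := by
  set P := Measure.infinitePi fun _ : ι => D with hP
  set ψ := coverRamp Cov t w with hψ
  have hψm : Measurable ψ := h.measurable_coverRamp t w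
  have hψb : ∀ ω, |ψ ω| ≤ 1 := fun ω => by
    rw [abs_of_nonneg (coverRamp_nonneg _ _ _ _)]; exact h.coverRamp_le_one t w ω
  have hdep : ∀ ω ω', (∀ i ∈ s, ω i = ω' i) → ψ ω = ψ ω' := fun ω ω' hω => by
    simp only [hψ, coverRamp]
    congr 1
    refine Finset.sum_congr rfl fun a _ => ?_
    by_cases ha : ω ∈ Cov (t + 1 + a)
    · rw [Set.indicator_of_mem ha, Set.indicator_of_mem (h.dep _ _ _ hω ha)]
    · rw [Set.indicator_of_notMem ha, Set.indicator_of_notMem fun hb =>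
        ha (h.dep _ _ _ (fun i hi => (hω i hi).symm) hb)]
  refine (efronStein_oneSided D s hψm hψb hdep).trans ?_
  have hw' : (0 : ℝ) < w := by exact_mod_cast hw
  set g : ι → (ι → X) → ℝ := fun i ω => ∫ y, max (ψ ω - ψ (Function.update ω i y)) 0 ^ 2 ∂D
  have hpt : ∀ ω y i, max (ψ ω - ψ (Function.update ω i y)) 0 ^ 2 ≤ 1 := fun ω y i => by
    refine pow_le_one₀ (le_max_right _ _) (max_le ?_ zero_le_one)
    have := coverRamp_nonneg Cov t w (Function.update ω i y)
    linarith [h.coverRamp_le_one t w ω]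
  have hgm : ∀ i, Measurable (g i) := fun i => by
    have m1 : Measurable fun p : (ι → X) × X => max (ψ p.1 - ψ (Function.update p.1 i p.2)) 0 ^ 2 :=
      (((hψm.comp measurable_fst).sub (hψm.comp measurable_update')).max
        measurable_const).pow_const 2
    exact (m1.stronglyMeasurable.integral_prod_right
      (f := fun ω y => max (ψ ω - ψ (Function.update ω i y)) 0 ^ 2)).measurable
  have hgi : ∀ i, Integrable (g i) P := fun i => integrable_of_bounded (hgm i) (b := 1) fun ω => by
    have := norm_integral_le_of_norm_le_const (μ := D) (C := 1)
      (f := fun y => max (ψ ω - ψ (Function.update ω i y)) 0 ^ 2)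
      (Filter.Eventually.of_forall fun y => by
        rw [Real.norm_eq_abs, abs_of_nonneg (by positivity)]; exact hpt ω y i)
    simpa using this
  have hwin : MeasurableSet (Cov (t + w) \ Cov t) := (h.meas _).diff (h.meas _)
  have hbound : ∀ ω, ∑ i ∈ s, g i ω ≤
      σ / w ^ 2 * (Cov (t + w) \ Cov t).indicator (fun _ => (1 : ℝ)) ω := fun ω => by
    have hzero : ∀ i, (∀ y, ψ ω ≤ ψ (Function.update ω i y)) → g i ω = 0 := fun i hle => by
      have : ∀ y, max (ψ ω - ψ (Function.update ω i y)) 0 ^ 2 = 0 := fun y => by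
        rw [max_eq_right (by linarith [hle y])]; norm_num
      simp only [g, this, integral_zero]
    -- Outside `Cov (t + w)` the ramp is already `0`. On `Cov t` it is `1` and remains so after a
    -- change, because the ramp starts at level `t + 1` and a change costs one level.
    by_cases h1 : ω ∈ Cov (t + w)
    · by_cases h2 : ω ∈ Cov t
      · rw [Finset.sum_eq_zero fun i _ => hzero i fun y => ?_]
        · simp [h2]
        · rw [hψ, h.coverRamp_eq_one hw (h.step _ _ _ _ h2)]; exact h.coverRamp_le_one _ _ _
      · rw [Set.indicator_of_mem (show ω ∈ Cov (t + w) \ Cov t from ⟨h1, h2⟩), mul_one]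
        obtain ⟨E, hE, hσ, hkeep⟩ := h.witness _ ω h1
        have hgi' : ∀ i ∈ s, g i ω ≤ D.real E / w ^ 2 := fun i _ => by
          have hle : ∀ y, max (ψ ω - ψ (Function.update ω i y)) 0 ^ 2 ≤
              1 / w ^ 2 * E.indicator (fun _ => (1 : ℝ)) y := fun y => by
            by_cases hy : y ∈ E
            · rw [Set.indicator_of_mem hy, mul_one, ← one_div_pow]
              refine pow_le_pow_left₀ (le_max_right _ _) (max_le ?_ (by positivity)) 2
              exact h.coverRamp_sub_update_le ω i y
            · rw [Set.indicator_of_notMem hy, mul_zero]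
              have : ψ ω ≤ ψ (Function.update ω i y) := by
                refine div_le_div_of_nonneg_right (Finset.sum_le_sum fun a _ => ?_) hw'.le
                by_cases ha : ω ∈ Cov (t + 1 + a)
                · rw [Set.indicator_of_mem ha, Set.indicator_of_mem (hkeep _ ha i y hy)]
                · rw [Set.indicator_of_notMem ha]
                  exact Set.indicator_nonneg (fun _ _ => zero_le_one) _
              rw [max_eq_right (by linarith)]; norm_num
          have hm1 : Measurable fun y => max (ψ ω - ψ (Function.update ω i y)) 0 ^ 2 :=
            ((measurable_const.sub (hψm.comp (measurable_update ω))).max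
              measurable_const).pow_const 2
          refine (integral_mono (integrable_of_bounded hm1 (b := 1) fun y => by
            rw [abs_of_nonneg (by positivity)]; exact hpt ω y i)
            (((integrable_const (1 : ℝ)).indicator hE).const_mul _) hle).trans (le_of_eq ?_)
          rw [integral_const_mul, integral_indicator_one_real hE]; ring
        refine (Finset.sum_le_sum hgi').trans ?_
        rw [Finset.sum_const, nsmul_eq_mul, ← mul_div_assoc]
        gcongr
    · rw [Finset.sum_eq_zero fun i _ => hzero i fun y => ?_]
      · simp [h1]
      · rw [hψ, h.coverRamp_eq_zero h1]; exact coverRamp_nonneg _ _ _ _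
  rw [← integral_finsetSum _ fun i _ => hgi i]
  refine (integral_mono (integrable_finsetSum _ fun i _ => hgi i)
    (((integrable_const (1 : ℝ)).indicator hwin).const_mul _) hbound).trans (le_of_eq ?_)
  rw [integral_const_mul, integral_indicator_one_real hwin, measureReal_sdiff (h.mono (by omega))
    (h.meas _)]

theorem measureReal_mono_level (h : IsCoverFamily D s Cov σ) {t t' : ℕ} (ht : t ≤ t') :
    (Measure.infinitePi fun _ : ι => D).real (Cov t) ≤
      (Measure.infinitePi fun _ : ι => D).real (Cov t') :=
  measureReal_mono (h.mono ht)

theorem integral_coverRamp_le (h : IsCoverFamily D s Cov σ) (t w : ℕ) :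
    ∫ ω, coverRamp Cov t w ω ∂(Measure.infinitePi fun _ : ι => D) ≤
      (Measure.infinitePi fun _ : ι => D).real (Cov (t + w)) := by
  rw [← integral_indicator_one_real (h.meas (t + w))]
  refine integral_mono (integrable_of_bounded (h.measurable_coverRamp t w) (b := 1) fun ω => ?_)
    ((integrable_const (1 : ℝ)).indicator (h.meas _)) fun ω => ?_
  · rw [abs_of_nonneg (coverRamp_nonneg _ _ _ _)]; exact h.coverRamp_le_one t w ω
  · by_cases hω : ω ∈ Cov (t + w)
    · rw [Set.indicator_of_mem hω]; exact h.coverRamp_le_one t w ω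
    · rw [Set.indicator_of_notMem hω, h.coverRamp_eq_zero hω]

theorem le_integral_coverRamp (h : IsCoverFamily D s Cov σ) (t : ℕ) {w : ℕ} (hw : 0 < w) :
    (Measure.infinitePi fun _ : ι => D).real (Cov t) ≤
      ∫ ω, coverRamp Cov t w ω ∂(Measure.infinitePi fun _ : ι => D) := by
  rw [← integral_indicator_one_real (h.meas t)]
  refine integral_mono ((integrable_const (1 : ℝ)).indicator (h.meas _))
    (integrable_of_bounded (h.measurable_coverRamp t w) (b := 1) fun ω => ?_) fun ω => ?_
  · rw [abs_of_nonneg (coverRamp_nonneg _ _ _ _)]; exact h.coverRamp_le_one t w ω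
  · by_cases hω : ω ∈ Cov t
    · rw [Set.indicator_of_mem hω, h.coverRamp_eq_one hw (h.mono (by omega) hω)]
    · rw [Set.indicator_of_notMem hω]; exact coverRamp_nonneg _ _ _ _

theorem integrable_coverRamp_sub_sq (h : IsCoverFamily D s Cov σ) (t w : ℕ) (m : ℝ) :
    Integrable (fun ω => (coverRamp Cov t w ω - m) ^ 2) (Measure.infinitePi fun _ : ι => D) := by
  refine integrable_of_bounded (((h.measurable_coverRamp t w).sub_const m).pow_const 2)
    (b := (1 + |m|) ^ 2) fun ω => ?_
  rw [abs_of_nonneg (sq_nonneg _), ← sq_abs]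
  refine pow_le_pow_left₀ (abs_nonneg _) ((abs_sub _ _).trans (add_le_add_left ?_ _)) 2
  rw [abs_of_nonneg (coverRamp_nonneg _ _ _ _)]; exact h.coverRamp_le_one t w ω

/-- A level of small probability has a probability that is small compared to the next window. -/
theorem prob_le_of_le_half (h : IsCoverFamily D s Cov σ) {t w : ℕ} (hw : 0 < w)
    (hp : (Measure.infinitePi fun _ : ι => D).real (Cov (t + w)) ≤ 1 / 2) :
    (Measure.infinitePi fun _ : ι => D).real (Cov t) ≤
      16 * σ / w ^ 2 * ((Measure.infinitePi fun _ : ι => D).real (Cov (t + w)) -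
        (Measure.infinitePi fun _ : ι => D).real (Cov t)) := by
  have hvar := h.integral_coverRamp_sub_sq_le (t := t) hw
  set P := Measure.infinitePi fun _ : ι => D
  set m := ∫ ω', coverRamp Cov t w ω' ∂P
  have hm : m ≤ 1 / 2 := (h.integral_coverRamp_le t w).trans hp
  -- On `Cov t` the ramp is `1` and its mean is at most `1/2`. The constant `1/16` matches the
  -- opposite tail, where the deviation is only known to be at least `1/4`.
  have hlow : 1 / 16 * P.real (Cov t) ≤ ∫ ω, (coverRamp Cov t w ω - m) ^ 2 ∂P := by
    rw [← integral_indicator_one_real (h.meas t), ← integral_const_mul]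
    refine integral_mono (((integrable_const (1 : ℝ)).indicator (h.meas _)).const_mul _)
      (h.integrable_coverRamp_sub_sq t w m) fun ω => ?_
    by_cases hω : ω ∈ Cov t
    · simp only [Set.indicator_of_mem hω]
      rw [h.coverRamp_eq_one hw (h.mono (by omega) hω)]; nlinarith
    · simp only [Set.indicator_of_notMem hω, mul_zero]; positivity
  calc P.real (Cov t) = 16 * (1 / 16 * P.real (Cov t)) := by ring
    _ ≤ 16 * (σ / w ^ 2 * (P.real (Cov (t + w)) - P.real (Cov t))) := by linarith
    _ = _ := by ring

/-- A level of non-negligible probability is followed by one that fails with a probability that is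
small compared to the window between them. -/
theorem one_sub_prob_le_of_quarter_le (h : IsCoverFamily D s Cov σ) {t w : ℕ} (hw : 0 < w)
    (hp : 1 / 4 ≤ (Measure.infinitePi fun _ : ι => D).real (Cov t)) :
    1 - (Measure.infinitePi fun _ : ι => D).real (Cov (t + w)) ≤
      16 * σ / w ^ 2 * ((Measure.infinitePi fun _ : ι => D).real (Cov (t + w)) -
        (Measure.infinitePi fun _ : ι => D).real (Cov t)) := by
  have hvar := h.integral_coverRamp_sub_sq_le (t := t) hw
  set P := Measure.infinitePi fun _ : ι => D
  set m := ∫ ω', coverRamp Cov t w ω' ∂P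
  have hm : 1 / 4 ≤ m := hp.trans (h.le_integral_coverRamp t hw)
  have hlow : 1 / 16 * P.real (Cov (t + w))ᶜ ≤ ∫ ω, (coverRamp Cov t w ω - m) ^ 2 ∂P := by
    rw [← integral_indicator_one_real (h.meas (t + w)).compl, ← integral_const_mul]
    refine integral_mono (((integrable_const (1 : ℝ)).indicator (h.meas _).compl).const_mul _)
      (h.integrable_coverRamp_sub_sq t w m) fun ω => ?_
    by_cases hω : ω ∈ Cov (t + w)
    · have : ω ∉ (Cov (t + w))ᶜ := fun h => h hω
      simp only [Set.indicator_of_notMem this, mul_zero]; positivity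
    · have : ω ∈ (Cov (t + w))ᶜ := hω
      simp only [Set.indicator_of_mem this]
      rw [h.coverRamp_eq_zero hω]; nlinarith
  rw [probReal_compl_eq_one_sub (h.meas _)] at hlow
  calc 1 - P.real (Cov (t + w)) = 16 * (1 / 16 * (1 - P.real (Cov (t + w)))) := by ring
    _ ≤ 16 * (σ / w ^ 2 * (P.real (Cov (t + w)) - P.real (Cov t))) := by linarith
    _ = _ := by ring

/-- Three consecutive windows each contribute a factor `g`; the last one also contributes its
increment, which is at most the total increment. -/
theorem prob_le_cube (h : IsCoverFamily D s Cov σ) {t w : ℕ} (hw : 0 < w) {g : ℝ}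
    (hg : 16 * σ / w ^ 2 ≤ g) (hg0 : 0 ≤ g)
    (hp : (Measure.infinitePi fun _ : ι => D).real (Cov (t + 3 * w)) ≤ 1 / 2) :
    (Measure.infinitePi fun _ : ι => D).real (Cov t) ≤
      g ^ 3 * ((Measure.infinitePi fun _ : ι => D).real (Cov (t + 3 * w)) -
        (Measure.infinitePi fun _ : ι => D).real (Cov t)) := by
  have m1 := h.measureReal_mono_level (by omega : t ≤ t + w)
  have m2 := h.measureReal_mono_level (by omega : t + w ≤ t + w + w)
  have m3 := h.measureReal_mono_level (by omega : t + w + w ≤ t + w + w + w)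
  have e3 : t + 3 * w = t + w + w + w := by ring
  rw [e3] at hp ⊢
  have h1 := h.prob_le_of_le_half (t := t) hw (by linarith)
  have h2 := h.prob_le_of_le_half (t := t + w) hw (by linarith)
  have h3 := h.prob_le_of_le_half (t := t + w + w) hw hp
  set P := Measure.infinitePi fun _ : ι => D
  set p0 := P.real (Cov t)
  set p1 := P.real (Cov (t + w))
  set p2 := P.real (Cov (t + w + w))
  set p3 := P.real (Cov (t + w + w + w))
  have n0 : 0 ≤ p0 := measureReal_nonneg
  have n1 : 0 ≤ p1 := measureReal_nonneg
  have n2 : 0 ≤ p2 := measureReal_nonneg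
  have k1 : p0 ≤ g * p1 := h1.trans (mul_le_mul hg (by linarith) (by linarith) hg0)
  have k2 : p1 ≤ g * p2 := h2.trans (mul_le_mul hg (by linarith) (by linarith) hg0)
  have k3 : p2 ≤ g * (p3 - p0) := h3.trans (mul_le_mul hg (by linarith) (by linarith) hg0)
  calc p0 ≤ g * (g * (g * (p3 - p0))) := by
        refine k1.trans (mul_le_mul_of_nonneg_left (k2.trans ?_) hg0)
        exact mul_le_mul_of_nonneg_left k3 hg0
    _ = _ := by ring

/-- The mirror image: the failure probability shrinks by `g` per window, and the increment enters
through the first window. -/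
theorem one_sub_prob_le_cube (h : IsCoverFamily D s Cov σ) {t w : ℕ} (hw : 0 < w) {g : ℝ}
    (hg : 16 * σ / w ^ 2 ≤ g) (hg0 : 0 ≤ g)
    (hp : 1 / 4 ≤ (Measure.infinitePi fun _ : ι => D).real (Cov t)) :
    1 - (Measure.infinitePi fun _ : ι => D).real (Cov (t + 3 * w)) ≤
      g ^ 3 * ((Measure.infinitePi fun _ : ι => D).real (Cov (t + 3 * w)) -
        (Measure.infinitePi fun _ : ι => D).real (Cov t)) := by
  have m1 := h.measureReal_mono_level (by omega : t ≤ t + w)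
  have m2 := h.measureReal_mono_level (by omega : t + w ≤ t + w + w)
  have m3 := h.measureReal_mono_level (by omega : t + w + w ≤ t + w + w + w)
  have e3 : t + 3 * w = t + w + w + w := by ring
  rw [e3]
  have h1 := h.one_sub_prob_le_of_quarter_le (t := t) hw hp
  have h2 := h.one_sub_prob_le_of_quarter_le (t := t + w) hw (by linarith)
  have h3 := h.one_sub_prob_le_of_quarter_le (t := t + w + w) hw (by linarith)
  set P := Measure.infinitePi fun _ : ι => D
  set p0 := P.real (Cov t)
  set p1 := P.real (Cov (t + w))
  set p2 := P.real (Cov (t + w + w))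
  set p3 := P.real (Cov (t + w + w + w))
  have n2 : p2 ≤ 1 := measureReal_le_one
  have n3 : p3 ≤ 1 := measureReal_le_one
  have k1 : 1 - p1 ≤ g * (p3 - p0) := h1.trans (mul_le_mul hg (by linarith) (by linarith) hg0)
  have k2 : 1 - p2 ≤ g * (1 - p1) := h2.trans (mul_le_mul hg (by linarith) (by linarith) hg0)
  have k3 : 1 - p3 ≤ g * (1 - p2) := h3.trans (mul_le_mul hg (by linarith) (by linarith) hg0)
  calc 1 - p3 ≤ g * (g * (g * (p3 - p0))) := by
        refine k3.trans (mul_le_mul_of_nonneg_left (k2.trans ?_) hg0)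
        exact mul_le_mul_of_nonneg_left k1 hg0
    _ = _ := by ring

end IsCoverFamily

end CoverEvents

/-! ### Independence of events on disjoint sets of coordinates -/

section Independence

variable {ι X : Type*} [MeasurableSpace X]

/-- Each event is the preimage, under restriction to its coordinates, of the set obtained by filling
the other coordinates with a fixed point `x₀`. Restrictions to disjoint sets of coordinates are
independent. -/
theorem prob_inter_of_dependsOn (D : Measure X) [IsProbabilityMeasure D] {s t : Finset ι}
    (hst : Disjoint s t) {A B : Set (ι → X)} (hA : MeasurableSet A) (hB : MeasurableSet B)
    (hAs : ∀ ω ω', (∀ i ∈ s, ω i = ω' i) → ω ∈ A → ω' ∈ A)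
    (hBt : ∀ ω ω', (∀ i ∈ t, ω i = ω' i) → ω ∈ B → ω' ∈ B) :
    (Measure.infinitePi fun _ : ι => D).real (A ∩ B) =
      (Measure.infinitePi fun _ : ι => D).real A * (Measure.infinitePi fun _ : ι => D).real B := by
  classical
  obtain ⟨x₀⟩ : Nonempty X := D.nonempty_of_neZero
  set P := Measure.infinitePi fun _ : ι => D
  let ext : (u : Finset ι) → (u → X) → ι → X := fun u z i => if h : i ∈ u then z ⟨i, h⟩ else x₀
  have hext : ∀ u, Measurable (ext u) := fun u => measurable_pi_lambda _ fun i => by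
    by_cases h : i ∈ u
    · simp only [ext, h, dite_true]; exact measurable_pi_apply _
    · simp only [ext, h, dite_false]; exact measurable_const
  have hind : ProbabilityTheory.iIndepFun (fun (i : ι) (ω : ι → X) => ω i) P :=
    ProbabilityTheory.iIndepFun_infinitePi (P := fun _ : ι => D) (X := fun _ x => x)
      fun _ => measurable_id
  have h2 := hind.indepFun_finset s t hst fun i => measurable_pi_apply i
  have hpre : ∀ (u : Finset ι) (G : Set (ι → X)),
      (∀ ω ω', (∀ i ∈ u, ω i = ω' i) → ω ∈ G → ω' ∈ G) →
      (fun (ω : ι → X) (i : u) => ω i) ⁻¹' (ext u ⁻¹' G) = G := fun u G hG => by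
    ext ω
    have hagree : ∀ i ∈ u, ext u (fun i : u => ω i) i = ω i := fun i hi => by simp [ext, hi]
    exact ⟨fun h => hG _ _ hagree h, fun h => hG _ _ (fun i hi => (hagree i hi).symm) h⟩
  have h3 := h2.measure_inter_preimage_eq_mul (ext s ⁻¹' A) (ext t ⁻¹' B) (hext s hA) (hext t hB)
  rw [hpre s A hAs, hpre t B hBt] at h3
  simp only [measureReal_def, h3, ENNReal.toReal_mul]

end Independence

/-! ### Survivors on prefixes of deterministic length, as a cover family -/

section Survivors

variable {X : Type*}

/-- The points on which `h` errs, for the target `c`. -/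
def errSet (c h : X → Bool) : Set X := {x | h x ≠ c x}

theorem measurableSet_errSet [MeasurableSpace X] {c h : X → Bool} (hc : Measurable c)
    (hh : Measurable h) : MeasurableSet (errSet c h) :=
  (measurableSet_eq_fun hh hc).compl

/-- The number of errors of `h` on the first `R` points of the stream `s`. -/
def errs (c h : X → Bool) (s : ℕ → X) (R : ℕ) : ℕ := hitCount (errSet c h) (Finset.range R) s

theorem errs_self (c : X → Bool) (s : ℕ → X) (R : ℕ) : errs c c s R = 0 := by
  classical
  simp [errs, hitCount, errSet]

theorem errs_mono_right (c h : X → Bool) (s : ℕ → X) {R R' : ℕ} (hR : R ≤ R') :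
    errs c h s R ≤ errs c h s R' :=
  hitCount_mono_right _ (Finset.range_mono hR) _

theorem dist_self [MeasurableSpace X] (D : Measure X) (c : X → Bool) : dist D c c = 0 := by
  simp [dist]

theorem dist_nonneg [MeasurableSpace X] (D : Measure X) (h c : X → Bool) : 0 ≤ dist D h c :=
  measureReal_nonneg

open Classical in
/-- The hypotheses with at most `n` errors on the first `R j` points of the stream `S j`, for all
`j < r`, among those for which the expected number of these errors is at most `B`. -/
def survivors [MeasurableSpace X] (D : Measure X) (C : Finset (X → Bool)) (c : X → Bool) (B : ℝ)
    (r : ℕ) (R : ℕ → ℕ) (n : ℕ) (S : ℕ → ℕ → X) : Finset (X → Bool) :=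
  {h ∈ C | ∀ j < r, errs c h (S j) (R j) ≤ n ∧ R j * dist D h c ≤ B}

/-- The law of a sequence of independent i.i.d. streams. -/
def streamsLaw [MeasurableSpace X] (D : Measure X) [IsProbabilityMeasure D] :
    Measure (ℕ → ℕ → X) :=
  Measure.infinitePi fun _ : ℕ => Measure.infinitePi fun _ : ℕ => D

instance [MeasurableSpace X] (D : Measure X) [IsProbabilityMeasure D] :
    IsProbabilityMeasure (streamsLaw D) := by
  unfold streamsLaw; infer_instance

/-- The event that some hypothesis of `T` survives. -/
def covered [MeasurableSpace X] (D : Measure X) (C : Finset (X → Bool)) (c : X → Bool) (B : ℝ)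
    (r : ℕ) (R : ℕ → ℕ) (T : Finset (X → Bool)) (n : ℕ) : Set (ℕ → ℕ → X) :=
  {S | ∃ h ∈ T, h ∈ survivors D C c B r R n S}

/-- The probability that some hypothesis of `T` survives. -/
def coverProb [MeasurableSpace X] (D : Measure X) [IsProbabilityMeasure D]
    (C : Finset (X → Bool)) (c : X → Bool) (B : ℝ)
    (r : ℕ) (R : ℕ → ℕ) (T : Finset (X → Bool)) (n : ℕ) : ℝ :=
  (streamsLaw D).real (covered D C c B r R T n)

variable [MeasurableSpace X] {D : Measure X} {C : Finset (X → Bool)} {c : X → Bool}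

theorem mem_survivors {B : ℝ} {r : ℕ} {R : ℕ → ℕ} {n : ℕ} {S : ℕ → ℕ → X} {h : X → Bool} :
    h ∈ survivors D C c B r R n S ↔
      h ∈ C ∧ ∀ j < r, errs c h (S j) (R j) ≤ n ∧ R j * dist D h c ≤ B := by
  classical
  simp [survivors]

theorem survivors_mono {B B' : ℝ} (hB : B ≤ B') {r : ℕ} {R R' : ℕ → ℕ} (hR : ∀ j < r, R' j ≤ R j)
    {n n' : ℕ} (hn : n ≤ n') (S : ℕ → ℕ → X) :
    survivors D C c B r R n S ⊆ survivors D C c B' r R' n' S := fun h hh => by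
  rw [mem_survivors] at hh ⊢
  refine ⟨hh.1, fun j hj => ⟨(errs_mono_right _ _ _ (hR j hj)).trans ((hh.2 j hj).1.trans hn), ?_⟩⟩
  refine le_trans ?_ ((hh.2 j hj).2.trans hB)
  have := dist_nonneg D h c
  have : (R' j : ℝ) ≤ R j := by exact_mod_cast hR j hj
  gcongr

theorem self_mem_survivors (hc : c ∈ C) {B : ℝ} (hB : 0 ≤ B) (r : ℕ) (R : ℕ → ℕ) (n : ℕ)
    (S : ℕ → ℕ → X) : c ∈ survivors D C c B r R n S := by
  rw [mem_survivors]
  exact ⟨hc, fun j _ => ⟨by simp [errs_self], by simpa [dist_self] using hB⟩⟩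

theorem measurable_errs (hC : ∀ h ∈ C, Measurable h) (hc : c ∈ C) {h : X → Bool} (hh : h ∈ C)
    (R : ℕ) : Measurable fun s : ℕ → X => errs c h s R :=
  measurable_hitCount (measurableSet_errSet (hC c hc) (hC h hh)) _

theorem measurableSet_mem_survivors (hC : ∀ h ∈ C, Measurable h) (hc : c ∈ C) (B : ℝ) (r : ℕ)
    (R : ℕ → ℕ) (n : ℕ) (h : X → Bool) :
    MeasurableSet {S : ℕ → ℕ → X | h ∈ survivors D C c B r R n S} := by
  by_cases hh : h ∈ C
  · have : {S : ℕ → ℕ → X | h ∈ survivors D C c B r R n S} =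
        ⋂ j ∈ Finset.range r, {S | errs c h (S j) (R j) ≤ n ∧ R j * dist D h c ≤ B} := by
      ext S; simp [mem_survivors, hh]
    rw [this]
    refine Finset.measurableSet_biInter _ fun j _ => MeasurableSet.inter ?_ (MeasurableSet.const _)
    exact measurableSet_le ((measurable_errs hC hc hh (R j)).comp (measurable_pi_apply j))
      measurable_const
  · simp [mem_survivors, hh]

theorem measurableSet_covered (hC : ∀ h ∈ C, Measurable h) (hc : c ∈ C) (B : ℝ) (r : ℕ)
    (R : ℕ → ℕ) (T : Finset (X → Bool)) (n : ℕ) : MeasurableSet (covered D C c B r R T n) := by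
  have : covered D C c B r R T n = ⋃ h ∈ T, {S | h ∈ survivors D C c B r R n S} := by
    ext S; simp [covered]
  rw [this]
  exact Finset.measurableSet_biUnion _ fun h _ => measurableSet_mem_survivors hC hc B r R n h

variable [IsProbabilityMeasure D]

theorem measurePreserving_curry :
    MeasurePreserving (MeasurableEquiv.curry ℕ ℕ X) (Measure.infinitePi fun _ : ℕ × ℕ => D)
      (streamsLaw D) :=
  ⟨(MeasurableEquiv.curry ℕ ℕ X).measurable,
    Measure.infinitePi_map_curry (fun (_ : ℕ) (_ : ℕ) => D)⟩

theorem streamsLaw_real_eq {A : Set (ℕ → ℕ → X)} (hA : MeasurableSet A) :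
    (streamsLaw D).real A =
      (Measure.infinitePi fun _ : ℕ × ℕ => D).real (MeasurableEquiv.curry ℕ ℕ X ⁻¹' A) := by
  rw [measureReal_def, measureReal_def, measurePreserving_curry.measure_preimage hA.nullMeasurableSet]

/-- The embedding of the positions of the `j`-th stream. -/
def streamPos (j : ℕ) : ℕ ↪ ℕ × ℕ := ⟨Prod.mk j, Prod.mk_right_injective j⟩

theorem curry_update_self (ω : ℕ × ℕ → X) (j i : ℕ) (y : X) :
    MeasurableEquiv.curry ℕ ℕ X (Function.update ω (j, i) y) j =
      Function.update (MeasurableEquiv.curry ℕ ℕ X ω j) i y := by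
  ext i'
  by_cases h : i' = i
  · subst h; simp [MeasurableEquiv.curry, Function.curry]
  · simp [MeasurableEquiv.curry, Function.curry, h]

theorem curry_update_of_ne (ω : ℕ × ℕ → X) {j j' : ℕ} (h : j' ≠ j) (i : ℕ) (y : X) :
    MeasurableEquiv.curry ℕ ℕ X (Function.update ω (j, i) y) j' =
      MeasurableEquiv.curry ℕ ℕ X ω j' := by
  ext i'
  simp [MeasurableEquiv.curry, Function.curry, h]

theorem errs_curry_update_le (c h : X → Bool) (ω : ℕ × ℕ → X) (p : ℕ × ℕ) (y : X) (j R : ℕ) :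
    errs c h (MeasurableEquiv.curry ℕ ℕ X (Function.update ω p y) j) R ≤
      errs c h (MeasurableEquiv.curry ℕ ℕ X ω j) R + 1 := by
  obtain ⟨j', i⟩ := p
  by_cases hj : j = j'
  · subst hj; rw [curry_update_self]; exact hitCount_update_le _ _ _ _ _
  · rw [curry_update_of_ne ω hj]; omega

theorem errs_curry_update_le_of_notMem (c h : X → Bool) (ω : ℕ × ℕ → X) (p : ℕ × ℕ) {y : X}
    (hy : y ∉ errSet c h) (j R : ℕ) :
    errs c h (MeasurableEquiv.curry ℕ ℕ X (Function.update ω p y) j) R ≤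
      errs c h (MeasurableEquiv.curry ℕ ℕ X ω j) R := by
  obtain ⟨j', i⟩ := p
  by_cases hj : j = j'
  · subst hj; rw [curry_update_self]; exact hitCount_update_le_of_notMem _ _ _ _ hy
  · rw [curry_update_of_ne ω hj]

/-- The positions of the streams `j < r` between `R j` and `R' j`. -/
def blocks (r : ℕ) (R R' : ℕ → ℕ) : Finset (ℕ × ℕ) :=
  (Finset.range r).biUnion fun j => (Finset.Ico (R j) (R' j)).map (streamPos j)

theorem mem_blocks {r : ℕ} {R R' : ℕ → ℕ} {p : ℕ × ℕ} :
    p ∈ blocks r R R' ↔ p.1 < r ∧ R p.1 ≤ p.2 ∧ p.2 < R' p.1 := by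
  obtain ⟨j, i⟩ := p
  simp only [blocks, streamPos, Finset.mem_biUnion, Finset.mem_range, Finset.mem_map,
    Finset.mem_Ico, Function.Embedding.coeFn_mk, Prod.mk.injEq]
  constructor
  · rintro ⟨j', hj', i', hi', rfl, rfl⟩; exact ⟨hj', hi'⟩
  · rintro ⟨hj, hi⟩; exact ⟨j, hj, i, hi, rfl, rfl⟩

theorem card_blocks_le (r : ℕ) (R : ℕ → ℕ) :
    (blocks r 0 R).card ≤ ∑ j ∈ Finset.range r, R j := by
  refine Finset.card_biUnion_le.trans (Finset.sum_le_sum fun j _ => ?_)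
  simp

theorem survivors_curry_congr {B : ℝ} {r : ℕ} {R : ℕ → ℕ} {n : ℕ} {ω ω' : ℕ × ℕ → X}
    (hω : ∀ p ∈ blocks r 0 R, ω p = ω' p) :
    survivors D C c B r R n (MeasurableEquiv.curry ℕ ℕ X ω) =
      survivors D C c B r R n (MeasurableEquiv.curry ℕ ℕ X ω') := by
  ext h
  simp only [mem_survivors]
  refine and_congr_right fun _ => forall₂_congr fun j hj => ?_
  have : errs c h (MeasurableEquiv.curry ℕ ℕ X ω j) (R j) =
      errs c h (MeasurableEquiv.curry ℕ ℕ X ω' j) (R j) :=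
    hitCount_congr _ _ fun i hi => hω (j, i) (mem_blocks.2 ⟨hj, by simp, by simpa using hi⟩)
  rw [this]

/-- The streams are flattened into one family over `ℕ × ℕ`. The witness set is the error set of a
hypothesis surviving at the least possible level: a new value outside it adds no error to this
hypothesis, so the outcome stays covered at every level at which it was covered. The side condition
on expected errors, at most `B` in each of `r` streams, gives `σ = r * B`. -/
theorem isCoverFamily_covered (hC : ∀ h ∈ C, Measurable h) (hc : c ∈ C) (B : ℝ) (r : ℕ)
    (R : ℕ → ℕ) (T : Finset (X → Bool)) :
    IsCoverFamily D (blocks r 0 R)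
      (fun n => MeasurableEquiv.curry ℕ ℕ X ⁻¹' covered D C c B r R T n) (r * B) where
  meas n := (MeasurableEquiv.curry ℕ ℕ X).measurable (measurableSet_covered hC hc B r R T n)
  mono n n' hn ω := by
    rintro ⟨h, hT, hh⟩
    exact ⟨h, hT, survivors_mono le_rfl (fun _ _ => le_rfl) hn _ hh⟩
  dep n ω ω' hω := by
    rintro ⟨h, hT, hh⟩
    exact ⟨h, hT, by rwa [← survivors_curry_congr hω]⟩
  step n ω p y := by
    rintro ⟨h, hT, hh⟩
    refine ⟨h, hT, ?_⟩
    rw [mem_survivors] at hh ⊢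
    exact ⟨hh.1, fun j hj => ⟨(errs_curry_update_le c h ω p y j (R j)).trans
      (Nat.add_le_add_right (hh.2 j hj).1 1), (hh.2 j hj).2⟩⟩
  witness n ω hω := by
    classical
    have hex : ∃ t, ω ∈ MeasurableEquiv.curry ℕ ℕ X ⁻¹' covered D C c B r R T t := ⟨n, hω⟩
    obtain ⟨h, hT, hh⟩ := Nat.find_spec hex
    have hhC := (mem_survivors.1 hh).1
    refine ⟨errSet c h, measurableSet_errSet (hC c hc) (hC h hhC), ?_, fun t' ht' p y hy => ?_⟩
    · have h1 : ((blocks r 0 R).card : ℝ) ≤ ∑ j ∈ Finset.range r, (R j : ℝ) := by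
        exact_mod_cast card_blocks_le r R
      calc ((blocks r 0 R).card : ℝ) * D.real (errSet c h)
          ≤ (∑ j ∈ Finset.range r, (R j : ℝ)) * D.real (errSet c h) := by gcongr
        _ = ∑ j ∈ Finset.range r, R j * dist D h c := by rw [Finset.sum_mul]; rfl
        _ ≤ ∑ _j ∈ Finset.range r, B :=
            Finset.sum_le_sum fun j hj => ((mem_survivors.1 hh).2 j (Finset.mem_range.1 hj)).2
        _ = r * B := by simp
    · have hle := Nat.find_min' hex ht'
      refine ⟨h, hT, ?_⟩
      rw [mem_survivors] at hh ⊢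
      exact ⟨hhC, fun j hj => ⟨(errs_curry_update_le_of_notMem c h ω p hy j (R j)).trans
        ((hh.2 j hj).1.trans hle), (hh.2 j hj).2⟩⟩

theorem coverProb_eq (hC : ∀ h ∈ C, Measurable h) (hc : c ∈ C) (B : ℝ) (r : ℕ)
    (R : ℕ → ℕ) (T : Finset (X → Bool)) (n : ℕ) :
    coverProb D C c B r R T n = (Measure.infinitePi fun _ : ℕ × ℕ => D).real
      (MeasurableEquiv.curry ℕ ℕ X ⁻¹' covered D C c B r R T n) :=
  streamsLaw_real_eq (measurableSet_covered hC hc B r R T n)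

theorem coverProb_nonneg (B : ℝ) (r : ℕ) (R : ℕ → ℕ) (T : Finset (X → Bool)) (n : ℕ) :
    0 ≤ coverProb D C c B r R T n := measureReal_nonneg

theorem coverProb_le_one (B : ℝ) (r : ℕ) (R : ℕ → ℕ) (T : Finset (X → Bool)) (n : ℕ) :
    coverProb D C c B r R T n ≤ 1 := measureReal_le_one

theorem coverProb_mono {B B' : ℝ} (hB : B ≤ B') {r : ℕ} {R R' : ℕ → ℕ} (hR : ∀ j < r, R' j ≤ R j)
    (T : Finset (X → Bool)) {n n' : ℕ} (hn : n ≤ n') :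
    coverProb D C c B r R T n ≤ coverProb D C c B' r R' T n' :=
  measureReal_mono fun S ⟨h, hT, hh⟩ => ⟨h, hT, survivors_mono hB hR hn S hh⟩

theorem coverProb_le_cube (hC : ∀ h ∈ C, Measurable h) (hc : c ∈ C) (B : ℝ) (r : ℕ)
    (R : ℕ → ℕ) (T : Finset (X → Bool)) {n w : ℕ} (hw : 0 < w) {g : ℝ} (hg0 : 0 ≤ g)
    (hg : 16 * (r * B) / w ^ 2 ≤ g) (hp : coverProb D C c B r R T (n + 3 * w) ≤ 1 / 2) :
    coverProb D C c B r R T n ≤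
      g ^ 3 * (coverProb D C c B r R T (n + 3 * w) - coverProb D C c B r R T n) := by
  simp only [coverProb_eq hC hc] at hp ⊢
  exact (isCoverFamily_covered hC hc B r R T).prob_le_cube hw hg hg0 hp

theorem one_sub_coverProb_le_cube (hC : ∀ h ∈ C, Measurable h) (hc : c ∈ C) (B : ℝ) (r : ℕ)
    (R : ℕ → ℕ) (T : Finset (X → Bool)) {n w : ℕ} (hw : 0 < w) {g : ℝ} (hg0 : 0 ≤ g)
    (hg : 16 * (r * B) / w ^ 2 ≤ g) (hp : 1 / 4 ≤ coverProb D C c B r R T n) :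
    1 - coverProb D C c B r R T (n + 3 * w) ≤
      g ^ 3 * (coverProb D C c B r R T (n + 3 * w) - coverProb D C c B r R T n) := by
  simp only [coverProb_eq hC hc] at hp ⊢
  exact (isCoverFamily_covered hC hc B r R T).one_sub_prob_le_cube hw hg hg0 hp

/-- Either the probability is still at most `1/2` at the end of the window, and the tail bound
applies with a factor at most `1`; or it has grown from below `1/4` to above `1/2`, by more than its
initial value. -/
theorem coverProb_le_window (hC : ∀ h ∈ C, Measurable h) (hc : c ∈ C) (B : ℝ) (r : ℕ)
    (R : ℕ → ℕ) (T : Finset (X → Bool)) {n w : ℕ} (hw : 0 < w)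
    (hg : 16 * (r * B) / w ^ 2 ≤ 1) (hp : coverProb D C c B r R T n < 1 / 4) :
    coverProb D C c B r R T n ≤ coverProb D C c B r R T (n + w) - coverProb D C c B r R T n := by
  by_cases h : coverProb D C c B r R T (n + w) ≤ 1 / 2
  · have hmono : coverProb D C c B r R T n ≤ coverProb D C c B r R T (n + w) :=
      coverProb_mono le_rfl (fun _ _ => le_rfl) T (by omega)
    have h1 : coverProb D C c B r R T n ≤ 16 * (r * B) / w ^ 2 *
        (coverProb D C c B r R T (n + w) - coverProb D C c B r R T n) := by
      simp only [coverProb_eq hC hc] at h ⊢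
      exact (isCoverFamily_covered hC hc B r R T).prob_le_of_le_half hw h
    exact h1.trans (mul_le_of_le_one_left (by linarith) hg)
  · push Not at h; linarith

end Survivors

/-! ### Conditioning on finitely many outcomes, longer prefixes, and union bounds -/

theorem measureReal_mem_apply_le {Ω κ : Type*} [MeasurableSpace Ω] (μ : Measure Ω)
    [IsProbabilityMeasure μ] (F : Finset κ) (f : Ω → κ) (B : κ → Set Ω) {η : ℝ}
    (hf : ∀ k ∈ F, MeasurableSet {ω | f ω = k})
    (hB : ∀ k ∈ F, μ.real ({ω | f ω = k} ∩ B k) ≤ η * μ.real {ω | f ω = k}) :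
    μ.real {ω | f ω ∈ F ∧ ω ∈ B (f ω)} ≤ η * μ.real {ω | f ω ∈ F} := by
  have h1 : {ω | f ω ∈ F ∧ ω ∈ B (f ω)} = ⋃ k ∈ F, ({ω | f ω = k} ∩ B k) := by
    ext ω; simp
  have h2 : {ω | f ω ∈ F} = ⋃ k ∈ F, {ω | f ω = k} := by ext ω; simp
  have h3 : μ.real {ω | f ω ∈ F} = ∑ k ∈ F, μ.real {ω | f ω = k} := by
    rw [h2]
    refine measureReal_biUnion_finset (fun a _ b _ hab => ?_) hf
    exact Set.disjoint_left.2 fun ω (ha : f ω = a) (hb : f ω = b) => hab (ha.symm.trans hb)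
  rw [h3, h1, Finset.mul_sum]
  exact (measureReal_biUnion_finset_le _ _).trans (Finset.sum_le_sum hB)

section

variable {X : Type*} [MeasurableSpace X] {D : Measure X} [IsProbabilityMeasure D]
  {C : Finset (X → Bool)} {c : X → Bool}

theorem errs_curry (h : X → Bool) (ω : ℕ × ℕ → X) (j R : ℕ) :
    errs c h (MeasurableEquiv.curry ℕ ℕ X ω j) R =
      hitCount (errSet c h) ((Finset.range R).map (streamPos j)) ω := by
  rw [hitCount_map]; rfl

theorem errs_curry_le_add (h : X → Bool) (ω : ℕ × ℕ → X) (j R R' : ℕ) :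
    errs c h (MeasurableEquiv.curry ℕ ℕ X ω j) R' ≤
      errs c h (MeasurableEquiv.curry ℕ ℕ X ω j) R +
        hitCount (errSet c h) ((Finset.Ico R R').map (streamPos j)) ω := by
  classical
  rw [errs_curry, errs_curry, ← hitCount_add_of_disjoint]
  · refine hitCount_mono_right _ ?_ _
    rw [← Finset.map_union]
    refine Finset.map_subset_map.2 fun i hi => ?_
    simp only [Finset.mem_union, Finset.mem_range, Finset.mem_Ico] at hi ⊢
    omega
  · refine (Finset.disjoint_map _).2 ?_
    rw [Finset.disjoint_left]
    intro i hi hi'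
    simp only [Finset.mem_range, Finset.mem_Ico] at hi hi'
    omega

/-- Chernoff at `θ = t / (2 * B)`, the minimizer of `B θ² - t θ`; the condition `t ≤ 2 * B` ensures
`θ ≤ 1`, where `exp θ - 1 ≤ θ + θ²`. -/
theorem prob_add_le_hitCount_of_le {ι : Type*} (D : Measure X) [IsProbabilityMeasure D] {A : Set X}
    (hA : MeasurableSet A) (J : Finset ι) {m B t : ℝ} (hm : J.card * D.real A ≤ m) (hmB : m ≤ B)
    (ht : 0 ≤ t) (htB : t ≤ 2 * B) :
    (Measure.infinitePi fun _ : ι => D).real {ω | m + t ≤ hitCount A J ω} ≤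
      Real.exp (-(t ^ 2 / (4 * B))) := by
  have hm0 : 0 ≤ m := le_trans (by positivity) hm
  rcases (hm0.trans hmB).eq_or_lt with h0 | hpos
  · rw [← h0]; simp
  have hθ : 0 ≤ t / (2 * B) := by positivity
  have hθ1 : t / (2 * B) ≤ 1 := by rw [div_le_one (by positivity)]; exact htB
  refine (prob_le_hitCount D hA J hθ _).trans (Real.exp_le_exp.2 ?_)
  have h1 := exp_sub_one_le hθ hθ1
  have h2 : 0 ≤ Real.exp (t / (2 * B)) - 1 := by linarith [Real.add_one_le_exp (t / (2 * B))]
  calc J.card * D.real A * (Real.exp (t / (2 * B)) - 1) - t / (2 * B) * (m + t)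
      ≤ m * (t / (2 * B) + (t / (2 * B)) ^ 2) - t / (2 * B) * (m + t) := by
        have := mul_le_mul hm h1 h2 hm0; linarith
    _ ≤ B * (t / (2 * B)) ^ 2 - t / (2 * B) * t := by
        have := mul_le_mul_of_nonneg_right hmB (sq_nonneg (t / (2 * B))); linarith
    _ = -(t ^ 2 / (4 * B)) := by field_simp; ring

/-- If some hypothesis of `T` survives with probability more than `1/2`, then, with a slightly
larger tolerance, some hypothesis of `T` survives slightly longer streams with probability at
least `1/4`. -/
theorem quarter_le_coverProb_of_half_lt (hC : ∀ h ∈ C, Measurable h) (hc : c ∈ C)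
    {Bp Bm κ : ℝ} {r : ℕ} {Rp Rm : ℕ → ℕ} (hκ : 0 ≤ κ)
    (hR : ∀ j < r, (Rm j : ℝ) ≤ (1 + κ) * Rp j) (hB : (1 + κ) * Bp ≤ Bm) {w : ℕ}
    (hw : κ * Bp ≤ w / 8) (hexp : r * Real.exp (-(3 / 4 * w)) ≤ 1 / 2)
    {T : Finset (X → Bool)} {t : ℕ} (hp : 1 / 2 < coverProb D C c Bp r Rp T t) :
    1 / 4 ≤ coverProb D C c Bm r Rm T (t + w) := by
  classical
  rw [coverProb_eq hC hc] at hp ⊢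
  set P := Measure.infinitePi fun _ : ℕ × ℕ => D
  let cur := MeasurableEquiv.curry ℕ ℕ X
  -- Condition on the set of survivors in `T` and select one of them. The points added to the
  -- prefixes lie in other blocks, so they are independent of the selection.
  let f : (ℕ × ℕ → X) → Finset (X → Bool) := fun ω => T ∩ survivors D C c Bp r Rp t (cur ω)
  let F : Finset (Finset (X → Bool)) := T.powerset.filter (·.Nonempty)
  let sel : Finset (X → Bool) → X → Bool := fun K => if h : K.Nonempty then h.choose else c
  have hsel : ∀ K, K.Nonempty → sel K ∈ K := fun K hK => by
    simp only [sel, hK, dite_true]; exact hK.choose_spec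
  let B : Finset (X → Bool) → Set (ℕ × ℕ → X) := fun K =>
    if sel K ∈ C ∧ ∀ j < r, Rp j * dist D (sel K) c ≤ Bp then
    {ω | ∃ j < r, w ≤ hitCount (errSet c (sel K)) ((Finset.Ico (Rp j) (Rm j)).map (streamPos j)) ω}
    else ∅
  have hfF : {ω | f ω ∈ F} = cur ⁻¹' covered D C c Bp r Rp T t := by
    ext ω
    have h1 : f ω ∈ F ↔ f ω ⊆ T ∧ (f ω).Nonempty := by
      simp only [F, Finset.mem_filter, Finset.mem_powerset]
    have h2 : f ω ⊆ T := Finset.inter_subset_left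
    simp only [Set.mem_ofPred_eq, h1, h2, true_and, Finset.Nonempty, f, Finset.mem_inter]
    rfl
  have hfmeas : ∀ K ∈ F, MeasurableSet {ω | f ω = K} := fun K hK => by
    have hKT : K ⊆ T := Finset.mem_powerset.1 (Finset.mem_filter.1 hK).1
    have : {ω | f ω = K} =
        cur ⁻¹' ⋂ h ∈ T, {S | h ∈ survivors D C c Bp r Rp t S ↔ h ∈ K} := by
      ext ω
      simp only [Set.mem_ofPred_eq, Set.mem_preimage, Set.mem_iInter, f, Finset.ext_iff,
        Finset.mem_inter]
      constructor
      · intro h g hg; rw [← h g]; simp [hg]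
      · intro h g
        by_cases hg : g ∈ T
        · simp [hg, h g hg]
        · simpa [hg] using fun hgK => hg (hKT hgK)
    rw [this]
    refine cur.measurable (Finset.measurableSet_biInter _ fun h _ => ?_)
    have hm := measurableSet_mem_survivors (D := D) hC hc Bp r Rp t h
    by_cases hK : h ∈ K
    · simpa [hK] using hm
    · simp only [hK, iff_false]; exact hm.compl
  have hBound : ∀ K ∈ F, P.real ({ω | f ω = K} ∩ B K) ≤ 1 / 2 * P.real {ω | f ω = K} := by
    intro K hK
    by_cases hd : sel K ∈ C ∧ ∀ j < r, Rp j * dist D (sel K) c ≤ Bp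
    swap
    · simp only [B, hd, if_false, Set.inter_empty]; simp [measureReal_nonneg]
    have hsC := hd.1
    have hE := measurableSet_errSet (hC c hc) (hC _ hsC)
    have hBK : B K = ⋃ j ∈ Finset.range r, {ω | w ≤ hitCount (errSet c (sel K))
        ((Finset.Ico (Rp j) (Rm j)).map (streamPos j)) ω} := by
      ext ω; simp only [B, if_pos hd]; simp
    have hmeasj : ∀ j, MeasurableSet {ω : ℕ × ℕ → X | w ≤ hitCount (errSet c (sel K))
        ((Finset.Ico (Rp j) (Rm j)).map (streamPos j)) ω} := fun j =>
      measurableSet_le measurable_const (measurable_hitCount hE _)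
    have hmeasB : MeasurableSet (B K) := by
      rw [hBK]; exact Finset.measurableSet_biUnion _ fun j _ => hmeasj j
    rw [prob_inter_of_dependsOn D (s := blocks r 0 Rp) (t := blocks r Rp Rm) ?_ (hfmeas K hK)
      hmeasB ?_ ?_, mul_comm]
    · refine mul_le_mul_of_nonneg_right ?_ measureReal_nonneg
      rw [hBK]
      refine (measureReal_biUnion_finset_le _ _).trans ?_
      refine le_trans ?_ hexp
      calc _ ≤ ∑ _j ∈ Finset.range r, Real.exp (-(3 / 4 * w)) := Finset.sum_le_sum fun j hj => ?_
        _ = _ := by simp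
      have hj := Finset.mem_range.1 hj
      have hm : (((Finset.Ico (Rp j) (Rm j)).map (streamPos j)).card : ℝ) *
          D.real (errSet c (sel K)) ≤ w / 8 := by
        rw [Finset.card_map, Nat.card_Ico]
        have h1 : ((Rm j - Rp j : ℕ) : ℝ) ≤ κ * Rp j := by
          rcases le_total (Rm j) (Rp j) with h | h
          · rw [Nat.sub_eq_zero_of_le h]; simp only [Nat.cast_zero]; positivity
          · rw [Nat.cast_sub h]; linarith [hR j hj]
        calc ((Rm j - Rp j : ℕ) : ℝ) * D.real (errSet c (sel K))
            ≤ κ * Rp j * D.real (errSet c (sel K)) := by gcongr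
          _ = κ * (Rp j * dist D (sel K) c) := by rw [mul_assoc]; rfl
          _ ≤ κ * Bp := by gcongr; exact hd.2 j hj
          _ ≤ _ := hw
      have := prob_le_hitCount_exp D hE _ hm (w : ℝ)
      simp only [Nat.cast_le] at this
      refine this.trans (Real.exp_le_exp.2 ?_)
      linarith
    · rw [Finset.disjoint_left]
      intro p hp hp'
      rw [mem_blocks] at hp hp'
      omega
    · intro ω ω' hω h
      simp only [Set.mem_ofPred_eq, f] at h ⊢
      rw [← h, ← survivors_curry_congr hω]
    · intro ω ω' hω h
      rw [hBK] at h ⊢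
      simp only [Set.mem_iUnion, Set.mem_ofPred_eq, Finset.mem_range, exists_prop] at h ⊢
      obtain ⟨j, hj, h⟩ := h
      refine ⟨j, hj, h.trans (le_of_eq (hitCount_congr _ _ fun p hp => hω p ?_))⟩
      simp only [Finset.mem_map, Finset.mem_Ico, streamPos, Function.Embedding.coeFn_mk] at hp
      obtain ⟨i, hi, rfl⟩ := hp
      exact mem_blocks.2 ⟨hj, hi⟩
  have hmain := measureReal_mem_apply_le P F f B hfmeas hBound
  rw [hfF] at hmain
  have hsub : cur ⁻¹' covered D C c Bp r Rp T t ⊆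
      {ω | f ω ∈ F ∧ ω ∈ B (f ω)} ∪ cur ⁻¹' covered D C c Bm r Rm T (t + w) := by
    intro ω hω
    by_cases hb : ω ∈ B (f ω)
    · exact Or.inl ⟨by rw [← hfF] at hω; exact hω, hb⟩
    refine Or.inr ?_
    have hne : (f ω).Nonempty := by
      rw [← hfF] at hω; exact (Finset.mem_filter.1 hω).2
    have hs := hsel _ hne
    have hs' := Finset.mem_inter.1 hs
    have hsv := mem_survivors.1 hs'.2
    have hd : sel (f ω) ∈ C ∧ ∀ j < r, Rp j * dist D (sel (f ω)) c ≤ Bp :=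
      ⟨hsv.1, fun j hj => (hsv.2 j hj).2⟩
    simp only [B, if_pos hd, Set.mem_ofPred_eq, not_exists, not_and, not_le] at hb
    refine ⟨sel (f ω), hs'.1, mem_survivors.2 ⟨hsv.1, fun j hj => ⟨?_, ?_⟩⟩⟩
    · have h1 := errs_curry_le_add (c := c) (sel (f ω)) ω j (Rp j) (Rm j)
      have h2 := (hsv.2 j hj).1
      have hjr : j < r := hj
      have hcond := hb j hjr
      have h3 : errs c (sel (f ω)) (MeasurableEquiv.curry ℕ ℕ X ω j) (Rp j) ≤ t := h2
      exact h1.trans (by omega)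
    · calc (Rm j : ℝ) * dist D (sel (f ω)) c ≤ (1 + κ) * Rp j * dist D (sel (f ω)) c := by
            have := dist_nonneg D (sel (f ω)) c
            gcongr; exact hR j hj
        _ = (1 + κ) * (Rp j * dist D (sel (f ω)) c) := by ring
        _ ≤ (1 + κ) * Bp := by gcongr; exact hd.2 j hj
        _ ≤ Bm := hB
  have h1 := (measureReal_mono (μ := P) hsub).trans (measureReal_union_le _ _)
  linarith

theorem streamsLaw_errs_real (hC : ∀ h ∈ C, Measurable h) (hc : c ∈ C) {h : X → Bool} (hh : h ∈ C)
    (j R : ℕ) (p : ℕ → Prop) :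
    (streamsLaw D).real {S | p (errs c h (S j) R)} =
      (Measure.infinitePi fun _ : ℕ => D).real
        {s | p (hitCount (errSet c h) (Finset.range R) s)} := by
  have h1 : MeasurePreserving (fun S : ℕ → ℕ → X => S j) (streamsLaw D)
      (Measure.infinitePi fun _ : ℕ => D) := measurePreserving_eval_infinitePi _ j
  have hm : MeasurableSet {s : ℕ → X | p (errs c h s R)} :=
    (measurable_errs hC hc hh R) (MeasurableSpace.measurableSet_top : MeasurableSet {n | p n})
  rw [measureReal_def, measureReal_def]
  exact congrArg ENNReal.toReal (h1.measure_preimage hm.nullMeasurableSet)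

/-- The hypotheses whose expected numbers of errors on the first `R j` points are at most `b`. -/
def expectedSurvivors (D : Measure X) (C : Finset (X → Bool)) (c : X → Bool) (b : ℝ) (r : ℕ)
    (R : ℕ → ℕ) : Finset (X → Bool) := by
  classical exact {h ∈ C | ∀ j < r, R j * dist D h c ≤ b}

theorem mem_expectedSurvivors {b : ℝ} {r : ℕ} {R : ℕ → ℕ} {h : X → Bool} :
    h ∈ expectedSurvivors D C c b r R ↔ h ∈ C ∧ ∀ j < r, R j * dist D h c ≤ b := by
  classical simp [expectedSurvivors]

/-- A survivor with an expected count above `b ≥ min (n + t) B` cannot exceed `B`, by the side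
condition. So its expected count exceeds `n + t` while its count is at most `n`: a deviation of at
least `t`, excluded by a union bound over hypotheses and streams. -/
theorem prob_not_survivors_subset (hC : ∀ h ∈ C, Measurable h) (hc : c ∈ C) {B b : ℝ} {r n : ℕ}
    {R : ℕ → ℕ} {t : ℝ} (hB : 0 < B) (ht : 0 ≤ t) (hb : min (n + t) B ≤ b) :
    (streamsLaw D).real {S | ¬ survivors D C c B r R n S ⊆ expectedSurvivors D C c b r R} ≤
      C.card * (r * Real.exp (-(t ^ 2 / (2 * B)))) := by
  let G : (X → Bool) → ℕ → Set (ℕ → ℕ → X) := fun h j =>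
    if R j * dist D h c ≤ B then {S | (errs c h (S j) (R j) : ℝ) ≤ R j * dist D h c - t} else ∅
  have hsub : {S | ¬ survivors D C c B r R n S ⊆ expectedSurvivors D C c b r R} ⊆
      ⋃ h ∈ C, ⋃ j ∈ Finset.range r, G h j := by
    intro S hS
    simp only [Set.mem_ofPred_eq, Finset.subset_iff, not_forall] at hS
    obtain ⟨h, hs, hn⟩ := hS
    have hs := mem_survivors.1 hs
    rw [mem_expectedSurvivors] at hn
    push Not at hn
    obtain ⟨j, hj, hbj⟩ := hn hs.1
    simp only [Set.mem_iUnion, Finset.mem_range, exists_prop]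
    refine ⟨h, hs.1, j, hj, ?_⟩
    have h2 := hs.2 j hj
    simp only [G, h2.2, if_true, Set.mem_ofPred_eq]
    have h3 : (errs c h (S j) (R j) : ℝ) ≤ n := by exact_mod_cast h2.1
    rcases min_lt_iff.1 (hb.trans_lt hbj) with h4 | h4 <;> linarith [h2.2]
  refine (measureReal_mono hsub (measure_ne_top _ _)).trans
    ((measureReal_biUnion_finset_le _ _).trans ?_)
  calc _ ≤ ∑ _h ∈ C, (r * Real.exp (-(t ^ 2 / (2 * B)))) := Finset.sum_le_sum fun h hh => ?_
    _ = _ := by simp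
  refine (measureReal_biUnion_finset_le _ _).trans ?_
  calc _ ≤ ∑ _j ∈ Finset.range r, Real.exp (-(t ^ 2 / (2 * B))) :=
        Finset.sum_le_sum fun j _ => ?_
    _ = _ := by simp
  by_cases hd : R j * dist D h c ≤ B
  · simp only [G, hd, if_true]
    rw [streamsLaw_errs_real hC hc hh j (R j) fun x => (x : ℝ) ≤ R j * dist D h c - t]
    have := prob_hitCount_le_mean_sub D (measurableSet_errSet (hC c hc) (hC h hh))
      (Finset.range (R j)) hB (by rw [Finset.card_range]; exact hd) ht
    simpa [dist, errSet] using this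
  · simp only [G, hd, if_false]; simp [Real.exp_nonneg]

theorem prob_not_subset_survivors (hC : ∀ h ∈ C, Measurable h) (hc : c ∈ C) {B b : ℝ} {r n : ℕ}
    {R R' : ℕ → ℕ} {t κ : ℝ} (hR : ∀ j < r, (R' j : ℝ) ≤ (1 + κ) * R j)
    (hκ : 0 ≤ κ) (hB : (1 + κ) * b ≤ B)
    (ht : 0 ≤ t) (htB : t ≤ 2 * B) (hb : (1 + κ) * b + t ≤ n) :
    (streamsLaw D).real {S | ¬ expectedSurvivors D C c b r R ⊆ survivors D C c B r R' n S} ≤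
      C.card * (r * Real.exp (-(t ^ 2 / (4 * B)))) := by
  let G : (X → Bool) → ℕ → Set (ℕ → ℕ → X) := fun h j =>
    {S | h ∈ expectedSurvivors D C c b r R ∧ (((1 + κ) * b + t : ℝ) ≤ errs c h (S j) (R' j))}
  have hle : ∀ h ∈ expectedSurvivors D C c b r R, ∀ j < r,
      (R' j : ℝ) * dist D h c ≤ (1 + κ) * b := fun h hh j hj => by
    have := dist_nonneg D h c
    calc (R' j : ℝ) * dist D h c ≤ (1 + κ) * R j * dist D h c := by gcongr; exact hR j hj
      _ = (1 + κ) * (R j * dist D h c) := by ring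
      _ ≤ _ := by gcongr; exact (mem_expectedSurvivors.1 hh).2 j hj
  have hsub : {S | ¬ expectedSurvivors D C c b r R ⊆ survivors D C c B r R' n S} ⊆
      ⋃ h ∈ C, ⋃ j ∈ Finset.range r, G h j := by
    intro S hS
    simp only [Set.mem_ofPred_eq, Finset.subset_iff, not_forall] at hS
    obtain ⟨h, hs, hn⟩ := hS
    have hsC := (mem_expectedSurvivors.1 hs).1
    rw [mem_survivors] at hn
    push Not at hn
    obtain ⟨j, hj, hbj⟩ := hn hsC
    simp only [Set.mem_iUnion, Finset.mem_range, exists_prop]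
    refine ⟨h, hsC, j, hj, hs, hb.trans ?_⟩
    by_contra hlt
    have h4 : errs c h (S j) (R' j) ≤ n := by
      have : (errs c h (S j) (R' j) : ℝ) ≤ n := (not_le.1 hlt).le
      exact_mod_cast this
    linarith [hbj h4, hle h hs j hj]
  refine (measureReal_mono hsub (measure_ne_top _ _)).trans
    ((measureReal_biUnion_finset_le _ _).trans ?_)
  calc _ ≤ ∑ _h ∈ C, (r * Real.exp (-(t ^ 2 / (4 * B)))) := Finset.sum_le_sum fun h hh => ?_
    _ = _ := by simp
  refine (measureReal_biUnion_finset_le _ _).trans ?_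
  calc _ ≤ ∑ _j ∈ Finset.range r, Real.exp (-(t ^ 2 / (4 * B))) :=
        Finset.sum_le_sum fun j hj => ?_
    _ = _ := by simp
  by_cases hd : h ∈ expectedSurvivors D C c b r R
  · simp only [G, hd, true_and]
    rw [streamsLaw_errs_real hC hc hh j (R' j) fun x => ((1 + κ) * b + t : ℝ) ≤ x]
    have hm' : ((Finset.range (R' j)).card : ℝ) * D.real (errSet c h) ≤ (1 + κ) * b := by
      rw [Finset.card_range]; exact hle h hd j (Finset.mem_range.1 hj)
    exact prob_add_le_hitCount_of_le D (measurableSet_errSet (hC c hc) (hC h hh)) _ hm' hB ht htB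
  · simp only [G, hd, false_and]; simp [Real.exp_nonneg]

end

/-! ### Quantiles of random variables with finitely many values -/

section Quantile

variable {Ω : Type*} [MeasurableSpace Ω]

/-- The least value that is exceeded with probability at most `q`. -/
def upperQuantile (μ : Measure Ω) (q : ℝ) (f : Ω → ℝ) : ℝ := sInf {z | μ.real {ω | z < f ω} ≤ q}

/-- The greatest value that is missed with probability at most `q`. -/
def lowerQuantile (μ : Measure Ω) (q : ℝ) (f : Ω → ℝ) : ℝ :=
  -upperQuantile μ q fun ω => -f ω

variable {μ : Measure Ω} [IsProbabilityMeasure μ] {q : ℝ} {f f' : Ω → ℝ} {z : ℝ}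

/-- Exceedance probabilities change only at the finitely many values of `f`, so the infimum is
attained at one of these. The condition `q < 1` excludes all `z` below every value. -/
theorem isLeast_upperQuantile (hq0 : 0 ≤ q) (hq : q < 1) (hf : (Set.range f).Finite) :
    IsLeast {z | μ.real {ω | z < f ω} ≤ q} (upperQuantile μ q f) := by
  classical
  suffices h : ∃ U, IsLeast {z | μ.real {ω | z < f ω} ≤ q} U by
    obtain ⟨U, hU⟩ := h
    rwa [upperQuantile, hU.csInf_eq]
  obtain ⟨ω₀⟩ : Nonempty Ω := μ.nonempty_of_neZero
  let s := hf.toFinset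
  have hs : ∀ ω, f ω ∈ s := fun ω => hf.mem_toFinset.2 ⟨ω, rfl⟩
  let A := s.filter fun z => μ.real {ω | z < f ω} ≤ q
  have hA : A.Nonempty := by
    obtain ⟨m, hm, hmax⟩ := s.exists_max_image id ⟨_, hs ω₀⟩
    refine ⟨m, Finset.mem_filter.2 ⟨hm, ?_⟩⟩
    have : {ω | m < f ω} = ∅ := by
      ext ω; simpa using hmax _ (hs ω)
    simpa [this] using hq0
  obtain ⟨U, hU, hmin⟩ := A.exists_min_image id hA
  refine ⟨U, (Finset.mem_filter.1 hU).2, fun z hz => ?_⟩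
  have hne : (s.filter (· ≤ z)).Nonempty := by
    by_contra hcon
    have : {ω | z < f ω} = Set.univ := by
      ext ω
      simp only [Set.mem_ofPred_eq, Set.mem_univ, iff_true]
      by_contra hle
      exact hcon ⟨f ω, Finset.mem_filter.2 ⟨hs ω, not_lt.1 hle⟩⟩
    simp only [Set.mem_ofPred_eq, this, probReal_univ] at hz
    linarith
  obtain ⟨v, hv, hmax⟩ := (s.filter (· ≤ z)).exists_max_image id hne
  rw [Finset.mem_filter] at hv
  have hset : {ω | v < f ω} = {ω | z < f ω} := by
    ext ω
    refine ⟨fun h => ?_, fun h => hv.2.trans_lt h⟩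
    by_contra hle
    exact absurd (hmax _ (Finset.mem_filter.2 ⟨hs ω, not_lt.1 hle⟩)) (not_le.2 h)
  refine le_trans (hmin v (Finset.mem_filter.2 ⟨hv.1, ?_⟩)) hv.2
  rw [hset]; exact hz

theorem prob_upperQuantile_lt (hq0 : 0 ≤ q) (hq : q < 1) (hf : (Set.range f).Finite) :
    μ.real {ω | upperQuantile μ q f < f ω} ≤ q :=
  (isLeast_upperQuantile hq0 hq hf).1

theorem upperQuantile_le (hq0 : 0 ≤ q) (hq : q < 1) (hf : (Set.range f).Finite)
    (hz : μ.real {ω | z < f ω} ≤ q) : upperQuantile μ q f ≤ z :=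
  (isLeast_upperQuantile hq0 hq hf).2 hz

theorem finite_range_neg (hf : (Set.range f).Finite) : (Set.range fun ω => -f ω).Finite := by
  have := hf.image Neg.neg
  rwa [← Set.range_comp] at this

theorem prob_lt_lowerQuantile (hq0 : 0 ≤ q) (hq : q < 1) (hf : (Set.range f).Finite) :
    μ.real {ω | f ω < lowerQuantile μ q f} ≤ q := by
  have := prob_upperQuantile_lt (μ := μ) hq0 hq (finite_range_neg hf)
  simpa only [lowerQuantile, lt_neg] using this

theorem le_lowerQuantile (hq0 : 0 ≤ q) (hq : q < 1) (hf : (Set.range f).Finite)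
    (hz : μ.real {ω | f ω < z} ≤ q) : z ≤ lowerQuantile μ q f := by
  rw [lowerQuantile, le_neg]
  exact upperQuantile_le hq0 hq (finite_range_neg hf) (by simpa only [neg_lt_neg_iff] using hz)

theorem upperQuantile_mono (hq0 : 0 ≤ q) (hq : q < 1) (hf : (Set.range f).Finite)
    (hf' : (Set.range f').Finite) (h : ∀ ω, f ω ≤ f' ω) :
    upperQuantile μ q f ≤ upperQuantile μ q f' :=
  upperQuantile_le hq0 hq hf ((measureReal_mono fun _ hω => lt_of_lt_of_le hω (h _)).trans
    (prob_upperQuantile_lt hq0 hq hf'))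

theorem lowerQuantile_mono (hq0 : 0 ≤ q) (hq : q < 1) (hf : (Set.range f).Finite)
    (hf' : (Set.range f').Finite) (h : ∀ ω, f ω ≤ f' ω) :
    lowerQuantile μ q f ≤ lowerQuantile μ q f' :=
  le_lowerQuantile hq0 hq hf' ((measureReal_mono fun _ hω => lt_of_le_of_lt (h _) hω).trans
    (prob_lt_lowerQuantile hq0 hq hf))

/-- Markov's inequality for a weighted sum of indicators. -/
theorem prob_lt_sum_indicator_le {κ : Type*} (F : Finset κ) (m : κ → ℝ) (A : κ → Set Ω)
    (hm : ∀ T ∈ F, 0 ≤ m T) (hA : ∀ T ∈ F, MeasurableSet (A T)) (hz : 0 < z) :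
    μ.real {ω | z < ∑ T ∈ F, m T * (A T).indicator (fun _ => (1 : ℝ)) ω} ≤
      (∑ T ∈ F, m T * μ.real (A T)) / z := by
  have hint : ∀ T ∈ F, Integrable (fun ω => m T * (A T).indicator (fun _ => (1 : ℝ)) ω) μ :=
    fun T hT => ((integrable_const 1).indicator (hA T hT)).const_mul _
  have h1 : ∫ ω, ∑ T ∈ F, m T * (A T).indicator (fun _ => (1 : ℝ)) ω ∂μ =
      ∑ T ∈ F, m T * μ.real (A T) := by
    rw [integral_finsetSum _ hint]
    refine Finset.sum_congr rfl fun T hT => ?_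
    rw [integral_const_mul, integral_indicator_one_real (hA T hT)]
  rw [le_div_iff₀ hz, ← h1, mul_comm]
  refine le_trans (mul_le_mul_of_nonneg_left (measureReal_mono fun ω hω => ?_) hz.le)
    (mul_meas_ge_le_integral_of_nonneg (Filter.Eventually.of_forall fun ω => ?_)
      (integrable_finsetSum _ hint) z)
  · exact le_of_lt (Set.mem_ofPred_eq ▸ hω)
  · exact Finset.sum_nonneg fun T hT =>
      mul_nonneg (hm T hT) (Set.indicator_nonneg (fun _ _ => zero_le_one) _)

end Quantile

/-! ### Mass of the survivors: concentration and comparison of the two processes -/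

section Mass

variable {X : Type*} [MeasurableSpace X]

/-- The probability that some hypothesis of `W` errs. -/
def mass (D : Measure X) (c : X → Bool) (W : Finset (X → Bool)) : ℝ :=
  D.real {x | ∃ h ∈ W, h x ≠ c x}

open Classical in
/-- The probability that exactly the hypotheses in `T` err. -/
def atomMass (D : Measure X) (C : Finset (X → Bool)) (c : X → Bool) (T : Finset (X → Bool)) : ℝ :=
  D.real {x | C.filter (fun h => h x ≠ c x) = T}

/-- The expected mass of the surviving hypotheses. -/
def expMass (D : Measure X) [IsProbabilityMeasure D] (C : Finset (X → Bool)) (c : X → Bool)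
    (B : ℝ) (r : ℕ) (R : ℕ → ℕ) (n : ℕ) : ℝ :=
  ∑ T ∈ C.powerset, atomMass D C c T * coverProb D C c B r R T n

variable {D : Measure X} [IsProbabilityMeasure D] {C : Finset (X → Bool)} {c : X → Bool}

theorem mass_nonneg (W : Finset (X → Bool)) : 0 ≤ mass D c W := measureReal_nonneg

theorem mass_le_one (W : Finset (X → Bool)) : mass D c W ≤ 1 := measureReal_le_one

theorem mass_mono {W W' : Finset (X → Bool)} (h : W ⊆ W') : mass D c W ≤ mass D c W' :=
  measureReal_mono fun _ ⟨g, hg, hx⟩ => ⟨g, h hg, hx⟩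

theorem atomMass_nonneg (T : Finset (X → Bool)) : 0 ≤ atomMass D C c T := measureReal_nonneg

-- The sets of points at which exactly the hypotheses in `T` err partition the space, and each lies
-- inside or outside the error region of `W` according to whether `T` meets `W`.
open Classical in
theorem mass_eq_sum (hC : ∀ h ∈ C, Measurable h) (hc : c ∈ C) {W : Finset (X → Bool)}
    (hW : W ⊆ C) : mass D c W =
      ∑ T ∈ C.powerset with ∃ h ∈ T, h ∈ W, atomMass D C c T := by
  classical
  have hmeas : ∀ T ∈ C.powerset, MeasurableSet {x | C.filter (fun h => h x ≠ c x) = T} := by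
    intro T hT
    have : {x | C.filter (fun h => h x ≠ c x) = T} =
        ⋂ h ∈ C, {x | h x ≠ c x ↔ h ∈ T} := by
      ext x
      simp only [Set.mem_ofPred_eq, Finset.ext_iff, Finset.mem_filter, Set.mem_iInter]
      constructor
      · intro h g hg; rw [← h g]; simp [hg]
      · intro h g
        by_cases hg : g ∈ C
        · rw [← h g hg]; simp [hg]
        · simpa [hg] using fun hgT => hg (Finset.mem_powerset.1 hT hgT)
    rw [this]
    refine Finset.measurableSet_biInter _ fun h hh => ?_
    have hm := measurableSet_errSet (hC c hc) (hC h hh)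
    by_cases hT : h ∈ T
    · simp only [hT, iff_true]; exact hm
    · simp only [hT, iff_false]; exact hm.compl
  have hset : {x | ∃ h ∈ W, h x ≠ c x} = ⋃ T ∈ C.powerset.filter (fun T => ∃ h ∈ T, h ∈ W),
      {x | C.filter (fun h => h x ≠ c x) = T} := by
    ext x
    simp only [Set.mem_ofPred_eq, Set.mem_iUnion, Finset.mem_filter, Finset.mem_powerset,
      exists_prop]
    constructor
    · rintro ⟨h, hh, hx⟩
      exact ⟨_, ⟨Finset.filter_subset _ _, h, Finset.mem_filter.2 ⟨hW hh, hx⟩, hh⟩, rfl⟩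
    · rintro ⟨T, ⟨-, h, hT, hh⟩, rfl⟩
      exact ⟨h, hh, (Finset.mem_filter.1 hT).2⟩
  rw [mass, hset, measureReal_biUnion_finset]
  · rfl
  · intro T _ T' _ hTT'
    exact Set.disjoint_left.2 fun x (h : _ = T) (h' : _ = T') => hTT' (h.symm.trans h')
  · exact fun T hT => hmeas T (Finset.mem_filter.1 hT).1

theorem sum_atomMass_le_one (hC : ∀ h ∈ C, Measurable h) (hc : c ∈ C)
    (F : Finset (Finset (X → Bool))) (hF : F ⊆ C.powerset) (hne : ∅ ∉ F) :
    ∑ T ∈ F, atomMass D C c T ≤ 1 := by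
  classical
  refine le_trans (Finset.sum_le_sum_of_subset_of_nonneg (fun T hT => ?_)
    fun _ _ _ => atomMass_nonneg _) ((mass_eq_sum (D := D) hC hc subset_rfl).symm.le.trans
      (mass_le_one C))
  refine Finset.mem_filter.2 ⟨hF hT, ?_⟩
  obtain ⟨h, hh⟩ := Finset.nonempty_of_ne_empty fun h => hne (h ▸ hT)
  exact ⟨h, hh, Finset.mem_powerset.1 (hF hT) hh⟩

/-- This linearizes the mass. Its expectation `expMass` is a nonnegative combination of cover
probabilities, so the threshold estimates for the events `covered … T n` turn into concentration of
the mass. -/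
theorem mass_survivors_eq (hC : ∀ h ∈ C, Measurable h) (hc : c ∈ C) (B : ℝ) (r : ℕ) (R : ℕ → ℕ)
    (n : ℕ) (S : ℕ → ℕ → X) : mass D c (survivors D C c B r R n S) =
      ∑ T ∈ C.powerset, atomMass D C c T *
        (covered D C c B r R T n).indicator (fun _ => (1 : ℝ)) S := by
  classical
  rw [mass_eq_sum hC hc fun h hh => (mem_survivors.1 hh).1, Finset.sum_filter]
  refine Finset.sum_congr rfl fun T _ => ?_
  by_cases h : S ∈ covered D C c B r R T n
  · rw [Set.indicator_of_mem h, if_pos (show ∃ h ∈ T, h ∈ survivors D C c B r R n S from h), mul_one]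
  · rw [Set.indicator_of_notMem h, mul_zero,
      if_neg (show ¬ ∃ h ∈ T, h ∈ survivors D C c B r R n S from h)]

theorem finite_range_mass_survivors (B : ℝ) (r : ℕ) (R : ℕ → ℕ) (n : ℕ) :
    (Set.range fun S : ℕ → ℕ → X => mass D c (survivors D C c B r R n S)).Finite := by
  refine ((C.powerset.finite_toSet).image (mass D c)).subset ?_
  rintro _ ⟨S, rfl⟩
  exact ⟨_, Finset.mem_coe.2 (Finset.mem_powerset.2 fun h hh => (mem_survivors.1 hh).1), rfl⟩

theorem expMass_nonneg (B : ℝ) (r : ℕ) (R : ℕ → ℕ) (n : ℕ) : 0 ≤ expMass D C c B r R n :=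
  Finset.sum_nonneg fun _ _ => mul_nonneg (atomMass_nonneg _) (coverProb_nonneg _ _ _ _ _)

theorem expMass_mono (B : ℝ) {r : ℕ} {R R' : ℕ → ℕ} (hR : ∀ j < r, R' j ≤ R j) {n n' : ℕ}
    (hn : n ≤ n') : expMass D C c B r R n ≤ expMass D C c B r R' n' :=
  Finset.sum_le_sum fun _ _ =>
    mul_le_mul_of_nonneg_left (coverProb_mono le_rfl hR _ hn) (atomMass_nonneg _)

theorem coverProb_empty (B : ℝ) (r : ℕ) (R : ℕ → ℕ) (n : ℕ) : coverProb D C c B r R ∅ n = 0 := by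
  simp [coverProb, covered]

theorem expMass_le_one (hC : ∀ h ∈ C, Measurable h) (hc : c ∈ C) (B : ℝ) (r : ℕ) (R : ℕ → ℕ)
    (n : ℕ) : expMass D C c B r R n ≤ 1 := by
  classical
  have h1 : expMass D C c B r R n =
      ∑ T ∈ C.powerset.erase ∅, atomMass D C c T * coverProb D C c B r R T n := by
    rw [Finset.sum_erase _ (by rw [coverProb_empty, mul_zero])]; rfl
  rw [h1]
  refine (Finset.sum_le_sum fun T _ => mul_le_of_le_one_right (atomMass_nonneg _)
    (coverProb_le_one _ _ _ _ _)).trans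
    (sum_atomMass_le_one hC hc _ (Finset.erase_subset _ _) (Finset.notMem_erase _ _))

/-- The quantiles of the mass of the survivors of slightly different streams are close, provided
that the expected masses vary smoothly with the number of admitted errors. -/
theorem max_upperQuantile_le_of_smooth (hC : ∀ h ∈ C, Measurable h) (hc : c ∈ C)
    {Bp Bm κ ξ ε₀ q g Λ : ℝ} {r n w : ℕ} {Rp Rp' Rm Rm' : ℕ → ℕ}
    (hRp : ∀ j < r, Rp' j ≤ Rp j) (hRm : ∀ j < r, Rm' j ≤ Rm j) (hκ : 0 ≤ κ)
    (hR : ∀ j < r, (Rm' j : ℝ) ≤ (1 + κ) * Rp j) (hB : (1 + κ) * Bp ≤ Bm)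
    (hκw : κ * Bp ≤ w / 8) (hexp : r * Real.exp (-(3 / 4 * w)) ≤ 1 / 2) (hw : 0 < w)
    (hgp : 16 * (r * Bp) / w ^ 2 ≤ g) (hgm : 16 * (r * Bm) / w ^ 2 ≤ g) (hg0 : 0 ≤ g)
    (hg1 : g ≤ 1) (hΛ0 : 0 ≤ Λ) (hΛ : Λ ≤ 1 / 2) (hξ : 0 < ξ) (hξ1 : ξ ≤ 1) (hε : 0 < ε₀)
    (hq1 : q < 1) (hq : 16 * (g ^ 3 * Λ) / ξ ≤ q)
    (hGp : expMass D C c Bp r Rp' (n + 7 * w) - expMass D C c Bp r Rp n ≤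
      Λ * (expMass D C c Bp r Rp n + ε₀))
    (hGm : expMass D C c Bm r Rm' (n + 7 * w) - expMass D C c Bm r Rm n ≤
      Λ * (expMass D C c Bm r Rm n + ε₀)) :
    max (upperQuantile (streamsLaw D) q fun S => mass D c (survivors D C c Bp r Rp n S)) ε₀ ≤
      (1 + ξ) * max (lowerQuantile (streamsLaw D) q
        fun S => mass D c (survivors D C c Bm r Rm' (n + 7 * w) S)) ε₀ := by
  classical
  have hq0 : 0 ≤ q := le_trans (by positivity) hq
  set m := atomMass D C c
  have hm : ∀ T, 0 ≤ m T := fun T => atomMass_nonneg T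
  let pp : Finset (X → Bool) → ℕ → ℝ := fun T t => coverProb D C c Bp r Rp T t
  let pm : Finset (X → Bool) → ℕ → ℝ := fun T t => coverProb D C c Bm r Rm' T t
  -- The reference family. At level `n` the upper process covers little outside `F`, and at level `n
  -- + 7 * w` the lower process misses little of `F`; so both masses are close to the total atom
  -- mass `a` of `F`. The seven windows are three for the tail of the upper process, one for passing
  -- to the longer prefixes of the lower process, and three for the tail of the lower process.
  let F := C.powerset.filter fun T => 1 / 4 ≤ pm T (n + 4 * w)
  let F' := C.powerset.filter fun T => ¬ 1 / 4 ≤ pm T (n + 4 * w)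
  have hsplit : ∀ f : Finset (X → Bool) → ℝ,
      ∑ T ∈ C.powerset, f T = ∑ T ∈ F, f T + ∑ T ∈ F', f T := fun f =>
    (Finset.sum_filter_add_sum_filter_not _ _ _).symm
  let a := ∑ T ∈ F, m T
  have ha : 0 ≤ a := Finset.sum_nonneg fun T _ => hm T
  set M := max a ε₀ with hM
  have hM0 : 0 < M := lt_max_of_lt_right hε
  have hle : a + ε₀ ≤ 2 * M := by linarith [le_max_left a ε₀, le_max_right a ε₀]
  -- Both expected discrepancies will be at most `4 g³ Λ M`; dividing by `z` in Markov's inequality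
  -- produces the hypothesis `16 g³ Λ / ξ ≤ q`.
  set z := ξ / 4 * M with hz
  have hz0 : 0 < z := by positivity
  have hg3 : g ^ 3 ≤ 1 := pow_le_one₀ hg0 hg1
  have hg30 : 0 ≤ g ^ 3 := by positivity
  have hmarkov : ∀ y ≤ 4 * (g ^ 3 * Λ) * M, y / z ≤ q := fun y hy => by
    refine le_trans ?_ hq
    rw [div_le_div_iff₀ hz0 hξ, hz]
    nlinarith
  -- the sets outside the reference family
  have hout : ∑ T ∈ F', m T * pp T n ≤ 4 * (g ^ 3 * Λ) * M := by
    set x := ∑ T ∈ F', m T * pp T n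
    have h1 : x ≤ g ^ 3 * ∑ T ∈ F', (m T * pp T (n + 3 * w) - m T * pp T n) := by
      rw [Finset.mul_sum]
      refine Finset.sum_le_sum fun T hT => ?_
      have hT' := (Finset.mem_filter.1 hT).2
      have hhalf : pp T (n + 3 * w) ≤ 1 / 2 := by
        by_contra hcon
        refine hT' ?_
        have := quarter_le_coverProb_of_half_lt hC hc hκ hR hB hκw hexp (not_le.1 hcon)
        rwa [show n + 3 * w + w = n + 4 * w by ring] at this
      have := mul_le_mul_of_nonneg_left
        (coverProb_le_cube hC hc Bp r Rp T hw hg0 hgp hhalf) (hm T)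
      simp only [pp]; linarith
    have h2 : ∑ T ∈ F', (m T * pp T (n + 3 * w) - m T * pp T n) ≤
        expMass D C c Bp r Rp' (n + 7 * w) - expMass D C c Bp r Rp n := by
      rw [expMass, expMass, ← Finset.sum_sub_distrib, hsplit]
      have h3 : ∀ T, m T * pp T (n + 3 * w) ≤
          m T * coverProb D C c Bp r Rp' T (n + 7 * w) := fun T =>
        mul_le_mul_of_nonneg_left (coverProb_mono le_rfl hRp T (by omega)) (hm T)
      have h4 : 0 ≤ ∑ T ∈ F, (m T * coverProb D C c Bp r Rp' T (n + 7 * w) - m T * pp T n) :=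
        Finset.sum_nonneg fun T _ => by
          have := mul_le_mul_of_nonneg_left (coverProb_mono (D := D) (C := C) (c := c)
            (le_refl Bp) hRp T (show n ≤ n + 7 * w by omega)) (hm T)
          simp only [pp]; linarith
      have h5 : ∑ T ∈ F', (m T * pp T (n + 3 * w) - m T * pp T n) ≤
          ∑ T ∈ F', (m T * coverProb D C c Bp r Rp' T (n + 7 * w) - m T * pp T n) :=
        Finset.sum_le_sum fun T _ => by linarith [h3 T]
      simp only [pp] at h4 h5 ⊢
      linarith
    have h3 : expMass D C c Bp r Rp n ≤ a + x := by
      rw [expMass, hsplit]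
      refine add_le_add (Finset.sum_le_sum fun T _ => ?_) le_rfl
      exact mul_le_of_le_one_right (hm T) (coverProb_le_one _ _ _ _ _)
    have hx0 : 0 ≤ x := Finset.sum_nonneg fun T _ => mul_nonneg (hm T) (coverProb_nonneg _ _ _ _ _)
    -- The smoothness hypothesis involves the expected mass, hence `x` itself; since `g³ Λ ≤ 1/2`
    -- this occurrence is absorbed on the left.
    have h4 : x ≤ g ^ 3 * (Λ * (a + x + ε₀)) := by
      refine h1.trans (mul_le_mul_of_nonneg_left ((h2.trans hGp).trans ?_) hg30)
      gcongr
    have h5 : g ^ 3 * Λ ≤ 1 / 2 := by nlinarith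
    have h6 : g ^ 3 * (Λ * (a + x + ε₀)) ≤ g ^ 3 * Λ * (2 * M) + 1 / 2 * x := by
      have h7 : g ^ 3 * Λ * (a + ε₀) ≤ g ^ 3 * Λ * (2 * M) :=
        mul_le_mul_of_nonneg_left hle (by positivity)
      have h8 : g ^ 3 * Λ * x ≤ 1 / 2 * x := mul_le_mul_of_nonneg_right h5 hx0
      linarith
    linarith
  have hin : ∑ T ∈ F, m T * (1 - pm T (n + 7 * w)) ≤ 4 * (g ^ 3 * Λ) * M := by
    have hdiff : ∀ T, m T * pm T (n + 5 * w) - m T * pm T (n + 4 * w) ≤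
        m T * pm T (n + 7 * w) - m T * coverProb D C c Bm r Rm T n := fun T => by
      have h3 := mul_le_mul_of_nonneg_left (coverProb_mono (D := D) (C := C) (c := c)
            (le_refl Bm) hRm T (show n ≤ n + 4 * w by omega)) (hm T)
      have h4 := mul_le_mul_of_nonneg_left (coverProb_mono (D := D) (C := C) (c := c)
            (le_refl Bm) (R := Rm') (r := r) (fun _ _ => le_rfl) T
            (show n + 5 * w ≤ n + 7 * w by omega)) (hm T)
      simp only [pm]; linarith
    have hdiff' : ∀ T, 0 ≤ m T * pm T (n + 7 * w) - m T * coverProb D C c Bm r Rm T n := fun T => by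
      have h3 := mul_le_mul_of_nonneg_left (coverProb_mono (D := D) (C := C) (c := c)
            (le_refl Bm) hRm T (show n ≤ n + 7 * w by omega)) (hm T)
      simp only [pm]; linarith
    set Δ := expMass D C c Bm r Rm' (n + 7 * w) - expMass D C c Bm r Rm n
    have hΔ : Δ = ∑ T ∈ F, (m T * pm T (n + 7 * w) - m T * coverProb D C c Bm r Rm T n) +
        ∑ T ∈ F', (m T * pm T (n + 7 * w) - m T * coverProb D C c Bm r Rm T n) := by
      rw [← hsplit, Finset.sum_sub_distrib]; rfl
    have hF0 := Finset.sum_nonneg fun T (_ : T ∈ F) => hdiff' T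
    have hF0' := Finset.sum_nonneg fun T (_ : T ∈ F') => hdiff' T
    have h1 : ∑ T ∈ F, m T * (1 - pm T (n + 7 * w)) ≤ g ^ 3 * Δ := by
      have h2 : ∑ T ∈ F, m T * (1 - pm T (n + 7 * w)) ≤
          g ^ 3 * ∑ T ∈ F, (m T * pm T (n + 7 * w) - m T * coverProb D C c Bm r Rm T n) := by
        rw [Finset.mul_sum]
        refine Finset.sum_le_sum fun T hT => ?_
        have h3 := one_sub_coverProb_le_cube hC hc Bm r Rm' T hw hg0 hgm
          (Finset.mem_filter.1 hT).2
        rw [show n + 4 * w + 3 * w = n + 7 * w by ring] at h3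
        have h4 := mul_le_mul_of_nonneg_left h3 (hm T)
        have h5 := mul_le_mul_of_nonneg_left (mul_le_mul_of_nonneg_left
          (coverProb_mono (D := D) (C := C) (c := c) (le_refl Bm) hRm T
            (show n ≤ n + 4 * w by omega)) (hm T)) hg30
        simp only [pm]; linarith
      refine h2.trans (mul_le_mul_of_nonneg_left ?_ hg30)
      linarith
    -- Outside `F` the cover probability at `n + 4 * w` is below `1/4`, hence bounded by the
    -- increment over the next window.
    have h2 : expMass D C c Bm r Rm n ≤ a + Δ := by
      rw [expMass, hsplit]
      refine add_le_add (Finset.sum_le_sum fun T _ => ?_) ?_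
      · exact mul_le_of_le_one_right (hm T) (coverProb_le_one _ _ _ _ _)
      · refine le_trans (Finset.sum_le_sum fun T hT => ?_) (show ∑ T ∈ F',
          (m T * pm T (n + 7 * w) - m T * coverProb D C c Bm r Rm T n) ≤ Δ by linarith)
        have h3 := coverProb_le_window hC hc Bm r Rm' T hw (hgm.trans hg1)
          (not_le.1 (Finset.mem_filter.1 hT).2)
        rw [show n + 4 * w + w = n + 5 * w by ring] at h3
        have h4 := mul_le_mul_of_nonneg_left h3 (hm T)
        have h5 := mul_le_mul_of_nonneg_left (coverProb_mono (D := D) (C := C) (c := c)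
          (le_refl Bm) hRm T (show n ≤ n + 4 * w by omega)) (hm T)
        have h6 := hdiff T
        simp only [pm] at h6 ⊢
        linarith
    have hG0 := expMass_nonneg (D := D) (C := C) (c := c) Bm r Rm n
    have h3 : Δ ≤ Λ * (4 * M) := by
      have h4 : expMass D C c Bm r Rm n + ε₀ ≤ 4 * M := by
        have : Λ * (expMass D C c Bm r Rm n + ε₀) ≤ 1 / 2 * (expMass D C c Bm r Rm n + ε₀) :=
          mul_le_mul_of_nonneg_right hΛ (by linarith)
        linarith
      exact hGm.trans (mul_le_mul_of_nonneg_left h4 hΛ0)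
    calc _ ≤ g ^ 3 * Δ := h1
      _ ≤ g ^ 3 * (Λ * (4 * M)) := mul_le_mul_of_nonneg_left h3 hg30
      _ = _ := by ring
  have hU : upperQuantile (streamsLaw D) q
      (fun S => mass D c (survivors D C c Bp r Rp n S)) ≤ a + z := by
    refine upperQuantile_le hq0 hq1 (finite_range_mass_survivors _ _ _ _) ?_
    refine le_trans (measureReal_mono (fun S hS => ?_) (measure_ne_top _ _))
      ((prob_lt_sum_indicator_le (μ := streamsLaw D) (z := z) F' m
        (fun T => covered D C c Bp r Rp T n) (fun T _ => hm T)
        (fun T _ => measurableSet_covered hC hc _ _ _ _ _) hz0).trans (hmarkov _ hout))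
    simp only [Set.mem_ofPred_eq] at hS ⊢
    rw [mass_survivors_eq hC hc, hsplit] at hS
    have : ∑ T ∈ F, m T * (covered D C c Bp r Rp T n).indicator (fun _ => (1 : ℝ)) S ≤ a :=
      Finset.sum_le_sum fun T _ => mul_le_of_le_one_right (hm T)
        (Set.indicator_le_self' (fun _ _ => zero_le_one) _ |>.trans le_rfl)
    simp only [m] at this ⊢
    linarith
  have hL : a - z ≤ lowerQuantile (streamsLaw D) q
      (fun S => mass D c (survivors D C c Bm r Rm' (n + 7 * w) S)) := by
    refine le_lowerQuantile hq0 hq1 (finite_range_mass_survivors _ _ _ _) ?_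
    have h1 : ∑ T ∈ F, m T * (streamsLaw D).real (covered D C c Bm r Rm' T (n + 7 * w))ᶜ ≤
        4 * (g ^ 3 * Λ) * M := by
      refine le_trans (le_of_eq (Finset.sum_congr rfl fun T _ => ?_)) hin
      rw [probReal_compl_eq_one_sub (measurableSet_covered hC hc _ _ _ _ _)]; rfl
    refine le_trans (measureReal_mono (fun S hS => ?_) (measure_ne_top _ _))
      ((prob_lt_sum_indicator_le (μ := streamsLaw D) (z := z) F m
        (fun T => (covered D C c Bm r Rm' T (n + 7 * w))ᶜ) (fun T _ => hm T)
        (fun T _ => (measurableSet_covered hC hc _ _ _ _ _).compl) hz0).trans (hmarkov _ h1))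
    simp only [Set.mem_ofPred_eq] at hS ⊢
    rw [mass_survivors_eq hC hc, hsplit] at hS
    have h2 : a = ∑ T ∈ F, m T * (covered D C c Bm r Rm' T (n + 7 * w)).indicator
          (fun _ => (1 : ℝ)) S + ∑ T ∈ F, m T * (covered D C c Bm r Rm' T (n + 7 * w))ᶜ.indicator
          (fun _ => (1 : ℝ)) S := by
      rw [← Finset.sum_add_distrib]
      refine Finset.sum_congr rfl fun T _ => ?_
      by_cases h : S ∈ covered D C c Bm r Rm' T (n + 7 * w) <;> simp [h]
    have h3 : 0 ≤ ∑ T ∈ F', m T * (covered D C c Bm r Rm' T (n + 7 * w)).indicator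
          (fun _ => (1 : ℝ)) S := Finset.sum_nonneg fun T _ =>
      mul_nonneg (hm T) (Set.indicator_nonneg (fun _ _ => zero_le_one) _)
    simp only [m] at h2 h3 ⊢
    linarith
  set U := upperQuantile (streamsLaw D) q fun S => mass D c (survivors D C c Bp r Rp n S)
  set Lo := lowerQuantile (streamsLaw D) q
    fun S => mass D c (survivors D C c Bm r Rm' (n + 7 * w) S)
  have h1 : max U ε₀ ≤ (1 + ξ / 4) * M := by
    refine max_le ?_ ?_
    · linarith [le_max_left a ε₀]
    · linarith [le_max_right a ε₀]
  have h2 : (1 - ξ / 4) * M ≤ max Lo ε₀ := by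
    rcases le_total a ε₀ with h | h
    · have : M = ε₀ := max_eq_right h
      refine le_trans ?_ (le_max_right _ _)
      rw [this]
      nlinarith
    · have : M = a := max_eq_left h
      refine le_trans ?_ (le_max_left _ _)
      linarith
  refine h1.trans (le_trans ?_ (mul_le_mul_of_nonneg_left h2 (by linarith)))
  have : (1 + ξ / 4) ≤ (1 + ξ) * (1 - ξ / 4) := by nlinarith
  calc _ ≤ (1 + ξ) * (1 - ξ / 4) * M := mul_le_mul_of_nonneg_right this hM0.le
    _ = _ := by ring

/-- The union-bound variant. Both processes are compared with the deterministic set `W` of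
hypotheses whose expected counts are at most `b = min (n + w) Bp`. With high probability `W`
contains the upper survivors at `n` and is contained in the lower survivors at `n + 7 * w`, since
the longer prefixes raise expected counts by at most `κ * b ≤ w/8`. -/
theorem max_upperQuantile_le_of_card (hC : ∀ h ∈ C, Measurable h) (hc : c ∈ C)
    {Bp Bm κ ξ ε₀ q : ℝ} {r n w : ℕ} {Rp Rm' : ℕ → ℕ} (hκ : 0 ≤ κ)
    (hR : ∀ j < r, (Rm' j : ℝ) ≤ (1 + κ) * Rp j) (hB : (1 + κ) * Bp ≤ Bm) (hBp : 0 < Bp)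
    (hκw : κ * Bp ≤ w / 8) (hwB : w ≤ 2 * Bm) (hξ : 0 ≤ ξ) (hε : 0 < ε₀)
    (hq1 : q < 1) (hqp : C.card * (r * Real.exp (-(w ^ 2 / (2 * Bp)))) ≤ q)
    (hqm : C.card * (r * Real.exp (-(w ^ 2 / (4 * Bm)))) ≤ q) :
    max (upperQuantile (streamsLaw D) q fun S => mass D c (survivors D C c Bp r Rp n S)) ε₀ ≤
      (1 + ξ) * max (lowerQuantile (streamsLaw D) q
        fun S => mass D c (survivors D C c Bm r Rm' (n + 7 * w) S)) ε₀ := by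
  have hq0 : 0 ≤ q := le_trans (by positivity) hqp
  set b := min ((n : ℝ) + w) Bp with hb
  have hb0 : 0 ≤ b := le_min (by positivity) hBp.le
  set W := expectedSurvivors D C c b r Rp
  have hU : upperQuantile (streamsLaw D) q
      (fun S => mass D c (survivors D C c Bp r Rp n S)) ≤ mass D c W := by
    refine upperQuantile_le hq0 hq1 (finite_range_mass_survivors _ _ _ _) (le_trans ?_ hqp)
    refine le_trans (measureReal_mono (fun S hS => ?_) (measure_ne_top _ _))
      (prob_not_survivors_subset hC hc (R := Rp) (n := n) hBp (Nat.cast_nonneg w) hb.ge)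
    exact fun hsub => absurd (mass_mono hsub) (not_le.2 hS)
  have hL : mass D c W ≤ lowerQuantile (streamsLaw D) q
      (fun S => mass D c (survivors D C c Bm r Rm' (n + 7 * w) S)) := by
    refine le_lowerQuantile hq0 hq1 (finite_range_mass_survivors _ _ _ _) (le_trans ?_ hqm)
    have hb1 : κ * b ≤ w / 8 := le_trans (by gcongr; exact min_le_right _ _) hκw
    refine le_trans (measureReal_mono (fun S hS => ?_) (measure_ne_top _ _))
      (prob_not_subset_survivors hC hc (B := Bm) (b := b) (n := n + 7 * w) (t := w) hR hκ ?_
        (Nat.cast_nonneg w) hwB ?_)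
    · exact fun hsub => absurd (mass_mono hsub) (not_le.2 hS)
    · refine le_trans ?_ hB; gcongr; exact min_le_right _ _
    · have : b ≤ n + w := min_le_left _ _
      have hw0 : (0 : ℝ) ≤ w := Nat.cast_nonneg w
      push_cast
      linarith
  refine (max_le_max_right ε₀ (hU.trans hL)).trans (le_mul_of_one_le_left ?_ (by linarith))
  exact le_max_of_le_right hε.le

end Mass

/-! ### Telescoping in the number of admitted errors, and the two sandwich processes -/

theorem sum_shift_sub_le {Φ : ℕ → ℝ} {lo hi : ℝ} (hlo : ∀ n, lo ≤ Φ n) (hhi : ∀ n, Φ n ≤ hi)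
    (H M : ℕ) : ∑ n ∈ Finset.range M, (Φ (n + H) - Φ n) ≤ H * (hi - lo) := by
  -- Raising `H` by one adds `∑ (Φ (n + 1 + H) - Φ (n + H))`, which telescopes to at most `hi - lo`.
  induction H with
  | zero => simp
  | succ H ih =>
    have h1 := Finset.sum_range_sub (fun n => Φ (n + H)) M
    have h2 : ∑ n ∈ Finset.range M, (Φ (n + (H + 1)) - Φ n) =
        ∑ n ∈ Finset.range M, (Φ (n + 1 + H) - Φ (n + H)) +
          ∑ n ∈ Finset.range M, (Φ (n + H) - Φ n) := by
      rw [← Finset.sum_add_distrib]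
      refine Finset.sum_congr rfl fun n _ => ?_
      rw [show n + (H + 1) = n + 1 + H by ring]; ring
    rw [h2, h1]
    push_cast
    linarith [hlo (0 + H), hhi (M + H)]

theorem half_le_log_one_add {x : ℝ} (h0 : 0 ≤ x) (h1 : x ≤ 1) : x / 2 ≤ Real.log (1 + x) := by
  have h2 := Real.one_sub_inv_le_log_of_pos (show 0 < 1 + x by linarith)
  refine le_trans ?_ h2
  have : x / 2 ≤ x / (1 + x) := div_le_div_of_nonneg_left h0 (by linarith) (by linarith)
  refine this.trans (le_of_eq ?_)
  field_simp
  ring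

section

variable {X : Type*} [MeasurableSpace X]

/-- The lengths of the stream prefixes on which the survivors are tested: the length for stream `r`
is determined by a statistic `Q` of the mass of the survivors of the previous streams. -/
def levels (D : Measure X) (C : Finset (X → Bool)) (c : X → Bool)
    (Q : ((ℕ → ℕ → X) → ℝ) → ℝ) (φ : ℝ → ℕ) (B : ℝ) (n : ℕ) : ℕ → ℕ
  | r => φ (Q fun S => mass D c
      (survivors D C c B r (fun j => if j < r then levels D C c Q φ B n j else 0) n S))

theorem survivors_congr {D : Measure X} {C : Finset (X → Bool)} {c : X → Bool} {B : ℝ} {r : ℕ}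
    {R R' : ℕ → ℕ} (h : ∀ j < r, R j = R' j) (n : ℕ) (S : ℕ → ℕ → X) :
    survivors D C c B r R n S = survivors D C c B r R' n S :=
  (survivors_mono le_rfl (fun j hj => (h j hj).ge) le_rfl S).antisymm
    (survivors_mono le_rfl (fun j hj => (h j hj).le) le_rfl S)

/-- The value `0` for `j ≥ r` in the recursion is a dummy: the survivors of `r` streams read only
the lengths with `j < r`. -/
theorem levels_eq (D : Measure X) (C : Finset (X → Bool)) (c : X → Bool)
    (Q : ((ℕ → ℕ → X) → ℝ) → ℝ) (φ : ℝ → ℕ) (B : ℝ) (n r : ℕ) :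
    levels D C c Q φ B n r =
      φ (Q fun S => mass D c (survivors D C c B r (levels D C c Q φ B n) n S)) := by
  rw [levels]
  congr 2
  ext S
  rw [survivors_congr fun j hj => if_pos hj]

/-- More admitted errors leave more survivors, hence a larger mass and shorter prefixes, which again
leave more survivors. This monotonicity in `n` is what makes increments nonnegative and their sums
small. -/
theorem levels_antitone (D : Measure X) [IsProbabilityMeasure D] (C : Finset (X → Bool))
    (c : X → Bool) {Q : ((ℕ → ℕ → X) → ℝ) → ℝ} {φ : ℝ → ℕ}
    (hQ : ∀ f f' : (ℕ → ℕ → X) → ℝ, (Set.range f).Finite → (Set.range f').Finite →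
      (∀ S, f S ≤ f' S) → Q f ≤ Q f')
    (hφ : Antitone φ) (B : ℝ) {n n' : ℕ} (hn : n ≤ n') (r : ℕ) :
    levels D C c Q φ B n' r ≤ levels D C c Q φ B n r := by
  induction r using Nat.strong_induction_on with
  | _ r ih =>
    rw [levels_eq, levels_eq D C c Q φ B n]
    exact hφ (hQ _ _ (finite_range_mass_survivors _ _ _ _) (finite_range_mass_survivors _ _ _ _)
      fun S => mass_mono (survivors_mono le_rfl ih hn S))

/-- Parameters of the processes that sandwich the version spaces. -/
structure Tuning where
  k : ℕ
  ε₀ : ℝ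
  ξ : ℝ
  q : ℝ
  Bp : ℝ
  Bm : ℝ
  g : ℝ
  Λ : ℝ
  w : ℕ
  N : ℕ

namespace Tuning

variable (t : Tuning)

/-- The relations between the parameters. -/
structure Valid : Prop where
  ξ_pos : 0 < t.ξ
  ξ_le : t.ξ ≤ 1 / 9
  one_le : 1 ≤ t.ξ * t.k
  ε_pos : 0 < t.ε₀
  ε_le : t.ε₀ ≤ 1
  q_nonneg : 0 ≤ t.q
  q_lt : t.q < 1 / 2
  Bp_pos : 0 < t.Bp
  Bp_le : (1 + 8 * t.ξ) * t.Bp ≤ t.Bm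
  le_w : 8 * t.ξ * t.Bp ≤ t.w / 8
  w_pos : 0 < t.w
  exp_le : t.N * Real.exp (-(3 / 4 * t.w)) ≤ 1 / 2
  le_g : 16 * (t.N * t.Bm) / t.w ^ 2 ≤ t.g
  g_le : t.g ≤ 1
  Λ_pos : 0 < t.Λ
  Λ_le : t.Λ ≤ 1 / 2

/-- The prefix lengths of the process that bounds the version spaces from above. -/
def upperLevels (D : Measure X) [IsProbabilityMeasure D] (C : Finset (X → Bool)) (c : X → Bool) :
    ℕ → ℕ → ℕ :=
  levels D C c (upperQuantile (streamsLaw D) t.q) (fun z => ⌊(1 - t.ξ) * t.k / max z t.ε₀⌋₊) t.Bp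

/-- The prefix lengths of the process that bounds the version spaces from below. -/
def lowerLevels (D : Measure X) [IsProbabilityMeasure D] (C : Finset (X → Bool)) (c : X → Bool) :
    ℕ → ℕ → ℕ :=
  levels D C c (lowerQuantile (streamsLaw D) t.q) (fun z => ⌈(1 + t.ξ) * t.k / max z t.ε₀⌉₊) t.Bm

/-- The bound for the version space from above. -/
def upperSpace (D : Measure X) [IsProbabilityMeasure D] (C : Finset (X → Bool)) (c : X → Bool)
    (n r : ℕ) (S : ℕ → ℕ → X) : Finset (X → Bool) :=
  survivors D C c t.Bp r (t.upperLevels D C c n) n S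

/-- The bound for the version space from below. -/
def lowerSpace (D : Measure X) [IsProbabilityMeasure D] (C : Finset (X → Bool)) (c : X → Bool)
    (n r : ℕ) (S : ℕ → ℕ → X) : Finset (X → Bool) :=
  survivors D C c t.Bm r (t.lowerLevels D C c n) n S

/-- The upper quantile of the mass of `upperSpace`. -/
def upperMass (D : Measure X) [IsProbabilityMeasure D] (C : Finset (X → Bool)) (c : X → Bool)
    (n r : ℕ) : ℝ :=
  upperQuantile (streamsLaw D) t.q fun S => mass D c (t.upperSpace D C c n r S)

/-- The lower quantile of the mass of `lowerSpace`. -/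
def lowerMass (D : Measure X) [IsProbabilityMeasure D] (C : Finset (X → Bool)) (c : X → Bool)
    (n r : ℕ) : ℝ :=
  lowerQuantile (streamsLaw D) t.q fun S => mass D c (t.lowerSpace D C c n r S)

/-- The expected masses in round `r` vary smoothly at `n`. -/
def Smooth (D : Measure X) [IsProbabilityMeasure D] (C : Finset (X → Bool)) (c : X → Bool)
    (n r : ℕ) : Prop :=
  expMass D C c t.Bp r (t.upperLevels D C c (n + 7 * t.w)) (n + 7 * t.w)
      - expMass D C c t.Bp r (t.upperLevels D C c n) n
      ≤ t.Λ * (expMass D C c t.Bp r (t.upperLevels D C c n) n + t.ε₀) ∧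
    expMass D C c t.Bm r (t.lowerLevels D C c (n + 7 * t.w)) (n + 7 * t.w)
      - expMass D C c t.Bm r (t.lowerLevels D C c n) n
      ≤ t.Λ * (expMass D C c t.Bm r (t.lowerLevels D C c n) n + t.ε₀)

/-- The union bound over all hypotheses is affordable. -/
def FewHypotheses (card : ℕ) : Prop :=
  t.w ≤ 2 * t.Bm ∧ card * (t.N * Real.exp (-(t.w ^ 2 / (2 * t.Bp)))) ≤ t.q ∧
    card * (t.N * Real.exp (-(t.w ^ 2 / (4 * t.Bm)))) ≤ t.q

variable {t} {D : Measure X} [IsProbabilityMeasure D] {C : Finset (X → Bool)} {c : X → Bool}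

theorem Valid.Bm_pos (ht : t.Valid) : 0 < t.Bm := by
  have h1 := ht.Bp_le
  have h2 := mul_pos ht.ξ_pos ht.Bp_pos
  linarith [ht.Bp_pos]

theorem Valid.k_pos (ht : t.Valid) : (0 : ℝ) < t.k := by
  have := ht.one_le
  by_contra h
  nlinarith [ht.ξ_pos]

theorem upperLevels_eq (n r : ℕ) : t.upperLevels D C c n r =
    ⌊(1 - t.ξ) * t.k / max (t.upperMass D C c n r) t.ε₀⌋₊ := by
  rw [upperLevels, levels_eq]; rfl

theorem lowerLevels_eq (n r : ℕ) : t.lowerLevels D C c n r =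
    ⌈(1 + t.ξ) * t.k / max (t.lowerMass D C c n r) t.ε₀⌉₊ := by
  rw [lowerLevels, levels_eq]; rfl

theorem upperLevels_antitone (ht : t.Valid) {n n' : ℕ} (hn : n ≤ n') (r : ℕ) :
    t.upperLevels D C c n' r ≤ t.upperLevels D C c n r := by
  refine levels_antitone D C c (fun f f' hf hf' h =>
    upperQuantile_mono ht.q_nonneg (by linarith [ht.q_lt]) hf hf' h) (fun z z' hz => ?_) _ hn r
  refine Nat.floor_mono (div_le_div_of_nonneg_left ?_ (lt_max_of_lt_right ht.ε_pos)
    (max_le_max_right _ hz))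
  have := ht.ξ_le
  have := ht.k_pos
  exact mul_nonneg (by linarith) (by linarith)

theorem lowerLevels_antitone (ht : t.Valid) {n n' : ℕ} (hn : n ≤ n') (r : ℕ) :
    t.lowerLevels D C c n' r ≤ t.lowerLevels D C c n r := by
  refine levels_antitone D C c (fun f f' hf hf' h =>
    lowerQuantile_mono ht.q_nonneg (by linarith [ht.q_lt]) hf hf' h) (fun z z' hz => ?_) _ hn r
  refine Nat.ceil_mono (div_le_div_of_nonneg_left ?_ (lt_max_of_lt_right ht.ε_pos)
    (max_le_max_right _ hz))
  have := ht.ξ_pos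
  have := ht.k_pos
  exact mul_nonneg (by linarith) (by linarith)

theorem lowerSpace_mono (ht : t.Valid) {n n' : ℕ} (hn : n ≤ n') (r : ℕ) (S : ℕ → ℕ → X) :
    t.lowerSpace D C c n r S ⊆ t.lowerSpace D C c n' r S :=
  survivors_mono le_rfl (fun j _ => lowerLevels_antitone ht hn j) hn S

theorem lowerMass_mono (ht : t.Valid) (r : ℕ) : Monotone fun n => t.lowerMass D C c n r :=
  fun _ _ hn => lowerQuantile_mono ht.q_nonneg (by linarith [ht.q_lt])
    (finite_range_mass_survivors _ _ _ _) (finite_range_mass_survivors _ _ _ _)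
    fun S => mass_mono (lowerSpace_mono ht hn r S)

theorem prob_upperMass_lt (ht : t.Valid) (n r : ℕ) :
    (streamsLaw D).real {S | t.upperMass D C c n r < mass D c (t.upperSpace D C c n r S)} ≤ t.q :=
  prob_upperQuantile_lt ht.q_nonneg (by linarith [ht.q_lt]) (finite_range_mass_survivors _ _ _ _)

theorem prob_lt_lowerMass (ht : t.Valid) (n r : ℕ) :
    (streamsLaw D).real {S | mass D c (t.lowerSpace D C c n r S) < t.lowerMass D C c n r} ≤ t.q :=
  prob_lt_lowerQuantile ht.q_nonneg (by linarith [ht.q_lt]) (finite_range_mass_survivors _ _ _ _)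

theorem upperMass_le_one (ht : t.Valid) (n r : ℕ) : t.upperMass D C c n r ≤ 1 := by
  refine upperQuantile_le ht.q_nonneg (by linarith [ht.q_lt])
    (finite_range_mass_survivors _ _ _ _) ?_
  have : {S : ℕ → ℕ → X | 1 < mass D c (t.upperSpace D C c n r S)} = ∅ := by
    ext S; simpa using mass_le_one _
  simp [this, ht.q_nonneg]

/-- For all but few `n`, the two processes are close. -/
theorem levels_close (hC : ∀ h ∈ C, Measurable h) (hc : c ∈ C) (ht : t.Valid) {n : ℕ}
    (h : (16 * (t.g ^ 3 * t.Λ) / t.ξ ≤ t.q ∧ ∀ r < t.N, t.Smooth D C c n r) ∨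
      t.FewHypotheses C.card) {r : ℕ} (hr : r < t.N) :
    max (t.upperMass D C c n r) t.ε₀ ≤
        (1 + t.ξ) * max (t.lowerMass D C c (n + 7 * t.w) r) t.ε₀ ∧
      (t.lowerLevels D C c (n + 7 * t.w) r : ℝ) ≤ (1 + 8 * t.ξ) * t.upperLevels D C c n r := by
  -- Close prefix lengths before round `r` are what the mass comparison in round `r` requires; close
  -- masses in turn give close lengths in round `r`.
  induction r using Nat.strong_induction_on with
  | _ r ih =>
    have hξ := ht.ξ_pos
    have hξ' := ht.ξ_le
    have hk := ht.k_pos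
    have hε := ht.ε_pos
    have hR : ∀ j < r, (t.lowerLevels D C c (n + 7 * t.w) j : ℝ) ≤
        (1 + 8 * t.ξ) * t.upperLevels D C c n j := fun j hj => (ih j hj (hj.trans hr)).2
    have hrN : (r : ℝ) ≤ t.N := by exact_mod_cast hr.le
    have hBm := ht.Bm_pos
    have hBp := ht.Bp_pos
    have hBpm : t.Bp ≤ t.Bm := by nlinarith [ht.Bp_le]
    have hw : (0 : ℝ) < t.w := by exact_mod_cast ht.w_pos
    have hmass : max (t.upperMass D C c n r) t.ε₀ ≤
        (1 + t.ξ) * max (t.lowerMass D C c (n + 7 * t.w) r) t.ε₀ := by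
      rcases h with ⟨hq, hs⟩ | ⟨hwB, hqp, hqm⟩
      · refine max_upperQuantile_le_of_smooth hC hc (κ := 8 * t.ξ) (g := t.g) (Λ := t.Λ)
          (Rp' := t.upperLevels D C c (n + 7 * t.w)) (Rm := t.lowerLevels D C c n)
          (fun j _ => upperLevels_antitone ht (by omega) j)
          (fun j _ => lowerLevels_antitone ht (by omega) j) (by linarith) hR ht.Bp_le ht.le_w ?_
          ht.w_pos ?_ ?_ ?_ ht.g_le ht.Λ_pos.le ht.Λ_le hξ (by linarith) hε
          (by linarith [ht.q_lt]) hq (hs r hr).1 (hs r hr).2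
        · refine le_trans ?_ ht.exp_le; gcongr
        · refine le_trans ?_ ht.le_g; gcongr
        · refine le_trans ?_ ht.le_g; gcongr
        · refine le_trans ?_ ht.le_g; positivity
      · refine max_upperQuantile_le_of_card hC hc (κ := 8 * t.ξ) (by linarith) hR ht.Bp_le hBp
          ht.le_w hwB hξ.le hε (by linarith [ht.q_lt]) (le_trans ?_ hqp) (le_trans ?_ hqm)
        · gcongr
        · gcongr
    refine ⟨hmass, ?_⟩
    rw [lowerLevels_eq, upperLevels_eq]
    set U := max (t.upperMass D C c n r) t.ε₀
    set L := max (t.lowerMass D C c (n + 7 * t.w) r) t.ε₀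
    have hU0 : 0 < U := lt_max_of_lt_right hε
    have hL0 : 0 < L := lt_max_of_lt_right hε
    have hU1 : U ≤ 1 := max_le (upperMass_le_one ht n r) ht.ε_le
    have h1 : (⌈(1 + t.ξ) * t.k / L⌉₊ : ℝ) ≤ (1 + t.ξ) * t.k / L + 1 :=
      (Nat.ceil_lt_add_one (by positivity)).le
    have h2 : (1 - t.ξ) * t.k / U - 1 ≤ ⌊(1 - t.ξ) * t.k / U⌋₊ := by
      linarith [Nat.lt_floor_add_one ((1 - t.ξ) * t.k / U)]
    set K := t.k / U with hK
    have hK1 : (t.k : ℝ) ≤ K := by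
      rw [hK, le_div_iff₀ hU0]; exact mul_le_of_le_one_right hk.le hU1
    have h3 : (1 + t.ξ) * t.k / L ≤ (1 + t.ξ) ^ 2 * K := by
      rw [hK, ← mul_div_assoc, div_le_div_iff₀ hL0 hU0]
      have := mul_le_mul_of_nonneg_left hmass (show 0 ≤ (1 + t.ξ) * t.k by positivity)
      nlinarith
    have h4 : (1 - t.ξ) * t.k / U = (1 - t.ξ) * K := by rw [hK, mul_div_assoc]
    -- Masses are at most `1`, so `K ≥ k` and the rounding errors are at most `ξ * K` each. It
    -- remains that `(1 + ξ)² + ξ ≤ (1 + 8ξ)(1 - 2ξ)`, which holds for `ξ ≤ 1/9`.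
    have h5 : 1 ≤ t.ξ * K := ht.one_le.trans (mul_le_mul_of_nonneg_left hK1 hξ.le)
    rw [h4] at h2
    have h6 := mul_le_mul_of_nonneg_left h2 (show 0 ≤ 1 + 8 * t.ξ by linarith)
    rw [h4]
    refine h1.trans (le_trans ?_ h6)
    nlinarith

theorem expMass_upper_mono (ht : t.Valid) (r : ℕ) {n n' : ℕ} (hn : n ≤ n') :
    expMass D C c t.Bp r (t.upperLevels D C c n) n ≤
      expMass D C c t.Bp r (t.upperLevels D C c n') n' :=
  expMass_mono _ (fun j _ => upperLevels_antitone ht hn j) hn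

theorem expMass_lower_mono (ht : t.Valid) (r : ℕ) {n n' : ℕ} (hn : n ≤ n') :
    expMass D C c t.Bm r (t.lowerLevels D C c n) n ≤
      expMass D C c t.Bm r (t.lowerLevels D C c n') n' :=
  expMass_mono _ (fun j _ => lowerLevels_antitone ht hn j) hn

end Tuning

theorem sum_log_shift_sub_le {G : ℕ → ℝ} {lo hi : ℝ} (hlo0 : 0 < lo) (hlo : ∀ n, lo ≤ G n)
    (hhi : ∀ n, G n ≤ hi) (H M : ℕ) :
    ∑ n ∈ Finset.range M, (Real.log (G (n + H)) - Real.log (G n)) ≤ H * Real.log (hi / lo) := by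
  rw [Real.log_div (by linarith [hlo 0, hhi 0]) hlo0.ne']
  exact sum_shift_sub_le (Φ := fun n => Real.log (G n))
    (fun n => Real.log_le_log hlo0 (hlo n))
    (fun n => Real.log_le_log (by linarith [hlo n]) (hhi n)) H M

open Classical in
/-- A monotone function rarely grows by a constant factor. -/
theorem card_jumps_le {G : ℕ → ℝ} (hG : Monotone G) (h0 : ∀ n, 0 ≤ G n) (h1 : ∀ n, G n ≤ 1)
    {ε₀ Λ : ℝ} (hε : 0 < ε₀) (hΛ0 : 0 ≤ Λ) (hΛ : Λ ≤ 1) (H M : ℕ) :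
    (((Finset.range M).filter fun n => ¬ G (n + H) - G n ≤ Λ * (G n + ε₀)).card : ℝ) * (Λ / 2) ≤
      H * Real.log ((1 + ε₀) / ε₀) := by
  refine le_trans ?_ (sum_log_shift_sub_le (G := fun n => G n + ε₀) hε
    (fun n => by linarith [h0 n]) (fun n => by linarith [h1 n]) H M)
  rw [← nsmul_eq_mul, ← Finset.sum_const, Finset.sum_filter]
  refine Finset.sum_le_sum fun n _ => ?_
  have hp : 0 < G n + ε₀ := by linarith [h0 n]
  by_cases h : G (n + H) - G n ≤ Λ * (G n + ε₀)
  · have := Real.log_le_log hp (show G n + ε₀ ≤ G (n + H) + ε₀ by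
      linarith [hG (Nat.le_add_right n H)])
    simp only [h, not_true, if_false]
    linarith
  · simp only [h, not_false_iff, if_true]
    rw [not_le] at h
    -- A jump multiplies `G + ε₀` by at least `1 + Λ` and so uses up `log (1 + Λ) ≥ Λ/2` of the
    -- telescoping sum of logarithms.
    have h2 : (1 + Λ) * (G n + ε₀) ≤ G (n + H) + ε₀ := by linarith
    have h3 := Real.log_le_log (by positivity) h2
    rw [Real.log_mul (by linarith) hp.ne'] at h3
    linarith [half_le_log_one_add hΛ0 hΛ]

-- One application of `card_jumps_le` for each round and each of the two processes.
open Classical in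
theorem Tuning.card_not_smooth_le {t : Tuning} (ht : t.Valid) {D : Measure X}
    [IsProbabilityMeasure D] {C : Finset (X → Bool)} {c : X → Bool}
    (hC : ∀ h ∈ C, Measurable h) (hc : c ∈ C) (M : ℕ) :
    (((Finset.range M).filter fun n => ¬ ∀ r < t.N, t.Smooth D C c n r).card : ℝ) * (t.Λ / 2) ≤
      2 * t.N * ((7 * t.w) * Real.log ((1 + t.ε₀) / t.ε₀)) := by
  let bp : ℕ → Finset ℕ := fun r => (Finset.range M).filter fun n =>
    ¬ expMass D C c t.Bp r (t.upperLevels D C c (n + 7 * t.w)) (n + 7 * t.w)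
      - expMass D C c t.Bp r (t.upperLevels D C c n) n
      ≤ t.Λ * (expMass D C c t.Bp r (t.upperLevels D C c n) n + t.ε₀)
  let bm : ℕ → Finset ℕ := fun r => (Finset.range M).filter fun n =>
    ¬ expMass D C c t.Bm r (t.lowerLevels D C c (n + 7 * t.w)) (n + 7 * t.w)
      - expMass D C c t.Bm r (t.lowerLevels D C c n) n
      ≤ t.Λ * (expMass D C c t.Bm r (t.lowerLevels D C c n) n + t.ε₀)
  have hp : ∀ r, ((bp r).card : ℝ) * (t.Λ / 2) ≤
      (7 * t.w : ℕ) * Real.log ((1 + t.ε₀) / t.ε₀) := fun r =>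
    card_jumps_le (G := fun n => expMass D C c t.Bp r (t.upperLevels D C c n) n)
      (fun _ _ hn => Tuning.expMass_upper_mono ht r hn) (fun n => expMass_nonneg _ _ _ _)
      (fun n => expMass_le_one hC hc _ _ _ _) ht.ε_pos ht.Λ_pos.le (by linarith [ht.Λ_le]) _ _
  have hm : ∀ r, ((bm r).card : ℝ) * (t.Λ / 2) ≤
      (7 * t.w : ℕ) * Real.log ((1 + t.ε₀) / t.ε₀) := fun r =>
    card_jumps_le (G := fun n => expMass D C c t.Bm r (t.lowerLevels D C c n) n)
      (fun _ _ hn => Tuning.expMass_lower_mono ht r hn) (fun n => expMass_nonneg _ _ _ _)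
      (fun n => expMass_le_one hC hc _ _ _ _) ht.ε_pos ht.Λ_pos.le (by linarith [ht.Λ_le]) _ _
  have hsub : (Finset.range M).filter (fun n => ¬ ∀ r < t.N, t.Smooth D C c n r) ⊆
      (Finset.range t.N).biUnion fun r => bp r ∪ bm r := by
    intro n hn
    obtain ⟨hnM, hn⟩ := Finset.mem_filter.1 hn
    push Not at hn
    obtain ⟨r, hr, hn⟩ := hn
    refine Finset.mem_biUnion.2 ⟨r, Finset.mem_range.2 hr, ?_⟩
    rw [Tuning.Smooth, not_and_or] at hn
    rcases hn with hn | hn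
    · exact Finset.mem_union_left _ (Finset.mem_filter.2 ⟨hnM, hn⟩)
    · exact Finset.mem_union_right _ (Finset.mem_filter.2 ⟨hnM, hn⟩)
  have hcard : (((Finset.range M).filter fun n => ¬ ∀ r < t.N, t.Smooth D C c n r).card : ℝ) ≤
      ∑ r ∈ Finset.range t.N, (((bp r).card : ℝ) + (bm r).card) := by
    have h1 := (Finset.card_le_card hsub).trans (Finset.card_biUnion_le.trans
      (Finset.sum_le_sum fun r _ => Finset.card_union_le (bp r) (bm r)))
    exact_mod_cast h1
  refine (mul_le_mul_of_nonneg_right hcard (by linarith [ht.Λ_pos])).trans ?_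
  rw [Finset.sum_mul]
  calc _ ≤ ∑ _r ∈ Finset.range t.N, 2 * ((7 * t.w) * Real.log ((1 + t.ε₀) / t.ε₀)) :=
        Finset.sum_le_sum fun r _ => by
          have h1 := hp r
          have h2 := hm r
          push_cast at h1 h2
          linarith
    _ = _ := by simp; ring

end

/-! ### Random orderings and the first element of a set -/

section Ordering

variable {X : Type*} {C : Finset (X → Bool)}

/-- The law of a uniformly random ordering. -/
def orderingLaw (C : Finset (X → Bool)) : Measure (Ordering C) :=
  (PMF.uniformOfFintype (Ordering C)).toMeasure

instance : IsProbabilityMeasure (orderingLaw C) := by unfold orderingLaw; infer_instance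

/-- In the given order, `h` precedes all other elements of `A`. -/
def IsFirst (σ : Ordering C) (A : Finset (X → Bool)) (h : X → Bool) : Prop :=
  ∃ hh : h ∈ C, ∀ g ∈ A, ∀ hg : g ∈ C, g ≠ h → Equiv.toFun σ ⟨h, hh⟩ < Equiv.toFun σ ⟨g, hg⟩

theorem IsFirst.mono {σ : Ordering C} {A B : Finset (X → Bool)} {h : X → Bool}
    (hf : IsFirst σ A h) (hBA : B ⊆ A) : IsFirst σ B h :=
  ⟨hf.1, fun g hg => hf.2 g (hBA hg)⟩

theorem exists_isFirst (σ : Ordering C) {A : Finset (X → Bool)} (hA : A ⊆ C) (hne : A.Nonempty) :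
    ∃ h ∈ A, IsFirst σ A h := by
  obtain ⟨h, hh, hmin⟩ := A.attach.exists_min_image (fun h => Equiv.toFun σ ⟨h.1, hA h.2⟩)
    (Finset.attach_nonempty_iff.2 hne)
  refine ⟨h, h.2, hA h.2, fun g hg hgC hne => lt_of_le_of_ne (hmin ⟨g, hg⟩ (Finset.mem_attach _ _))
    fun heq => hne ?_⟩
  have := (Equiv.injective (σ : {h // h ∈ C} ≃ Fin C.card)) heq
  exact (congrArg Subtype.val this).symm

theorem firstIn_eq_some {σ : Ordering C} {V : Finset (X → Bool)} {h : X → Bool} (hV : h ∈ V)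
    (hf : IsFirst σ V h) : firstIn σ V = some h := by
  obtain ⟨hh, hf⟩ := hf
  let e : {h // h ∈ C} ≃ Fin C.card := σ
  rw [firstIn, List.find?_eq_some_iff_getElem]
  refine ⟨by simpa using hV, (e ⟨h, hh⟩ : Fin C.card), by simp, ?_, fun j hj => ?_⟩
  · rw [List.getElem_ofFn]
    exact congrArg Subtype.val (e.symm_apply_apply ⟨h, hh⟩)
  · rw [List.getElem_ofFn]
    simp only [Bool.not_eq_true', decide_eq_false_iff_not]
    intro hmem
    set g := e.symm ⟨j, _⟩ with hg
    have hgj : e g = ⟨j, _⟩ := e.apply_symm_apply _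
    by_cases hgh : (g : X → Bool) = h
    · have : g = ⟨h, hh⟩ := Subtype.ext hgh
      rw [this] at hgj
      rw [hgj] at hj
      simp at hj
    · have := hf g hmem g.2 hgh
      have h2 : e ⟨h, hh⟩ < e g := this
      rw [hgj] at h2
      have h3 : ((e ⟨h, hh⟩ : Fin C.card) : ℕ) < j := h2
      omega

theorem exists_firstIn_eq_some (σ : Ordering C) {V : Finset (X → Bool)} (hV : V ⊆ C)
    (hne : V.Nonempty) : ∃ h ∈ V, firstIn σ V = some h := by
  obtain ⟨h, hh, hf⟩ := exists_isFirst σ hV hne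
  exact ⟨h, hh, firstIn_eq_some hh hf⟩

/-- Take the first element of `V ∪ A`. If it lay in both sets, it would be the first element of
both. Being first in the union, it precedes all of `A`, so only the set `A` enters the event about
the ordering. -/
theorem exists_isFirst_of_firstIn_ne {σ : Ordering C} {V A : Finset (X → Bool)} (hV : V ⊆ C)
    (hA : A ⊆ C) (hne : A.Nonempty) (h : firstIn σ V ≠ firstIn σ A) :
    ∃ g ∈ C, (g ∈ V ∧ g ∉ A ∨ g ∈ A ∧ g ∉ V) ∧ IsFirst σ A g := by
  classical
  obtain ⟨g, hg, hf⟩ := exists_isFirst σ (Finset.union_subset hV hA)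
    (hne.mono Finset.subset_union_right)
  refine ⟨g, Finset.union_subset hV hA hg, ?_, hf.mono Finset.subset_union_right⟩
  by_cases h1 : g ∈ V <;> by_cases h2 : g ∈ A
  · exact absurd ((firstIn_eq_some h1 (hf.mono Finset.subset_union_left)).trans
      (firstIn_eq_some h2 (hf.mono Finset.subset_union_right)).symm) h
  · exact Or.inl ⟨h1, h2⟩
  · exact Or.inr ⟨h2, h1⟩
  · exact absurd hg (by simp [h1, h2])

/-- The probability that a given hypothesis precedes all other elements of `A`. -/
theorem orderingLaw_isFirst_le {A : Finset (X → Bool)} (hA : A ⊆ C) (hne : A.Nonempty)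
    (h : X → Bool) : (orderingLaw C).real {σ | IsFirst σ A h} ≤ 1 / A.card := by
  classical
  have hApos : (0 : ℝ) < A.card := by exact_mod_cast hne.card_pos
  by_cases hh : h ∈ C
  swap
  · have : {σ : Ordering C | IsFirst σ A h} = ∅ := by
      ext σ; simp [IsFirst, hh]
    rw [this]; simp
  let E : Finset (Ordering C) := Finset.univ.filter fun σ => IsFirst σ A h
  -- Exchanging the ranks of `h` and `g` is an involution. It maps orderings with `h` ahead of the
  -- rest of `A` to orderings with `g` ahead of the rest of `A`. For different `g ∈ A` these images
  -- are disjoint and have equal size, so `#A * #E` is at most the number of orderings.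
  let sw : {g // g ∈ C} → Ordering C → Ordering C := fun g σ =>
    (Equiv.swap ⟨h, hh⟩ g).trans (σ : {h // h ∈ C} ≃ Fin C.card)
  have hsw : ∀ g σ x, Equiv.toFun (sw g σ) x = Equiv.toFun σ (Equiv.swap ⟨h, hh⟩ g x) :=
    fun _ _ _ => rfl
  have hinv : ∀ g σ, sw g (sw g σ) = σ := fun g σ => by
    refine Equiv.ext fun x => ?_
    refine ((hsw g (sw g σ) x).trans (hsw g σ _)).trans ?_
    rw [Equiv.swap_apply_self]; rfl
  let Eg : {g // g ∈ C} → Finset (Ordering C) := fun g => E.image (sw g)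
  have hcard : ∀ g, (Eg g).card = E.card := fun g =>
    Finset.card_image_of_injective _ (Function.LeftInverse.injective (hinv g))
  have hEg : ∀ g : {g // g ∈ C}, (g : X → Bool) ∈ A → ∀ σ ∈ Eg g,
      ∀ y : {g // g ∈ C}, (y : X → Bool) ∈ A → y ≠ g → Equiv.toFun σ g < Equiv.toFun σ y := by
    intro g hgA σ hσ y hy hyg
    obtain ⟨σ', hσ', rfl⟩ := Finset.mem_image.1 hσ
    obtain ⟨_, hf⟩ := (Finset.mem_filter.1 hσ').2
    have h1 : Equiv.toFun (sw g σ') g = Equiv.toFun σ' ⟨h, hh⟩ := by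
      rw [hsw, Equiv.swap_apply_right]
    rw [h1]
    by_cases hyh : y = ⟨h, hh⟩
    · have h2 : Equiv.toFun (sw g σ') y = Equiv.toFun σ' g := by
        rw [hsw, hyh, Equiv.swap_apply_left]
      rw [h2]
      exact hf g hgA g.2 fun heq => hyg (by rw [hyh]; exact (Subtype.ext heq).symm)
    · have h2 : Equiv.toFun (sw g σ') y = Equiv.toFun σ' y := by
        rw [hsw, Equiv.swap_apply_of_ne_of_ne hyh hyg]
      rw [h2]
      exact hf y hy y.2 fun heq => hyh (Subtype.ext heq)
  let A' : Finset {g // g ∈ C} := A.attach.image fun g => ⟨g.1, hA g.2⟩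
  have hA' : ∀ g ∈ A', (g : X → Bool) ∈ A := fun g hg => by
    obtain ⟨x, _, rfl⟩ := Finset.mem_image.1 hg
    exact x.2
  have hcardA : A'.card = A.card := by
    rw [Finset.card_image_of_injective, Finset.card_attach]
    intro a b hab
    have h1 : a.1 = b.1 := congrArg (fun x : {g // g ∈ C} => x.1) hab
    exact Subtype.ext h1
  have hdisj : (A'.biUnion Eg).card = ∑ g ∈ A', (Eg g).card := by
    refine Finset.card_biUnion fun g hg g' hg' hne' => Finset.disjoint_left.2 fun σ h1 h2 => ?_
    exact lt_asymm (hEg g (hA' g hg) σ h1 g' (hA' g' hg') hne'.symm)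
      (hEg g' (hA' g' hg') σ h2 g (hA' g hg) hne')
  have hle : A.card * E.card ≤ Fintype.card (Ordering C) := by
    have := Finset.card_le_univ (A'.biUnion Eg)
    rw [hdisj] at this
    simpa [hcard, hcardA] using this
  have hset : {σ : Ordering C | IsFirst σ A h} = (E : Set (Ordering C)) := by
    ext σ; simp [E]
  have hmeas : (orderingLaw C).real {σ | IsFirst σ A h} =
      E.card / Fintype.card (Ordering C) := by
    rw [hset, measureReal_def, orderingLaw, PMF.toMeasure_uniformOfFintype_apply _
      MeasurableSpace.measurableSet_top, ENNReal.toReal_div]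
    simp
  rw [hmeas, div_le_div_iff₀ (by exact_mod_cast Fintype.card_pos) hApos]
  rw [one_mul, mul_comm]
  exact_mod_cast hle

end Ordering

/-! ### The deterministic reference set, and how rarely the first hypothesis differs -/

namespace Tuning

variable {X : Type*} [MeasurableSpace X] {t : Tuning} {D : Measure X} [IsProbabilityMeasure D]
  {C : Finset (X → Bool)} {c : X → Bool}

open Classical in
/-- A set of hypotheses that is close to the version spaces, for most `n`. -/
def refSpace (t : Tuning) (D : Measure X) [IsProbabilityMeasure D] (C : Finset (X → Bool))
    (c : X → Bool) (n r : ℕ) : Finset (X → Bool) :=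
  C.filter fun h =>
    1 / 4 ≤ coverProb D C c t.Bm r (t.lowerLevels D C c (n + 7 * t.w)) {h} (n + 4 * t.w)

/-- The probability that `h` is in `upperSpace`. -/
def upperProb (t : Tuning) (D : Measure X) [IsProbabilityMeasure D] (C : Finset (X → Bool))
    (c : X → Bool) (n r : ℕ) (h : X → Bool) : ℝ :=
  coverProb D C c t.Bp r (t.upperLevels D C c n) {h} n

/-- The probability that `h` is in `lowerSpace`. -/
def lowerProb (t : Tuning) (D : Measure X) [IsProbabilityMeasure D] (C : Finset (X → Bool))
    (c : X → Bool) (n r : ℕ) (h : X → Bool) : ℝ :=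
  coverProb D C c t.Bm r (t.lowerLevels D C c n) {h} n

/-- The expected size of `upperSpace`. -/
def upperSize (t : Tuning) (D : Measure X) [IsProbabilityMeasure D] (C : Finset (X → Bool))
    (c : X → Bool) (n r : ℕ) : ℝ := ∑ h ∈ C, t.upperProb D C c n r h

/-- The expected size of `lowerSpace`. -/
def lowerSize (t : Tuning) (D : Measure X) [IsProbabilityMeasure D] (C : Finset (X → Bool))
    (c : X → Bool) (n r : ℕ) : ℝ := ∑ h ∈ C, t.lowerProb D C c n r h

theorem upperProb_mono (ht : t.Valid) {n n' : ℕ} (hn : n ≤ n') (r : ℕ) (h : X → Bool) :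
    t.upperProb D C c n r h ≤ t.upperProb D C c n' r h :=
  coverProb_mono le_rfl (fun j _ => upperLevels_antitone ht hn j) _ hn

theorem lowerProb_mono (ht : t.Valid) {n n' : ℕ} (hn : n ≤ n') (r : ℕ) (h : X → Bool) :
    t.lowerProb D C c n r h ≤ t.lowerProb D C c n' r h :=
  coverProb_mono le_rfl (fun j _ => lowerLevels_antitone ht hn j) _ hn

theorem coverProb_singleton_self (hc : c ∈ C) {B : ℝ} (hB : 0 ≤ B) (r : ℕ) (R : ℕ → ℕ) (n : ℕ) :
    coverProb D C c B r R {c} n = 1 := by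
  have : covered D C c B r R {c} n = Set.univ := by
    ext S; simpa [covered] using self_mem_survivors hc hB r R n S
  rw [coverProb, this, probReal_univ]

theorem self_mem_refSpace (hc : c ∈ C) (ht : t.Valid) (n r : ℕ) : c ∈ t.refSpace D C c n r := by
  classical
  refine Finset.mem_filter.2 ⟨hc, ?_⟩
  rw [coverProb_singleton_self hc ht.Bm_pos.le]
  norm_num

/-- If the upper process kept `h` with probability above `1/2` at `n + 3 * w`, the lower one would
keep it with probability at least `1/4` at `n + 4 * w`, and `h` would be in the reference set. So
`h` is in the lower tail, where probabilities are bounded by increments. -/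
theorem upperProb_le_of_notMem (hC : ∀ h ∈ C, Measurable h) (hc : c ∈ C) (ht : t.Valid) {n r : ℕ}
    (hr : r ≤ t.N) (hR : ∀ j < r, (t.lowerLevels D C c (n + 7 * t.w) j : ℝ) ≤
      (1 + 8 * t.ξ) * t.upperLevels D C c n j) {h : X → Bool} (hh : h ∈ C)
    (hn : h ∉ t.refSpace D C c n r) :
    t.upperProb D C c n r h ≤ t.upperProb D C c (n + 7 * t.w) r h - t.upperProb D C c n r h := by
  classical
  have hξ := ht.ξ_pos
  have hw : (0 : ℝ) < t.w := by exact_mod_cast ht.w_pos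
  have hBm := ht.Bm_pos
  have hBp := ht.Bp_pos
  have hBpm : t.Bp ≤ t.Bm := by nlinarith [ht.Bp_le]
  have hrN : (r : ℝ) ≤ t.N := by exact_mod_cast hr
  have hg0 : 0 ≤ t.g := le_trans (by positivity) ht.le_g
  have hhalf : coverProb D C c t.Bp r (t.upperLevels D C c n) {h} (n + 3 * t.w) ≤ 1 / 2 := by
    by_contra hcon
    refine hn (Finset.mem_filter.2 ⟨hh, ?_⟩)
    have := quarter_le_coverProb_of_half_lt hC hc (κ := 8 * t.ξ) (by linarith) hR ht.Bp_le ht.le_w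
      (le_trans (by gcongr) ht.exp_le) (not_le.1 hcon)
    rwa [show n + 3 * t.w + t.w = n + 4 * t.w by ring] at this
  have h1 := coverProb_le_cube hC hc t.Bp r (t.upperLevels D C c n) {h} ht.w_pos hg0
    (le_trans (by gcongr) ht.le_g) hhalf
  have h2 : coverProb D C c t.Bp r (t.upperLevels D C c n) {h} n ≤
      coverProb D C c t.Bp r (t.upperLevels D C c n) {h} (n + 3 * t.w) :=
    coverProb_mono le_rfl (fun _ _ => le_rfl) _ (by omega)
  have h3 : coverProb D C c t.Bp r (t.upperLevels D C c n) {h} (n + 3 * t.w) ≤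
      t.upperProb D C c (n + 7 * t.w) r h :=
    coverProb_mono le_rfl (fun j _ => upperLevels_antitone ht (by omega) j) _ (by omega)
  have h4 : t.g ^ 3 ≤ 1 := pow_le_one₀ hg0 ht.g_le
  have h5 := mul_le_mul_of_nonneg_right h4 (sub_nonneg.2 h2)
  change coverProb D C c t.Bp r (t.upperLevels D C c n) {h} n ≤
    t.upperProb D C c (n + 7 * t.w) r h - coverProb D C c t.Bp r (t.upperLevels D C c n) {h} n
  linarith

theorem lowerProb_le_of_notMem (hC : ∀ h ∈ C, Measurable h) (hc : c ∈ C) (ht : t.Valid) {n r : ℕ}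
    (hr : r ≤ t.N) {h : X → Bool} (hh : h ∈ C) (hn : h ∉ t.refSpace D C c n r) :
    t.lowerProb D C c n r h ≤ t.lowerProb D C c (n + 7 * t.w) r h - t.lowerProb D C c n r h := by
  classical
  have hw : (0 : ℝ) < t.w := by exact_mod_cast ht.w_pos
  have hBm := ht.Bm_pos
  have hrN : (r : ℝ) ≤ t.N := by exact_mod_cast hr
  have hlt : coverProb D C c t.Bm r (t.lowerLevels D C c (n + 7 * t.w)) {h} (n + 4 * t.w) < 1 / 4 :=
    not_le.1 fun hle => hn (Finset.mem_filter.2 ⟨hh, hle⟩)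
  have h1 := coverProb_le_window hC hc t.Bm r (t.lowerLevels D C c (n + 7 * t.w)) {h} ht.w_pos
    (le_trans (le_trans (by gcongr) ht.le_g) ht.g_le) hlt
  have h2 : t.lowerProb D C c n r h ≤
      coverProb D C c t.Bm r (t.lowerLevels D C c (n + 7 * t.w)) {h} (n + 4 * t.w) :=
    coverProb_mono le_rfl (fun j _ => lowerLevels_antitone ht (by omega) j) _ (by omega)
  have h3 : coverProb D C c t.Bm r (t.lowerLevels D C c (n + 7 * t.w)) {h} (n + 4 * t.w + t.w) ≤
      t.lowerProb D C c (n + 7 * t.w) r h :=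
    coverProb_mono le_rfl (fun _ _ => le_rfl) _ (by omega)
  linarith

/-- In the upper tail the failure probability at `n + 7 * w` is at most the increment; going back to
`n` adds one more increment, whence the factor `2`. -/
theorem one_sub_lowerProb_le_of_mem (hC : ∀ h ∈ C, Measurable h) (hc : c ∈ C) (ht : t.Valid)
    {n r : ℕ} (hr : r ≤ t.N) {h : X → Bool} (hn : h ∈ t.refSpace D C c n r) :
    1 - t.lowerProb D C c n r h ≤
      2 * (t.lowerProb D C c (n + 7 * t.w) r h - t.lowerProb D C c n r h) := by
  classical
  have hw : (0 : ℝ) < t.w := by exact_mod_cast ht.w_pos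
  have hBm := ht.Bm_pos
  have hrN : (r : ℝ) ≤ t.N := by exact_mod_cast hr
  have hg0 : 0 ≤ t.g := le_trans (by positivity) ht.le_g
  have h1 := one_sub_coverProb_le_cube hC hc t.Bm r (t.lowerLevels D C c (n + 7 * t.w)) {h}
    ht.w_pos hg0 (le_trans (by gcongr) ht.le_g) (Finset.mem_filter.1 hn).2
  rw [show n + 4 * t.w + 3 * t.w = n + 7 * t.w by ring] at h1
  have h2 : t.lowerProb D C c n r h ≤
      coverProb D C c t.Bm r (t.lowerLevels D C c (n + 7 * t.w)) {h} (n + 4 * t.w) :=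
    coverProb_mono le_rfl (fun j _ => lowerLevels_antitone ht (by omega) j) _ (by omega)
  have h3 : coverProb D C c t.Bm r (t.lowerLevels D C c (n + 7 * t.w)) {h} (n + 4 * t.w) ≤
      t.lowerProb D C c (n + 7 * t.w) r h :=
    coverProb_mono le_rfl (fun _ _ => le_rfl) _ (by omega)
  have h4 : t.g ^ 3 ≤ 1 := pow_le_one₀ hg0 ht.g_le
  have h5 := mul_le_mul_of_nonneg_right h4 (sub_nonneg.2 h3)
  have h6 : coverProb D C c t.Bm r (t.lowerLevels D C c (n + 7 * t.w)) {h} (n + 7 * t.w) =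
      t.lowerProb D C c (n + 7 * t.w) r h := rfl
  rw [h6] at h1
  linarith

theorem upperProb_eq (n r : ℕ) (h : X → Bool) :
    t.upperProb D C c n r h = (streamsLaw D).real {S | h ∈ t.upperSpace D C c n r S} := by
  simp [upperProb, coverProb, covered, upperSpace]

theorem one_sub_lowerProb_eq (hC : ∀ h ∈ C, Measurable h) (hc : c ∈ C) (n r : ℕ) (h : X → Bool) :
    1 - t.lowerProb D C c n r h =
      (streamsLaw D).real {S | h ∉ t.lowerSpace D C c n r S} := by
  have h1 : {S | h ∉ t.lowerSpace D C c n r S} = {S | h ∈ t.lowerSpace D C c n r S}ᶜ := rfl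
  rw [h1, probReal_compl_eq_one_sub (show MeasurableSet {S | h ∈ t.lowerSpace D C c n r S} from
    measurableSet_mem_survivors hC hc _ _ _ _ _)]
  simp [lowerProb, coverProb, covered, lowerSpace]

theorem one_le_upperSize (hc : c ∈ C) (ht : t.Valid) (n r : ℕ) : 1 ≤ t.upperSize D C c n r := by
  refine le_trans ?_ (Finset.single_le_sum (f := t.upperProb D C c n r)
    (fun h _ => coverProb_nonneg _ _ _ _ _) hc)
  exact (coverProb_singleton_self hc ht.Bp_pos.le _ _ _).ge

theorem one_le_lowerSize (hc : c ∈ C) (ht : t.Valid) (n r : ℕ) : 1 ≤ t.lowerSize D C c n r := by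
  refine le_trans ?_ (Finset.single_le_sum (f := t.lowerProb D C c n r)
    (fun h _ => coverProb_nonneg _ _ _ _ _) hc)
  exact (coverProb_singleton_self hc ht.Bm_pos.le _ _ _).ge

theorem upperSize_le (n r : ℕ) : t.upperSize D C c n r ≤ C.card := by
  refine (Finset.sum_le_card_nsmul _ _ 1 fun h _ => coverProb_le_one _ _ _ _ _).trans ?_
  simp

theorem lowerSize_le (n r : ℕ) : t.lowerSize D C c n r ≤ C.card := by
  refine (Finset.sum_le_card_nsmul _ _ 1 fun h _ => coverProb_le_one _ _ _ _ _).trans ?_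
  simp

/-- Put `y = (Γ' - Γ) / Γ`. A small increment of the logarithm gives `y ≤ 1/2`, so `Γ ≤ a + Γ/2`,
that is `Γ ≤ 2a`. The increment relative to `a` is then at most `2y ≤ 4 log (1 + y)`. -/
theorem mul_log_bound {Γ Γ' a : ℝ} (hΓ : 1 ≤ Γ) (hΓ' : Γ ≤ Γ') (ha : 1 ≤ a)
    (h : Γ ≤ a + (Γ' - Γ)) (h1 : 4 * (Real.log Γ' - Real.log Γ) < 1) :
    (Γ' - Γ) / a ≤ 4 * (Real.log Γ' - Real.log Γ) := by
  have hpos : 0 < Γ := by linarith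
  set y := (Γ' - Γ) / Γ with hy
  have hy0 : 0 ≤ y := div_nonneg (by linarith) hpos.le
  have hlog : Real.log Γ' - Real.log Γ = Real.log (1 + y) := by
    rw [← Real.log_div (by linarith) hpos.ne']
    congr 1
    rw [hy]; field_simp; ring
  have hy1 : y ≤ 1 / 2 := by
    by_contra hcon
    have h2 := half_le_log_one_add (x := 1 / 2) (by norm_num) (by norm_num)
    have h3 := Real.log_le_log (by norm_num) (show (1 : ℝ) + 1 / 2 ≤ 1 + y by linarith)
    linarith
  have h2 : Γ' - Γ = y * Γ := by rw [hy]; field_simp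
  have h3 : Γ ≤ 2 * a := by nlinarith
  have h4 : (Γ' - Γ) / a ≤ 2 * y := by
    rw [div_le_iff₀ (by linarith), h2]; nlinarith
  rw [hlog]
  linarith [half_le_log_one_add hy0 (by linarith)]

/-- The first hypotheses of the version space and of the reference space are likely to be the
same. -/
theorem prob_first_differs_le (hC : ∀ h ∈ C, Measurable h) (hc : c ∈ C) (ht : t.Valid) {n r : ℕ}
    (hr : r ≤ t.N) (hR : ∀ j < r, (t.lowerLevels D C c (n + 7 * t.w) j : ℝ) ≤
      (1 + 8 * t.ξ) * t.upperLevels D C c n j) :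
    ((streamsLaw D).prod (orderingLaw C)).real {p | ∃ h ∈ C,
      (h ∈ t.upperSpace D C c n r p.1 ∧ h ∉ t.refSpace D C c n r ∨
        h ∈ t.refSpace D C c n r ∧ h ∉ t.lowerSpace D C c n r p.1) ∧
      IsFirst p.2 (t.refSpace D C c n r) h} ≤
    8 * ((Real.log (t.upperSize D C c (n + 7 * t.w) r) - Real.log (t.upperSize D C c n r)) +
      (Real.log (t.lowerSize D C c (n + 7 * t.w) r) - Real.log (t.lowerSize D C c n r))) := by
  classical
  set A := t.refSpace D C c n r
  have hAC : A ⊆ C := Finset.filter_subset _ _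
  have hcA : c ∈ A := self_mem_refSpace hc ht n r
  have hAne : A.Nonempty := ⟨c, hcA⟩
  have hA1 : (1 : ℝ) ≤ A.card := by exact_mod_cast hAne.card_pos
  set n' := n + 7 * t.w
  have hnn' : n ≤ n' := by omega
  let dp : (X → Bool) → ℝ := fun h => t.upperProb D C c n' r h - t.upperProb D C c n r h
  let dm : (X → Bool) → ℝ := fun h => t.lowerProb D C c n' r h - t.lowerProb D C c n r h
  have hdp : ∀ h, 0 ≤ dp h := fun h => sub_nonneg.2 (upperProb_mono ht hnn' r h)
  have hdm : ∀ h, 0 ≤ dm h := fun h => sub_nonneg.2 (lowerProb_mono ht hnn' r h)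
  have hsp : t.upperSize D C c n' r - t.upperSize D C c n r = ∑ h ∈ C, dp h := by
    rw [upperSize, upperSize, ← Finset.sum_sub_distrib]
  have hsm : t.lowerSize D C c n' r - t.lowerSize D C c n r = ∑ h ∈ C, dm h := by
    rw [lowerSize, lowerSize, ← Finset.sum_sub_distrib]
  have hsplit : ∀ f : (X → Bool) → ℝ, ∑ h ∈ C, f h = ∑ h ∈ A, f h + ∑ h ∈ C \ A, f h := fun f => by
    rw [add_comm, Finset.sum_sdiff hAC]
  have hupper : t.upperSize D C c n r ≤
      A.card + (t.upperSize D C c n' r - t.upperSize D C c n r) := by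
    rw [hsp, upperSize, hsplit, hsplit dp]
    have h1 : ∑ h ∈ A, t.upperProb D C c n r h ≤ A.card := by
      refine (Finset.sum_le_card_nsmul _ _ 1 fun h _ => coverProb_le_one _ _ _ _ _).trans ?_
      simp
    have h2 : ∑ h ∈ C \ A, t.upperProb D C c n r h ≤ ∑ h ∈ C \ A, dp h :=
      Finset.sum_le_sum fun h hh =>
        upperProb_le_of_notMem hC hc ht hr hR (Finset.mem_sdiff.1 hh).1 (Finset.mem_sdiff.1 hh).2
    have h3 := Finset.sum_nonneg fun h (_ : h ∈ A) => hdp h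
    linarith
  have hlower : t.lowerSize D C c n r ≤
      A.card + (t.lowerSize D C c n' r - t.lowerSize D C c n r) := by
    rw [hsm, lowerSize, hsplit, hsplit dm]
    have h1 : ∑ h ∈ A, t.lowerProb D C c n r h ≤ A.card := by
      refine (Finset.sum_le_card_nsmul _ _ 1 fun h _ => coverProb_le_one _ _ _ _ _).trans ?_
      simp
    have h2 : ∑ h ∈ C \ A, t.lowerProb D C c n r h ≤ ∑ h ∈ C \ A, dm h :=
      Finset.sum_le_sum fun h hh =>
        lowerProb_le_of_notMem hC hc ht hr (Finset.mem_sdiff.1 hh).1 (Finset.mem_sdiff.1 hh).2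
    have h3 := Finset.sum_nonneg fun h (_ : h ∈ A) => hdm h
    linarith
  have hup : t.upperSize D C c n r ≤ t.upperSize D C c n' r := by
    linarith [Finset.sum_nonneg fun h (_ : h ∈ C) => hdp h]
  have hlow : t.lowerSize D C c n r ≤ t.lowerSize D C c n' r := by
    linarith [Finset.sum_nonneg fun h (_ : h ∈ C) => hdm h]
  have hu1 := one_le_upperSize (D := D) hc ht n r
  have hl1 := one_le_lowerSize (D := D) hc ht n r
  have hxp : 0 ≤ Real.log (t.upperSize D C c n' r) - Real.log (t.upperSize D C c n r) :=
    sub_nonneg.2 (Real.log_le_log (by linarith) hup)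
  have hxm : 0 ≤ Real.log (t.lowerSize D C c n' r) - Real.log (t.lowerSize D C c n r) :=
    sub_nonneg.2 (Real.log_le_log (by linarith) hlow)
  -- If one logarithmic increment is at least `1/4`, the claimed bound is at least `2` and there is
  -- nothing to prove.
  by_cases hbig : 4 * (Real.log (t.upperSize D C c n' r) - Real.log (t.upperSize D C c n r)) < 1 ∧
      4 * (Real.log (t.lowerSize D C c n' r) - Real.log (t.lowerSize D C c n r)) < 1
  swap
  · refine measureReal_le_one.trans ?_
    rw [not_and_or, not_lt, not_lt] at hbig
    rcases hbig with h | h <;> linarith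
  have hp := mul_log_bound hu1 hup hA1 hupper hbig.1
  have hm := mul_log_bound hl1 hlow hA1 hlower hbig.2
  let Q : (X → Bool) → Set (ℕ → ℕ → X) := fun h =>
    {S | h ∈ t.upperSpace D C c n r S ∧ h ∉ A ∨ h ∈ A ∧ h ∉ t.lowerSpace D C c n r S}
  have hQ : ∀ h ∈ C, (streamsLaw D).real (Q h) ≤ dp h + 2 * dm h := fun h hh => by
    by_cases hA : h ∈ A
    · have : Q h = {S | h ∉ t.lowerSpace D C c n r S} := by ext S; simp [Q, hA]
      rw [this, ← one_sub_lowerProb_eq hC hc]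
      linarith [one_sub_lowerProb_le_of_mem hC hc ht hr hA, hdp h]
    · have : Q h = {S | h ∈ t.upperSpace D C c n r S} := by ext S; simp [Q, hA]
      rw [this, ← upperProb_eq]
      linarith [upperProb_le_of_notMem hC hc ht hr hR hh hA, hdm h]
  have hset : {p : (ℕ → ℕ → X) × Ordering C | ∃ h ∈ C,
      (h ∈ t.upperSpace D C c n r p.1 ∧ h ∉ A ∨ h ∈ A ∧ h ∉ t.lowerSpace D C c n r p.1) ∧
      IsFirst p.2 A h} = ⋃ h ∈ C, Q h ×ˢ {σ | IsFirst σ A h} := by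
    ext p
    simp only [Set.mem_ofPred_eq, Set.mem_iUnion, Set.mem_prod, exists_prop, Q]
  rw [hset]
  -- The streams and the ordering are independent and `A` is deterministic. A misplaced `h` matters
  -- only if it precedes the rest of `A`, which costs a factor `1 / #A`.
  calc _ ≤ ∑ h ∈ C, ((streamsLaw D).prod (orderingLaw C)).real (Q h ×ˢ {σ | IsFirst σ A h}) :=
        measureReal_biUnion_finset_le _ _
    _ ≤ ∑ h ∈ C, (dp h + 2 * dm h) * (1 / A.card) := Finset.sum_le_sum fun h hh => by
        rw [measureReal_prod_prod]
        exact mul_le_mul (hQ h hh) (orderingLaw_isFirst_le hAC hAne h) measureReal_nonneg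
          (by linarith [hdp h, hdm h])
    _ = (t.upperSize D C c n' r - t.upperSize D C c n r) / A.card +
        2 * ((t.lowerSize D C c n' r - t.lowerSize D C c n r) / A.card) := by
        rw [← Finset.sum_mul, Finset.sum_add_distrib, ← Finset.mul_sum, hsp, hsm]; ring
    _ ≤ _ := by linarith

theorem sum_log_size_le (hc : c ∈ C) (ht : t.Valid) (r M : ℕ) :
    ∑ n ∈ Finset.range M,
      ((Real.log (t.upperSize D C c (n + 7 * t.w) r) - Real.log (t.upperSize D C c n r)) +
      (Real.log (t.lowerSize D C c (n + 7 * t.w) r) - Real.log (t.lowerSize D C c n r))) ≤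
      2 * (7 * t.w * Real.log C.card) := by
  rw [Finset.sum_add_distrib]
  have h1 := sum_log_shift_sub_le (G := fun n => t.upperSize D C c n r) one_pos
    (fun n => one_le_upperSize hc ht n r) (fun n => upperSize_le n r) (7 * t.w) M
  have h2 := sum_log_shift_sub_le (G := fun n => t.lowerSize D C c n r) one_pos
    (fun n => one_le_lowerSize hc ht n r) (fun n => lowerSize_le n r) (7 * t.w) M
  rw [div_one] at h1 h2
  push_cast at h1 h2
  linarith

end Tuning

/-! ### Version spaces in terms of the integer number of admitted errors -/

section VersionSpaces

variable {X : Type*}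

/-- The number of errors of `h` on the labeled sample of a round. -/
def wrongs (k : ℕ) (c : X → Bool) (s : ℕ → X) (V : Finset (X → Bool)) (h : X → Bool) : ℕ :=
  (Finset.univ.filter fun i : Fin k =>
    h (labeledSample k c s V i).1 ≠ (labeledSample k c s V i).2).card

open Classical in
/-- The version spaces for the admitted number `n` of errors per round. -/
def vspace (k : ℕ) (C : Finset (X → Bool)) (c : X → Bool) (n : ℕ) :
    ℕ → (ℕ → ℕ → X) → Finset (X → Bool)
  | 0, _ => C
  | r + 1, S => {h ∈ vspace k C c n r S | wrongs k c (S r) (vspace k C c n r S) h ≤ n}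

variable {k : ℕ} {C : Finset (X → Bool)} {c : X → Bool} {n : ℕ}

theorem mem_vspace_succ {r : ℕ} {S : ℕ → ℕ → X} {h : X → Bool} :
    h ∈ vspace k C c n (r + 1) S ↔
      h ∈ vspace k C c n r S ∧ wrongs k c (S r) (vspace k C c n r S) h ≤ n := by
  classical
  simp [vspace]

theorem vspace_succ_subset (r : ℕ) (S : ℕ → ℕ → X) :
    vspace k C c n (r + 1) S ⊆ vspace k C c n r S := fun _ hh => (mem_vspace_succ.1 hh).1

theorem vspace_subset (r : ℕ) (S : ℕ → ℕ → X) : vspace k C c n r S ⊆ C := by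
  induction r with
  | zero => exact subset_rfl
  | succ r ih => exact (vspace_succ_subset r S).trans ih

theorem wrongs_self (s : ℕ → X) (V : Finset (X → Bool)) : wrongs k c s V c = 0 := by
  simp [wrongs, labeledSample]

theorem self_mem_vspace (hc : c ∈ C) (r : ℕ) (S : ℕ → ℕ → X) : c ∈ vspace k C c n r S := by
  induction r with
  | zero => exact hc
  | succ r ih => exact mem_vspace_succ.2 ⟨ih, by simp [wrongs_self]⟩

theorem empErr_le_iff (hk : 0 < k) {v : ℝ} (hv : 0 ≤ v) (s : ℕ → X) (V : Finset (X → Bool))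
    (h : X → Bool) :
    empErr (labeledSample k c s V) h ≤ v ↔ wrongs k c s V h ≤ ⌊v * k⌋₊ := by
  rw [empErr, div_le_iff₀ (by exact_mod_cast hk), Nat.le_floor_iff (by positivity)]
  rfl

/-- Errors are counted in integers, so the threshold acts only through `⌊v * k⌋`. All estimates are
made for a fixed such integer and averaged at the end. -/
theorem versionSpace_eq (P : Params) (hk : 0 < P.k) {v : ℝ} (hv : 0 ≤ v) (S : Sample X) (r : ℕ) :
    versionSpace P C c S v r = vspace P.k C c ⌊v * P.k⌋₊ r S.1 := by
  classical
  induction r with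
  | zero => rfl
  | succ r ih =>
    ext h
    rw [versionSpace, ih, mem_vspace_succ, Finset.mem_filter, empErr_le_iff hk hv]

theorem vspace_congr {r : ℕ} {S S' : ℕ → ℕ → X} (h : ∀ j < r, S j = S' j) :
    vspace k C c n r S = vspace k C c n r S' := by
  induction r with
  | zero => rfl
  | succ r ih =>
    ext g
    rw [mem_vspace_succ, mem_vspace_succ, ih fun j hj => h j (by omega), h r (by omega)]

theorem DIS_eq {V : Finset (X → Bool)} (hc : c ∈ V) : DIS V = {x | ∃ h ∈ V, h x ≠ c x} := by
  ext x
  constructor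
  · rintro ⟨h₁, hh₁, h₂, hh₂, hne⟩
    by_cases h : h₁ x = c x
    · exact ⟨h₂, hh₂, fun h' => hne (h.trans h'.symm)⟩
    · exact ⟨h₁, hh₁, h⟩
  · rintro ⟨h, hh, hne⟩
    exact ⟨h, hh, c, hc, hne⟩

theorem nth_card_condition {p : ℕ → Prop} [DecidablePred p] {i R : ℕ} (h : i < Nat.count p R)
    (hf : (Set.ofPred p).Finite) : i < hf.toFinset.card :=
  h.trans_le (Nat.count_le_card hf R)

theorem count_eq_hitCount (A : Set X) [DecidablePred (· ∈ A)] (s : ℕ → X) (R : ℕ) :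
    Nat.count (fun j => s j ∈ A) R = hitCount A (Finset.range R) s := by
  classical
  rw [Nat.count_eq_card_filter_range, hitCount]
  congr 1
  ext j
  simp only [Finset.mem_filter]

/-- A prefix with at least `k` points of the disagreement region contains all labeled points, and
these sit at distinct positions. -/
theorem wrongs_le_errs {s : ℕ → X} {V : Finset (X → Bool)} {R : ℕ} (h : X → Bool)
    (hR : k ≤ hitCount (DIS V) (Finset.range R) s) : wrongs k c s V h ≤ errs c h s R := by
  classical
  rw [← count_eq_hitCount] at hR
  rw [wrongs, errs, hitCount]
  refine Finset.card_le_card_of_injOn (fun i : Fin k => Nat.nth (fun j => s j ∈ DIS V) i)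
    (fun i hi => ?_) fun i _ i' _ heq => ?_
  · have hi := (Finset.mem_filter.1 hi).2
    exact Finset.mem_filter.2 ⟨Finset.mem_range.2 (Nat.nth_lt_of_lt_count (i.2.trans_le hR)), hi⟩
  · have h1 := Nat.count_nth (p := fun j => s j ∈ DIS V)
      fun hf => nth_card_condition (i.2.trans_le hR) hf
    have h2 := Nat.count_nth (p := fun j => s j ∈ DIS V)
      fun hf => nth_card_condition (i'.2.trans_le hR) hf
    simp only at heq
    rw [heq, h2] at h1
    exact Fin.ext h1.symm

/-- Since `h` and `c` belong to `V`, every error of `h` is a point of the disagreement region; if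
the prefix has at most `k` such points, all of them get labeled. -/
theorem errs_le_wrongs {s : ℕ → X} {V : Finset (X → Bool)} {R : ℕ} {h : X → Bool}
    (hc : c ∈ V) (hh : h ∈ V)
    (hR : hitCount (DIS V) (Finset.range R) s ≤ k) : errs c h s R ≤ wrongs k c s V h := by
  classical
  rw [← count_eq_hitCount] at hR
  rw [wrongs, errs, hitCount]
  refine Finset.card_le_card_of_surjOn (fun i : Fin k => Nat.nth (fun j => s j ∈ DIS V) i)
    fun j hj => ?_
  obtain ⟨hj, hne⟩ := Finset.mem_filter.1 hj
  have hj := Finset.mem_range.1 hj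
  have hD : s j ∈ DIS V := ⟨h, hh, c, hc, hne⟩
  have hlt := (Nat.count_strict_mono (p := fun j => s j ∈ DIS V) hD hj).trans_le hR
  have hnth := Nat.nth_count (p := fun j => s j ∈ DIS V) hD
  refine ⟨⟨_, hlt⟩, ?_, hnth⟩
  refine Finset.mem_coe.2 (Finset.mem_filter.2 ⟨Finset.mem_univ _, ?_⟩)
  change h (s (Nat.nth (fun j => s j ∈ DIS V) (Nat.count (fun j => s j ∈ DIS V) j))) ≠
    c (s (Nat.nth (fun j => s j ∈ DIS V) (Nat.count (fun j => s j ∈ DIS V) j)))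
  rw [hnth]
  exact hne

variable [MeasurableSpace X]

theorem measurableSet_nth_eq {A : Set X} (hA : MeasurableSet A) (i m : ℕ) :
    MeasurableSet {s : ℕ → X | Nat.nth (fun j => s j ∈ A) i = m} := by
  classical
  have hset : ∀ m, MeasurableSet {s : ℕ → X | s m ∈ A ∧ hitCount A (Finset.range m) s = i} :=
    fun m => (measurable_pi_apply m hA).inter
      (measurableSet_eq_fun (measurable_hitCount hA _) measurable_const)
  have hpos : ∀ m, m ≠ 0 → {s : ℕ → X | Nat.nth (fun j => s j ∈ A) i = m} =
      {s : ℕ → X | s m ∈ A ∧ hitCount A (Finset.range m) s = i} := fun m hm => by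
    ext s
    simp only [Set.mem_ofPred_eq, ← count_eq_hitCount]
    constructor
    · intro h
      have hcond : ∀ hf : (Set.ofPred fun j => s j ∈ A).Finite, i < hf.toFinset.card := fun hf => by
        by_contra hcon
        exact hm (h.symm.trans (Nat.nth_of_card_le hf (not_lt.1 hcon)))
      have h1 := Nat.nth_mem i hcond
      have h2 := Nat.count_nth hcond
      rw [h] at h1 h2
      exact ⟨h1, h2⟩
    · rintro ⟨h1, h2⟩
      rw [← h2]
      exact Nat.nth_count (p := fun j => s j ∈ A) h1
  -- `Nat.nth` also returns `0` when there is no `i`-th point, so the value `0` is treated as the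
  -- complement of the positive values.
  by_cases hm : m = 0
  · have : {s : ℕ → X | Nat.nth (fun j => s j ∈ A) i = m} =
        (⋃ m', {s : ℕ → X | Nat.nth (fun j => s j ∈ A) i = m' + 1})ᶜ := by
      ext s
      simp only [hm, Set.mem_ofPred_eq, Set.mem_compl_iff, Set.mem_iUnion, not_exists]
      exact ⟨fun h m' => by omega, fun h => by
        by_contra hne
        exact h _ (Nat.succ_pred_eq_of_ne_zero hne).symm⟩
    rw [this]
    refine (MeasurableSet.iUnion fun m' => ?_).compl
    rw [hpos (m' + 1) (by omega)]
    exact hset _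
  · rw [hpos m hm]; exact hset m

theorem measurableSet_DIS (hC : ∀ h ∈ C, Measurable h) {V : Finset (X → Bool)} (hV : V ⊆ C) :
    MeasurableSet (DIS V) := by
  have : DIS V = ⋃ h₁ ∈ V, ⋃ h₂ ∈ V, {x | h₁ x ≠ h₂ x} := by
    ext x; simp [DIS]
  rw [this]
  exact Finset.measurableSet_biUnion _ fun h₁ hh₁ => Finset.measurableSet_biUnion _ fun h₂ hh₂ =>
    (measurableSet_eq_fun (hC _ (hV hh₁)) (hC _ (hV hh₂))).compl

theorem measurable_wrongs (hC : ∀ h ∈ C, Measurable h) (hc : c ∈ C) {V : Finset (X → Bool)}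
    (hV : V ⊆ C) {h : X → Bool} (hh : h ∈ C) : Measurable fun s : ℕ → X => wrongs k c s V h := by
  classical
  have hE := measurableSet_errSet (hC c hc) (hC h hh)
  have hD := measurableSet_DIS hC hV
  have hi : ∀ i : Fin k, MeasurableSet {s : ℕ → X |
      h (labeledSample k c s V i).1 ≠ (labeledSample k c s V i).2} := fun i => by
    have : {s : ℕ → X | h (labeledSample k c s V i).1 ≠ (labeledSample k c s V i).2} =
        ⋃ m, ({s : ℕ → X | Nat.nth (fun j => s j ∈ DIS V) i = m} ∩ {s | s m ∈ errSet c h}) := by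
      ext s; simp [labeledSample, errSet]
    rw [this]
    exact MeasurableSet.iUnion fun m => (measurableSet_nth_eq hD i m).inter
      (measurable_pi_apply m hE)
  simp only [wrongs, Finset.card_filter]
  exact Finset.measurable_sum _ fun i _ => Measurable.ite (hi i) measurable_const measurable_const

theorem measurableSet_vspace_eq (hC : ∀ h ∈ C, Measurable h) (hc : c ∈ C) (r : ℕ)
    (V : Finset (X → Bool)) : MeasurableSet {S : ℕ → ℕ → X | vspace k C c n r S = V} := by
  classical
  induction r generalizing V with
  | zero => exact MeasurableSet.const (C = V)
  | succ r ih =>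
    have : {S : ℕ → ℕ → X | vspace k C c n (r + 1) S = V} = ⋃ V' ∈ C.powerset,
        ({S | vspace k C c n r S = V'} ∩
          ⋂ h ∈ C, {S | (h ∈ V' ∧ wrongs k c (S r) V' h ≤ n) ↔ h ∈ V}) ∩ {S | V ⊆ C} := by
      ext S
      simp only [Set.mem_ofPred_eq, Set.mem_iUnion, Set.mem_inter_iff, Set.mem_iInter,
        Finset.mem_powerset, exists_prop]
      constructor
      · rintro rfl
        refine ⟨_, vspace_subset r S, ⟨rfl, fun h _ => mem_vspace_succ.symm⟩, vspace_subset _ _⟩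
      · rintro ⟨V', hV', ⟨rfl, h⟩, hV⟩
        ext g
        rw [mem_vspace_succ]
        by_cases hg : g ∈ C
        · exact h g hg
        · exact ⟨fun h' => absurd (hV' h'.1) hg, fun h' => absurd (hV h') hg⟩
    rw [this]
    refine Finset.measurableSet_biUnion _ fun V' hV' => ((ih V').inter ?_).inter
      (MeasurableSet.const _)
    refine Finset.measurableSet_biInter _ fun h hh => ?_
    have hm : MeasurableSet {S : ℕ → ℕ → X | h ∈ V' ∧ wrongs k c (S r) V' h ≤ n} :=
      (MeasurableSet.const _).inter (measurableSet_le
        ((measurable_wrongs hC hc (Finset.mem_powerset.1 hV') hh).comp (measurable_pi_apply r))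
        measurable_const)
    by_cases hV : h ∈ V
    · simp only [hV, iff_true]; exact hm
    · simp only [hV, iff_false]; exact hm.compl

/-- The version space of round `r` is independent of the stream of round `r`. -/
theorem prob_vspace_fresh_le (D : Measure X) [IsProbabilityMeasure D]
    (hC : ∀ h ∈ C, Measurable h) (hc : c ∈ C) (r : ℕ) (Q : Finset (X → Bool) → Prop)
    (B : Finset (X → Bool) → Set (ℕ → X)) {η : ℝ} (hη : 0 ≤ η)
    (hB : ∀ V ⊆ C, c ∈ V → Q V → MeasurableSet (B V) ∧
      (Measure.infinitePi fun _ : ℕ => D).real (B V) ≤ η) :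
    (streamsLaw D).real {S | Q (vspace k C c n r S) ∧ S r ∈ B (vspace k C c n r S)} ≤ η := by
  classical
  let F := C.powerset.filter fun V => c ∈ V ∧ Q V
  have h1 := measureReal_mem_apply_le (streamsLaw D) F (vspace k C c n r)
    (fun V => {S | S r ∈ B V}) (η := η) (fun V _ => measurableSet_vspace_eq hC hc r V) ?_
  · refine le_trans (measureReal_mono (fun S hS => ?_) (measure_ne_top _ _))
      (h1.trans (mul_le_of_le_one_right hη measureReal_le_one))
    exact ⟨Finset.mem_filter.2 ⟨Finset.mem_powerset.2 (vspace_subset r S), self_mem_vspace hc r S,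
      hS.1⟩, hS.2⟩
  · intro V hV
    obtain ⟨hVC, hcV, hQ⟩ := Finset.mem_filter.1 hV
    obtain ⟨hm, hle⟩ := hB V (Finset.mem_powerset.1 hVC) hcV hQ
    have hmS : MeasurableSet {S : ℕ → ℕ → X | S r ∈ B V} := measurable_pi_apply r hm
    have h2 := prob_inter_of_dependsOn (ι := ℕ) (Measure.infinitePi fun _ : ℕ => D)
      (s := Finset.range r) (t := {r}) (by simp)
      (measurableSet_vspace_eq (k := k) (n := n) hC hc r V) hmS
      (fun S S' hSS' h => by
        simp only [Set.mem_ofPred_eq] at h ⊢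
        rw [← h]
        exact (vspace_congr fun j hj => hSS' j (Finset.mem_range.2 hj)).symm)
      (fun S S' hSS' h => by
        simp only [Set.mem_ofPred_eq] at h ⊢
        rwa [← hSS' r (Finset.mem_singleton_self r)])
    have h3 : (streamsLaw D).real {S | S r ∈ B V} = (Measure.infinitePi fun _ : ℕ => D).real (B V) := by
      have h4 : MeasurePreserving (fun S : ℕ → ℕ → X => S r) (streamsLaw D)
        (Measure.infinitePi fun _ : ℕ => D) := measurePreserving_eval_infinitePi _ r
      rw [measureReal_def, measureReal_def]
      exact congrArg ENNReal.toReal (h4.measure_preimage hm.nullMeasurableSet)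
    refine (le_of_eq h2).trans ?_
    rw [mul_comm]
    exact mul_le_mul_of_nonneg_right (h3.le.trans hle) measureReal_nonneg

end VersionSpaces

/-! ### Halving of the mass, and the sandwich of the version spaces -/

section Comparison

variable {X : Type*} [MeasurableSpace X]

section Disagreement

variable {D : Measure X} {C : Finset (X → Bool)} {c : X → Bool}

theorem real_DIS {V : Finset (X → Bool)} (hc : c ∈ V) : D.real (DIS V) = mass D c V := by
  rw [DIS_eq hc, mass]

theorem dist_comm' (h h' : X → Bool) : dist D h h' = dist D h' h := by
  simp only [dist, ne_comm]

variable [IsProbabilityMeasure D]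

theorem mem_ball {r : ℝ} {h : X → Bool} : h ∈ ball D C c r ↔ h ∈ C ∧ dist D h c ≤ r := by
  classical
  simp [ball, dist_comm' c h]

theorem mass_le_sum (W : Finset (X → Bool)) : mass D c W ≤ ∑ h ∈ W, dist D h c := by
  have : {x | ∃ h ∈ W, h x ≠ c x} = ⋃ h ∈ W, {x | h x ≠ c x} := by ext x; simp
  rw [mass, this]
  exact measureReal_biUnion_finset_le _ _

/-- The family is bounded because a ball of radius `r` has error region of mass at most `#C * r`;
without a bound the real supremum would be the default value `0`. -/
theorem mass_ball_div_le (hc : c ∈ C) {r : ℝ} (hr : 0 < r) :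
    D.real (DIS (ball D C c r)) / r ≤ disagreementCoeff D C c := by
  have hself : ∀ r : ℝ, 0 < r → c ∈ ball D C c r := fun r hr => mem_ball.2 ⟨hc, by
    rw [dist_self]; exact hr.le⟩
  have hbdd : BddAbove (Set.range fun r : Set.Ioi (0 : ℝ) => D.real (DIS (ball D C c r)) / r) := by
    refine ⟨C.card, ?_⟩
    rintro _ ⟨⟨r, hr⟩, rfl⟩
    have hr : 0 < r := hr
    rw [div_le_iff₀ hr, real_DIS (hself r hr)]
    refine (mass_le_sum _).trans ?_
    refine (Finset.sum_le_card_nsmul _ _ r fun h hh => (mem_ball.1 hh).2).trans ?_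
    rw [nsmul_eq_mul]
    refine mul_le_mul_of_nonneg_right ?_ hr.le
    exact_mod_cast Finset.card_le_card fun h hh => (mem_ball.1 hh).1
  exact le_ciSup hbdd ⟨r, hr⟩

theorem mass_le_coeff_mul (hc : c ∈ C) {V : Finset (X → Bool)} (hV : V ⊆ C) {r : ℝ} (hr : 0 < r)
    (h : ∀ h ∈ V, dist D h c ≤ r) : mass D c V ≤ disagreementCoeff D C c * r := by
  have h1 := mass_ball_div_le (D := D) hc hr
  rw [div_le_iff₀ hr, real_DIS (c := c) (mem_ball.2 ⟨hc, by rw [dist_self]; exact hr.le⟩)] at h1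
  exact (mass_mono fun g hg => mem_ball.2 ⟨hV hg, h g hg⟩).trans h1

/-- At the radius `dist D h c`, the error set of `h` alone already has mass equal to the radius. -/
theorem one_le_disagreementCoeff (hc : c ∈ C) {h : X → Bool} (hh : h ∈ C)
    (hd : 0 < dist D h c) : 1 ≤ disagreementCoeff D C c := by
  have h1 := mass_le_coeff_mul (D := D) hc (V := {h}) (by simpa using hh) hd (by simp)
  have h2 : mass D c {h} = dist D h c := by simp [mass, dist]
  rw [h2] at h1
  by_contra hlt
  nlinarith

end Disagreement

theorem prob_prod_fresh_le {Ω₁ Ω₂ κ : Type*} [MeasurableSpace Ω₁] [MeasurableSpace Ω₂]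
    (μ₁ : Measure Ω₁) (μ₂ : Measure Ω₂) [IsProbabilityMeasure μ₁] [IsProbabilityMeasure μ₂]
    (F : Finset κ) (f : Ω₁ → κ) (B : κ → Set Ω₂) {η : ℝ} (hη : 0 ≤ η)
    (hf : ∀ k ∈ F, MeasurableSet {ω | f ω = k}) (hB : ∀ k ∈ F, μ₂.real (B k) ≤ η) :
    (μ₁.prod μ₂).real {p | f p.1 ∈ F ∧ p.2 ∈ B (f p.1)} ≤ η := by
  have h1 : {p : Ω₁ × Ω₂ | f p.1 ∈ F ∧ p.2 ∈ B (f p.1)} =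
      ⋃ k ∈ F, {ω | f ω = k} ×ˢ B k := by
    ext p; simp
  rw [h1]
  refine (measureReal_biUnion_finset_le _ _).trans ?_
  calc _ ≤ ∑ k ∈ F, μ₁.real {ω | f ω = k} * η := Finset.sum_le_sum fun k hk => by
        rw [measureReal_prod_prod]
        exact mul_le_mul_of_nonneg_left (hB k hk) measureReal_nonneg
    _ = μ₁.real (⋃ k ∈ F, {ω | f ω = k}) * η := by
        rw [← Finset.sum_mul, measureReal_biUnion_finset _ hf]
        intro a _ b _ hab
        exact Set.disjoint_left.2 fun ω (ha : f ω = a) (hb : f ω = b) => hab (ha.symm.trans hb)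
    _ ≤ η := mul_le_of_le_one_left hη measureReal_le_one

section Rounds

variable {D : Measure X} [IsProbabilityMeasure D] {C : Finset (X → Bool)} {c : X → Bool}
  {k n : ℕ}

theorem prob_hitCount_lt {A : Set X} (hA : MeasurableSet A) {R : ℕ} {ξ : ℝ} (hξ0 : 0 ≤ ξ)
    (hξ1 : ξ ≤ 1) (hR : (1 + ξ) * k ≤ R * D.real A) :
    (Measure.infinitePi fun _ : ℕ => D).real {s | hitCount A (Finset.range R) s < k} ≤
      Real.exp (-(ξ ^ 2 * k / 4)) := by
  rcases Nat.eq_zero_or_pos k with rfl | hk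
  · simp
  have hk : (0 : ℝ) < k := by exact_mod_cast hk
  refine le_trans (measureReal_mono (fun s hs => ?_) (measure_ne_top _ _))
    ((prob_hitCount_le_sub D hA (Finset.range R) (m := (1 + ξ) * k) (t := ξ * k) (by positivity)
      (by simpa using hR) (by positivity)).trans (Real.exp_le_exp.2 ?_))
  · have : hitCount A (Finset.range R) s < k := hs
    have h1 : (hitCount A (Finset.range R) s : ℝ) ≤ k := by exact_mod_cast this.le
    simp only [Set.mem_ofPred_eq]
    linarith
  · rw [neg_le_neg_iff, div_le_div_iff₀ (by norm_num) (by positivity)]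
    have : ξ ^ 2 * k ^ 2 * ξ ≤ ξ ^ 2 * k ^ 2 * 1 := mul_le_mul_of_nonneg_left hξ1 (by positivity)
    nlinarith

theorem prob_lt_hitCount {A : Set X} (hA : MeasurableSet A) {R : ℕ} {ξ : ℝ} (hξ0 : 0 ≤ ξ)
    (hξ1 : ξ ≤ 1) (hR : R * D.real A ≤ (1 - ξ) * k) :
    (Measure.infinitePi fun _ : ℕ => D).real {s | k < hitCount A (Finset.range R) s} ≤
      Real.exp (-(ξ ^ 2 * k / 4)) := by
  have hk : (0 : ℝ) ≤ k := Nat.cast_nonneg k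
  refine le_trans (measureReal_mono (fun s hs => ?_) (measure_ne_top _ _))
    ((prob_add_le_hitCount_of_le D hA (Finset.range R) (m := (1 - ξ) * k) (t := ξ * k) (B := k)
      (by simpa using hR) (by nlinarith) (by positivity) (by nlinarith)).trans
      (Real.exp_le_exp.2 ?_))
  · have : k < hitCount A (Finset.range R) s := hs
    have h1 : (k : ℝ) ≤ hitCount A (Finset.range R) s := by exact_mod_cast this.le
    simp only [Set.mem_ofPred_eq]
    linarith
  · rcases hk.eq_or_lt with h | h
    · rw [← h]; simp
    · refine le_of_eq ?_
      field_simp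

/-- The event that the labels of a round, starting from `V`, do not rule out all hypotheses of
large error. -/
def halvingBad (D : Measure X) (C : Finset (X → Bool)) (c : X → Bool) (k n : ℕ)
    (V : Finset (X → Bool)) : Set (ℕ → X) :=
  {s | k < hitCount (DIS V) (Finset.range ⌊0.95 * k / mass D c V⌋₊) s} ∪
    ⋃ h ∈ C, {s | mass D c V / (2 * disagreementCoeff D C c) < dist D h c ∧
      errs c h s ⌊0.95 * k / mass D c V⌋₊ ≤ n}

theorem measurableSet_halvingBad (hC : ∀ h ∈ C, Measurable h) (hc : c ∈ C)
    {V : Finset (X → Bool)} (hV : V ⊆ C) : MeasurableSet (halvingBad D C c k n V) := by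
  refine (measurableSet_lt measurable_const (measurable_hitCount (measurableSet_DIS hC hV) _)).union
    (Finset.measurableSet_biUnion _ fun h hh => (MeasurableSet.const _).inter ?_)
  exact measurableSet_le (measurable_errs hC hc hh _) measurable_const

theorem dist_le_of_notMem_halvingBad {V : Finset (X → Bool)} (hV : V ⊆ C) (hc : c ∈ V)
    {s : ℕ → X} (hs : s ∉ halvingBad D C c k n V) {h : X → Bool} (hh : h ∈ V)
    (hn : wrongs k c s V h ≤ n) : dist D h c ≤ mass D c V / (2 * disagreementCoeff D C c) := by
  simp only [halvingBad, Set.mem_union, Set.mem_iUnion, not_or, not_exists] at hs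
  by_contra hlt
  refine hs.2 h (hV hh) ⟨not_le.1 hlt, ?_⟩
  exact (errs_le_wrongs hc hh (not_lt.1 hs.1)).trans hn

/-- Among the first `0.95 k / m` points the expected number in the disagreement region is at most
`0.95 k`, so they exceed the labeled sample only with small probability. A hypothesis of error above
`m / (2Θ)` has an expected number of errors on them of at least `0.475 κ - 1/2 ≥ 0.47 κ`, where the
`1/2` pays for rounding and `κ = k/Θ ≥ 100`. This is `0.095 κ` above the largest admitted number
`3κ/8`. -/
theorem prob_halvingBad_le (hC : ∀ h ∈ C, Measurable h) (hc : c ∈ C) {V : Finset (X → Bool)}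
    (hV : V ⊆ C) (hcV : c ∈ V) (hm : 0 < mass D c V) (hΘ : 1 ≤ disagreementCoeff D C c)
    (hn : (n : ℝ) ≤ 3 / 8 * (k / disagreementCoeff D C c))
    (hk : 100 ≤ k / disagreementCoeff D C c) :
    (Measure.infinitePi fun _ : ℕ => D).real (halvingBad D C c k n V) ≤
      2 * C.card * Real.exp (-(k / disagreementCoeff D C c / 1600)) := by
  set Θ := disagreementCoeff D C c
  set m := mass D c V with hmdef
  set R := ⌊0.95 * k / m⌋₊ with hR
  have hΘ0 : 0 < Θ := by linarith
  set κ₀ := (k : ℝ) / Θ with hκ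
  have hkκ : κ₀ ≤ k := div_le_self (Nat.cast_nonneg k) hΘ
  have hkeq : (k : ℝ) = κ₀ * Θ := by rw [hκ]; field_simp
  have hm1 : m ≤ 1 := mass_le_one V
  have hcard : (1 : ℝ) ≤ C.card := by exact_mod_cast Finset.card_pos.2 ⟨c, hc⟩
  have hRle : (R : ℝ) ≤ 0.95 * k / m := Nat.floor_le (by positivity)
  have hRge : 0.95 * k / m - 1 ≤ R := by
    have := Nat.lt_floor_add_one ((0.95 : ℝ) * k / m)
    rw [← hR] at this
    linarith
  have h1 : (Measure.infinitePi fun _ : ℕ => D).real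
      {s | k < hitCount (DIS V) (Finset.range R) s} ≤ Real.exp (-(κ₀ / 1600)) := by
    refine (prob_lt_hitCount (measurableSet_DIS hC hV) (ξ := 0.05) (by norm_num) (by norm_num)
      ?_).trans (Real.exp_le_exp.2 (by linarith))
    rw [real_DIS hcV]
    calc (R : ℝ) * mass D c V ≤ 0.95 * k / m * m := by gcongr
      _ = (1 - 0.05) * k := by field_simp; norm_num; ring
  have h2 : ∀ h ∈ C, (Measure.infinitePi fun _ : ℕ => D).real
      {s | m / (2 * Θ) < dist D h c ∧ errs c h s R ≤ n} ≤ Real.exp (-(κ₀ / 1600)) := fun h hh => by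
    by_cases hd : m / (2 * Θ) < dist D h c
    swap
    · simp only [hd, false_and]; simp [Real.exp_nonneg]
    simp only [hd, true_and]
    have hmean : 0.47 * κ₀ ≤ (Finset.range R).card * D.real (errSet c h) := by
      rw [Finset.card_range]
      calc 0.47 * κ₀ ≤ (0.95 * k / m - 1) * (m / (2 * Θ)) := by
            have h3 : (0.95 * k / m - 1) * (m / (2 * Θ)) = 0.475 * κ₀ - m / (2 * Θ) := by
              rw [hκ]; field_simp; ring
            have h4 : m / (2 * Θ) ≤ 1 / 2 := by
              rw [div_le_div_iff₀ (by linarith) (by norm_num)]; linarith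
            rw [h3]; linarith
        _ ≤ R * (m / (2 * Θ)) := by gcongr
        _ ≤ R * D.real (errSet c h) := mul_le_mul_of_nonneg_left hd.le (Nat.cast_nonneg _)
    refine le_trans (measureReal_mono (fun s hs => ?_) (measure_ne_top _ _))
      ((prob_hitCount_le_sub D (measurableSet_errSet (hC c hc) (hC h hh)) (Finset.range R)
        (t := 0.095 * κ₀) (by linarith) hmean (by linarith)).trans (Real.exp_le_exp.2 ?_))
    · have h5 : (errs c h s R : ℝ) ≤ n := by exact_mod_cast hs
      change (errs c h s R : ℝ) ≤ 0.47 * κ₀ - 0.095 * κ₀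
      linarith
    · rw [neg_le_neg_iff, div_le_div_iff₀ (by norm_num) (by linarith)]
      nlinarith
  calc _ ≤ _ := measureReal_union_le _ _
    _ ≤ Real.exp (-(κ₀ / 1600)) + ∑ _h ∈ C, Real.exp (-(κ₀ / 1600)) :=
        add_le_add h1 ((measureReal_biUnion_finset_le _ _).trans (Finset.sum_le_sum h2))
    _ ≤ _ := by
        rw [Finset.sum_const, nsmul_eq_mul]
        have := Real.exp_nonneg (-(κ₀ / 1600))
        nlinarith

/-- Every remaining hypothesis has error at most `m / (2Θ)`, and the ball of this radius has mass at
most `Θ * m / (2Θ)`. -/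
theorem mass_vspace_succ_le (hc : c ∈ C) (hΘ : 1 ≤ disagreementCoeff D C c) {r : ℕ}
    {S : ℕ → ℕ → X} (hm : 0 < mass D c (vspace k C c n r S))
    (hS : S r ∉ halvingBad D C c k n (vspace k C c n r S)) :
    mass D c (vspace k C c n (r + 1) S) ≤ mass D c (vspace k C c n r S) / 2 := by
  have h1 := mass_le_coeff_mul (D := D) hc (vspace_subset (k := k) (n := n) (r + 1) S)
    (r := mass D c (vspace k C c n r S) / (2 * disagreementCoeff D C c)) (by positivity)
    fun h hh => dist_le_of_notMem_halvingBad (vspace_subset r S) (self_mem_vspace hc r S) hS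
      (mem_vspace_succ.1 hh).1 (mem_vspace_succ.1 hh).2
  refine h1.trans (le_of_eq ?_)
  field_simp

/-- The event that some round fails to halve the mass of the version space. -/
def someHalvingBad (D : Measure X) (C : Finset (X → Bool)) (c : X → Bool) (k n N : ℕ) (ε₀ : ℝ) :
    Set (ℕ → ℕ → X) :=
  ⋃ r ∈ Finset.range N, {S | ε₀ ≤ mass D c (vspace k C c n r S) ∧
    S r ∈ halvingBad D C c k n (vspace k C c n r S)}

theorem prob_someHalvingBad_le (hC : ∀ h ∈ C, Measurable h) (hc : c ∈ C)
    (hΘ : 1 ≤ disagreementCoeff D C c) (hn : (n : ℝ) ≤ 3 / 8 * (k / disagreementCoeff D C c))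
    (hk : 100 ≤ k / disagreementCoeff D C c) (N : ℕ) {ε₀ : ℝ} (hε : 0 < ε₀) :
    (streamsLaw D).real (someHalvingBad D C c k n N ε₀) ≤
      N * (2 * C.card * Real.exp (-(k / disagreementCoeff D C c / 1600))) := by
  refine (measureReal_biUnion_finset_le _ _).trans ?_
  refine (Finset.sum_le_card_nsmul _ _ _ fun r _ => ?_).trans
    (by rw [Finset.card_range, nsmul_eq_mul])
  exact prob_vspace_fresh_le D hC hc r (fun V => ε₀ ≤ mass D c V) (halvingBad D C c k n)
    (by positivity) fun V hV hcV hm => ⟨measurableSet_halvingBad hC hc hV,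
      prob_halvingBad_le hC hc hV hcV (hε.trans_le hm) hΘ hn hk⟩

theorem mass_vspace_le_of_notMem (hc : c ∈ C) (hΘ : 1 ≤ disagreementCoeff D C c) {N : ℕ} {ε₀ : ℝ}
    (hε : 0 < ε₀) {S : ℕ → ℕ → X} (hS : S ∉ someHalvingBad D C c k n N ε₀) {r : ℕ} (hr : r < N)
    (hm : ∀ j < r, ε₀ ≤ mass D c (vspace k C c n j S)) :
    mass D c (vspace k C c n r S) ≤ (1 / 2) ^ r := by
  induction r with
  | zero => simpa using mass_le_one _
  | succ r ih =>
    have h1 := ih (by omega) fun j hj => hm j (by omega)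
    have h2 := hm r (by omega)
    have h3 : S r ∉ halvingBad D C c k n (vspace k C c n r S) := fun hmem => hS <|
      Set.mem_biUnion (Finset.mem_coe.2 (Finset.mem_range.2 (show r < N by omega))) ⟨h2, hmem⟩
    have h4 := mass_vspace_succ_le hc hΘ (hε.trans_le h2) h3
    rw [pow_succ]
    linarith

end Rounds

namespace Tuning

variable {t : Tuning} {D : Measure X} [IsProbabilityMeasure D] {C : Finset (X → Bool)}
  {c : X → Bool} {n : ℕ}

/-- The event that the bounds for the version spaces may fail. -/
def sandwichBad (t : Tuning) (D : Measure X) [IsProbabilityMeasure D] (C : Finset (X → Bool))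
    (c : X → Bool) (n : ℕ) : Set (ℕ → ℕ → X) :=
  someHalvingBad D C c t.k n t.N t.ε₀ ∪ ⋃ r ∈ Finset.range t.N,
    (({S | t.upperMass D C c n r < mass D c (t.upperSpace D C c n r S)} ∪
      {S | mass D c (t.lowerSpace D C c n r S) < t.lowerMass D C c n r}) ∪
    ({S | mass D c (vspace t.k C c n r S) ≤ max (t.upperMass D C c n r) t.ε₀ ∧
      S r ∈ {s | t.k < hitCount (DIS (vspace t.k C c n r S))
        (Finset.range (t.upperLevels D C c n r)) s}} ∪
    {S | max (t.lowerMass D C c n r) t.ε₀ ≤ mass D c (vspace t.k C c n r S) ∧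
      S r ∈ {s | hitCount (DIS (vspace t.k C c n r S))
        (Finset.range (t.lowerLevels D C c n r)) s < t.k}}))

/-- Each quantile fails with probability at most `q` per round. For the counts, the stream of a
round is independent of its version space; on the relevant side of the deterministic mass bound, the
margin `ξ` in the prefix length becomes a relative deviation `ξ` from `k`. -/
theorem prob_sandwichBad_le (hC : ∀ h ∈ C, Measurable h) (hc : c ∈ C) (ht : t.Valid)
    (hΘ : 1 ≤ disagreementCoeff D C c) (hn : (n : ℝ) ≤ 3 / 8 * (t.k / disagreementCoeff D C c))
    (hk : 100 ≤ t.k / disagreementCoeff D C c) :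
    (streamsLaw D).real (t.sandwichBad D C c n) ≤
      t.N * (2 * C.card * Real.exp (-(t.k / disagreementCoeff D C c / 1600)) +
        (2 * t.q + 2 * Real.exp (-(t.ξ ^ 2 * t.k / 4)))) := by
  have hξ := ht.ξ_pos
  have hξ1 : t.ξ ≤ 1 := by linarith [ht.ξ_le]
  have hkpos := ht.k_pos
  rw [mul_add]
  refine (measureReal_union_le _ _).trans
    (add_le_add (prob_someHalvingBad_le hC hc hΘ hn hk _ ht.ε_pos) ?_)
  refine (measureReal_biUnion_finset_le _ _).trans ?_
  refine (Finset.sum_le_card_nsmul _ _ _ fun r _ => ?_).trans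
    (by rw [Finset.card_range, nsmul_eq_mul])
  rw [two_mul, two_mul]
  refine (measureReal_union_le _ _).trans (add_le_add ((measureReal_union_le _ _).trans
    (add_le_add (prob_upperMass_lt ht n r) (prob_lt_lowerMass ht n r)))
    ((measureReal_union_le _ _).trans (add_le_add ?_ ?_)))
  · refine prob_vspace_fresh_le D hC hc r
      (fun V => mass D c V ≤ max (t.upperMass D C c n r) t.ε₀)
      (fun V => {s | t.k < hitCount (DIS V) (Finset.range (t.upperLevels D C c n r)) s})
      (Real.exp_nonneg _) fun V hV hcV hm => ⟨?_, ?_⟩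
    · exact measurableSet_lt measurable_const (measurable_hitCount (measurableSet_DIS hC hV) _)
    · refine prob_lt_hitCount (measurableSet_DIS hC hV) hξ.le hξ1 ?_
      rw [real_DIS hcV, upperLevels_eq]
      have hU : 0 < max (t.upperMass D C c n r) t.ε₀ := lt_max_of_lt_right ht.ε_pos
      calc _ ≤ (1 - t.ξ) * t.k / max (t.upperMass D C c n r) t.ε₀ *
            max (t.upperMass D C c n r) t.ε₀ :=
            mul_le_mul (Nat.floor_le (div_nonneg (mul_nonneg (by linarith) hkpos.le) hU.le)) hm
              (mass_nonneg _) (div_nonneg (mul_nonneg (by linarith) hkpos.le) hU.le)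
        _ = _ := div_mul_cancel₀ _ hU.ne'
  · refine prob_vspace_fresh_le D hC hc r
      (fun V => max (t.lowerMass D C c n r) t.ε₀ ≤ mass D c V)
      (fun V => {s | hitCount (DIS V) (Finset.range (t.lowerLevels D C c n r)) s < t.k})
      (Real.exp_nonneg _) fun V hV hcV hm => ⟨?_, ?_⟩
    · exact measurableSet_lt (measurable_hitCount (measurableSet_DIS hC hV) _) measurable_const
    · refine prob_hitCount_lt (measurableSet_DIS hC hV) hξ.le hξ1 ?_
      rw [real_DIS hcV, lowerLevels_eq]
      have hU : 0 < max (t.lowerMass D C c n r) t.ε₀ := lt_max_of_lt_right ht.ε_pos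
      calc (1 + t.ξ) * t.k = (1 + t.ξ) * t.k / max (t.lowerMass D C c n r) t.ε₀ *
            max (t.lowerMass D C c n r) t.ε₀ := (div_mul_cancel₀ _ hU.ne').symm
        _ ≤ _ := mul_le_mul (Nat.le_ceil _) hm hU.le (Nat.cast_nonneg _)

/-- Off an unlikely event, the version spaces are between their bounds. -/
theorem vspace_between (hc : c ∈ C) (ht : t.Valid) (hΘ : 1 ≤ disagreementCoeff D C c)
    (hBp : t.Bp = t.k / (2 * disagreementCoeff D C c)) {S : ℕ → ℕ → X}
    (hS : S ∉ t.sandwichBad D C c n) {r : ℕ} (hr : r < t.N)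
    (hm : ∀ j < r, t.ε₀ ≤ mass D c (vspace t.k C c n j S)) :
    t.lowerSpace D C c n r S ⊆ vspace t.k C c n r S ∧
      vspace t.k C c n r S ⊆ t.upperSpace D C c n r S := by
  have hξ := ht.ξ_pos
  have hξ1 : t.ξ ≤ 1 := by linarith [ht.ξ_le]
  have hkpos := ht.k_pos
  induction r with
  | zero =>
    refine ⟨fun h hh => (mem_survivors.1 hh).1, fun h hh => mem_survivors.2 ⟨hh, by simp⟩⟩
  | succ r ih =>
    obtain ⟨hlow, hup⟩ := ih (by omega) fun j hj => hm j (by omega)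
    have hmr := hm r (by omega)
    simp only [sandwichBad, Set.mem_union, not_or, Set.mem_iUnion, not_exists, Finset.mem_range]
      at hS
    obtain ⟨hS1, hS2⟩ := hS
    obtain ⟨⟨hU, hL⟩, ha, hb⟩ := hS2 r (by omega)
    rw [Set.mem_ofPred_eq, not_lt] at hU hL
    set V := vspace t.k C c n r S with hV
    have hmU : mass D c V ≤ t.upperMass D C c n r := (mass_mono hup).trans hU
    have hmL : t.lowerMass D C c n r ≤ mass D c V := hL.trans (mass_mono hlow)
    -- The upper prefix is short enough to contain at most `k` points of the disagreement region,
    -- the lower one long enough to contain at least `k`; the error counts on the two prefixes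
    -- bracket the number of errors on the labeled sample.
    have ha' : hitCount (DIS V) (Finset.range (t.upperLevels D C c n r)) (S r) ≤ t.k :=
      not_lt.1 fun hlt => ha ⟨hmU.trans (le_max_left _ _), hlt⟩
    have hb' : t.k ≤ hitCount (DIS V) (Finset.range (t.lowerLevels D C c n r)) (S r) :=
      not_lt.1 fun hlt => hb ⟨max_le hmL hmr, hlt⟩
    have hhalf : S r ∉ halvingBad D C c t.k n V := fun hmem => hS1 <|
      Set.mem_biUnion (Finset.mem_coe.2 (Finset.mem_range.2 (show r < t.N by omega))) ⟨hmr, hmem⟩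
    constructor
    · intro h hh
      have hh := mem_survivors.1 hh
      rw [mem_vspace_succ]
      refine ⟨hlow (mem_survivors.2 ⟨hh.1, fun j hj => hh.2 j (by omega)⟩), ?_⟩
      exact (wrongs_le_errs h hb').trans (hh.2 r (by omega)).1
    · intro h hh
      obtain ⟨hhV, hw⟩ := mem_vspace_succ.1 hh
      have hhu := mem_survivors.1 (hup hhV)
      refine mem_survivors.2 ⟨hhu.1, fun j hj => ?_⟩
      rcases Nat.lt_succ_iff_lt_or_eq.1 hj with hj | rfl
      · exact hhu.2 j hj
      have hcV : c ∈ V := self_mem_vspace hc j S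
      refine ⟨(errs_le_wrongs hcV hhV ha').trans hw, ?_⟩
      have hd := dist_le_of_notMem_halvingBad (vspace_subset j S) hcV hhalf hhV hw
      have hUpos : 0 < max (t.upperMass D C c n j) t.ε₀ := lt_max_of_lt_right ht.ε_pos
      -- The side condition of the upper process comes from halving: the error of a remaining
      -- hypothesis is at most the mass over `2Θ`, while the prefix length is at most `(1 - ξ) k`
      -- over an upper bound of the mass.
      rw [upperLevels_eq, hBp]
      calc (⌊(1 - t.ξ) * t.k / max (t.upperMass D C c n j) t.ε₀⌋₊ : ℝ) * dist D h c
          ≤ (1 - t.ξ) * t.k / max (t.upperMass D C c n j) t.ε₀ *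
            (max (t.upperMass D C c n j) t.ε₀ / (2 * disagreementCoeff D C c)) := by
            refine mul_le_mul (Nat.floor_le (div_nonneg (mul_nonneg (by linarith) hkpos.le)
              hUpos.le)) (hd.trans ?_) (dist_nonneg _ _ _)
              (div_nonneg (mul_nonneg (by linarith) hkpos.le) hUpos.le)
            gcongr
            exact hmU.trans (le_max_left _ _)
        _ = (1 - t.ξ) * (t.k / (2 * disagreementCoeff D C c)) := by field_simp
        _ ≤ t.k / (2 * disagreementCoeff D C c) :=
            mul_le_of_le_one_left (by positivity) (by linarith)

theorem mass_vspace_between (hc : c ∈ C) (ht : t.Valid) (hΘ : 1 ≤ disagreementCoeff D C c)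
    (hBp : t.Bp = t.k / (2 * disagreementCoeff D C c)) {S : ℕ → ℕ → X}
    (hS : S ∉ t.sandwichBad D C c n) {r : ℕ} (hr : r < t.N)
    (hm : ∀ j < r, t.ε₀ ≤ mass D c (vspace t.k C c n j S)) :
    t.lowerMass D C c n r ≤ mass D c (vspace t.k C c n r S) ∧
      mass D c (vspace t.k C c n r S) ≤ t.upperMass D C c n r := by
  obtain ⟨hlow, hup⟩ := vspace_between hc ht hΘ hBp hS hr hm
  simp only [sandwichBad, Set.mem_union, not_or, Set.mem_iUnion, not_exists, Finset.mem_range]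
      at hS
  obtain ⟨⟨hU, hL⟩, -, -⟩ := hS.2 r hr
  rw [Set.mem_ofPred_eq, not_lt] at hU hL
  exact ⟨hL.trans (mass_mono hlow), (mass_mono hup).trans hU⟩

end Tuning

end Comparison

/-! ### Random offsets and the stopping decision of `rSTAT` -/

section UnitInterval

theorem volume_unitInterval_Ioc_le (a b : ℝ) :
    (volume : Measure unitInterval).real {u | a < u ∧ (u : ℝ) ≤ b} ≤
      max (min b 1 - max a 0) 0 := by
  have hm : MeasurableSet {u : unitInterval | a < u ∧ (u : ℝ) ≤ b} :=
    (measurableSet_lt measurable_const measurable_subtype_coe).inter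
      (measurableSet_le measurable_subtype_coe measurable_const)
  have h1 := unitInterval.measurableEmbedding_coe.comap_apply volume
    {u : unitInterval | a < u ∧ (u : ℝ) ≤ b}
  have h2 : (Subtype.val '' {u : unitInterval | a < u ∧ (u : ℝ) ≤ b} : Set ℝ) ⊆
      Set.Icc (max a 0) (min b 1) := by
    rintro _ ⟨u, hu, rfl⟩
    exact ⟨max_le hu.1.le u.2.1, le_min hu.2 u.2.2⟩
  rw [measureReal_def]
  refine ENNReal.toReal_le_of_le_ofReal (le_max_right _ _) ?_
  calc (volume : Measure unitInterval) {u | a < u ∧ (u : ℝ) ≤ b}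
      = volume (Subtype.val '' {u : unitInterval | a < u ∧ (u : ℝ) ≤ b} : Set ℝ) := h1
    _ ≤ volume (Set.Icc (max a 0) (min b 1)) := measure_mono h2
    _ = ENNReal.ofReal (min b 1 - max a 0) := Real.volume_Icc
    _ ≤ _ := ENNReal.ofReal_le_ofReal (le_max_left _ _)

/-- The floors differ only if an integer lies in `(x - u, y - u]`. For `y - x < 1` only `⌊y⌋` and
`⌊y⌋ - 1` are possible. The two corresponding intervals of offsets, cut to `[0, 1]`, have lengths
adding up to at most `y - x`. -/
theorem volume_floor_sub_ne_le_aux {x y : ℝ} (hxy : x ≤ y) :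
    (volume : Measure unitInterval).real {u | ⌊x - (u : ℝ)⌋ ≠ ⌊y - (u : ℝ)⌋} ≤ y - x := by
  by_cases h1 : 1 ≤ y - x
  · exact measureReal_le_one.trans h1
  push Not at h1
  set m := ⌊y⌋ with hm
  have hm0 : (m : ℝ) ≤ y := Int.floor_le y
  have hm1 : y < m + 1 := Int.lt_floor_add_one y
  have hsub : {u : unitInterval | ⌊x - (u : ℝ)⌋ ≠ ⌊y - (u : ℝ)⌋} ⊆
      {u | x - m < u ∧ (u : ℝ) ≤ y - m} ∪ {u | x - m + 1 < u ∧ (u : ℝ) ≤ y - m + 1} := by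
    intro u hu
    have hlt : ⌊x - (u : ℝ)⌋ < ⌊y - (u : ℝ)⌋ :=
      lt_of_le_of_ne (Int.floor_mono (by linarith)) hu
    set i := ⌊y - (u : ℝ)⌋
    have hi1 : (i : ℝ) ≤ y - u := Int.floor_le _
    have hi2 : x - u < i := Int.floor_lt.1 hlt
    have hu0 := u.2.1
    have hu1 := u.2.2
    have hle : i ≤ m := Int.floor_mono (by linarith)
    have hge : m - 1 ≤ i := by
      have h2 : (m : ℝ) - 2 < i := by linarith
      have h3 : m - 2 < i := by exact_mod_cast h2
      omega
    rcases (show i = m ∨ i = m - 1 by omega) with h | h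
    · rw [h] at hi1 hi2
      exact Or.inl ⟨by linarith, by linarith⟩
    · rw [h] at hi1 hi2
      push_cast at hi1 hi2
      exact Or.inr ⟨by linarith, by linarith⟩
  refine (measureReal_mono hsub).trans ((measureReal_union_le _ _).trans ((add_le_add
    (volume_unitInterval_Ioc_le _ _) (volume_unitInterval_Ioc_le _ _)).trans ?_))
  rcases le_total (m : ℝ) x with h | h
  · rw [min_eq_left (by linarith), max_eq_left (show (0 : ℝ) ≤ x - m by linarith),
      min_eq_right (by linarith), max_eq_left (show (0 : ℝ) ≤ x - m + 1 by linarith),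
      max_eq_left (by linarith), max_eq_right (by linarith)]
    linarith
  · rw [min_eq_left (by linarith), max_eq_right (show x - m ≤ (0 : ℝ) by linarith),
      min_eq_right (by linarith), max_eq_left (show (0 : ℝ) ≤ x - m + 1 by linarith),
      max_eq_left (by linarith), max_eq_left (by linarith)]
    linarith

theorem volume_floor_sub_ne_le (x y : ℝ) :
    (volume : Measure unitInterval).real {u | ⌊x - (u : ℝ)⌋ ≠ ⌊y - (u : ℝ)⌋} ≤ |x - y| := by
  rcases le_total x y with h | h
  · rw [abs_sub_comm, abs_of_nonneg (by linarith)]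
    exact volume_floor_sub_ne_le_aux h
  · rw [abs_of_nonneg (by linarith)]
    have := volume_floor_sub_ne_le_aux h
    simpa only [ne_comm] using this

end UnitInterval

section Cells

/-- The midpoint of the region that contains `z`, in the partition of `[0, 1]` with offset
`α * u` and width `α`. -/
def cellMid (α : ℝ) (z : ℝ) (u : unitInterval) : ℝ :=
  if z < α * u then α * u / 2
  else (α * u + α * (⌊(z - α * u) / α⌋ : ℤ) +
    min (α * u + α * (⌊(z - α * u) / α⌋ : ℤ) + α) 1) / 2

theorem rSTAT_eq {X : Type*} (ρ τ δ : ℝ) (φ : X → ℝ) {T : ℕ} (x : Fin T → X) (u : unitInterval) :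
    rSTAT ρ τ δ φ x u = cellMid (rSTATWidth ρ τ δ) ((∑ i, φ (x i)) / T) u := rfl

theorem abs_cellMid_sub_le {α z : ℝ} (hα : 0 < α) (hz0 : 0 ≤ z) (hz1 : z ≤ 1) (u : unitInterval) :
    |cellMid α z u - z| ≤ α / 2 := by
  have hu0 := u.2.1
  have hu1 := u.2.2
  rw [cellMid, abs_le]
  split_ifs with h
  · constructor <;> nlinarith
  · push Not at h
    set f : ℝ := ((⌊(z - α * u) / α⌋ : ℤ) : ℝ)
    have h1 : f ≤ (z - α * u) / α := Int.floor_le _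
    have h2 : (z - α * u) / α < f + 1 := Int.lt_floor_add_one _
    rw [le_div_iff₀ hα] at h1
    rw [div_lt_iff₀ hα] at h2
    rcases le_total (α * u + α * f + α) 1 with h3 | h3
    · rw [min_eq_left h3]; constructor <;> linarith
    · rw [min_eq_right h3]; constructor <;> linarith

/-- The integer `⌊z / α - u⌋` identifies the region of `z`; a negative value stands for the
truncated first region. -/
theorem cellMid_congr {α z z' : ℝ} (hα : 0 < α) {u : unitInterval}
    (h : ⌊z / α - u⌋ = ⌊z' / α - u⌋) : cellMid α z u = cellMid α z' u := by
  have hdiv : ∀ z : ℝ, (z - α * u) / α = z / α - u := fun z => by field_simp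
  have hlt : ∀ z : ℝ, z < α * u ↔ ⌊z / α - u⌋ < 0 := fun z => by
    rw [Int.floor_lt, ← hdiv, Int.cast_zero, div_lt_iff₀ hα, zero_mul, sub_neg]
  simp only [cellMid, hdiv, hlt, h]

theorem measurable_cellMid (α : ℝ) :
    Measurable fun p : ℝ × unitInterval => cellMid α p.1 p.2 := by
  have hu : Measurable fun p : ℝ × unitInterval => α * (p.2 : ℝ) :=
    (measurable_subtype_coe.comp measurable_snd).const_mul α
  have hf : Measurable fun p : ℝ × unitInterval =>
      ((⌊(p.1 - α * p.2) / α⌋ : ℤ) : ℝ) :=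
    (measurable_from_top (f := fun i : ℤ => (i : ℝ))).comp
      (((measurable_fst.sub hu).div_const α).floor)
  exact Measurable.ite (measurableSet_lt measurable_fst hu) (hu.div_const 2)
    (((hu.add (hf.const_mul α)).add
      (((hu.add (hf.const_mul α)).add_const α).min measurable_const)).div_const 2)

/-- The truncation of `z` to the range that matters for the stopping decision. -/
def clip (ε z : ℝ) : ℝ := min (max z (ε / 8)) ε

theorem le_clip {ε : ℝ} (hε : 0 < ε) (z : ℝ) : ε / 8 ≤ clip ε z :=
  le_min (le_max_right _ _) (by linarith)

theorem clip_le (ε z : ℝ) : clip ε z ≤ ε := min_le_right _ _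

theorem clip_mono (ε : ℝ) : Monotone (clip ε) := fun _ _ h =>
  min_le_min_right _ (max_le_max_right _ h)

theorem abs_clip_sub_clip_le (ε z z' : ℝ) : |clip ε z - clip ε z'| ≤ |z - z'| :=
  (abs_inf_sub_inf_le_abs _ _ _).trans (abs_max_sub_max_le_abs _ _ _)

variable {ε α : ℝ}

theorem cellMid_lt_of_le (hα0 : 0 < α) (hα : α ≤ 0.54 * ε) {z : ℝ} (hz0 : 0 ≤ z)
    (hz1 : z ≤ 1) (hz : z ≤ 0.225 * ε) (u : unitInterval) : cellMid α z u < ε / 2 := by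
  have := (abs_le.1 (abs_cellMid_sub_le hα0 hz0 hz1 u)).2
  linarith

theorem lt_of_cellMid_lt (hα0 : 0 < α) (hα : α ≤ 0.54 * ε) {z : ℝ} (hz0 : 0 ≤ z)
    (hz1 : z ≤ 1) {u : unitInterval} (h : cellMid α z u < ε / 2) : z < 0.77 * ε := by
  have := (abs_le.1 (abs_cellMid_sub_le hα0 hz0 hz1 u)).1
  linarith

/-- The midpoint is within `α/2 ≤ 0.27 ε` of `z`, so values up to `0.225 ε` always stop and values
from `0.77 ε` on never do. Truncation to `[ε/8, ε]` therefore changes no decision, and it makes the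
range of the telescoping masses comparable with the region width. -/
theorem cellMid_clip_lt_iff (hε : 0 < ε) (hε1 : ε ≤ 1) (hα0 : 0 < α) (hα : α ≤ 0.54 * ε) {z : ℝ}
    (hz0 : 0 ≤ z) (hz1 : z ≤ 1) (u : unitInterval) :
    cellMid α (clip ε z) u < ε / 2 ↔ cellMid α z u < ε / 2 := by
  have hc0 : 0 ≤ clip ε z := by linarith [le_clip hε z]
  have hc1 : clip ε z ≤ 1 := (clip_le ε z).trans hε1
  rcases le_total z (ε / 8) with h | h
  · have hcl : clip ε z = ε / 8 := by
      rw [clip, max_eq_right h, min_eq_left (by linarith)]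
    exact iff_of_true (cellMid_lt_of_le hα0 hα hc0 hc1 (by rw [hcl]; linarith) u)
      (cellMid_lt_of_le hα0 hα hz0 hz1 (by linarith) u)
  · rcases le_total z ε with h' | h'
    · rw [show clip ε z = z by rw [clip, max_eq_left h, min_eq_left h']]
    · have hcl : clip ε z = ε := by rw [clip, max_eq_left h, min_eq_right h']
      refine iff_of_false (fun hlt => ?_) (fun hlt => ?_)
      · have := lt_of_cellMid_lt hα0 hα hc0 hc1 hlt
        rw [hcl] at this; linarith
      · have := lt_of_cellMid_lt hα0 hα hz0 hz1 hlt
        linarith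

theorem volume_decision_ne_le (hα0 : 0 < α) (z z' : ℝ) :
    (volume : Measure unitInterval).real
      {u | ¬ (cellMid α z u < ε / 2 ↔ cellMid α z' u < ε / 2)} ≤ |z - z'| / α := by
  refine (measureReal_mono fun u hu => ?_).trans ((volume_floor_sub_ne_le (z / α) (z' / α)).trans
    (le_of_eq ?_))
  · exact fun heq => hu (by rw [cellMid_congr hα0 heq])
  · rw [← sub_div, abs_div, abs_of_pos hα0]

theorem rSTATWidth_bounds {ε δ ρ : ℝ} (hε : 0 < ε) (hδ : 0 < δ ∧ δ ≤ 1 / 2)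
    (hρ : 0 < ρ ∧ ρ ≤ 1 / 2) {N : ℕ} (hN : 9 ≤ N) :
    0.4 * ε ≤ rSTATWidth (ρ / (2 * N)) (ε / 4) (δ / (2 * N)) ∧
      rSTATWidth (ρ / (2 * N)) (ε / 4) (δ / (2 * N)) ≤ 0.54 * ε := by
  have hN' : (9 : ℝ) ≤ N := by exact_mod_cast hN
  have h1 : ρ / (2 * N) ≤ 1 / 36 := by
    rw [div_le_div_iff₀ (by linarith) (by norm_num)]; linarith
  have h2 : δ / (2 * N) ≤ 1 / 36 := by
    rw [div_le_div_iff₀ (by linarith) (by norm_num)]; linarith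
  have h3 : 0 ≤ ρ / (2 * N) := div_nonneg hρ.1.le (by linarith)
  have h4 : 0 ≤ δ / (2 * N) := div_nonneg hδ.1.le (by linarith)
  rw [rSTATWidth, le_div_iff₀ (by linarith), div_le_iff₀ (by linarith)]
  constructor <;> nlinarith

end Cells

/-! ### Empirical frequencies on fresh samples -/

section EmpiricalMean

variable {X : Type*}

/-- The fraction of the first `T` points of the stream that lie in `A`. -/
def freq (A : Set X) (T : ℕ) (s : ℕ → X) : ℝ := hitCount A (Finset.range T) s / T

theorem freq_eq (A : Set X) (T : ℕ) (s : ℕ → X) :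
    (∑ i : Fin T, A.indicator (fun _ => (1 : ℝ)) (s i)) / T = freq A T s := by
  rw [freq, cast_hitCount, Finset.sum_range]

theorem freq_nonneg (A : Set X) (T : ℕ) (s : ℕ → X) : 0 ≤ freq A T s := by
  unfold freq; positivity

theorem freq_le_one (A : Set X) (T : ℕ) (s : ℕ → X) : freq A T s ≤ 1 := by
  rw [freq]
  refine div_le_one_of_le₀ ?_ (Nat.cast_nonneg _)
  have := hitCount_le_card A (Finset.range T) s
  rw [Finset.card_range] at this
  exact_mod_cast this

variable [MeasurableSpace X]

theorem measurable_freq {A : Set X} (hA : MeasurableSet A) (T : ℕ) :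
    Measurable fun s : ℕ → X => freq A T s :=
  ((measurable_from_top (f := fun i : ℕ => (i : ℝ))).comp (measurable_hitCount hA _)).div_const _

theorem integral_abs_freq_sub_le (D : Measure X) [IsProbabilityMeasure D] {A : Set X}
    (hA : MeasurableSet A) {T : ℕ} (hT : 0 < T) :
    ∫ s, |freq A T s - D.real A| ∂(Measure.infinitePi fun _ : ℕ => D) ≤ 1 / Real.sqrt T := by
  have hT' : (0 : ℝ) < T := by exact_mod_cast hT
  have hmeas : Measurable fun s : ℕ → X => |freq A T s - D.real A| :=
    ((measurable_freq hA T).sub_const _).abs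
  have hb : ∀ s : ℕ → X, |freq A T s - D.real A| ≤ 1 := fun s => by
    have h1 := freq_nonneg A T s
    have h2 := freq_le_one A T s
    have h3 : 0 ≤ D.real A := measureReal_nonneg
    have h4 : D.real A ≤ 1 := measureReal_le_one
    rw [abs_le]; constructor <;> linarith
  have h1 : (∫ s, |freq A T s - D.real A| ∂(Measure.infinitePi fun _ : ℕ => D)) ^ 2 ≤ 1 / T := by
    have hsq := integral_sq_hitCount_sub_le D hA (Finset.range T)
    rw [Finset.card_range] at hsq
    have h2 : ∫ s, |freq A T s - D.real A| ^ 2 ∂(Measure.infinitePi fun _ : ℕ => D) =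
        (∫ s, ((hitCount A (Finset.range T) s : ℝ) - T * D.real A) ^ 2
          ∂(Measure.infinitePi fun _ : ℕ => D)) / T ^ 2 := by
      rw [← integral_div]
      refine integral_congr_ae (Filter.Eventually.of_forall fun s => ?_)
      simp only [sq_abs, freq]
      field_simp
    have h3 := sq_integral_le (μ := Measure.infinitePi fun _ : ℕ => D) hmeas
      (b := 1) (fun s => by rw [abs_abs]; exact hb s)
    refine h3.trans (h2.le.trans ?_)
    rw [div_le_div_iff₀ (by positivity) hT']
    nlinarith
  rw [le_div_iff₀ (Real.sqrt_pos.2 hT')]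
  have h0 : 0 ≤ ∫ s, |freq A T s - D.real A| ∂(Measure.infinitePi fun _ : ℕ => D) :=
    integral_nonneg fun _ => abs_nonneg _
  refine abs_le_of_sq_le_sq' ?_ zero_le_one |>.2
  rw [mul_pow, Real.sq_sqrt hT'.le]
  rw [le_div_iff₀ hT'] at h1
  linarith

/-- The empirical frequency is close to the probability. -/
theorem prob_freq_sub_le (D : Measure X) [IsProbabilityMeasure D] {A : Set X}
    (hA : MeasurableSet A) {T : ℕ} (hT : 0 < T) {ε : ℝ} (hε : 0 ≤ ε) (hε1 : ε ≤ 1) :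
    (Measure.infinitePi fun _ : ℕ => D).real {s | ε < |freq A T s - D.real A|} ≤
      2 * Real.exp (-(T * ε ^ 2 / 4)) := by
  have hT' : (0 : ℝ) < T := by exact_mod_cast hT
  have hcard : ((Finset.range T).card : ℝ) * D.real A ≤ T := by
    rw [Finset.card_range]
    exact mul_le_of_le_one_right hT'.le measureReal_le_one
  have h1 := prob_add_le_hitCount_of_le D hA (Finset.range T) (m := T * D.real A) (B := T)
    (t := T * ε) (by rw [Finset.card_range]) (by simpa using hcard) (by positivity) (by nlinarith)
  have h2 := prob_hitCount_le_mean_sub D hA (Finset.range T) hT' hcard (t := T * ε) (by positivity)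
  have hsub : {s : ℕ → X | ε < |freq A T s - D.real A|} ⊆
      {s | T * D.real A + T * ε ≤ hitCount A (Finset.range T) s} ∪
      {s | (hitCount A (Finset.range T) s : ℝ) ≤
        (Finset.range T).card * D.real A - T * ε} := by
    intro s hs
    have hs : ε < |freq A T s - D.real A| := hs
    have hf : (hitCount A (Finset.range T) s : ℝ) = T * freq A T s := by
      rw [freq]; field_simp
    rcases lt_abs.1 hs with h | h
    · left
      simp only [Set.mem_ofPred_eq, hf]
      nlinarith
    · right
      simp only [Set.mem_ofPred_eq, hf, Finset.card_range]
      nlinarith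
  refine (measureReal_mono hsub (measure_ne_top _ _)).trans ((measureReal_union_le _ _).trans ?_)
  have e1 : (T * ε) ^ 2 / (4 * T) = T * ε ^ 2 / 4 := by field_simp
  have e2 : T * ε ^ 2 / 4 ≤ (T * ε) ^ 2 / (2 * T) := by
    rw [show (T * ε) ^ 2 / (2 * T) = T * ε ^ 2 / 2 by field_simp]
    have : 0 ≤ T * ε ^ 2 := by positivity
    linarith
  rw [e1] at h1
  have h3 := h2.trans (Real.exp_le_exp.2 (neg_le_neg e2))
  linarith

/-- The stopping decision, on a fresh sample and with a fresh offset, is likely to be the same as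
for the reference value `z`. -/
theorem prob_decision_ne_le (D : Measure X) [IsProbabilityMeasure D] {A : Set X}
    (hA : MeasurableSet A) {T : ℕ} (hT : 0 < T) {ε α : ℝ} (hε : 0 < ε) (hε1 : ε ≤ 1) (hα0 : 0 < α)
    (hα : α ≤ 0.54 * ε) (z : ℝ) (r : ℕ) :
    ((streamsLaw D).prod (Measure.infinitePi fun _ : ℕ => (volume : Measure unitInterval))).real
      {p | ¬ (cellMid α (freq A T (p.1 r)) (p.2 r) < ε / 2 ↔
        cellMid α (clip ε z) (p.2 r) < ε / 2)} ≤
      (1 / Real.sqrt T + |clip ε (D.real A) - clip ε z|) / α := by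
  set μ := streamsLaw D
  set ν := Measure.infinitePi fun _ : ℕ => (volume : Measure unitInterval)
  have hfreq : Measurable fun S : ℕ → ℕ → X => freq A T (S r) :=
    (measurable_freq hA T).comp (measurable_pi_apply r)
  have hm1 : Measurable fun p : (ℕ → ℕ → X) × (ℕ → unitInterval) =>
      cellMid α (freq A T (p.1 r)) (p.2 r) := (measurable_cellMid α).comp
    ((hfreq.comp measurable_fst).prodMk ((measurable_pi_apply r).comp measurable_snd))
  have hm2 : Measurable fun p : (ℕ → ℕ → X) × (ℕ → unitInterval) =>
      cellMid α (clip ε z) (p.2 r) := (measurable_cellMid α).comp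
    (measurable_const.prodMk ((measurable_pi_apply r).comp measurable_snd))
  have hE : MeasurableSet {p : (ℕ → ℕ → X) × (ℕ → unitInterval) |
      ¬ (cellMid α (freq A T (p.1 r)) (p.2 r) < ε / 2 ↔ cellMid α (clip ε z) (p.2 r) < ε / 2)} :=
    ((measurableSet_lt hm1 measurable_const).iff (measurableSet_lt hm2 measurable_const)).compl
  -- For a fixed sample only the offset is random, and the decisions differ with probability at most
  -- the distance of the truncated values over `α`. Integrating over the sample leaves the mean
  -- absolute deviation of the frequency.
  have hfib : ∀ S : ℕ → ℕ → X, ν.real (Prod.mk S ⁻¹' {p : (ℕ → ℕ → X) × (ℕ → unitInterval) |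
      ¬ (cellMid α (freq A T (p.1 r)) (p.2 r) < ε / 2 ↔ cellMid α (clip ε z) (p.2 r) < ε / 2)}) ≤
      (|freq A T (S r) - D.real A| + |clip ε (D.real A) - clip ε z|) / α := fun S => by
    have hev : MeasurePreserving (fun u : ℕ → unitInterval => u r) ν volume :=
      measurePreserving_eval_infinitePi _ r
    have hsub : Prod.mk S ⁻¹' {p : (ℕ → ℕ → X) × (ℕ → unitInterval) |
        ¬ (cellMid α (freq A T (p.1 r)) (p.2 r) < ε / 2 ↔
          cellMid α (clip ε z) (p.2 r) < ε / 2)} =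
        (fun u : ℕ → unitInterval => u r) ⁻¹' {u | ¬ (cellMid α (clip ε (freq A T (S r))) u < ε / 2 ↔
          cellMid α (clip ε z) u < ε / 2)} := by
      ext u
      simp only [Set.mem_preimage, Set.mem_ofPred_eq,
        cellMid_clip_lt_iff hε hε1 hα0 hα (freq_nonneg A T (S r)) (freq_le_one A T (S r))]
    have hmB : MeasurableSet {u | ¬ (cellMid α (clip ε (freq A T (S r))) u < ε / 2 ↔
          cellMid α (clip ε z) u < ε / 2)} :=
      ((measurableSet_lt ((measurable_cellMid α).comp (measurable_const.prodMk measurable_id))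
        measurable_const).iff (measurableSet_lt ((measurable_cellMid α).comp
          (measurable_const.prodMk measurable_id)) measurable_const)).compl
    rw [hsub, measureReal_def, hev.measure_preimage hmB.nullMeasurableSet, ← measureReal_def]
    refine (volume_decision_ne_le hα0 _ _).trans ?_
    gcongr
    exact (abs_sub_le _ (clip ε (D.real A)) _).trans
      (add_le_add (abs_clip_sub_clip_le _ _ _) le_rfl)
  have hint : Integrable (fun S : ℕ → ℕ → X =>
      (|freq A T (S r) - D.real A| + |clip ε (D.real A) - clip ε z|) / α) μ := by
    refine Integrable.div_const (Integrable.add ?_ (integrable_const _)) _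
    refine integrable_of_bounded ((hfreq.sub_const _).abs) (b := 1) fun S => ?_
    have h1 := freq_nonneg A T (S r)
    have h2 := freq_le_one A T (S r)
    have h3 : 0 ≤ D.real A := measureReal_nonneg
    have h4 : D.real A ≤ 1 := measureReal_le_one
    rw [abs_abs, abs_le]; constructor <;> linarith
  rw [measureReal_def, Measure.prod_apply hE]
  have hle : ∫⁻ S, ν (Prod.mk S ⁻¹' {p : (ℕ → ℕ → X) × (ℕ → unitInterval) |
      ¬ (cellMid α (freq A T (p.1 r)) (p.2 r) < ε / 2 ↔ cellMid α (clip ε z) (p.2 r) < ε / 2)}) ∂μ ≤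
      ENNReal.ofReal (∫ S : ℕ → ℕ → X,
        (|freq A T (S r) - D.real A| + |clip ε (D.real A) - clip ε z|) / α ∂μ) := by
    rw [ofReal_integral_eq_lintegral_ofReal hint
      (Filter.Eventually.of_forall fun _ => by positivity)]
    refine lintegral_mono fun S => ?_
    rw [← ENNReal.ofReal_toReal (measure_ne_top ν _)]
    exact ENNReal.ofReal_le_ofReal (hfib S)
  refine (ENNReal.toReal_le_of_le_ofReal (integral_nonneg fun _ => by positivity) hle).trans ?_
  rw [integral_div]
  gcongr
  have hint1 : Integrable (fun S : ℕ → ℕ → X => |freq A T (S r) - D.real A|) μ := by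
    refine integrable_of_bounded ((hfreq.sub_const _).abs) (b := 1) fun S => ?_
    have h1 := freq_nonneg A T (S r)
    have h2 := freq_le_one A T (S r)
    have h3 : 0 ≤ D.real A := measureReal_nonneg
    have h4 : D.real A ≤ 1 := measureReal_le_one
    rw [abs_abs, abs_le]; constructor <;> linarith
  rw [integral_add hint1 (integrable_const _)]
  simp only [integral_const, probReal_univ, one_smul]
  gcongr
  have hev : MeasurePreserving (fun S : ℕ → ℕ → X => S r) μ
      (Measure.infinitePi fun _ : ℕ => D) := measurePreserving_eval_infinitePi _ r
  refine le_trans (le_of_eq ?_) (integral_abs_freq_sub_le D hA hT)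
  rw [← hev.map_eq, integral_map hev.measurable.aemeasurable
    (((measurable_freq hA T).sub_const _).abs).aestronglyMeasurable]

end EmpiricalMean

/-! ### The internal randomness, disintegrated along the number of admitted errors -/

/-- The law of the offsets of the calls of `rSTAT`. -/
def offsetLaw : Measure (ℕ → unitInterval) :=
  Measure.infinitePi fun _ : ℕ => (volume : Measure unitInterval)

instance : IsProbabilityMeasure offsetLaw := by unfold offsetLaw; infer_instance

section Coins

variable {X : Type*} (P : Params) (C : Finset (X → Bool))

/-- The law of the coins that determine the threshold. -/
def thresholdCoinLaw : Measure (Fin (P.g + 1) × unitInterval) :=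
  (PMF.uniformOfFintype (Fin (P.g + 1))).toMeasure.prod volume

instance : IsProbabilityMeasure (thresholdCoinLaw P) := by
  unfold thresholdCoinLaw; infer_instance

instance : IsProbabilityMeasure (coinLaw P C) := by unfold coinLaw; infer_instance

/-- The threshold, as a function of the coins that determine it. -/
def thresholdOf (y : Fin (P.g + 1) × unitInterval) : ℝ :=
  (y.2 : ℝ) * (1 / (4 * P.Θ)) + (2 * ((y.1 : ℕ) : ℝ) + 3) / 2 * P.τ

/-- The number of admitted errors per round. -/
def admitted (y : Fin (P.g + 1) × unitInterval) : ℕ := ⌊thresholdOf P y * P.k⌋₊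

variable {P C}

theorem thresholdOf_nonneg (hΘ : 0 < P.Θ) (y : Fin (P.g + 1) × unitInterval) :
    0 ≤ thresholdOf P y := by
  have := y.2.2.1
  unfold thresholdOf Params.τ
  positivity

theorem thresholdOf_le (hΘ : 0 < P.Θ) (y : Fin (P.g + 1) × unitInterval) :
    thresholdOf P y ≤ 3 / 8 / P.Θ := by
  have h1 := y.2.2.2
  have h2 : ((y.1 : ℕ) : ℝ) ≤ P.g := by exact_mod_cast Nat.lt_succ_iff.1 y.1.2
  have h3 : (0 : ℝ) < (P.g + 2 : ℕ) := by positivity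
  have h4 : (2 * ((y.1 : ℕ) : ℝ) + 3) / 2 * P.τ ≤ 1 / (8 * P.Θ) := by
    rw [Params.τ, mul_one_div, div_le_div_iff₀ (by positivity) (by positivity)]
    push_cast
    nlinarith
  have h5 : (y.2 : ℝ) * (1 / (4 * P.Θ)) ≤ 1 / (4 * P.Θ) :=
    mul_le_of_le_one_left (by positivity) h1
  refine (add_le_add h5 h4).trans (le_of_eq ?_)
  field_simp
  norm_num

theorem admitted_le (hΘ : 0 < P.Θ) (y : Fin (P.g + 1) × unitInterval) :
    (admitted P y : ℝ) ≤ 3 / 8 * (P.k / P.Θ) := by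
  refine (Nat.floor_le (mul_nonneg (thresholdOf_nonneg hΘ y) (Nat.cast_nonneg _))).trans ?_
  refine (mul_le_mul_of_nonneg_right (thresholdOf_le hΘ y) (Nat.cast_nonneg _)).trans
    (le_of_eq ?_)
  ring

theorem volume_unitInterval_Icc_le (a b : ℝ) :
    (volume : Measure unitInterval).real {u | a ≤ u ∧ (u : ℝ) ≤ b} ≤ max (b - a) 0 := by
  have h1 := unitInterval.volume_apply (s := {u : unitInterval | a ≤ u ∧ (u : ℝ) ≤ b})
  rw [measureReal_def]
  refine ENNReal.toReal_le_of_le_ofReal (le_max_right _ _) ?_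
  rw [h1]
  calc volume (Subtype.val '' {u : unitInterval | a ≤ u ∧ (u : ℝ) ≤ b} : Set ℝ)
      ≤ volume (Set.Icc a b) := measure_mono (by rintro _ ⟨u, hu, rfl⟩; exact hu)
    _ = ENNReal.ofReal (b - a) := Real.volume_Icc
    _ ≤ _ := ENNReal.ofReal_le_ofReal (le_max_left _ _)

/-- No number of admitted errors is likely. -/
theorem prob_admitted_eq_le (hΘ : 0 < P.Θ) (hk : 0 < P.k) (n : ℕ) :
    (thresholdCoinLaw P).real {y | admitted P y = n} ≤ 4 / (P.k / P.Θ) := by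
  have hk' : (0 : ℝ) < P.k := by exact_mod_cast hk
  have h1 := prob_prod_fresh_le (PMF.uniformOfFintype (Fin (P.g + 1))).toMeasure
    (volume : Measure unitInterval) Finset.univ id
    (fun i => {u | admitted P (i, u) = n}) (η := 4 / (P.k / P.Θ)) (by positivity)
    (fun i _ => MeasurableSpace.measurableSet_top) fun i _ => ?_
  · refine le_trans (measureReal_mono fun y hy => ?_) h1
    exact ⟨Finset.mem_univ _, hy⟩
  -- For every grid index the positions `u` leading to `n` lie in an interval of length `4Θ / k`:
  -- the uniform start value alone already spreads `n`.
  · set d := (2 * ((i : ℕ) : ℝ) + 3) / 2 * P.τ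
    have hsub : {u : unitInterval | admitted P (i, u) = n} ⊆
        {u | (n / P.k - d) * (4 * P.Θ) ≤ u ∧ (u : ℝ) ≤ ((n + 1) / P.k - d) * (4 * P.Θ)} := by
      intro u hu
      have hu : ⌊thresholdOf P (i, u) * P.k⌋₊ = n := hu
      have h0 : 0 ≤ thresholdOf P (i, u) * P.k :=
        mul_nonneg (thresholdOf_nonneg hΘ _) (Nat.cast_nonneg _)
      rw [Nat.floor_eq_iff h0] at hu
      have hv : thresholdOf P (i, u) = u * (1 / (4 * P.Θ)) + d := rfl
      have e1 : (n : ℝ) / P.k ≤ thresholdOf P (i, u) := by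
        rw [div_le_iff₀ hk']; exact hu.1
      have e2 : thresholdOf P (i, u) ≤ (n + 1) / P.k := by
        rw [le_div_iff₀ hk']; exact hu.2.le
      have e3 : (u : ℝ) = (thresholdOf P (i, u) - d) * (4 * P.Θ) := by
        rw [hv]; field_simp; ring
      constructor
      · rw [e3]; gcongr
      · rw [e3]; gcongr
    refine (measureReal_mono hsub).trans ((volume_unitInterval_Icc_le _ _).trans ?_)
    rw [max_eq_left]
    · refine le_of_eq ?_; field_simp; ring
    · rw [sub_nonneg]; gcongr; linarith

/-- The threshold coins, separated from the samples and the other coins. -/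
theorem measurePreserving_separate {Ω : Type*} [MeasurableSpace Ω] (μ : Measure Ω)
    [IsProbabilityMeasure μ] :
    MeasurePreserving (fun p : Ω × Coins P C => ((p.2.2.1, p.2.1), (p.1, p.2.2.2)))
      (μ.prod (coinLaw P C))
      ((thresholdCoinLaw P).prod (μ.prod (offsetLaw.prod (orderingLaw C)))) := by
  set π₁ : Measure unitInterval := volume
  set π₂ := (PMF.uniformOfFintype (Fin (P.g + 1))).toMeasure
  set π₃ := offsetLaw.prod (orderingLaw C)
  have s1 : MeasurePreserving (fun p : Ω × (unitInterval × Fin (P.g + 1) × ((ℕ → unitInterval) ×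
      Ordering C)) => (p.1, ((p.2.1, p.2.2.1), p.2.2.2))) (μ.prod (π₁.prod (π₂.prod π₃)))
      (μ.prod ((π₁.prod π₂).prod π₃)) :=
    (MeasurePreserving.id μ).prod (measurePreserving_prodAssoc π₁ π₂ π₃).symm
  have s2 : MeasurePreserving (fun p : Ω × ((unitInterval × Fin (P.g + 1)) × ((ℕ → unitInterval) ×
      Ordering C)) => ((p.1, p.2.1), p.2.2)) (μ.prod ((π₁.prod π₂).prod π₃))
      ((μ.prod (π₁.prod π₂)).prod π₃) :=
    (measurePreserving_prodAssoc μ (π₁.prod π₂) π₃).symm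
  have s3 : MeasurePreserving (fun p : (Ω × (unitInterval × Fin (P.g + 1))) × ((ℕ → unitInterval) ×
      Ordering C) => (((p.1.2.2, p.1.2.1), p.1.1), p.2)) ((μ.prod (π₁.prod π₂)).prod π₃)
      (((π₂.prod π₁).prod μ).prod π₃) :=
    (((Measure.measurePreserving_swap (μ := π₁) (ν := π₂)).prod (MeasurePreserving.id μ)).comp
      (Measure.measurePreserving_swap (μ := μ) (ν := π₁.prod π₂))).prod (MeasurePreserving.id π₃)
  have s4 := measurePreserving_prodAssoc (π₂.prod π₁) μ π₃
  exact s4.comp (s3.comp (s2.comp s1))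

/-- Bound for the probability of an event that depends on the threshold only through the number of
admitted errors. -/
theorem prob_coins_le {Ω : Type*} [MeasurableSpace Ω] (μ : Measure Ω) [IsProbabilityMeasure μ]
    (E : ℕ → Set (Ω × ((ℕ → unitInterval) × Ordering C))) {M : ℕ}
    (hM : ∀ y, admitted P y < M) :
    (μ.prod (coinLaw P C)).real {p | (p.1, p.2.2.2) ∈ E (admitted P (p.2.2.1, p.2.1))} ≤
      ∑ n ∈ Finset.range M, (thresholdCoinLaw P).real {y | admitted P y = n} *
        (μ.prod (offsetLaw.prod (orderingLaw C))).real (E n) := by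
  have h1 := measurePreserving_separate (P := P) (C := C) μ
  have hset : {p : Ω × Coins P C | (p.1, p.2.2.2) ∈ E (admitted P (p.2.2.1, p.2.1))} ⊆
      (fun p : Ω × Coins P C => ((p.2.2.1, p.2.1), (p.1, p.2.2.2))) ⁻¹'
        ⋃ n ∈ Finset.range M, {y | admitted P y = n} ×ˢ E n := by
    intro p hp
    simp only [Set.mem_preimage, Set.mem_iUnion, exists_prop, Finset.mem_range]
    exact ⟨_, hM _, rfl, hp⟩
  refine (measureReal_mono hset).trans ?_
  refine le_trans (ENNReal.toReal_mono (measure_ne_top _ _) (h1.measure_preimage_le _)) ?_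
  refine (measureReal_biUnion_finset_le _ _).trans (Finset.sum_le_sum fun n _ => ?_)
  rw [measureReal_prod_prod]

theorem measurableSet_admitted_eq (n : ℕ) :
    MeasurableSet {y : Fin (P.g + 1) × unitInterval | admitted P y = n} := by
  have h1 : Measurable fun y : Fin (P.g + 1) × unitInterval => thresholdOf P y * P.k := by
    unfold thresholdOf
    refine Measurable.mul_const (((measurable_subtype_coe.comp measurable_snd).mul_const _).add ?_) _
    exact (measurable_from_top (f := fun i : Fin (P.g + 1) =>
      (2 * ((i : ℕ) : ℝ) + 3) / 2 * P.τ)).comp measurable_fst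
  exact (Nat.measurable_floor.comp h1) (MeasurableSpace.measurableSet_top : MeasurableSet {n})

theorem sum_prob_admitted_le (M : ℕ) :
    ∑ n ∈ Finset.range M, (thresholdCoinLaw P).real {y | admitted P y = n} ≤ 1 := by
  rw [← measureReal_biUnion_finset _ fun n _ => measurableSet_admitted_eq n]
  · exact measureReal_le_one
  · intro a _ b _ hab
    exact Set.disjoint_left.2 fun y (ha : _ = a) (hb : _ = b) => hab (ha.symm.trans hb)

theorem prob_coins_le_of_forall {Ω : Type*} [MeasurableSpace Ω] (μ : Measure Ω)
    [IsProbabilityMeasure μ] (E : ℕ → Set (Ω × ((ℕ → unitInterval) × Ordering C)))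
    {M : ℕ} (hM : ∀ y, admitted P y < M) {η : ℝ} (hη : 0 ≤ η)
    (hE : ∀ n < M, (μ.prod (offsetLaw.prod (orderingLaw C))).real (E n) ≤ η) :
    (μ.prod (coinLaw P C)).real {p | (p.1, p.2.2.2) ∈ E (admitted P (p.2.2.1, p.2.1))} ≤ η := by
  refine (prob_coins_le μ E hM).trans ?_
  calc _ ≤ ∑ n ∈ Finset.range M, (thresholdCoinLaw P).real {y | admitted P y = n} * η :=
        Finset.sum_le_sum fun n hn =>
          mul_le_mul_of_nonneg_left (hE n (Finset.mem_range.1 hn)) measureReal_nonneg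
    _ = (∑ n ∈ Finset.range M, (thresholdCoinLaw P).real {y | admitted P y = n}) * η := by
        rw [Finset.sum_mul]
    _ ≤ η := mul_le_of_le_one_left hη (sum_prob_admitted_le M)

end Coins

theorem measureReal_prod_preimage_fst_le {α β : Type*} [MeasurableSpace α] [MeasurableSpace β]
    (μ : Measure α) (ν : Measure β) [IsProbabilityMeasure μ] [IsProbabilityMeasure ν] (s : Set α) :
    (μ.prod ν).real {p | p.1 ∈ s} ≤ μ.real s :=
  ENNReal.toReal_mono (measure_ne_top _ _)
    ((measurePreserving_fst (μ := μ) (ν := ν)).measure_preimage_le s)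

/-! ### A run in terms of `vspace`, `freq` and `cellMid` -/

section Runs

variable {X : Type*} {P : Params} {C : Finset (X → Bool)} {c : X → Bool}

/-- The width of the regions in the calls of `rSTAT`. -/
def Params.width (P : Params) : ℝ := rSTATWidth (P.ρ / (2 * P.N)) (P.ε / 4) (P.δ / (2 * P.N))

theorem massEstimate_eq (S : Sample X) (b : Coins P C) (V : Finset (X → Bool)) (r : ℕ) :
    massEstimate P S b V r = cellMid P.width (freq (DIS V) P.T (S.2 r)) (b.2.2.1 r) := by
  rw [massEstimate, rSTAT_eq, freq_eq (DIS V) P.T (S.2 r)]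
  rfl

theorem versionSpace_threshold (hΘ : 0 < P.Θ) (hk : 0 < P.k) (S : Sample X) (b : Coins P C)
    (r : ℕ) : versionSpace P C c S (threshold P b) r =
      vspace P.k C c (admitted P (b.2.1, b.1)) r S.1 := by
  have h := versionSpace_eq (C := C) (c := c) P hk (thresholdOf_nonneg hΘ (b.2.1, b.1)) S r
  exact h

theorem stopsAt_iff (hΘ : 0 < P.Θ) (hk : 0 < P.k) (S : Sample X) (b : Coins P C) (r : ℕ) :
    StopsAt P C c S b r ↔
      cellMid P.width (freq (DIS (vspace P.k C c (admitted P (b.2.1, b.1)) r S.1)) P.T (S.2 r))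
        (b.2.2.1 r) < P.ε / 2 := by
  rw [StopsAt, massEstimate_eq, versionSpace_threshold hΘ hk]

open Classical in
theorem repliCAL_of_stop {S : Sample X} {b : Coins P C} {R : ℕ} (hR : StopsAt P C c S b R)
    (hlt : ∀ r < R, ¬ StopsAt P C c S b r) :
    repliCAL P C c S b =
      { hypothesis := firstIn b.2.2.2 (versionSpace P C c S (threshold P b) R)
        labels := P.k * R
        examples := (∑ r ∈ Finset.range R, pointsRead P.k (S.1 r)
          (versionSpace P C c S (threshold P b) r)) + (R + 1) * P.T } := by
  have hex : ∃ r, StopsAt P C c S b r := ⟨R, hR⟩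
  have hfind : Nat.find hex = R := (Nat.find_eq_iff hex).2 ⟨hR, hlt⟩
  rw [repliCAL, dif_pos hex]
  simp only [hfind]

theorem pointsRead_le {k m : ℕ} {s : ℕ → X} {V : Finset (X → Bool)}
    (h : k ≤ hitCount (DIS V) (Finset.range m) s) : pointsRead k s V ≤ m := by
  classical
  rw [← count_eq_hitCount] at h
  rw [pointsRead]
  refine iInf₂_le m ?_
  convert h

theorem coe_examples_le {N : ℕ} {R T m : ℕ} (hR : R < N) {f : ℕ → ℕ∞} (hf : ∀ r < R, f r ≤ m) :
    (∑ r ∈ Finset.range R, f r) + (R + 1) * T ≤ ((N * (m + T) : ℕ) : ℕ∞) := by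
  have h1 : ∑ r ∈ Finset.range R, f r ≤ ((R * m : ℕ) : ℕ∞) := by
    refine (Finset.sum_le_card_nsmul _ _ (m : ℕ∞) fun r hr => hf r (Finset.mem_range.1 hr)).trans ?_
    simp
  have h2 : ((R : ℕ∞) + 1) * T = (((R + 1) * T : ℕ) : ℕ∞) := by push_cast; rfl
  rw [h2]
  refine (add_le_add_left h1 _).trans ?_
  rw [← Nat.cast_add]
  refine Nat.cast_le.2 ?_
  calc R * m + (R + 1) * T ≤ N * m + N * T :=
        Nat.add_le_add (Nat.mul_le_mul_right _ hR.le) (Nat.mul_le_mul_right _ hR)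
    _ = _ := by ring

theorem coe_le_ofReal_of_le {x : ℕ∞} {m : ℕ} (h : x ≤ m) {q : ℝ} (hq : (m : ℝ) ≤ q) :
    (x : ℝ≥0∞) ≤ ENNReal.ofReal q := by
  calc (x : ℝ≥0∞) ≤ ((m : ℕ∞) : ℝ≥0∞) := by exact_mod_cast h
    _ = ENNReal.ofReal m := by simp
    _ ≤ _ := ENNReal.ofReal_le_ofReal hq

end Runs

/-! ### The learning guarantee -/

section PAC

variable {X : Type*} [MeasurableSpace X] {D : Measure X} [IsProbabilityMeasure D] {P : Params}
  {C : Finset (X → Bool)} {c : X → Bool}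

theorem dist_le_mass {V : Finset (X → Bool)} {h : X → Bool} (hh : h ∈ V) :
    dist D h c ≤ mass D c V := measureReal_mono fun _ hx => ⟨h, hh, hx⟩

/-- The event that the empirical means, or the numbers of points found, are atypical. -/
def pacBad (P : Params) (D : Measure X) (C : Finset (X → Bool)) (c : X → Bool) (n : ℕ) :
    Set (Sample X) :=
  {S | S.1 ∈ someHalvingBad D C c P.k n P.N (P.ε / 8)} ∪
    ({S | S.1 ∈ ⋃ r ∈ Finset.range P.N, {S' : ℕ → ℕ → X |
      P.ε / 8 ≤ mass D c (vspace P.k C c n r S') ∧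
        S' r ∈ {s | hitCount (DIS (vspace P.k C c n r S')) (Finset.range ⌈16 * P.k / P.ε⌉₊) s
          < P.k}}} ∪
    ⋃ r ∈ Finset.range P.N, {S | P.ε / 10 <
      |freq (DIS (vspace P.k C c n r S.1)) P.T (S.2 r) - mass D c (vspace P.k C c n r S.1)|})

theorem prob_freq_vspace_le (hC : ∀ h ∈ C, Measurable h) (hc : c ∈ C) {k n r T : ℕ} (hT : 0 < T)
    {ε : ℝ} (hε : 0 ≤ ε) (hε1 : ε ≤ 1) :
    ((streamsLaw D).prod (streamsLaw D)).real {S : Sample X | ε <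
      |freq (DIS (vspace k C c n r S.1)) T (S.2 r) - mass D c (vspace k C c n r S.1)|} ≤
      2 * Real.exp (-(T * ε ^ 2 / 4)) := by
  classical
  have h1 := prob_prod_fresh_le (streamsLaw D) (streamsLaw D)
    (C.powerset.filter fun V => c ∈ V) (vspace k C c n r)
    (fun V => {S | ε < |freq (DIS V) T (S r) - mass D c V|})
    (η := 2 * Real.exp (-(T * ε ^ 2 / 4))) (by positivity)
    (fun V _ => measurableSet_vspace_eq hC hc r V) fun V hV => ?_
  · refine le_trans (measureReal_mono fun S hS => ?_) h1
    exact ⟨Finset.mem_filter.2 ⟨Finset.mem_powerset.2 (vspace_subset r S.1),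
      self_mem_vspace hc r S.1⟩, hS⟩
  · obtain ⟨hVC, hcV⟩ := Finset.mem_filter.1 hV
    have hD := measurableSet_DIS hC (Finset.mem_powerset.1 hVC)
    have hev : MeasurePreserving (fun S : ℕ → ℕ → X => S r) (streamsLaw D)
      (Measure.infinitePi fun _ : ℕ => D) := measurePreserving_eval_infinitePi _ r
    have h2 := prob_freq_sub_le D hD hT hε hε1
    rw [real_DIS hcV] at h2
    refine le_trans (ENNReal.toReal_mono (measure_ne_top _ _) (hev.measure_preimage_le
      {s | ε < |freq (DIS V) T s - mass D c V|})) h2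

theorem prob_pacBad_le (hC : ∀ h ∈ C, Measurable h) (hc : c ∈ C)
    (hΘ : 1 ≤ disagreementCoeff D C c) {n : ℕ}
    (hn : (n : ℝ) ≤ 3 / 8 * (P.k / disagreementCoeff D C c))
    (hk : 100 ≤ P.k / disagreementCoeff D C c) (hε : 0 < P.ε ∧ P.ε ≤ 1 / 2) (hT : 0 < P.T) :
    (sampleLaw D).real (pacBad P D C c n) ≤
      P.N * (2 * C.card * Real.exp (-(P.k / disagreementCoeff D C c / 1600))) +
        (P.N * Real.exp (-(P.k / 4)) + P.N * (2 * Real.exp (-(P.T * (P.ε / 10) ^ 2 / 4)))) := by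
  have hε8 : 0 < P.ε / 8 := by linarith [hε.1]
  refine (measureReal_union_le _ _).trans (add_le_add ?_ ((measureReal_union_le _ _).trans
    (add_le_add ?_ ?_)))
  · exact (measureReal_prod_preimage_fst_le _ _ _).trans
      (prob_someHalvingBad_le hC hc hΘ hn hk _ hε8)
  · refine (measureReal_prod_preimage_fst_le (streamsLaw D) (streamsLaw D) _).trans ?_
    refine (measureReal_biUnion_finset_le _ _).trans ?_
    refine (Finset.sum_le_card_nsmul _ _ _ fun r _ => ?_).trans
      (by rw [Finset.card_range, nsmul_eq_mul])
    refine prob_vspace_fresh_le D hC hc r (fun V => P.ε / 8 ≤ mass D c V)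
      (fun V => {s | hitCount (DIS V) (Finset.range ⌈16 * P.k / P.ε⌉₊) s < P.k})
      (Real.exp_nonneg _) fun V hV hcV hm => ⟨measurableSet_lt (measurable_hitCount
        (measurableSet_DIS hC hV) _) measurable_const, ?_⟩
    have h1 := prob_hitCount_lt (D := D) (k := P.k) (R := ⌈16 * P.k / P.ε⌉₊)
      (measurableSet_DIS hC hV) zero_le_one le_rfl ?_
    · simpa using h1
    · rw [real_DIS hcV]
      -- Of `16 k / ε` points, at least `2 k` are expected in a region of mass `ε/8`, which is twice
      -- the number needed.
      calc ((1 : ℝ) + 1) * P.k = 16 * P.k / P.ε * (P.ε / 8) := by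
            have := hε.1; field_simp; norm_num; ring
        _ ≤ _ := mul_le_mul (Nat.le_ceil _) hm hε8.le (Nat.cast_nonneg _)
  · refine (measureReal_biUnion_finset_le _ _).trans ?_
    refine (Finset.sum_le_card_nsmul _ _ _ fun r _ => ?_).trans
      (by rw [Finset.card_range, nsmul_eq_mul])
    exact prob_freq_vspace_le hC hc hT (by linarith [hε.1]) (by linarith [hε.2])

/-- Off an unlikely event, the run is successful. -/
theorem run_success (hc : c ∈ C) (hPΘ : P.Θ = disagreementCoeff D C c)
    (hΘ : 1 ≤ disagreementCoeff D C c) (hk : 0 < P.k) (hε : 0 < P.ε ∧ P.ε ≤ 1 / 2)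
    (hα0 : 0 < P.width) (hα : P.width ≤ 0.54 * P.ε) (hN : 0 < P.N)
    (hpow : (1 / 2 : ℝ) ^ (P.N - 1) ≤ P.ε / 8) {S : Sample X} {b : Coins P C}
    (hS : S ∉ pacBad P D C c (admitted P (b.2.1, b.1))) :
    (∃ h ∈ C, (repliCAL P C c S b).hypothesis = some h ∧ dist D h c < P.ε) ∧
      (repliCAL P C c S b).labels ≤ ((P.k * P.N : ℕ) : ℕ∞) ∧
      (repliCAL P C c S b).examples ≤ ((P.N * (⌈16 * P.k / P.ε⌉₊ + P.T) : ℕ) : ℕ∞) := by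
  classical
  have hΘ0 : 0 < P.Θ := by rw [hPΘ]; linarith
  set n := admitted P (b.2.1, b.1)
  simp only [pacBad, Set.mem_union, not_or, Set.mem_iUnion, Finset.mem_range, not_exists,
    Set.mem_ofPred_eq] at hS
  obtain ⟨hhalf, hcount, hfreq⟩ := hS
  have hfreq' : ∀ r < P.N, |freq (DIS (vspace P.k C c n r S.1)) P.T (S.2 r) -
      mass D c (vspace P.k C c n r S.1)| ≤ P.ε / 10 := fun r hr => not_lt.1 (hfreq r hr)
  -- A mass below `ε/8` gives a frequency of at most `ε/8 + ε/10 = 0.225 ε`, which forces a stop.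
  have hmass : ∀ r < P.N, ¬ StopsAt P C c S b r → P.ε / 8 ≤ mass D c (vspace P.k C c n r S.1) := by
    intro r hr hns
    rw [stopsAt_iff hΘ0 hk] at hns
    by_contra hlt
    refine hns (cellMid_lt_of_le hα0 hα (freq_nonneg _ _ _) (freq_le_one _ _ _) ?_ _)
    have := (abs_le.1 (hfreq' r hr)).2
    linarith
  have hhalt : ∃ r, r < P.N ∧ StopsAt P C c S b r := by
    by_contra hcon
    push Not at hcon
    have h1 := mass_vspace_le_of_notMem hc hΘ (show 0 < P.ε / 8 by linarith [hε.1]) hhalf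
      (show P.N - 1 < P.N by omega)
      fun j hj => hmass j (by omega) (hcon j (by omega))
    refine hcon (P.N - 1) (by omega) ?_
    rw [stopsAt_iff hΘ0 hk]
    refine cellMid_lt_of_le hα0 hα (freq_nonneg _ _ _) (freq_le_one _ _ _) ?_ _
    have := (abs_le.1 (hfreq' (P.N - 1) (by omega))).2
    linarith
  obtain ⟨hRN, hR⟩ := Nat.find_spec hhalt
  set R := Nat.find hhalt
  have hlt : ∀ r < R, ¬ StopsAt P C c S b r := fun r hr h =>
    Nat.find_min hhalt hr ⟨hr.trans hRN, h⟩
  have hV : ∀ r, versionSpace P C c S (threshold P b) r = vspace P.k C c n r S.1 := fun r =>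
    versionSpace_threshold hΘ0 hk S b r
  rw [repliCAL_of_stop hR hlt]
  simp only [hV]
  refine ⟨?_, ?_, ?_⟩
  · obtain ⟨h, hh, hf⟩ := exists_firstIn_eq_some b.2.2.2 (vspace_subset (n := n) (k := P.k) R S.1)
      ⟨c, self_mem_vspace hc R S.1⟩
    refine ⟨h, vspace_subset _ _ hh, hf, (dist_le_mass hh).trans_lt ?_⟩
    rw [stopsAt_iff hΘ0 hk] at hR
    -- Stopping means a frequency below `0.77 ε`, hence a mass below `0.87 ε`.
    have h1 := lt_of_cellMid_lt hα0 hα (freq_nonneg _ _ _) (freq_le_one _ _ _) hR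
    have h2 := (abs_le.1 (hfreq' R hRN)).1
    linarith [hε.1]
  · rw [Nat.cast_mul]
    gcongr
  · refine coe_examples_le hRN fun r hr => pointsRead_le ?_
    by_contra hcon
    exact hcount r (by omega) ⟨hmass r (by omega) (hlt r hr), not_le.1 hcon⟩

theorem isActivePAC_of_bounds (hC : ∀ h ∈ C, Measurable h) (hc : c ∈ C)
    (hPΘ : P.Θ = disagreementCoeff D C c) (hΘ : 1 ≤ disagreementCoeff D C c)
    (hk : 100 ≤ P.k / disagreementCoeff D C c) (hε : 0 < P.ε ∧ P.ε ≤ 1 / 2) (hT : 0 < P.T)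
    (hα0 : 0 < P.width) (hα : P.width ≤ 0.54 * P.ε) (hN : 0 < P.N)
    (hpow : (1 / 2 : ℝ) ^ (P.N - 1) ≤ P.ε / 8)
    (hδ : P.N * (2 * C.card * Real.exp (-(P.k / disagreementCoeff D C c / 1600))) +
        (P.N * Real.exp (-(P.k / 4)) + P.N * (2 * Real.exp (-(P.T * (P.ε / 10) ^ 2 / 4)))) ≤ P.δ)
    {q m : ℝ} (hq : ((P.k * P.N : ℕ) : ℝ) ≤ q)
    (hm : ((P.N * (⌈16 * P.k / P.ε⌉₊ + P.T) : ℕ) : ℝ) ≤ m) :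
    IsActivePAC D C c (sampleLaw D) (coinLaw P C) (repliCAL P C c) P.ε P.δ q m := by
  have : IsProbabilityMeasure (sampleLaw D) :=
    inferInstanceAs (IsProbabilityMeasure ((streamsLaw D).prod (streamsLaw D)))
  have hk0 : 0 < P.k := by
    rcases Nat.eq_zero_or_pos P.k with h | h
    · rw [h] at hk; norm_num at hk
    · exact h
  have hΘ0 : 0 < P.Θ := by rw [hPΘ]; linarith
  have hbad : ((sampleLaw D).prod (coinLaw P C)).real
      {p | p.1 ∈ pacBad P D C c (admitted P (p.2.2.1, p.2.1))} ≤ P.δ := by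
    refine prob_coins_le_of_forall (sampleLaw D) (fun n => {p | p.1 ∈ pacBad P D C c n})
      (M := ⌊3 / 8 * (P.k / P.Θ)⌋₊ + 1) (fun y => Nat.lt_succ_of_le
        (Nat.le_floor (admitted_le hΘ0 y))) (le_trans (by positivity) hδ) fun n hn => ?_
    refine (measureReal_prod_preimage_fst_le _ _ _).trans
      ((prob_pacBad_le hC hc hΘ ?_ hk hε hT).trans hδ)
    rw [← hPΘ]
    exact (Nat.le_floor_iff (by positivity)).1 (Nat.lt_succ_iff.1 hn)
  rw [IsActivePAC]
  refine le_trans (measure_mono (t := {p | p.1 ∈ pacBad P D C c (admitted P (p.2.2.1, p.2.1))})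
    fun p hp => ?_) ?_
  · by_contra hgood
    obtain ⟨h1, h2, h3⟩ := run_success hc hPΘ hΘ hk0 hε hα0 hα hN hpow hgood
    exact hp ⟨h1, coe_le_ofReal_of_le h2 hq, coe_le_ofReal_of_le h3 hm⟩
  · rw [← ENNReal.ofReal_toReal (measure_ne_top ((sampleLaw D).prod (coinLaw P C)) _)]
    exact ENNReal.ofReal_le_ofReal hbad

end PAC

/-! ### The reference run, and replicability for fixed parameters -/

section ReferenceRun

variable {X : Type*} [MeasurableSpace X] {D : Measure X} [IsProbabilityMeasure D] {P : Params}
  {t : Tuning} {C : Finset (X → Bool)} {c : X → Bool}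

/-- The stopping decision for the reference value of the mass. -/
def refStops (P : Params) (t : Tuning) (D : Measure X) [IsProbabilityMeasure D]
    (C : Finset (X → Bool)) (c : X → Bool) (n r : ℕ) (u : ℕ → unitInterval) : Prop :=
  cellMid P.width (clip P.ε (t.lowerMass D C c n r)) (u r) < P.ε / 2

open Classical in
/-- The answer that a run is likely to give, as a function of the internal randomness. -/
def refAnswer (P : Params) (t : Tuning) (D : Measure X) [IsProbabilityMeasure D]
    (C : Finset (X → Bool)) (c : X → Bool) (n : ℕ) (u : ℕ → unitInterval) (σ : Ordering C) :
    Option (X → Bool) :=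
  if h : ∃ r, refStops P t D C c n r u then firstIn σ (t.refSpace D C c n (Nat.find h)) else none

/-- The event that the decision of a round differs from the reference decision. -/
def decisionBad (P : Params) (t : Tuning) (D : Measure X) [IsProbabilityMeasure D]
    (C : Finset (X → Bool)) (c : X → Bool) (n r : ℕ) :
    Set ((ℕ → ℕ → X) × ((ℕ → ℕ → X) × (ℕ → unitInterval))) :=
  {p | (t.lowerMass D C c n r ≤ mass D c (vspace P.k C c n r p.1) ∧
      mass D c (vspace P.k C c n r p.1) ≤ t.upperMass D C c n r) ∧
    p.2 ∈ {p' : (ℕ → ℕ → X) × (ℕ → unitInterval) |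
      ¬ (cellMid P.width (freq (DIS (vspace P.k C c n r p.1)) P.T (p'.1 r)) (p'.2 r) < P.ε / 2 ↔
        cellMid P.width (clip P.ε (t.lowerMass D C c n r)) (p'.2 r) < P.ε / 2)}}

/-- The event that the choice of the hypothesis may differ from the reference choice. -/
def choiceBad (t : Tuning) (D : Measure X) [IsProbabilityMeasure D]
    (C : Finset (X → Bool)) (c : X → Bool) (n r : ℕ) : Set ((ℕ → ℕ → X) × Ordering C) :=
  {p | ∃ h ∈ C, (h ∈ t.upperSpace D C c n r p.1 ∧ h ∉ t.refSpace D C c n r ∨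
      h ∈ t.refSpace D C c n r ∧ h ∉ t.lowerSpace D C c n r p.1) ∧
      IsFirst p.2 (t.refSpace D C c n r) h}

/-- The event that a run may differ from the reference run. -/
def runBad (P : Params) (t : Tuning) (D : Measure X) [IsProbabilityMeasure D]
    (C : Finset (X → Bool)) (c : X → Bool) (n : ℕ) :
    Set (Sample X × ((ℕ → unitInterval) × Ordering C)) :=
  {p | p.1.1 ∈ t.sandwichBad D C c n} ∪
    ((⋃ r ∈ Finset.range t.N, {p | (p.1.1, (p.1.2, p.2.1)) ∈ decisionBad P t D C c n r}) ∪
      ⋃ r ∈ Finset.range t.N, {p | (p.1.1, p.2.2) ∈ choiceBad t D C c n r})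

theorem clip_eq_of_le {ε z : ℝ} (hε : 0 < ε) (hz : z ≤ ε / 8) : clip ε z = ε / 8 := by
  rw [clip, max_eq_right hz, min_eq_left (by linarith)]

/-- Off an unlikely event, the run gives the reference answer. -/
theorem hypothesis_eq_refAnswer (hc : c ∈ C) (ht : t.Valid) (htk : t.k = P.k) (htN : t.N = P.N)
    (htε : t.ε₀ = P.ε / 8) (hBp : t.Bp = t.k / (2 * disagreementCoeff D C c))
    (hPΘ : P.Θ = disagreementCoeff D C c) (hΘ : 1 ≤ disagreementCoeff D C c)
    (hε : 0 < P.ε ∧ P.ε ≤ 1 / 2) (hα0 : 0 < P.width) (hα : P.width ≤ 0.54 * P.ε) (hN : 0 < P.N)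
    (hpow : (1 / 2 : ℝ) ^ (P.N - 1) ≤ P.ε / 8) {S : Sample X} {b : Coins P C}
    (hS : (S, b.2.2) ∉ runBad P t D C c (admitted P (b.2.1, b.1))) :
    ∃ h, (repliCAL P C c S b).hypothesis = some h ∧
      refAnswer P t D C c (admitted P (b.2.1, b.1)) b.2.2.1 b.2.2.2 = some h := by
  classical
  have hΘ0 : 0 < P.Θ := by rw [hPΘ]; linarith
  have hk : 0 < P.k := by
    have := ht.k_pos
    rw [htk] at this
    exact_mod_cast this
  set n := admitted P (b.2.1, b.1)
  set u := b.2.2.1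
  simp only [runBad, Set.mem_union, not_or, Set.mem_iUnion, Finset.mem_range, not_exists,
    Set.mem_ofPred_eq] at hS
  obtain ⟨hsand, hdec, hchoice⟩ := hS
  have hhalf : S.1 ∉ someHalvingBad D C c P.k n P.N (P.ε / 8) := fun h =>
    hsand (Or.inl (by rw [htk, htN, htε]; exact h))
  have hclip1 : ∀ z, clip P.ε z ≤ 1 := fun z => (clip_le _ _).trans (by linarith [hε.2])
  have hclip0 : ∀ z, 0 ≤ clip P.ε z := fun z => by linarith [le_clip hε.1 z, hε.1]
  have hlow : ∀ r, t.lowerMass D C c n r ≤ P.ε / 8 → refStops P t D C c n r u := fun r h => by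
    refine cellMid_lt_of_le hα0 hα (hclip0 _) (hclip1 _) ?_ _
    rw [clip_eq_of_le hε.1 h]; linarith [hε.1]
  -- The sandwich is valid only while the mass of the version space is at least `ε₀ = ε/8`. If the
  -- reference run does not stop at `j`, its mass is above `ε/8`, and by the sandwich so is that of
  -- the version space; thus the sandwich extends to the next round.
  have hmass : ∀ r, r ≤ P.N → (∀ j < r, ¬ refStops P t D C c n j u) →
      ∀ j < r, t.ε₀ ≤ mass D c (vspace t.k C c n j S.1) := by
    intro r
    induction r with
    | zero => intro _ _ j hj; omega
    | succ r ih =>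
      intro hr hns j hj
      have hprev := ih (by omega) fun j hj => hns j (by omega)
      rcases Nat.lt_succ_iff_lt_or_eq.1 hj with hj | rfl
      · exact hprev j hj
      have h1 := (Tuning.mass_vspace_between hc ht hΘ hBp hsand (show j < t.N by omega) hprev).1
      have h2 : P.ε / 8 < t.lowerMass D C c n j := not_le.1 fun hle => hns j (by omega) (hlow j hle)
      rw [htε]
      linarith
  -- If the reference run never stopped, the version space would have been halved `N - 1` times; the
  -- lower mass is at most its mass, hence at most `ε/8`, which forces a stop.
  have hex : ∃ r, r < P.N ∧ refStops P t D C c n r u := by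
    by_contra hcon
    push Not at hcon
    have hm := hmass (P.N - 1) (by omega) fun j hj => hcon j (by omega)
    have h1 := (Tuning.mass_vspace_between hc ht hΘ hBp hsand (show P.N - 1 < t.N by omega) hm).1
    have h2 := mass_vspace_le_of_notMem hc hΘ (show 0 < P.ε / 8 by linarith [hε.1]) hhalf
      (show P.N - 1 < P.N by omega) (by rw [htk, htε] at hm; exact hm)
    rw [htk] at h1
    exact hcon (P.N - 1) (by omega) (hlow _ (by linarith))
  have hex' : ∃ r, refStops P t D C c n r u := ⟨hex.choose, hex.choose_spec.2⟩
  set R := Nat.find hex' with hRdef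
  have hR : refStops P t D C c n R u := Nat.find_spec hex'
  have hRN : R < P.N := (Nat.find_min' hex' hex.choose_spec.2).trans_lt hex.choose_spec.1
  have hlt : ∀ r < R, ¬ refStops P t D C c n r u := fun r hr => Nat.find_min hex' hr
  have hagree : ∀ r ≤ R, (StopsAt P C c S b r ↔ refStops P t D C c n r u) := fun r hr => by
    rw [stopsAt_iff hΘ0 hk]
    have hm := hmass r (by omega) fun j hj => hlt j (by omega)
    have hb := Tuning.mass_vspace_between hc ht hΘ hBp hsand (show r < t.N by omega) hm
    by_contra hne
    refine hdec r (by omega) ⟨?_, hne⟩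
    rw [htk] at hb
    exact hb
  have hVR : versionSpace P C c S (threshold P b) R = vspace P.k C c n R S.1 :=
    versionSpace_threshold hΘ0 hk S b R
  have hrun := repliCAL_of_stop ((hagree R le_rfl).2 hR)
    fun r hr h => hlt r hr ((hagree r hr.le).1 h)
  have hans : refAnswer P t D C c n u b.2.2.2 = firstIn b.2.2.2 (t.refSpace D C c n R) := by
    rw [refAnswer, dif_pos hex']
  have hrefC : t.refSpace D C c n R ⊆ C := Finset.filter_subset _ _
  have hrefc := Tuning.self_mem_refSpace (D := D) hc ht n R
  obtain ⟨h, -, hh⟩ := exists_firstIn_eq_some b.2.2.2 hrefC ⟨c, hrefc⟩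
  refine ⟨h, ?_, hans.trans hh⟩
  rw [hrun, ← hh]
  simp only [hVR]
  by_contra hne
  obtain ⟨g, hgC, hg, hfirst⟩ := exists_isFirst_of_firstIn_ne (vspace_subset R S.1) hrefC
    ⟨c, hrefc⟩ hne
  have hm := hmass R (by omega) hlt
  obtain ⟨hb1, hb2⟩ := Tuning.vspace_between hc ht hΘ hBp hsand (show R < t.N by omega) hm
  rw [htk] at hb1 hb2
  refine hchoice R (by omega) ⟨g, hgC, ?_, hfirst⟩
  rcases hg with ⟨h1, h2⟩ | ⟨h1, h2⟩
  · exact Or.inl ⟨hb2 h1, h2⟩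
  · exact Or.inr ⟨h1, fun h3 => h2 (hb1 h3)⟩

theorem prob_decisionBad_le (hC : ∀ h ∈ C, Measurable h) (hc : c ∈ C)
    (hε : 0 < P.ε ∧ P.ε ≤ 1 / 2) (hα0 : 0 < P.width) (hα : P.width ≤ 0.54 * P.ε)
    (hT : 0 < P.T) (n r : ℕ) {y : ℝ}
    (hy : clip P.ε (t.upperMass D C c n r) - clip P.ε (t.lowerMass D C c n r) ≤ y) (hy0 : 0 ≤ y) :
    ((streamsLaw D).prod ((streamsLaw D).prod offsetLaw)).real (decisionBad P t D C c n r) ≤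
      (1 / Real.sqrt P.T + y) / P.width := by
  classical
  have h1 := prob_prod_fresh_le (streamsLaw D) ((streamsLaw D).prod offsetLaw)
    (C.powerset.filter fun V => c ∈ V ∧ t.lowerMass D C c n r ≤ mass D c V ∧
      mass D c V ≤ t.upperMass D C c n r) (vspace P.k C c n r)
    (fun V => {p' : (ℕ → ℕ → X) × (ℕ → unitInterval) |
      ¬ (cellMid P.width (freq (DIS V) P.T (p'.1 r)) (p'.2 r) < P.ε / 2 ↔
        cellMid P.width (clip P.ε (t.lowerMass D C c n r)) (p'.2 r) < P.ε / 2)})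
    (η := (1 / Real.sqrt P.T + y) / P.width) (by positivity)
    (fun V _ => measurableSet_vspace_eq hC hc r V) fun V hV => ?_
  · refine le_trans (measureReal_mono fun p hp => ?_) h1
    exact ⟨Finset.mem_filter.2 ⟨Finset.mem_powerset.2 (vspace_subset r p.1),
      self_mem_vspace hc r p.1, hp.1⟩, hp.2⟩
  · obtain ⟨hVC, hcV, hlo, hup⟩ := Finset.mem_filter.1 hV
    have hD := measurableSet_DIS hC (Finset.mem_powerset.1 hVC)
    refine (prob_decision_ne_le D hD hT hε.1 (by linarith [hε.2]) hα0 hα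
      (t.lowerMass D C c n r) r).trans ?_
    rw [real_DIS hcV]
    gcongr
    rw [abs_of_nonneg (sub_nonneg.2 (clip_mono _ hlo))]
    exact le_trans (sub_le_sub_right (clip_mono _ hup) _) hy

/-- Replaces the upper process by the lower one at a shifted `n`, at the cost `ξ * ε`, so that
increments of a single function monotone in `n` remain to be summed. -/
theorem clip_upper_sub_le {ξ U L L' ε : ℝ} (hξ : 0 ≤ ξ) (hε : 0 < ε)
    (h : max U (ε / 8) ≤ (1 + ξ) * max L' (ε / 8)) :
    clip ε U - clip ε L ≤ clip ε L' - clip ε L + ξ * ε := by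
  have h1 : clip ε U ≤ (1 + ξ) * clip ε L' := by
    rw [clip, clip, mul_min_of_nonneg _ _ (by linarith)]
    exact min_le_min h (by nlinarith)
  have h2 := mul_le_mul_of_nonneg_left (clip_le ε L') hξ
  linarith

/-- The sum over all rounds of the bounds for the probabilities that a decision or the choice of
the hypothesis differs from the reference. -/
def roundsBound (P : Params) (t : Tuning) (D : Measure X) [IsProbabilityMeasure D]
    (C : Finset (X → Bool)) (c : X → Bool) (n : ℕ) : ℝ :=
  ∑ r ∈ Finset.range t.N,
    (((clip P.ε (t.lowerMass D C c (n + 7 * t.w) r) - clip P.ε (t.lowerMass D C c n r)) +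
        t.ξ * P.ε) / P.width +
      8 * ((Real.log (t.upperSize D C c (n + 7 * t.w) r) - Real.log (t.upperSize D C c n r)) +
        (Real.log (t.lowerSize D C c (n + 7 * t.w) r) - Real.log (t.lowerSize D C c n r))))

/-- The bound for the probability of the events that do not depend on the choice of `n`. -/
def baseBound (P : Params) (t : Tuning) (D : Measure X) (C : Finset (X → Bool)) (c : X → Bool) :
    ℝ :=
  t.N * (2 * C.card * Real.exp (-(t.k / disagreementCoeff D C c / 1600)) +
        (2 * t.q + 2 * Real.exp (-(t.ξ ^ 2 * t.k / 4)))) + t.N * (1 / Real.sqrt P.T / P.width)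

theorem upperSize_mono (ht : t.Valid) (r : ℕ) {n n' : ℕ} (hn : n ≤ n') :
    t.upperSize D C c n r ≤ t.upperSize D C c n' r :=
  Finset.sum_le_sum fun h _ => Tuning.upperProb_mono ht hn r h

theorem lowerSize_mono (ht : t.Valid) (r : ℕ) {n n' : ℕ} (hn : n ≤ n') :
    t.lowerSize D C c n r ≤ t.lowerSize D C c n' r :=
  Finset.sum_le_sum fun h _ => Tuning.lowerProb_mono ht hn r h

theorem roundsBound_nonneg (hc : c ∈ C) (ht : t.Valid) (hε : 0 < P.ε) (hα0 : 0 < P.width) (n : ℕ) :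
    0 ≤ roundsBound P t D C c n := by
  refine Finset.sum_nonneg fun r _ => add_nonneg (div_nonneg (add_nonneg ?_ ?_) hα0.le)
    (mul_nonneg (by norm_num) (add_nonneg ?_ ?_))
  · exact sub_nonneg.2 (clip_mono _ (Tuning.lowerMass_mono ht r (Nat.le_add_right _ _)))
  · exact mul_nonneg ht.ξ_pos.le hε.le
  · exact sub_nonneg.2 (Real.log_le_log (by linarith [Tuning.one_le_upperSize (D := D) hc ht n r])
      (upperSize_mono ht r (Nat.le_add_right _ _)))
  · exact sub_nonneg.2 (Real.log_le_log (by linarith [Tuning.one_le_lowerSize (D := D) hc ht n r])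
      (lowerSize_mono ht r (Nat.le_add_right _ _)))

theorem prob_runBad_le (hC : ∀ h ∈ C, Measurable h) (hc : c ∈ C) (ht : t.Valid)
    (htε : t.ε₀ = P.ε / 8) (hΘ : 1 ≤ disagreementCoeff D C c)
    (hk : 100 ≤ t.k / disagreementCoeff D C c)
    (hε : 0 < P.ε ∧ P.ε ≤ 1 / 2) (hα0 : 0 < P.width) (hα : P.width ≤ 0.54 * P.ε) (hT : 0 < P.T)
    {n : ℕ} (hn : (n : ℝ) ≤ 3 / 8 * (t.k / disagreementCoeff D C c))
    (h : (16 * (t.g ^ 3 * t.Λ) / t.ξ ≤ t.q ∧ ∀ r < t.N, t.Smooth D C c n r) ∨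
      t.FewHypotheses C.card) :
    ((sampleLaw D).prod (offsetLaw.prod (orderingLaw C))).real (runBad P t D C c n) ≤
      baseBound P t D C c + roundsBound P t D C c n := by
  have : IsProbabilityMeasure (sampleLaw D) :=
    inferInstanceAs (IsProbabilityMeasure ((streamsLaw D).prod (streamsLaw D)))
  set lam := (sampleLaw D).prod (offsetLaw.prod (orderingLaw C))
  have hproj1 : MeasurePreserving (fun p : Sample X × ((ℕ → unitInterval) × Ordering C) =>
      (p.1.1, (p.1.2, p.2.1))) lam ((streamsLaw D).prod ((streamsLaw D).prod offsetLaw)) :=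
    (measurePreserving_prodAssoc (streamsLaw D) (streamsLaw D) offsetLaw).comp
      ((MeasurePreserving.id (sampleLaw D)).prod
        (measurePreserving_fst (μ := offsetLaw) (ν := orderingLaw C)))
  have hproj2 : MeasurePreserving (fun p : Sample X × ((ℕ → unitInterval) × Ordering C) =>
      (p.1.1, p.2.2)) lam ((streamsLaw D).prod (orderingLaw C)) :=
    (measurePreserving_fst (μ := streamsLaw D) (ν := streamsLaw D)).prod
        (measurePreserving_snd (μ := offsetLaw) (ν := orderingLaw C))
  have hproj3 : MeasurePreserving (fun p : Sample X × ((ℕ → unitInterval) × Ordering C) =>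
      p.1.1) lam (streamsLaw D) :=
    (measurePreserving_fst (μ := streamsLaw D) (ν := streamsLaw D)).comp
      (measurePreserving_fst (μ := sampleLaw D) (ν := offsetLaw.prod (orderingLaw C)))
  have h1 : lam.real {p | p.1.1 ∈ t.sandwichBad D C c n} ≤ _ :=
    (ENNReal.toReal_mono (measure_ne_top _ _) (hproj3.measure_preimage_le
      (t.sandwichBad D C c n))).trans (Tuning.prob_sandwichBad_le hC hc ht hΘ hn hk)
  have h2 : ∀ r ∈ Finset.range t.N,
      lam.real {p | (p.1.1, (p.1.2, p.2.1)) ∈ decisionBad P t D C c n r} ≤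
      (1 / Real.sqrt P.T + ((clip P.ε (t.lowerMass D C c (n + 7 * t.w) r) -
        clip P.ε (t.lowerMass D C c n r)) + t.ξ * P.ε)) / P.width := fun r hr => by
    have hclose := (Tuning.levels_close hC hc ht h (Finset.mem_range.1 hr)).1
    rw [htε] at hclose
    refine (ENNReal.toReal_mono (measure_ne_top _ _) (hproj1.measure_preimage_le
      (decisionBad P t D C c n r))).trans (prob_decisionBad_le hC hc hε hα0 hα hT n r
        (clip_upper_sub_le ht.ξ_pos.le hε.1 hclose) ?_)
    have e1 := clip_mono P.ε (Tuning.lowerMass_mono (D := D) (C := C) (c := c) ht r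
      (Nat.le_add_right n (7 * t.w)))
    have e2 := mul_nonneg ht.ξ_pos.le hε.1.le
    simp only at e1
    linarith
  have h3 : ∀ r ∈ Finset.range t.N, lam.real {p | (p.1.1, p.2.2) ∈ choiceBad t D C c n r} ≤
      8 * ((Real.log (t.upperSize D C c (n + 7 * t.w) r) - Real.log (t.upperSize D C c n r)) +
        (Real.log (t.lowerSize D C c (n + 7 * t.w) r) - Real.log (t.lowerSize D C c n r))) :=
    fun r hr => by
      have hr := Finset.mem_range.1 hr
      exact (ENNReal.toReal_mono (measure_ne_top _ _) (hproj2.measure_preimage_le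
        (choiceBad t D C c n r))).trans (Tuning.prob_first_differs_le hC hc ht hr.le
          fun j hj => (Tuning.levels_close hC hc ht h (hj.trans hr)).2)
  calc _ ≤ _ + (_ + _) := (measureReal_union_le _ _).trans
        (add_le_add h1 ((measureReal_union_le _ _).trans (add_le_add
          ((measureReal_biUnion_finset_le _ _).trans (Finset.sum_le_sum h2))
          ((measureReal_biUnion_finset_le _ _).trans (Finset.sum_le_sum h3)))))
    _ = _ := by
      rw [roundsBound, baseBound, add_assoc]
      congr 1
      rw [← Finset.sum_add_distrib, ← nsmul_eq_mul, ← Finset.card_range t.N, ← Finset.sum_const,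
        Finset.card_range, ← Finset.sum_add_distrib]
      refine Finset.sum_congr rfl fun r _ => ?_
      rw [add_div]; ring

/-- Truncated masses lie in `[0, ε]` and logarithms of sizes in `[0, log #C]`, so increments over `7
* w` steps sum to at most `7 * w` times these ranges. The factor `ε` cancels against the region
width. -/
theorem sum_roundsBound_le (hc : c ∈ C) (ht : t.Valid) (hε : 0 < P.ε) (hα : 0.4 * P.ε ≤ P.width)
    (M : ℕ) :
    ∑ n ∈ Finset.range M, roundsBound P t D C c n ≤
      t.N * ((7 * t.w + M * t.ξ) / 0.4 + 16 * (7 * t.w * Real.log C.card)) := by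
  have hα0 : 0 < P.width := by linarith
  simp only [roundsBound]
  rw [Finset.sum_comm]
  refine (Finset.sum_le_card_nsmul _ _ _ fun r _ => ?_).trans
    (by rw [Finset.card_range, nsmul_eq_mul])
  rw [Finset.sum_add_distrib, ← Finset.sum_div, Finset.sum_add_distrib, ← Finset.mul_sum _ _ (8 : ℝ)]
  have h1 := Tuning.sum_log_size_le (D := D) hc ht r M
  have h2 := sum_shift_sub_le (Φ := fun n => clip P.ε (t.lowerMass D C c n r)) (lo := 0)
    (hi := P.ε) (fun n => by linarith [le_clip hε (t.lowerMass D C c n r)])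
    (fun n => clip_le _ _) (7 * t.w) M
  push_cast at h2
  refine add_le_add ?_ (by linarith)
  rw [div_le_div_iff₀ hα0 (by norm_num)]
  simp only [Finset.sum_const, Finset.card_range, nsmul_eq_mul]
  have h3 : (0 : ℝ) ≤ 7 * t.w + M * t.ξ := by have := ht.ξ_pos; positivity
  have h4 := mul_le_mul_of_nonneg_left hα h3
  linarith

open Classical in
/-- A run is likely to give the reference answer. -/
theorem prob_ne_refAnswer_le (hC : ∀ h ∈ C, Measurable h) (hc : c ∈ C) (ht : t.Valid)
    (htk : t.k = P.k) (htN : t.N = P.N)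
    (htε : t.ε₀ = P.ε / 8) (hBp : t.Bp = t.k / (2 * disagreementCoeff D C c))
    (hPΘ : P.Θ = disagreementCoeff D C c) (hΘ : 1 ≤ disagreementCoeff D C c)
    (hk : 100 ≤ P.k / disagreementCoeff D C c)
    (hε : 0 < P.ε ∧ P.ε ≤ 1 / 2) (hα1 : 0.4 * P.ε ≤ P.width) (hα : P.width ≤ 0.54 * P.ε)
    (hT : 0 < P.T) (hN : 0 < P.N) (hpow : (1 / 2 : ℝ) ^ (P.N - 1) ≤ P.ε / 8)
    {M : ℕ} (hM : M = ⌊3 / 8 * (P.k / P.Θ)⌋₊ + 1) {bad : ℝ}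
    (hbad : (((Finset.range M).filter fun n =>
      ¬ ((16 * (t.g ^ 3 * t.Λ) / t.ξ ≤ t.q ∧ ∀ r < t.N, t.Smooth D C c n r) ∨
        t.FewHypotheses C.card)).card : ℝ) ≤ bad) :
    ((sampleLaw D).prod (coinLaw P C)).real {p | ¬ ∃ h,
      (repliCAL P C c p.1 p.2).hypothesis = some h ∧
      refAnswer P t D C c (admitted P (p.2.2.1, p.2.1)) p.2.2.2.1 p.2.2.2.2 = some h} ≤
    baseBound P t D C c + 4 / (P.k / P.Θ) *
      (bad + t.N * ((7 * t.w + M * t.ξ) / 0.4 + 16 * (7 * t.w * Real.log C.card))) := by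
  have : IsProbabilityMeasure (sampleLaw D) :=
    inferInstanceAs (IsProbabilityMeasure ((streamsLaw D).prod (streamsLaw D)))
  have hα0 : 0 < P.width := by linarith [hε.1]
  have hΘ0 : 0 < P.Θ := by rw [hPΘ]; linarith
  have hk0 : 0 < P.k := by
    rcases Nat.eq_zero_or_pos P.k with h | h
    · rw [h] at hk; norm_num at hk
    · exact h
  have hk0' : (0 : ℝ) < P.k := by exact_mod_cast hk0
  have hMlt : ∀ y, admitted P y < M := fun y => by
    rw [hM]; exact Nat.lt_succ_of_le (Nat.le_floor (admitted_le hΘ0 y))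
  have hbase : 0 ≤ baseBound P t D C c := by
    have := ht.q_nonneg
    unfold baseBound
    positivity
  refine le_trans (measureReal_mono fun p hp => ?_)
    ((prob_coins_le (sampleLaw D) (runBad P t D C c) hMlt).trans ?_)
  · by_contra hgood
    exact hp (hypothesis_eq_refAnswer hc ht htk htN htε hBp hPΘ hΘ hε hα0 hα hN hpow hgood)
  set good : ℕ → Prop := fun n =>
    (16 * (t.g ^ 3 * t.Λ) / t.ξ ≤ t.q ∧ ∀ r < t.N, t.Smooth D C c n r) ∨ t.FewHypotheses C.card
  set lam := (sampleLaw D).prod (offsetLaw.prod (orderingLaw C))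
  let pn : ℕ → ℝ := fun n => (thresholdCoinLaw P).real {y | admitted P y = n}
  have hpn0 : ∀ n, 0 ≤ pn n := fun n => measureReal_nonneg
  have hpn : ∀ n, pn n ≤ 4 / (P.k / P.Θ) := prob_admitted_eq_le hΘ0 hk0
  -- For a good `n`, the bound `4/κ` on its probability is used only for the `n`-dependent errors;
  -- the base part is averaged with total weight at most `1`. A bad `n` costs at most its own
  -- probability.
  have hterm : ∀ n ∈ Finset.range M, pn n * lam.real (runBad P t D C c n) ≤
      pn n * baseBound P t D C c + 4 / (P.k / P.Θ) *
        ((if ¬ good n then 1 else 0) + roundsBound P t D C c n) := fun n hn => by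
    have hr0 := roundsBound_nonneg (D := D) hc ht hε.1 hα0 n
    by_cases hg : good n
    · have h1 := prob_runBad_le hC hc ht htε hΘ (by rw [htk]; exact hk) hε hα0 hα hT (n := n) ?_ hg
      · simp only [hg, not_true, if_false, zero_add]
        have h2 := mul_le_mul_of_nonneg_left h1 (hpn0 n)
        have h3 := mul_le_mul_of_nonneg_right (hpn n) hr0
        linarith
      · rw [htk, ← hPΘ]
        have := Finset.mem_range.1 hn
        rw [hM] at this
        exact (Nat.le_floor_iff (by positivity)).1 (Nat.lt_succ_iff.1 this)
    · simp only [hg, not_false_iff, if_true]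
      have h2 : pn n * lam.real (runBad P t D C c n) ≤ pn n * 1 :=
        mul_le_mul_of_nonneg_left measureReal_le_one (hpn0 n)
      have h3 := mul_nonneg (hpn0 n) hbase
      have h4 : 0 ≤ 4 / (P.k / P.Θ) * roundsBound P t D C c n := by positivity
      linarith [hpn n]
  refine (Finset.sum_le_sum hterm).trans ?_
  rw [Finset.sum_add_distrib, ← Finset.sum_mul, ← Finset.mul_sum, Finset.sum_add_distrib]
  refine add_le_add (mul_le_of_le_one_left hbase (sum_prob_admitted_le M))
    (mul_le_mul_of_nonneg_left (add_le_add ?_ (sum_roundsBound_le hc ht hε.1 hα1 M))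
      (by positivity))
  refine le_trans (le_of_eq ?_) hbad
  rw [Finset.sum_ite]
  simp [good]

/-- The intended answer is a function of the shared randomness only; if each run misses it with
probability at most `ρ/2`, the two runs agree except with probability `ρ`. -/
theorem isReplicable_of_prob_le {S B : Type*} [MeasurableSpace S] [MeasurableSpace B]
    {μ : Measure S} {ν : Measure B} [IsProbabilityMeasure μ] [IsProbabilityMeasure ν]
    {A : S → B → Outcome X} {ρ : ℝ} (ans : B → Option (X → Bool))
    (h : (μ.prod ν).real {p | ¬ ∃ h, (A p.1 p.2).hypothesis = some h ∧ ans p.2 = some h} ≤ ρ / 2) :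
    IsReplicable μ ν A ρ := by
  set E := {p : S × B | ¬ ∃ h, (A p.1 p.2).hypothesis = some h ∧ ans p.2 = some h}
  have h1 : MeasurePreserving (fun ω : S × S × B => (ω.1, ω.2.2)) (μ.prod (μ.prod ν)) (μ.prod ν) :=
    (MeasurePreserving.id μ).prod measurePreserving_snd
  have h2 : MeasurePreserving (fun ω : S × S × B => ω.2) (μ.prod (μ.prod ν)) (μ.prod ν) :=
    measurePreserving_snd
  rw [IsReplicable]
  have hE : (μ.prod ν) E ≤ ENNReal.ofReal (ρ / 2) := by
    rw [← ENNReal.ofReal_toReal (measure_ne_top (μ.prod ν) E)]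
    exact ENNReal.ofReal_le_ofReal h
  have hρ : 0 ≤ ρ / 2 := le_trans measureReal_nonneg h
  calc (μ.prod (μ.prod ν)) {ω | ¬ ∃ h, (A ω.1 ω.2.2).hypothesis = some h ∧
        (A ω.2.1 ω.2.2).hypothesis = some h}
      ≤ (μ.prod (μ.prod ν)) ((fun ω : S × S × B => (ω.1, ω.2.2)) ⁻¹' E ∪
          (fun ω : S × S × B => ω.2) ⁻¹' E) := measure_mono fun ω hω => by
        by_contra hcon
        simp only [E, Set.mem_union, Set.mem_preimage, Set.mem_ofPred_eq, not_or, not_not] at hcon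
        obtain ⟨⟨g, hg, hg'⟩, ⟨g2, hg2, hg2'⟩⟩ := hcon
        rw [hg'] at hg2'
        exact hω ⟨g, hg, by rw [hg2, hg2']⟩
    _ ≤ (μ.prod ν) E + (μ.prod ν) E := (measure_union_le _ _).trans
        (add_le_add (h1.measure_preimage_le _) (h2.measure_preimage_le _))
    _ ≤ ENNReal.ofReal (ρ / 2) + ENNReal.ofReal (ρ / 2) := add_le_add hE hE
    _ = ENNReal.ofReal ρ := by rw [← ENNReal.ofReal_add hρ hρ]; congr 1; ring

end ReferenceRun

/-! ### The degenerate case in which all concepts agree almost everywhere -/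

section NoDisagreement

variable {X : Type*} [MeasurableSpace X] {D : Measure X} [IsProbabilityMeasure D] {P : Params}
  {C : Finset (X → Bool)} {c : X → Bool}

instance : IsProbabilityMeasure (sampleLaw D) :=
  inferInstanceAs (IsProbabilityMeasure ((streamsLaw D).prod (streamsLaw D)))

theorem disagreementCoeff_le_card (hc : c ∈ C) : disagreementCoeff D C c ≤ C.card := by
  have : Nonempty (Set.Ioi (0 : ℝ)) := ⟨⟨1, Set.mem_Ioi.2 one_pos⟩⟩
  refine ciSup_le fun r => ?_
  obtain ⟨r, hr⟩ := r
  have hr : 0 < r := hr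
  rw [div_le_iff₀ hr, real_DIS (c := c) (mem_ball.2 ⟨hc, by rw [dist_self]; exact hr.le⟩)]
  refine (mass_le_sum _).trans ?_
  refine (Finset.sum_le_card_nsmul _ _ r fun h hh => (mem_ball.1 hh).2).trans ?_
  rw [nsmul_eq_mul]
  refine mul_le_mul_of_nonneg_right ?_ hr.le
  exact_mod_cast Finset.card_le_card fun h hh => (mem_ball.1 hh).1

/-- If the concepts agree almost everywhere, then almost surely no example shows a
disagreement. -/
theorem ae_notMem_DIS (hc : c ∈ C) (hd : ∀ h ∈ C, dist D h c = 0) :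
    ∀ᵐ S ∂sampleLaw D, ∀ i, S.2 0 i ∉ DIS C := by
  have h0 : ∀ᵐ x ∂D, x ∉ DIS C := by
    rw [ae_iff]
    simp only [not_not]
    have h1 : D.real (DIS C) ≤ 0 := by
      rw [real_DIS hc]
      exact (mass_le_sum C).trans (Finset.sum_nonpos fun h hh => (hd h hh).le)
    have h2 : D.real (DIS C) = 0 := le_antisymm h1 measureReal_nonneg
    exact (measureReal_eq_zero_iff).1 h2
  refine ae_all_iff.2 fun i => ?_
  have hev : MeasurePreserving (fun S : Sample X => S.2 0 i) (sampleLaw D) D :=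
    ((measurePreserving_eval_infinitePi (fun _ : ℕ => D) i).comp
      (measurePreserving_eval_infinitePi
        (fun _ : ℕ => Measure.infinitePi fun _ : ℕ => D) 0)).comp measurePreserving_snd
  exact hev.quasiMeasurePreserving.ae h0

/-- Here `Θ` vanishes and the general estimates do not apply. But the first empirical mass is `0`,
so the loop is left before any label is queried, and the answer depends on the ordering alone. -/
theorem repliCAL_of_notMem_DIS (hε : 0 < P.ε) (hα0 : 0 < P.width) (hα : P.width ≤ 0.54 * P.ε)
    {S : Sample X} (hS : ∀ i, S.2 0 i ∉ DIS C) (b : Coins P C) :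
    repliCAL P C c S b =
      { hypothesis := firstIn b.2.2.2 C, labels := 0, examples := P.T } := by
  have h0 : freq (DIS C) P.T (S.2 0) = 0 := by simp [freq, hitCount, hS]
  have hhalt : StopsAt P C c S b 0 := by
    rw [StopsAt, massEstimate_eq]
    exact cellMid_lt_of_le hα0 hα (freq_nonneg _ _ _) (freq_le_one _ _ _)
      (by rw [versionSpace, h0]; positivity) _
  rw [repliCAL_of_stop hhalt fun r hr => absurd hr (Nat.not_lt_zero r)]
  simp [versionSpace]

theorem isActivePAC_of_dist_eq_zero (hc : c ∈ C) (hd : ∀ h ∈ C, dist D h c = 0) (hε : 0 < P.ε)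
    (hα0 : 0 < P.width) (hα : P.width ≤ 0.54 * P.ε) {δ q m : ℝ} (hm : (P.T : ℝ) ≤ m) :
    IsActivePAC D C c (sampleLaw D) (coinLaw P C) (repliCAL P C c) P.ε δ q m := by
  have h1 : ∀ᵐ p ∂(sampleLaw D).prod (coinLaw P C), ∀ i, p.1.2 0 i ∉ DIS C :=
    Measure.quasiMeasurePreserving_fst.ae (ae_notMem_DIS hc hd)
  rw [IsActivePAC]
  refine le_trans (le_of_eq (ae_iff.1 ?_)) (zero_le)
  filter_upwards [h1] with p hp
  rw [repliCAL_of_notMem_DIS hε hα0 hα hp]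
  obtain ⟨h, hh, hf⟩ := exists_firstIn_eq_some p.2.2.2.2 (subset_refl C) ⟨c, hc⟩
  exact ⟨⟨h, hh, hf, by rwa [hd h hh]⟩, by simp, coe_le_ofReal_of_le le_rfl hm⟩

theorem isReplicable_of_dist_eq_zero (hc : c ∈ C) (hd : ∀ h ∈ C, dist D h c = 0) (hε : 0 < P.ε)
    (hα0 : 0 < P.width) (hα : P.width ≤ 0.54 * P.ε) {ρ : ℝ} (hρ : 0 ≤ ρ) :
    IsReplicable (sampleLaw D) (coinLaw P C) (repliCAL P C c) ρ := by
  have h1 : ∀ᵐ p ∂(sampleLaw D).prod (coinLaw P C), ∀ i, p.1.2 0 i ∉ DIS C :=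
    Measure.quasiMeasurePreserving_fst.ae (ae_notMem_DIS hc hd)
  refine isReplicable_of_prob_le (fun b => firstIn b.2.2.2 C) (le_trans (le_of_eq ?_)
    (div_nonneg hρ two_pos.le))
  refine (measureReal_eq_zero_iff).2 (ae_iff.1 ?_)
  filter_upwards [h1] with p hp
  rw [repliCAL_of_notMem_DIS hε hα0 hα hp]
  obtain ⟨h, hh, hf⟩ := exists_firstIn_eq_some p.2.2.2.2 (subset_refl C) ⟨c, hc⟩
  exact ⟨h, hf, hf⟩

end NoDisagreement

/-! ### Numerical estimates for the number of rounds and the test samples -/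

section Estimates

/-- Since `log y ≥ 1/4`, the surplus `4 m log y` in the exponent is at least `m`, and `exp (-m) ≤
1/m` supplies the constant factor. -/
theorem exp_neg_le_of_log {y m x : ℝ} (hy : 0 < y) (hl : 1 / 4 ≤ Real.log y) (hm : 0 < m)
    (hx : (1 + 4 * m) * Real.log y ≤ x) : Real.exp (-x) ≤ 1 / (m * y) := by
  have h1 : Real.exp (-x) ≤ Real.exp (-Real.log y) * Real.exp (-m) := by
    rw [← Real.exp_add]
    exact Real.exp_le_exp.2 (by nlinarith)
  have h2 : Real.exp (-Real.log y) = y⁻¹ := by rw [Real.exp_neg, Real.exp_log hy]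
  have h3 : Real.exp (-m) ≤ m⁻¹ := by
    rw [Real.exp_neg]
    exact inv_anti₀ hm (by linarith [Real.add_one_le_exp m])
  calc _ ≤ _ := h1
    _ ≤ y⁻¹ * m⁻¹ := by rw [h2]; exact mul_le_mul_of_nonneg_left h3 (by positivity)
    _ = _ := by rw [one_div, mul_inv, mul_comm]

theorem quarter_le_log {y : ℝ} (hy : 4 / 3 ≤ y) : 1 / 4 ≤ Real.log y := by
  have h1 := Real.one_sub_inv_le_log_of_pos (show 0 < y by linarith)
  have h2 : y⁻¹ ≤ (4 / 3 : ℝ)⁻¹ := inv_anti₀ (by norm_num) hy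
  norm_num at h2
  linarith

/-- The admissible inputs, with the constants in the parameter settings fixed. -/
structure Params.Standard (P : Params) : Prop where
  ε_pos : 0 < P.ε
  ε_le : P.ε ≤ 1 / 2
  δ_pos : 0 < P.δ
  δ_le : P.δ ≤ 1 / 2
  ρ_pos : 0 < P.ρ
  ρ_le : P.ρ ≤ 1 / 2
  one_le_card : 1 ≤ P.card
  aN_eq : P.aN = 12
  aT_eq : P.aT = 10 ^ 8
  ak_eq : P.ak = 10 ^ 20

namespace Params.Standard

variable {P : Params} (hP : P.Standard)
include hP

theorem L_ge : 0.69 ≤ P.L := by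
  have h1 : (2 : ℝ) ≤ 1 / P.ε := by
    rw [le_div_iff₀ hP.ε_pos]; linarith [hP.ε_le]
  have h2 := Real.log_le_log two_pos h1
  have h3 := Real.log_two_gt_d9
  rw [Params.L]
  linarith

theorem L_le : P.L ≤ 1 / P.ε := by
  have h : 0 < 1 / P.ε := one_div_pos.2 hP.ε_pos
  exact (Real.log_le_sub_one_of_pos h).trans (by linarith)

theorem le_N : 12 * P.L ≤ P.N := by
  rw [Params.N, hP.aN_eq]; exact Nat.le_ceil _

theorem N_le : (P.N : ℝ) ≤ 14 * P.L := by
  have h1 := hP.L_ge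
  have h2 := Nat.ceil_lt_add_one (show 0 ≤ P.aN * P.L by rw [hP.aN_eq]; linarith)
  rw [hP.aN_eq] at h2
  have h3 : (P.N : ℝ) < 12 * P.L + 1 := by rw [Params.N, hP.aN_eq]; exact h2
  linarith

theorem nine_le_N : 9 ≤ P.N := by
  have h1 : (8 : ℝ) < P.N := by linarith [hP.L_ge, hP.le_N]
  have h2 : 8 < P.N := by exact_mod_cast h1
  omega

theorem width_bounds : 0.4 * P.ε ≤ P.width ∧ P.width ≤ 0.54 * P.ε :=
  rSTATWidth_bounds hP.ε_pos ⟨hP.δ_pos, hP.δ_le⟩ ⟨hP.ρ_pos, hP.ρ_le⟩ hP.nine_le_N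

theorem half_pow_le : (1 / 2 : ℝ) ^ (P.N - 1) ≤ P.ε / 8 := by
  have h9 := hP.nine_le_N
  have hL := hP.L_ge
  have hN := hP.le_N
  have h2 := Real.log_two_gt_d9
  have h2' := Real.log_two_lt_d9
  have h1 : (1 / 2 : ℝ) ^ (P.N - 1) = Real.exp (-((P.N - 1 : ℕ) * Real.log 2)) := by
    rw [← mul_neg, mul_comm, ← Real.rpow_natCast, Real.rpow_def_of_pos (by norm_num), one_div,
      Real.log_inv]
  have h3 : P.ε / 8 = Real.exp (-(P.L + 3 * Real.log 2)) := by
    rw [neg_add, Real.exp_add, Params.L, one_div, Real.log_inv, neg_neg, Real.exp_log hP.ε_pos,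
      show (3 : ℝ) * Real.log 2 = Real.log (2 ^ 3) by rw [Real.log_pow]; norm_num, Real.exp_neg,
      Real.exp_log (by norm_num)]
    norm_num [div_eq_mul_inv]
  rw [h1, h3, Nat.cast_sub (by omega)]
  refine Real.exp_le_exp.2 (neg_le_neg ?_)
  push_cast
  nlinarith

theorem le_T : 10 ^ 8 * (P.L ^ 2 * Real.log (P.L / P.δ) / (P.ε ^ 2 * P.ρ ^ 2)) ≤ P.T := by
  rw [Params.T, hP.aT_eq]; exact Nat.le_ceil _

theorem log_L_div_ge {x : ℝ} (h0 : 0 < x) (h : x ≤ 1 / 2) : 1 / 4 ≤ Real.log (P.L / x) :=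
  quarter_le_log (by rw [le_div_iff₀ h0]; linarith [hP.L_ge])

theorem sq_le_T : (5000 * P.L / (P.ε * P.ρ)) ^ 2 ≤ P.T := by
  refine le_trans ?_ hP.le_T
  have h1 := hP.log_L_div_ge hP.δ_pos hP.δ_le
  have h2 := hP.ε_pos
  have h3 := hP.ρ_pos
  have h4 : 0 ≤ P.L ^ 2 / (P.ε ^ 2 * P.ρ ^ 2) := by positivity
  calc (5000 * P.L / (P.ε * P.ρ)) ^ 2 = 10 ^ 8 * (P.L ^ 2 / (P.ε ^ 2 * P.ρ ^ 2)) * (1 / 4) := by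
        field_simp; ring
    _ ≤ 10 ^ 8 * (P.L ^ 2 / (P.ε ^ 2 * P.ρ ^ 2)) * Real.log (P.L / P.δ) :=
        mul_le_mul_of_nonneg_left h1 (by positivity)
    _ = _ := by ring

theorem T_pos : 0 < P.T := by
  have h1 : (0 : ℝ) < P.T := by
    refine lt_of_lt_of_le ?_ hP.sq_le_T
    have := hP.ε_pos
    have := hP.ρ_pos
    have := hP.L_ge
    positivity
  exact_mod_cast h1

/-- The replicability requirement on the test samples: a fluctuation `1/√T ≤ ε ρ / (5000 L)`,
relative to a width of at least `0.4 ε`, in each of at most `14 L` rounds. -/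
theorem noise_le : P.N * (1 / Real.sqrt P.T / P.width) ≤ P.ρ / 100 := by
  have h2 := hP.ε_pos
  have h3 := hP.ρ_pos
  have hL := hP.L_ge
  have hL0 : 0 < P.L := by linarith
  obtain ⟨hw, -⟩ := hP.width_bounds
  have hw0 : 0 < P.width := by linarith
  have h4 : 5000 * P.L / (P.ε * P.ρ) ≤ Real.sqrt P.T := Real.le_sqrt_of_sq_le hP.sq_le_T
  have h5 : 5000 * P.L / (P.ε * P.ρ) * (0.4 * P.ε) ≤ Real.sqrt P.T * P.width :=
    mul_le_mul h4 hw (by positivity) (Real.sqrt_nonneg _)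
  have h6 : 5000 * P.L / (P.ε * P.ρ) * (0.4 * P.ε) = 2000 * P.L / P.ρ := by field_simp; norm_num
  rw [h6] at h5
  rw [div_div, mul_one_div, div_le_iff₀ (lt_of_lt_of_le (by positivity) h5)]
  calc (P.N : ℝ) ≤ 14 * P.L := hP.N_le
    _ ≤ P.ρ / 100 * (2000 * P.L / P.ρ) := by field_simp; norm_num
    _ ≤ _ := mul_le_mul_of_nonneg_left h5 (by positivity)

theorem N_mul_exp_T_le : P.N * (2 * Real.exp (-(P.T * (P.ε / 10) ^ 2 / 4))) ≤ P.δ / 3 := by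
  have hε := hP.ε_pos
  have hρ := hP.ρ_pos
  have hδ := hP.δ_pos
  have hL := hP.L_ge
  have hL0 : 0 < P.L := by linarith
  have hlog := hP.log_L_div_ge hP.δ_pos hP.δ_le
  have h1 := exp_neg_le_of_log (y := P.L / P.δ) (m := 1000) (x := P.T * (P.ε / 10) ^ 2 / 4)
    (by positivity) hlog (by norm_num) ?_
  · calc P.N * (2 * Real.exp (-(P.T * (P.ε / 10) ^ 2 / 4)))
        ≤ 14 * P.L * (2 * (1 / (1000 * (P.L / P.δ)))) :=
          mul_le_mul hP.N_le (by linarith) (by positivity) (by positivity)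
      _ = 28 / 1000 * P.δ := by field_simp; norm_num
      _ ≤ _ := by linarith
  · have h2 : 10 ^ 8 * (P.L ^ 2 * Real.log (P.L / P.δ) / (P.ε ^ 2 * P.ρ ^ 2)) * (P.ε / 10) ^ 2 / 4 ≤
        P.T * (P.ε / 10) ^ 2 / 4 := by
      have := hP.le_T
      gcongr
    refine le_trans ?_ h2
    have h3 : 10 ^ 8 * (P.L ^ 2 * Real.log (P.L / P.δ) / (P.ε ^ 2 * P.ρ ^ 2)) * (P.ε / 10) ^ 2 / 4 =
      250000 * (P.L / P.ρ) ^ 2 * Real.log (P.L / P.δ) := by field_simp; norm_num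
    rw [h3]
    have h4 : 1 ≤ P.L / P.ρ := by rw [le_div_iff₀ hρ]; linarith [hP.ρ_le]
    have h5 : 1 ≤ (P.L / P.ρ) ^ 2 := one_le_pow₀ h4
    refine mul_le_mul_of_nonneg_right ?_ (by linarith)
    linarith

end Params.Standard

end Estimates

/-! ### Choice of the window width and of the other parameters of the processes -/

namespace Params

variable (P : Params)

/-- The logarithm of the number of concepts. -/
def logCard : ℝ := Real.log P.card

/-- The number of labels per round, relative to the disagreement coefficient. -/
def κ : ℝ := P.k / P.Θ

/-- The target for the width of a window of numbers of admitted errors. -/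
def windowTarget : ℝ := P.ρ * P.κ / (10 ^ 6 * (P.L * P.logCard))

/-- The parameters of the reference process. -/
def tuning : Tuning where
  k := P.k
  ε₀ := P.ε / 8
  -- The largest value that `Valid.le_w` admits: `8 * ξ * Bp = w / 8` for `Bp = κ / 2`.
  ξ := ⌊P.windowTarget⌋₊ / (32 * P.κ)
  q := P.ρ / (100 * P.N)
  Bp := P.κ / 2
  Bm := P.κ
  g := 16 * (P.N * P.κ) / (⌊P.windowTarget⌋₊ : ℝ) ^ 2
  -- The number of non-smooth `n` is of order `N w L / Λ`, so this is as small as `Λ` may be, up to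
  -- constants, for that number to stay `O(w L log #C)` when `L ≤ log #C`. The maximum keeps `Λ ≤
  -- 1/2` in the other case.
  Λ := P.L / (2 * max P.logCard P.L)
  w := ⌊P.windowTarget⌋₊
  N := P.N

/-- The case of at least two concepts and a positive disagreement coefficient. -/
structure Nontrivial : Prop extends P.Standard where
  two_le_card : 2 ≤ P.card
  one_le_Θ : 1 ≤ P.Θ

namespace Nontrivial

variable {P} (hP : P.Nontrivial)
include hP

theorem L_pos : 0 < P.L := by linarith [hP.L_ge]

theorem logCard_ge : 0.69 ≤ P.logCard := by
  have h1 : (2 : ℝ) ≤ P.card := by exact_mod_cast hP.two_le_card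
  have h2 := Real.log_le_log two_pos h1
  have h3 := Real.log_two_gt_d9
  rw [Params.logCard]
  linarith

theorem logCard_pos : 0 < P.logCard := by linarith [hP.logCard_ge]

theorem card_pos : (0 : ℝ) < P.card := by
  have := hP.one_le_card
  exact_mod_cast this

theorem log_ge : 1 / 4 ≤ Real.log (P.L / P.ρ) := hP.log_L_div_ge hP.ρ_pos hP.ρ_le

theorem card_mul_ge : 4 / 3 ≤ P.card * P.L / P.δ := by
  have h1 : (2 : ℝ) ≤ P.card := by exact_mod_cast hP.two_le_card
  rw [le_div_iff₀ hP.δ_pos]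
  nlinarith [hP.L_ge, hP.δ_le]

theorem log_card_mul_ge : 1 / 4 ≤ Real.log (P.card * P.L / P.δ) := quarter_le_log hP.card_mul_ge

theorem labelNumerator_div : P.labelNumerator / P.ρ ^ 4 =
    P.logCard ^ 2 * Real.log (P.L / P.ρ) * P.L ^ 4 / P.ρ ^ 4 + Real.log (P.card * P.L / P.δ) := by
  have := hP.ρ_pos
  rw [Params.labelNumerator, Params.logCard]
  field_simp

theorem κ_ge : 10 ^ 20 * (P.logCard ^ 2 * Real.log (P.L / P.ρ) * P.L ^ 4 / P.ρ ^ 4 +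
    Real.log (P.card * P.L / P.δ)) ≤ P.κ := by
  have hΘ : 0 < P.Θ := by linarith [hP.one_le_Θ]
  rw [Params.κ, le_div_iff₀ hΘ, ← hP.labelNumerator_div]
  refine le_trans (le_of_eq ?_) (Nat.le_ceil _)
  rw [hP.ak_eq]
  ring

theorem κ_ge_left : 10 ^ 20 * (P.logCard ^ 2 * Real.log (P.L / P.ρ) * P.L ^ 4 / P.ρ ^ 4) ≤ P.κ := by
  linarith [hP.κ_ge, hP.log_card_mul_ge]

theorem κ_ge_right : 10 ^ 20 * Real.log (P.card * P.L / P.δ) ≤ P.κ := by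
  have h1 : 0 ≤ P.logCard ^ 2 * Real.log (P.L / P.ρ) * P.L ^ 4 / P.ρ ^ 4 := by
    have := hP.log_ge
    have := hP.ρ_pos
    have : 0 ≤ Real.log (P.L / P.ρ) := by linarith
    positivity
  linarith [hP.κ_ge]

theorem hundred_le_κ : 100 ≤ P.κ := by linarith [hP.κ_ge_right, hP.log_card_mul_ge]

theorem κ_le_k : P.κ ≤ P.k := div_le_self (Nat.cast_nonneg _) hP.one_le_Θ

theorem κ_ge_log : 10 ^ 18 * Real.log (P.L / P.ρ) ≤ P.κ := by
  have hρ := hP.ρ_pos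
  have h1 := hP.log_ge
  have h2 := hP.logCard_ge
  have h3 := hP.L_ge
  have h4 : 1 ≤ P.L / P.ρ := by rw [le_div_iff₀ hρ]; linarith [hP.ρ_le]
  have h5 : 1 ≤ (P.L / P.ρ) ^ 4 := one_le_pow₀ h4
  have h6 : 0.01 ≤ P.logCard ^ 2 := by nlinarith
  refine le_trans ?_ hP.κ_ge_left
  calc 10 ^ 18 * Real.log (P.L / P.ρ) = 10 ^ 20 * (0.01 * Real.log (P.L / P.ρ) * 1) := by ring
    _ ≤ 10 ^ 20 * (P.logCard ^ 2 * Real.log (P.L / P.ρ) * (P.L / P.ρ) ^ 4) := by gcongr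
    _ = _ := by ring

theorem windowTarget_ge : 10 ^ 6 * P.L ≤ P.windowTarget := by
  have hρ := hP.ρ_pos
  have hL := hP.L_pos
  have hℓ := hP.logCard_pos
  have h1 := hP.log_ge
  have h2 := hP.logCard_ge
  have h3 := hP.L_ge
  rw [Params.windowTarget, le_div_iff₀ (by positivity)]
  have h4 := mul_le_mul_of_nonneg_left hP.κ_ge_left hρ.le
  refine le_trans ?_ h4
  have h5 : 0.69 ≤ P.L / P.ρ := by rw [le_div_iff₀ hρ]; linarith [hP.ρ_le]
  have h6 : (0.69 : ℝ) ^ 2 ≤ (P.L / P.ρ) ^ 2 := by gcongr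
  have h7 : 1 ≤ 1 / P.ρ := by rw [le_div_iff₀ hρ]; linarith [hP.ρ_le]
  calc 10 ^ 6 * P.L * (10 ^ 6 * (P.L * P.logCard)) =
        10 ^ 12 * (P.L ^ 2 * P.logCard) * 1 * 1 := by ring
    _ ≤ 10 ^ 12 * (P.L ^ 2 * P.logCard) * (10 ^ 8 * (0.69 * (1 / 4) * 0.69 ^ 2)) * 1 := by
        gcongr; norm_num
    _ ≤ 10 ^ 12 * (P.L ^ 2 * P.logCard) *
        (10 ^ 8 * (P.logCard * Real.log (P.L / P.ρ) * (P.L / P.ρ) ^ 2)) * (1 / P.ρ) := by gcongr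
    _ = _ := by field_simp

theorem w_le : (P.tuning.w : ℝ) ≤ P.windowTarget :=
  Nat.floor_le (by linarith [hP.windowTarget_ge, hP.L_pos])

theorem le_w : P.windowTarget / 2 ≤ P.tuning.w := by
  have h1 := Nat.lt_floor_add_one P.windowTarget
  have h2 := hP.windowTarget_ge
  have h3 := hP.L_ge
  change P.windowTarget / 2 ≤ (⌊P.windowTarget⌋₊ : ℝ)
  linarith

theorem w_ge : 10 ^ 5 * P.L ≤ P.tuning.w := by
  linarith [hP.le_w, hP.windowTarget_ge, hP.L_pos]

theorem κ_pos : 0 < P.κ := by linarith [hP.hundred_le_κ]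

theorem w_pos : (0 : ℝ) < P.tuning.w := by linarith [hP.w_ge, hP.L_pos]

theorem w_mul_le : P.tuning.w * (P.L * P.logCard) ≤ 1 / 10 ^ 6 * (P.ρ * P.κ) := by
  have hL := hP.L_pos
  have hℓ := hP.logCard_pos
  have h1 := hP.w_le
  rw [Params.windowTarget, le_div_iff₀ (by positivity)] at h1
  linarith

theorem le_w_mul : 1 / (2 * 10 ^ 6) * (P.ρ * P.κ) ≤ P.tuning.w * (P.L * P.logCard) := by
  have hL := hP.L_pos
  have hℓ := hP.logCard_pos
  have h1 := hP.le_w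
  rw [Params.windowTarget, div_div, div_le_iff₀ (by positivity)] at h1
  linarith

theorem w_mul_L_le : P.tuning.w * P.L ≤ 1 / (5 * 10 ^ 5) * (P.ρ * P.κ) := by
  have h0 := mul_pos hP.w_pos hP.L_pos
  have h1 := hP.w_mul_le
  nlinarith [hP.logCard_ge]

/-- The square of the width of a window is large compared with the number of labels. -/
theorem w_sq_ge : 2 * 10 ^ 7 * (Real.log (P.L / P.ρ) * (P.L / P.ρ) ^ 2) ≤
    (P.tuning.w : ℝ) ^ 2 / P.κ := by
  have hρ := hP.ρ_pos
  have hL := hP.L_pos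
  have hℓ := hP.logCard_pos
  have hκ := hP.κ_pos
  have hlog := hP.log_ge
  -- With `w` of order `ρ κ / (L log #C)`, the quotient `w²/κ` is of order `ρ² κ / (L log #C)²`. The
  -- factor `log² #C * L⁴ / ρ⁴` in `κ` thus leaves `(L/ρ)²`, and its factor `log (L/ρ)` is kept for
  -- the exponential bounds.
  have h1 : (1 / (2 * 10 ^ 6) * (P.ρ * P.κ) / (P.L * P.logCard)) ^ 2 ≤ (P.tuning.w : ℝ) ^ 2 := by
    refine pow_le_pow_left₀ (by positivity) ?_ 2
    rw [div_le_iff₀ (by positivity)]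
    exact hP.le_w_mul
  calc 2 * 10 ^ 7 * (Real.log (P.L / P.ρ) * (P.L / P.ρ) ^ 2)
      ≤ 10 ^ 20 * (P.logCard ^ 2 * Real.log (P.L / P.ρ) * P.L ^ 4 / P.ρ ^ 4) *
        ((1 / (2 * 10 ^ 6)) ^ 2 * (P.ρ ^ 2 / (P.L * P.logCard) ^ 2)) := by
        have : 10 ^ 20 * (P.logCard ^ 2 * Real.log (P.L / P.ρ) * P.L ^ 4 / P.ρ ^ 4) *
          ((1 / (2 * 10 ^ 6)) ^ 2 * (P.ρ ^ 2 / (P.L * P.logCard) ^ 2)) =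
          2.5 * 10 ^ 7 * (Real.log (P.L / P.ρ) * (P.L / P.ρ) ^ 2) := by
          field_simp; norm_num
        rw [this]
        have h2 : 0 ≤ Real.log (P.L / P.ρ) * (P.L / P.ρ) ^ 2 :=
          mul_nonneg (by linarith) (by positivity)
        linarith
    _ ≤ P.κ * ((1 / (2 * 10 ^ 6)) ^ 2 * (P.ρ ^ 2 / (P.L * P.logCard) ^ 2)) :=
        mul_le_mul_of_nonneg_right hP.κ_ge_left (by positivity)
    _ = (1 / (2 * 10 ^ 6) * (P.ρ * P.κ) / (P.L * P.logCard)) ^ 2 / P.κ := by field_simp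
    _ ≤ _ := div_le_div_of_nonneg_right h1 hκ.le

theorem one_le_L_div : 1 ≤ P.L / P.ρ := by
  rw [le_div_iff₀ hP.ρ_pos]; linarith [hP.ρ_le, hP.L_ge]

theorem w_sq_ge_log : 2 * 10 ^ 7 * Real.log (P.L / P.ρ) ≤ (P.tuning.w : ℝ) ^ 2 / P.κ := by
  refine le_trans ?_ hP.w_sq_ge
  have h1 : 1 ≤ (P.L / P.ρ) ^ 2 := one_le_pow₀ hP.one_le_L_div
  have h2 := hP.log_ge
  have h3 : 0 ≤ 2 * 10 ^ 7 * Real.log (P.L / P.ρ) := by linarith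
  nlinarith

/-- Here `g = 16 N / (w²/κ)` with `N ≤ 14 L` and `w²/κ ≥ 5 * 10⁶ (L/ρ)²`. -/
theorem g_le : P.tuning.g ≤ 50 * P.ρ ^ 2 / (10 ^ 6 * P.L) := by
  have hρ := hP.ρ_pos
  have hL := hP.L_pos
  have hκ := hP.κ_pos
  have hw := hP.w_pos
  have h1 := hP.w_sq_ge
  have h2 : 5 * 10 ^ 6 * (P.L / P.ρ) ^ 2 ≤ (P.tuning.w : ℝ) ^ 2 / P.κ := by
    refine le_trans ?_ h1
    have := mul_le_mul_of_nonneg_right hP.log_ge (sq_nonneg (P.L / P.ρ))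
    linarith
  have h3 : P.tuning.g = 16 * P.N / ((P.tuning.w : ℝ) ^ 2 / P.κ) := by
    change 16 * (P.N * P.κ) / (P.tuning.w : ℝ) ^ 2 = _
    field_simp
  rw [h3]
  calc 16 * P.N / ((P.tuning.w : ℝ) ^ 2 / P.κ)
      ≤ 16 * (14 * P.L) / (5 * 10 ^ 6 * (P.L / P.ρ) ^ 2) := by
        have := hP.N_le
        gcongr
    _ = 44.8 * P.ρ ^ 2 / (10 ^ 6 * P.L) := by field_simp; norm_num
    _ ≤ _ := by gcongr; norm_num

theorem g_nonneg : 0 ≤ P.tuning.g := by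
  have := hP.κ_pos
  change 0 ≤ 16 * (P.N * P.κ) / (⌊P.windowTarget⌋₊ : ℝ) ^ 2
  positivity

theorem ξ_eq : P.tuning.ξ = P.tuning.w / (32 * P.κ) := rfl

theorem N_pos : (0 : ℝ) < P.N := by linarith [hP.le_N, hP.L_pos]

theorem tuning_valid : P.tuning.Valid where
  ξ_pos := by
    have := hP.κ_pos
    have := hP.w_pos
    rw [hP.ξ_eq]; positivity
  ξ_le := by
    have hκ := hP.κ_pos
    rw [hP.ξ_eq, div_le_iff₀ (by positivity)]
    have h1 := hP.w_mul_L_le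
    have h2 := hP.L_ge
    have h3 := hP.w_pos
    have h4 := hP.ρ_le
    nlinarith
  one_le := by
    have hκ := hP.κ_pos
    have h1 : P.tuning.ξ * P.κ = P.tuning.w / 32 := by rw [hP.ξ_eq]; field_simp
    have h2 : P.tuning.ξ * P.κ ≤ P.tuning.ξ * P.tuning.k :=
      mul_le_mul_of_nonneg_left hP.κ_le_k (by rw [hP.ξ_eq]; positivity)
    linarith [hP.w_ge, hP.L_ge]
  ε_pos := by have := hP.ε_pos; change 0 < P.ε / 8; positivity
  ε_le := by have := hP.ε_le; change P.ε / 8 ≤ 1; linarith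
  q_nonneg := by have := hP.ρ_pos; change 0 ≤ P.ρ / (100 * P.N); positivity
  q_lt := by
    have h1 := hP.ρ_le
    have h2 : (9 : ℝ) ≤ P.N := by exact_mod_cast hP.nine_le_N
    change P.ρ / (100 * P.N) < 1 / 2
    rw [div_lt_iff₀ (by linarith)]
    linarith
  Bp_pos := by have := hP.κ_pos; change 0 < P.κ / 2; positivity
  Bp_le := by
    have hκ := hP.κ_pos
    have h1 : P.tuning.ξ * P.κ = P.tuning.w / 32 := by rw [hP.ξ_eq]; field_simp
    have h2 := hP.w_mul_L_le
    have h3 := hP.w_pos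
    change (1 + 8 * P.tuning.ξ) * (P.κ / 2) ≤ P.κ
    nlinarith [hP.L_ge, hP.ρ_le]
  le_w := by
    have hκ := hP.κ_pos
    have h1 : P.tuning.ξ * P.κ = P.tuning.w / 32 := by rw [hP.ξ_eq]; field_simp
    change 8 * P.tuning.ξ * (P.κ / 2) ≤ P.tuning.w / 8
    linarith
  w_pos := by have := hP.w_pos; exact_mod_cast this
  exp_le := by
    have h1 := hP.w_ge
    have hL := hP.L_pos
    have h2 : Real.exp (-(3 / 4 * P.tuning.w)) ≤ (10 ^ 4 * P.L)⁻¹ := by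
      rw [Real.exp_neg]
      refine inv_anti₀ (by positivity) ?_
      linarith [Real.add_one_le_exp (3 / 4 * (P.tuning.w : ℝ))]
    calc (P.N : ℝ) * Real.exp (-(3 / 4 * P.tuning.w)) ≤ 14 * P.L * (10 ^ 4 * P.L)⁻¹ :=
          mul_le_mul hP.N_le h2 (Real.exp_nonneg _) (by positivity)
      _ = 14 / 10 ^ 4 := by field_simp
      _ ≤ _ := by norm_num
  le_g := le_rfl
  g_le := by
    refine hP.g_le.trans ?_
    have hL := hP.L_pos
    rw [div_le_one (by positivity)]
    nlinarith [hP.L_ge, hP.ρ_le, hP.ρ_pos]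
  Λ_pos := by
    have := hP.L_pos
    have : 0 < max P.logCard P.L := lt_max_of_lt_right this
    change 0 < P.L / (2 * max P.logCard P.L)
    positivity
  Λ_le := by
    have h1 := hP.L_pos
    have h2 : 0 < max P.logCard P.L := lt_max_of_lt_right h1
    change P.L / (2 * max P.logCard P.L) ≤ 1 / 2
    rw [div_le_div_iff₀ (by positivity) two_pos]
    linarith [le_max_right P.logCard P.L]

end Nontrivial
end Params

/-! ### The error terms fit into the allowed failure probabilities -/

namespace Params.Nontrivial

variable {P : Params} (hP : P.Nontrivial)
include hP

theorem exp_κ_le {a : ℝ} (ha : a ≤ 4000) (ha0 : 0 < a) :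
    Real.exp (-(P.κ / a)) ≤ 1 / (10 ^ 6 * (P.card * P.L / P.δ)) := by
  have h1 := hP.κ_ge_right
  have h2 := hP.log_card_mul_ge
  refine exp_neg_le_of_log (by linarith [hP.card_mul_ge]) h2 (by norm_num) ?_
  rw [le_div_iff₀ ha0]
  nlinarith

theorem exp_κ_le' : Real.exp (-(P.κ / 3200)) ≤ 1 / (10 ^ 6 * (P.L / P.ρ)) := by
  have h1 := hP.κ_ge_log
  have h2 := hP.log_ge
  refine exp_neg_le_of_log (by linarith [hP.one_le_L_div]) h2 (by norm_num) ?_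
  linarith

theorem failure_le : P.N * (2 * P.card * Real.exp (-(P.κ / 1600))) +
    (P.N * Real.exp (-(P.k / 4)) + P.N * (2 * Real.exp (-(P.T * (P.ε / 10) ^ 2 / 4)))) ≤ P.δ := by
  have hδ := hP.δ_pos
  have hL := hP.L_pos
  have hC := hP.card_pos
  have hC1 : (1 : ℝ) ≤ P.card := by exact_mod_cast hP.one_le_card
  have h1 : P.N * (2 * P.card * Real.exp (-(P.κ / 1600))) ≤ P.δ / 3 :=
    calc P.N * (2 * P.card * Real.exp (-(P.κ / 1600)))
        ≤ 14 * P.L * (2 * P.card * (1 / (10 ^ 6 * (P.card * P.L / P.δ)))) := by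
          have := hP.N_le
          have := hP.exp_κ_le (a := 1600) (by norm_num) (by norm_num)
          gcongr
      _ = 28 / 10 ^ 6 * P.δ := by field_simp; norm_num
      _ ≤ _ := by linarith
  have h2 : P.N * Real.exp (-(P.k / 4)) ≤ P.δ / 3 :=
    calc P.N * Real.exp (-(P.k / 4)) ≤ 14 * P.L * (P.card * (1 / (10 ^ 6 * (P.card * P.L / P.δ)))) := by
          have h3 := hP.N_le
          have h4 := hP.exp_κ_le (a := 4) (by norm_num) (by norm_num)
          have h5 : Real.exp (-(P.k / 4 : ℝ)) ≤ Real.exp (-(P.κ / 4)) :=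
            Real.exp_le_exp.2 (by linarith [hP.κ_le_k])
          refine mul_le_mul h3 ?_ (Real.exp_nonneg _) (by positivity)
          exact (h5.trans h4).trans (le_mul_of_one_le_left (by positivity) hC1)
      _ = 14 / 10 ^ 6 * P.δ := by field_simp
      _ ≤ _ := by linarith
  linarith [hP.N_mul_exp_T_le]

/-- The exponent is at least `ξ² κ / 4 = (w²/κ) / 4096`, a large multiple of `log (L/ρ)`. -/
theorem exp_ξ_le : P.N * (2 * Real.exp (-(P.tuning.ξ ^ 2 * P.tuning.k / 4))) ≤ P.ρ / 20 := by
  have hρ := hP.ρ_pos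
  have hL := hP.L_pos
  have hκ := hP.κ_pos
  have h1 := exp_neg_le_of_log (y := P.L / P.ρ) (m := 1000) (x := P.tuning.ξ ^ 2 * P.tuning.k / 4)
    (by linarith [hP.one_le_L_div]) hP.log_ge (by norm_num) ?_
  · calc P.N * (2 * Real.exp (-(P.tuning.ξ ^ 2 * P.tuning.k / 4)))
        ≤ 14 * P.L * (2 * (1 / (1000 * (P.L / P.ρ)))) := by
          have := hP.N_le
          gcongr
      _ = 28 / 1000 * P.ρ := by field_simp; norm_num
      _ ≤ _ := by linarith
  · have h2 : P.tuning.ξ ^ 2 * P.κ / 4 ≤ P.tuning.ξ ^ 2 * P.tuning.k / 4 := by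
      have := hP.κ_le_k
      change _ ≤ P.tuning.ξ ^ 2 * (P.k : ℝ) / 4
      gcongr
    have h3 : P.tuning.ξ ^ 2 * P.κ / 4 = (P.tuning.w : ℝ) ^ 2 / P.κ / 4096 := by
      rw [hP.ξ_eq]; field_simp; norm_num; ring
    linarith [hP.w_sq_ge_log, hP.log_ge]

theorem half_le_log : Real.log ((1 + P.ε / 8) / (P.ε / 8)) ≤ 5 * P.L := by
  have hε := hP.ε_pos
  have h1 : (1 + P.ε / 8) / (P.ε / 8) ≤ 2 ^ 4 * (1 / P.ε) := by
    rw [div_le_iff₀ (by positivity)]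
    have : 2 ^ 4 * (1 / P.ε) * (P.ε / 8) = 2 := by field_simp; norm_num
    linarith [hP.ε_le]
  have h2 : Real.log 2 ≤ P.L := by
    rw [Params.L]
    exact Real.log_le_log two_pos (by rw [le_div_iff₀ hε]; linarith [hP.ε_le])
  calc _ ≤ Real.log (2 ^ 4 * (1 / P.ε)) := Real.log_le_log (by positivity) h1
    _ = 4 * Real.log 2 + P.L := by
      rw [Real.log_mul (by norm_num) (by positivity), Real.log_pow, Params.L]; norm_num
    _ ≤ _ := by linarith

theorem tuning_q_ge : P.ρ / (1400 * P.L) ≤ P.tuning.q := by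
  have := hP.ρ_pos
  have := hP.N_pos
  have := hP.N_le
  change _ ≤ P.ρ / (100 * P.N)
  exact div_le_div_of_nonneg_left (by positivity) (by positivity) (by linarith)

/-- The exponent `w² / (4κ)` is at least `L + 10⁶ log (L/ρ)`. The part `L` pays for `#C ≤ exp L`;
the rest, used as two factors, pays for the number of rounds and for `q`. -/
theorem fewHypotheses (h : P.logCard ≤ P.L) : P.tuning.FewHypotheses P.card := by
  have hρ := hP.ρ_pos
  have hL := hP.L_pos
  have hκ := hP.κ_pos
  have hlog := hP.log_ge
  have hw := hP.w_pos
  have hr := hP.one_le_L_div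
  have hkey : P.card * (P.N * Real.exp (-((P.tuning.w : ℝ) ^ 2 / (4 * P.κ)))) ≤ P.tuning.q := by
    refine le_trans ?_ hP.tuning_q_ge
    have h1 : P.L + 10 ^ 6 * Real.log (P.L / P.ρ) ≤ (P.tuning.w : ℝ) ^ 2 / (4 * P.κ) := by
      have h2 : (P.tuning.w : ℝ) ^ 2 / (4 * P.κ) = (P.tuning.w : ℝ) ^ 2 / P.κ / 4 := by
        field_simp
      have h4 : P.L ≤ (P.L / P.ρ) ^ 2 := by
        rw [div_pow, le_div_iff₀ (by positivity)]
        have : P.ρ ^ 2 ≤ P.L := by nlinarith [hP.ρ_le, hP.L_ge]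
        nlinarith
      have h5 := mul_le_mul_of_nonneg_right hlog (sq_nonneg (P.L / P.ρ))
      rw [h2]
      linarith [hP.w_sq_ge, hP.w_sq_ge_log]
    have h2 : Real.exp (-((P.tuning.w : ℝ) ^ 2 / (4 * P.κ))) ≤
        Real.exp (-P.L) * (Real.exp (-(10 ^ 5 * Real.log (P.L / P.ρ))) *
          Real.exp (-(10 ^ 5 * Real.log (P.L / P.ρ)))) := by
      rw [← Real.exp_add, ← Real.exp_add]
      exact Real.exp_le_exp.2 (by linarith)
    have h3 : Real.exp (-(10 ^ 5 * Real.log (P.L / P.ρ))) ≤ 1 / (10 ^ 4 * (P.L / P.ρ)) :=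
      exp_neg_le_of_log (by linarith) hlog (by norm_num) (by linarith)
    have h4 : P.card * Real.exp (-P.L) ≤ 1 := by
      have : (P.card : ℝ) = Real.exp P.logCard := (Real.exp_log hP.card_pos).symm
      rw [this, ← Real.exp_add]
      exact Real.exp_le_one_iff.2 (by linarith)
    calc P.card * (P.N * Real.exp (-((P.tuning.w : ℝ) ^ 2 / (4 * P.κ))))
        ≤ P.card * (14 * P.L * (Real.exp (-P.L) * (1 / (10 ^ 4 * (P.L / P.ρ)) *
            (1 / (10 ^ 4 * (P.L / P.ρ)))))) := by
          have := hP.N_le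
          refine mul_le_mul_of_nonneg_left (mul_le_mul this (h2.trans ?_) (Real.exp_nonneg _)
            (by positivity)) (Nat.cast_nonneg _)
          gcongr
      _ = P.card * Real.exp (-P.L) * (14 * P.L * (1 / (10 ^ 4 * (P.L / P.ρ)) *
            (1 / (10 ^ 4 * (P.L / P.ρ))))) := by ring
      _ ≤ 1 * (14 * P.L * (1 / (10 ^ 4 * (P.L / P.ρ)) * (1 / (10 ^ 4 * (P.L / P.ρ))))) := by
          gcongr
      _ = P.ρ * (14 / 10 ^ 8) / P.L * P.ρ := by field_simp
      _ ≤ P.ρ * (14 / 10 ^ 8) / P.L * 1 := by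
          gcongr; linarith [hP.ρ_le]
      _ ≤ _ := by rw [mul_one, div_le_div_iff₀ hL (by positivity)]; nlinarith [mul_pos hρ hL]
  refine ⟨?_, ?_, hkey⟩
  · have h1 := hP.w_mul_L_le
    change (P.tuning.w : ℝ) ≤ 2 * P.κ
    nlinarith [hP.L_ge, hP.ρ_le]
  · refine le_trans ?_ hkey
    refine mul_le_mul_of_nonneg_left (mul_le_mul_of_nonneg_left (Real.exp_le_exp.2
      (neg_le_neg ?_)) (Nat.cast_nonneg _)) (Nat.cast_nonneg _)
    change _ ≤ (P.tuning.w : ℝ) ^ 2 / (2 * (P.κ / 2))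
    exact div_le_div_of_nonneg_left (by positivity) (by positivity) (by linarith)

theorem Λ_eq (h : P.L ≤ P.logCard) : P.tuning.Λ = P.L / (2 * P.logCard) := by
  change P.L / (2 * max P.logCard P.L) = _
  rw [max_eq_left h]

/-- The factors are `g³ = O(ρ⁶/L³)`, `Λ = L / (2 log #C)` and `1/ξ = O(L log #C / ρ)`, with product
`O(ρ⁵/L)`, while `q` is at least of order `ρ/L`. With `g²` in place of `g³` the factor `1/L` would
be lost, which is why tails are followed over three windows. -/
theorem smooth_suffices (h : P.L ≤ P.logCard) :
    16 * (P.tuning.g ^ 3 * P.tuning.Λ) / P.tuning.ξ ≤ P.tuning.q := by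
  have hρ := hP.ρ_pos
  have hL := hP.L_pos
  have hℓ := hP.logCard_pos
  have hκ := hP.κ_pos
  have hξ : P.ρ / (64 * 10 ^ 6 * (P.L * P.logCard)) ≤ P.tuning.ξ := by
    rw [hP.ξ_eq, div_le_div_iff₀ (by positivity) (by positivity)]
    linarith [hP.le_w_mul]
  rw [div_le_iff₀ hP.tuning_valid.ξ_pos, hP.Λ_eq h]
  calc 16 * (P.tuning.g ^ 3 * (P.L / (2 * P.logCard)))
      ≤ 16 * ((50 * P.ρ ^ 2 / (10 ^ 6 * P.L)) ^ 3 * (P.L / (2 * P.logCard))) := by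
        have := pow_le_pow_left₀ hP.g_nonneg hP.g_le 3
        gcongr
    _ = 10 ^ 6 / 10 ^ 18 * P.ρ ^ 4 * (P.ρ ^ 2 / (P.L ^ 2 * P.logCard)) := by
        field_simp; norm_num
    _ ≤ 1 / (1400 * (64 * 10 ^ 6)) * (P.ρ ^ 2 / (P.L ^ 2 * P.logCard)) := by
        refine mul_le_mul_of_nonneg_right ?_ (by positivity)
        have : P.ρ ^ 4 ≤ 1 := pow_le_one₀ hρ.le (by linarith [hP.ρ_le])
        linarith
    _ = P.ρ / (1400 * P.L) * (P.ρ / (64 * 10 ^ 6 * (P.L * P.logCard))) := by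
        field_simp
    _ ≤ _ := mul_le_mul hP.tuning_q_ge hξ (by positivity) hP.tuning_valid.q_nonneg

-- If `log #C ≤ L`, the union bound makes every `n` good. Otherwise the bound `O(N w L / Λ)` on the
-- number of jumps, with `Λ = L / (2 log #C)`, is `O(w L log #C)`.
open Classical in
theorem card_bad_le {X : Type*} [MeasurableSpace X] {D : Measure X} [IsProbabilityMeasure D]
    {C : Finset (X → Bool)} {c : X → Bool} (hC : ∀ h ∈ C, Measurable h) (hc : c ∈ C)
    (hcard : P.card = C.card) (M : ℕ) :
    (((Finset.range M).filter fun n => ¬ ((16 * (P.tuning.g ^ 3 * P.tuning.Λ) / P.tuning.ξ ≤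
        P.tuning.q ∧ ∀ r < P.tuning.N, P.tuning.Smooth D C c n r) ∨
        P.tuning.FewHypotheses C.card)).card : ℝ) ≤ 4000 * (P.tuning.w * (P.L * P.logCard)) := by
  have hL := hP.L_pos
  have hℓ := hP.logCard_pos
  have hw := hP.w_pos
  rcases le_total P.logCard P.L with h | h
  · have h1 := hP.fewHypotheses h
    rw [hcard] at h1
    simp only [h1, or_true, not_true, Finset.filter_false, Finset.card_empty, Nat.cast_zero]
    positivity
  · have h1 := hP.smooth_suffices h
    have h2 := Tuning.card_not_smooth_le hP.tuning_valid hC hc (D := D) M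
    rw [hP.Λ_eq h] at h2
    have h3 : (((Finset.range M).filter fun n => ¬ ((16 * (P.tuning.g ^ 3 * P.tuning.Λ) /
        P.tuning.ξ ≤ P.tuning.q ∧ ∀ r < P.tuning.N, P.tuning.Smooth D C c n r) ∨
        P.tuning.FewHypotheses C.card)).card : ℝ) ≤ (((Finset.range M).filter fun n =>
          ¬ ∀ r < P.tuning.N, P.tuning.Smooth D C c n r).card : ℝ) := by
      refine Nat.cast_le.2 (Finset.card_le_card (Finset.monotone_filter_right _ fun n _ hn => ?_))
      exact fun hs => hn (Or.inl ⟨h1, hs⟩)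
    refine h3.trans ?_
    have h4 : 2 * (P.tuning.N : ℝ) * ((7 * P.tuning.w) * Real.log ((1 + P.tuning.ε₀) / P.tuning.ε₀))
        ≤ 2 * (14 * P.L) * ((7 * P.tuning.w) * (5 * P.L)) := by
      have h5 : (P.tuning.N : ℝ) ≤ 14 * P.L := hP.N_le
      have h6 : Real.log ((1 + P.tuning.ε₀) / P.tuning.ε₀) ≤ 5 * P.L := hP.half_le_log
      have h7 : 0 ≤ Real.log ((1 + P.tuning.ε₀) / P.tuning.ε₀) := by
        have := hP.tuning_valid.ε_pos
        exact Real.log_nonneg (by rw [le_div_iff₀ this]; linarith)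
      gcongr
    have h5 := h2.trans h4
    rw [div_div, ← mul_div_assoc, div_le_iff₀ (by positivity)] at h5
    refine le_of_mul_le_mul_right (h5.trans ?_) hL
    nlinarith [mul_pos hw (mul_pos hL (mul_pos hL hℓ))]

/-- All terms are multiples of `w * L` or `w * L * log #C`, hence small multiples of `ρ κ` by the
choice of the window. The term `M * ξ` is harmless because `M ≤ κ` and `ξ κ = w / 32`. -/
theorem windows_le {M : ℕ} (hM : M = ⌊3 / 8 * P.κ⌋₊ + 1) :
    4 / P.κ * (4000 * (P.tuning.w * (P.L * P.logCard)) + P.tuning.N *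
      ((7 * P.tuning.w + M * P.tuning.ξ) / 0.4 + 16 * (7 * P.tuning.w * P.logCard))) ≤
      P.ρ / 4 := by
  have hρ := hP.ρ_pos
  have hL := hP.L_pos
  have hℓ := hP.logCard_pos
  have hw := hP.w_pos
  have hκ := hP.κ_pos
  have h1 : (M : ℝ) ≤ P.κ := by
    have := Nat.floor_le (show 0 ≤ 3 / 8 * P.κ by positivity)
    rw [hM]
    push_cast
    linarith [hP.hundred_le_κ]
  have h2 : M * P.tuning.ξ ≤ P.tuning.w := by
    calc M * P.tuning.ξ ≤ P.κ * P.tuning.ξ :=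
          mul_le_mul_of_nonneg_right h1 hP.tuning_valid.ξ_pos.le
      _ = P.tuning.w / 32 := by rw [hP.ξ_eq]; field_simp
      _ ≤ _ := by linarith
  have h3 : (P.tuning.N : ℝ) ≤ 14 * P.L := hP.N_le
  have h4 : P.tuning.N * ((7 * P.tuning.w + M * P.tuning.ξ) / 0.4 +
      16 * (7 * P.tuning.w * P.logCard)) ≤
      14 * P.L * ((7 * P.tuning.w + P.tuning.w) / 0.4 + 16 * (7 * P.tuning.w * P.logCard)) := by
    have := hP.tuning_valid.ξ_pos
    gcongr
  rw [div_mul_eq_mul_div, div_le_iff₀ hκ]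
  have h5 := hP.w_mul_le
  have h6 := hP.w_mul_L_le
  have h7 : 14 * P.L * ((7 * P.tuning.w + P.tuning.w) / 0.4 + 16 * (7 * P.tuning.w * P.logCard)) =
    280 * (P.tuning.w * P.L) + 1568 * (P.tuning.w * (P.L * P.logCard)) := by ring
  have := mul_pos hρ hκ
  linarith

theorem baseBound_le {X : Type*} [MeasurableSpace X] {D : Measure X} {C : Finset (X → Bool)}
    {c : X → Bool} (hcard : P.card = C.card) (hΘ : P.Θ = disagreementCoeff D C c) :
    baseBound P P.tuning D C c ≤ P.ρ / 4 := by
  have hρ := hP.ρ_pos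
  have hδ := hP.δ_pos
  have hL := hP.L_pos
  have hN := hP.N_pos
  have hC := hP.card_pos
  have h1 : P.N * (2 * P.card * Real.exp (-(P.κ / 1600))) ≤ P.ρ / 100 := by
    -- Half of the exponent pays for the number of hypotheses, the other half for `ρ`.
    have h2 : Real.exp (-(P.κ / 1600)) = Real.exp (-(P.κ / 3200)) * Real.exp (-(P.κ / 3200)) := by
      rw [← Real.exp_add]; congr 1; ring
    rw [h2]
    calc P.N * (2 * P.card * (Real.exp (-(P.κ / 3200)) * Real.exp (-(P.κ / 3200))))
        ≤ 14 * P.L * (2 * P.card * (1 / (10 ^ 6 * (P.card * P.L / P.δ)) *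
          (1 / (10 ^ 6 * (P.L / P.ρ))))) := by
          have := hP.N_le
          have := hP.exp_κ_le (a := 3200) (by norm_num) (by norm_num)
          have := hP.exp_κ_le'
          gcongr
      _ = 28 / 10 ^ 12 * P.ρ * (P.δ / P.L) := by field_simp; norm_num
      _ ≤ 28 / 10 ^ 12 * P.ρ * 1 := by
          have : P.δ / P.L ≤ 1 := by
            rw [div_le_one hL]; linarith [hP.L_ge, hP.δ_le]
          gcongr
      _ ≤ _ := by linarith
  have h2 : P.N * (2 * P.tuning.q) = P.ρ / 50 := by
    change P.N * (2 * (P.ρ / (100 * P.N))) = _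
    field_simp; norm_num
  have h3 := hP.exp_ξ_le
  have h4 := hP.noise_le
  have h5 : baseBound P P.tuning D C c = P.N * (2 * P.card * Real.exp (-(P.κ / 1600))) +
      P.N * (2 * P.tuning.q) + P.N * (2 * Real.exp (-(P.tuning.ξ ^ 2 * P.tuning.k / 4))) +
      P.N * (1 / Real.sqrt P.T / P.width) := by
    rw [baseBound, ← hcard, ← hΘ]
    change (P.N : ℝ) * (2 * P.card * Real.exp (-(P.κ / 1600)) + _) + _ = _
    ring_nf
    rfl
  rw [h5]
  linarith

end Params.Nontrivial

/-! ### Label complexity and a polynomial bound for the number of examples -/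

section Complexity

variable {P : Params}

theorem Params.Nontrivial.k_mul_N_le (hP : P.Nontrivial) :
    ((P.k * P.N : ℕ) : ℝ) ≤ 14 * (10 ^ 20 + 8) * P.labelComplexity := by
  have hL := hP.L_pos
  have hΘ := hP.one_le_Θ
  have hY : 1 / 4 ≤ P.labelNumerator / P.ρ ^ 4 := by
    rw [hP.labelNumerator_div]
    have h1 : 0 ≤ P.logCard ^ 2 * Real.log (P.L / P.ρ) * P.L ^ 4 / P.ρ ^ 4 := by
      have := hP.log_ge
      have := hP.ρ_pos
      have : 0 ≤ Real.log (P.L / P.ρ) := by linarith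
      positivity
    linarith [hP.log_card_mul_ge]
  have hΘY : 1 / 4 ≤ P.Θ * (P.labelNumerator / P.ρ ^ 4) := by nlinarith
  have hk : (P.k : ℝ) ≤ (10 ^ 20 + 8) * (P.Θ * (P.labelNumerator / P.ρ ^ 4)) := by
    have h1 := Nat.ceil_lt_add_one (show 0 ≤ P.ak * (P.Θ * (P.labelNumerator / P.ρ ^ 4)) by
      rw [hP.ak_eq]; linarith)
    rw [hP.ak_eq] at h1
    have h2 : (P.k : ℝ) < 10 ^ 20 * (P.Θ * (P.labelNumerator / P.ρ ^ 4)) + 1 := by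
      rw [Params.k, hP.ak_eq]; exact h1
    linarith
  rw [Nat.cast_mul]
  calc (P.k : ℝ) * P.N ≤ (10 ^ 20 + 8) * (P.Θ * (P.labelNumerator / P.ρ ^ 4)) * (14 * P.L) :=
        mul_le_mul hk hP.N_le (Nat.cast_nonneg _) (by positivity)
    _ = _ := by rw [Params.labelComplexity]; ring

/-- The quantity in which the number of examples is polynomial. -/
def Params.size (P : Params) : ℝ := P.card / (P.ε * P.δ * P.ρ)

namespace Params.Standard

variable (hP : P.Standard)
include hP

theorem le_size {x a b d e : ℝ} (hx : x = a * (b * d * e)) (ha : a ≤ P.card)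
    (hb0 : 0 ≤ b) (hb : b ≤ 1 / P.ε) (hd0 : 0 ≤ d) (hd : d ≤ 1 / P.δ) (he0 : 0 ≤ e)
    (he : e ≤ 1 / P.ρ) : x ≤ P.size := by
  have := hP.ε_pos
  have := hP.δ_pos
  have := hP.ρ_pos
  calc x = a * (b * d * e) := hx
    _ ≤ P.card * (1 / P.ε * (1 / P.δ) * (1 / P.ρ)) := by gcongr
    _ = _ := by rw [Params.size]; field_simp

theorem one_le_inv : 1 ≤ 1 / P.ε ∧ 1 ≤ 1 / P.δ ∧ 1 ≤ 1 / P.ρ := by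
  refine ⟨?_, ?_, ?_⟩
  · rw [le_div_iff₀ hP.ε_pos]; linarith [hP.ε_le]
  · rw [le_div_iff₀ hP.δ_pos]; linarith [hP.δ_le]
  · rw [le_div_iff₀ hP.ρ_pos]; linarith [hP.ρ_le]

theorem one_le_card_cast : (1 : ℝ) ≤ P.card := by exact_mod_cast hP.one_le_card

theorem one_le_size : 1 ≤ P.size := by
  obtain ⟨h1, h2, h3⟩ := hP.one_le_inv
  exact hP.le_size (by ring) hP.one_le_card_cast zero_le_one h1 zero_le_one h2
    zero_le_one h3

theorem L_le_size : P.L ≤ P.size := by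
  obtain ⟨h1, h2, h3⟩ := hP.one_le_inv
  exact hP.le_size (a := 1) (b := P.L) (d := 1) (e := 1) (by ring)
    hP.one_le_card_cast (by linarith [hP.L_ge]) hP.L_le zero_le_one h2 zero_le_one h3

theorem inv_le_size : 1 / P.ε ≤ P.size ∧ 1 / P.ρ ≤ P.size := by
  obtain ⟨h1, h2, h3⟩ := hP.one_le_inv
  exact ⟨hP.le_size (a := 1) (b := 1 / P.ε) (d := 1) (e := 1) (by ring)
    hP.one_le_card_cast (by linarith) le_rfl zero_le_one h2 zero_le_one h3,
    hP.le_size (a := 1) (b := 1) (d := 1) (e := 1 / P.ρ) (by ring)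
    hP.one_le_card_cast zero_le_one h1 zero_le_one h2 (by linarith) le_rfl⟩

theorem card_le_size : (P.card : ℝ) ≤ P.size := by
  obtain ⟨h1, h2, h3⟩ := hP.one_le_inv
  exact hP.le_size (a := P.card) (b := 1) (d := 1) (e := 1) (by ring) le_rfl
    zero_le_one h1 zero_le_one h2 zero_le_one h3

theorem log_le_size : Real.log (P.L / P.ρ) ≤ P.size ∧ Real.log (P.L / P.δ) ≤ P.size ∧
    Real.log (P.card * P.L / P.δ) ≤ P.size := by
  obtain ⟨h1, h2, h3⟩ := hP.one_le_inv
  have hL : 0 < P.L := by linarith [hP.L_ge]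
  have hρ := hP.ρ_pos
  have hδ := hP.δ_pos
  have hc := hP.one_le_card_cast
  refine ⟨(Real.log_le_self (by positivity)).trans ?_, (Real.log_le_self (by positivity)).trans ?_,
    (Real.log_le_self (by positivity)).trans ?_⟩
  · exact hP.le_size (a := 1) (b := P.L) (d := 1) (e := 1 / P.ρ) (by ring)
      hc hL.le hP.L_le zero_le_one h2 (by positivity) le_rfl
  · exact hP.le_size (a := 1) (b := P.L) (d := 1 / P.δ) (e := 1) (by ring)
      hc hL.le hP.L_le (by positivity) le_rfl zero_le_one h3
  · exact hP.le_size (a := P.card) (b := P.L) (d := 1 / P.δ) (e := 1) (by ring)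
      le_rfl hL.le hP.L_le (by positivity) le_rfl zero_le_one h3

theorem T_le : (P.T : ℝ) ≤ (10 ^ 8 + 1) * P.size ^ 13 := by
  have hZ := hP.one_le_size
  have hL : 0 < P.L := by linarith [hP.L_ge]
  have hlog : 0 ≤ Real.log (P.L / P.δ) := by linarith [hP.log_L_div_ge hP.δ_pos hP.δ_le]
  have hε := hP.ε_pos
  have hρ := hP.ρ_pos
  obtain ⟨h1, h2⟩ := hP.inv_le_size
  have h3 : P.L ^ 2 * Real.log (P.L / P.δ) / (P.ε ^ 2 * P.ρ ^ 2) ≤ P.size ^ 7 := by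
    calc P.L ^ 2 * Real.log (P.L / P.δ) / (P.ε ^ 2 * P.ρ ^ 2)
        = P.L ^ 2 * Real.log (P.L / P.δ) * ((1 / P.ε) ^ 2 * (1 / P.ρ) ^ 2) := by
          field_simp
      _ ≤ P.size ^ 2 * P.size * (P.size ^ 2 * P.size ^ 2) := by
          have := hP.L_le_size
          have := hP.log_le_size.2.1
          gcongr
      _ = _ := by ring
  have h4 : P.size ^ 7 ≤ P.size ^ 13 := pow_le_pow_right₀ hZ (by norm_num)
  have h5 : 1 ≤ P.size ^ 13 := one_le_pow₀ hZ
  have h6 := Nat.ceil_lt_add_one (show 0 ≤ P.aT *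
    (P.L ^ 2 * Real.log (P.L / P.δ) / (P.ε ^ 2 * P.ρ ^ 2)) by rw [hP.aT_eq]; positivity)
  rw [hP.aT_eq] at h6
  have h7 : (P.T : ℝ) <
      10 ^ 8 * (P.L ^ 2 * Real.log (P.L / P.δ) / (P.ε ^ 2 * P.ρ ^ 2)) + 1 := by
    rw [Params.T, hP.aT_eq]; exact h6
  linarith

/-- The four factors of the leading term contribute `2 + 1 + 4 + 4 = 11` powers of `size`, and `Θ ≤
#C` one more. Two further powers, for `1/ε` and for `N`, lead to the final degree `14`. -/
theorem k_le (hΘ0 : 0 ≤ P.Θ) (hΘ : P.Θ ≤ P.card) :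
    (P.k : ℝ) ≤ (2 * 10 ^ 20 + 1) * P.size ^ 12 := by
  have hZ := hP.one_le_size
  have hL : 0 < P.L := by linarith [hP.L_ge]
  have hε := hP.ε_pos
  have hρ := hP.ρ_pos
  have hc := hP.one_le_card_cast
  have hlog1 : 0 ≤ Real.log (P.L / P.ρ) := by linarith [hP.log_L_div_ge hP.ρ_pos hP.ρ_le]
  have hlog2 : 0 ≤ Real.log P.card := Real.log_nonneg hc
  have hlog3 : 0 ≤ Real.log (P.card * P.L / P.δ) := by
    refine Real.log_nonneg ?_
    rw [le_div_iff₀ hP.δ_pos]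
    nlinarith [hP.L_ge, hP.δ_le]
  have h1 : P.labelNumerator / P.ρ ^ 4 = Real.log P.card ^ 2 * Real.log (P.L / P.ρ) * P.L ^ 4 *
      (1 / P.ρ) ^ 4 + Real.log (P.card * P.L / P.δ) := by
    rw [Params.labelNumerator]; field_simp
  have h0 : 0 ≤ P.labelNumerator / P.ρ ^ 4 := by rw [h1]; positivity
  have h2 : P.labelNumerator / P.ρ ^ 4 ≤ 2 * P.size ^ 11 := by
    rw [h1]
    calc _ ≤ P.size ^ 2 * P.size * P.size ^ 4 * P.size ^ 4 + P.size := by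
          have := hP.L_le_size
          have := hP.log_le_size.1
          have := hP.log_le_size.2.2
          have := hP.inv_le_size.2
          have : Real.log P.card ≤ P.size :=
            (Real.log_le_self (Nat.cast_nonneg _)).trans hP.card_le_size
          gcongr
      _ ≤ P.size ^ 11 + P.size ^ 11 := add_le_add (le_of_eq (by ring))
          (le_self_pow₀ hZ (by norm_num))
      _ = _ := by ring
  have h3 : P.Θ * (P.labelNumerator / P.ρ ^ 4) ≤ 2 * P.size ^ 12 := by
    calc _ ≤ P.size * (2 * P.size ^ 11) :=
          mul_le_mul (hΘ.trans hP.card_le_size) h2 h0 (by linarith)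
      _ = _ := by ring
  have h6 := Nat.ceil_lt_add_one (show 0 ≤ P.ak * (P.Θ * (P.labelNumerator / P.ρ ^ 4)) by
    rw [hP.ak_eq]; positivity)
  rw [hP.ak_eq] at h6
  have h7 : (P.k : ℝ) < 10 ^ 20 * (P.Θ * (P.labelNumerator / P.ρ ^ 4)) + 1 := by
    rw [Params.k, hP.ak_eq]; exact h6
  have h8 : 1 ≤ P.size ^ 12 := one_le_pow₀ hZ
  linarith

theorem examples_le (hΘ0 : 0 ≤ P.Θ) (hΘ : P.Θ ≤ P.card) :
    ((P.N * (⌈16 * P.k / P.ε⌉₊ + P.T) : ℕ) : ℝ) ≤ 10 ^ 23 * P.size ^ 14 := by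
  have hZ := hP.one_le_size
  have hε := hP.ε_pos
  have h1 : 16 * P.k / P.ε ≤ 16 * (2 * 10 ^ 20 + 1) * P.size ^ 13 := by
    calc 16 * P.k / P.ε = 16 * P.k * (1 / P.ε) := by ring
      _ ≤ 16 * ((2 * 10 ^ 20 + 1) * P.size ^ 12) * P.size := by
          have := hP.k_le hΘ0 hΘ
          have := hP.inv_le_size.1
          gcongr
      _ = _ := by ring
  have h2 := Nat.ceil_lt_add_one (show 0 ≤ 16 * P.k / P.ε by positivity)
  have h3 := hP.T_le
  have h4 : 1 ≤ P.size ^ 13 := one_le_pow₀ hZ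
  have h5 : (⌈16 * P.k / P.ε⌉₊ : ℝ) + P.T ≤ 7 * 10 ^ 21 * P.size ^ 13 := by linarith
  have h6 := hP.N_le.trans (mul_le_mul_of_nonneg_left hP.L_le_size (by norm_num))
  push_cast
  calc _ ≤ 14 * P.size * (7 * 10 ^ 21 * P.size ^ 13) :=
        mul_le_mul h6 h5 (by positivity) (by positivity)
    _ = 98 * 10 ^ 21 * P.size ^ 14 := by ring
    _ ≤ _ := by
        have : 0 ≤ P.size ^ 14 := by positivity
        linarith

theorem T_le_size : (P.T : ℝ) ≤ 10 ^ 23 * P.size ^ 14 := by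
  have hZ := hP.one_le_size
  have h1 := hP.T_le
  have h2 : P.size ^ 13 ≤ P.size ^ 14 := pow_le_pow_right₀ hZ (by norm_num)
  have h3 : 0 ≤ P.size ^ 13 := by positivity
  linarith

end Params.Standard

end Complexity

/-! ### The two guarantees for the chosen constants -/

section Guarantees

variable {X : Type*} [MeasurableSpace X] {D : Measure X} [IsProbabilityMeasure D] {P : Params}
  {C : Finset (X → Bool)} {c : X → Bool}

theorem Params.Standard.nontrivial (hP : P.Standard) (hcard : P.card = C.card)
    (hΘ : P.Θ = disagreementCoeff D C c) (hc : c ∈ C) (h : ∃ h ∈ C, dist D h c ≠ 0) :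
    P.Nontrivial := by
  obtain ⟨h, hh, hd⟩ := h
  refine ⟨hP, ?_, ?_⟩
  · rw [hcard]
    refine Finset.one_lt_card.2 ⟨h, hh, c, hc, fun heq => hd ?_⟩
    rw [heq, dist_self]
  · rw [hΘ]
    exact one_le_disagreementCoeff hc hh (lt_of_le_of_ne measureReal_nonneg (Ne.symm hd))

theorem Params.Standard.isActivePAC (hP : P.Standard) (hcard : P.card = C.card)
    (hΘ : P.Θ = disagreementCoeff D C c) (hC : ∀ h ∈ C, Measurable h) (hc : c ∈ C) :
    IsActivePAC D C c (sampleLaw D) (coinLaw P C) (repliCAL P C c) P.ε P.δ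
      (14 * (10 ^ 20 + 8) * P.labelComplexity) (10 ^ 23 * P.size ^ 14) := by
  obtain ⟨hw, hw'⟩ := hP.width_bounds
  have hw0 : 0 < P.width := by linarith [hP.ε_pos]
  by_cases h : ∃ h ∈ C, dist D h c ≠ 0
  · have hP' := hP.nontrivial hcard hΘ hc h
    have hΘ1 := hP'.one_le_Θ
    refine isActivePAC_of_bounds hC hc hΘ (hΘ ▸ hΘ1) (hΘ ▸ hP'.hundred_le_κ) ⟨hP.ε_pos, hP.ε_le⟩
      hP.T_pos hw0 hw' (by linarith [hP.nine_le_N]) hP.half_pow_le ?_ hP'.k_mul_N_le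
      (hP.examples_le (by linarith) ?_)
    · rw [← hcard, ← hΘ]; exact hP'.failure_le
    · rw [hΘ, hcard]; exact disagreementCoeff_le_card hc
  · push Not at h
    exact isActivePAC_of_dist_eq_zero hc h hP.ε_pos hw0 hw' hP.T_le_size

theorem Params.Standard.isReplicable (hP : P.Standard) (hcard : P.card = C.card)
    (hΘ : P.Θ = disagreementCoeff D C c) (hC : ∀ h ∈ C, Measurable h) (hc : c ∈ C) :
    IsReplicable (sampleLaw D) (coinLaw P C) (repliCAL P C c) P.ρ := by
  obtain ⟨hw, hw'⟩ := hP.width_bounds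
  have hw0 : 0 < P.width := by linarith [hP.ε_pos]
  by_cases h : ∃ h ∈ C, dist D h c ≠ 0
  · have hP' := hP.nontrivial hcard hΘ hc h
    refine isReplicable_of_prob_le (fun b => refAnswer P P.tuning D C c (admitted P (b.2.1, b.1))
      b.2.2.1 b.2.2.2) ((prob_ne_refAnswer_le (t := P.tuning) hC hc
      hP'.tuning_valid rfl rfl rfl ?_ hΘ (hΘ ▸ hP'.one_le_Θ) (hΘ ▸ hP'.hundred_le_κ)
      ⟨hP.ε_pos, hP.ε_le⟩ hw hw' hP.T_pos (by linarith [hP.nine_le_N]) hP.half_pow_le rfl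
      (hP'.card_bad_le hC hc hcard _)).trans ?_)
    · rw [← hΘ]
      change P.k / P.Θ / 2 = P.k / (2 * P.Θ)
      rw [div_div, mul_comm]
    · have h1 := hP'.windows_le rfl
      have h2 := hP'.baseBound_le (D := D) (c := c) hcard hΘ
      rw [Params.logCard, hcard] at h1
      rw [Params.logCard, hcard]
      exact (add_le_add h2 h1).trans (by linarith)
  · push Not at h
    exact isReplicable_of_dist_eq_zero hc h hP.ε_pos hw0 hw' hP.ρ_pos.le

end Guarantees
end RepliCAL
end

theorem theorem1 :
    ∃ (aN aτ aT ak K K' : ℝ) (d : ℕ), 0 < aN ∧ 0 < aτ ∧ 0 < aT ∧ 0 < ak ∧ 0 < K ∧ 0 < K' ∧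
      ∀ (X : Type*) [MeasurableSpace X] (D : Measure X) [IsProbabilityMeasure D]
        (C : Finset (X → Bool)) (_ : ∀ h ∈ C, Measurable h) (c : X → Bool) (_ : c ∈ C)
        (ε δ ρ : ℝ) (_ : 0 < ε ∧ ε ≤ 1 / 2) (_ : 0 < δ ∧ δ ≤ 1 / 2) (_ : 0 < ρ ∧ ρ ≤ 1 / 2),
        let P : RepliCAL.Params :=
          { ε := ε, δ := δ, ρ := ρ, Θ := RepliCAL.disagreementCoeff D C c, card := C.card,
            aN := aN, aτ := aτ, aT := aT, ak := ak }
        RepliCAL.IsActivePAC D C c (RepliCAL.sampleLaw D) (RepliCAL.coinLaw P C)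
            (RepliCAL.repliCAL P C c) ε δ
            (K * P.labelComplexity) (K' * (C.card / (ε * δ * ρ)) ^ d) ∧
          RepliCAL.IsReplicable (RepliCAL.sampleLaw D) (RepliCAL.coinLaw P C)
            (RepliCAL.repliCAL P C c) ρ := by
  -- The value `1` for `aτ` is arbitrary, since the estimates hold for each grid index separately.
  -- In the label bound, `14` comes from `N ≤ 14 L`, and the summand `8` absorbs the rounding of
  -- `k`.
  refine ⟨12, 1, 10 ^ 8, 10 ^ 20, 14 * (10 ^ 20 + 8), 10 ^ 23, 14, by norm_num, by norm_num,
    by norm_num, by norm_num, by norm_num, by norm_num, ?_⟩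
  intro X _ D _ C hC c hc ε δ ρ hε hδ hρ P
  have hP : P.Standard := ⟨hε.1, hε.2, hδ.1, hδ.2, hρ.1, hρ.2, Finset.card_pos.2 ⟨c, hc⟩,
    rfl, rfl, rfl⟩
  exact ⟨hP.isActivePAC rfl rfl hC hc, hP.isReplicable rfl rfl hC hc⟩
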